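/- On $\mathbb C^2$ write $R_i=|z_i|^2$, measure angles $\theta_i$ in $\mathbb R/\mathbb Z$, and let $\omega_{st}=\sum dR_i\wedge d\theta_i$. Let $m\ge 1$, $\kappa_1,\dots,\kappa_m>0$, $a_1,\dots,a_m>0$. For $u_1,\dots,u_m\in U(2)$ such that the complex lines $d_j:=u_j(\{z_2=0\})$ are pairwise distinct, let $$\lambda_u:=\frac1m\sum_{j=1}^m (u_j)_*\big((m\kappa_j-R_2)\,d\theta_2-R_1\,d\theta_1\big),$$ a Liouville form on $\mathbb C^2\setminus\bigcup_j d_j$ with residue $\kappa_j$ along $d_j$, and let $X_u$ be its Liouville vector field, defined by $\omega_{st}(X_u,\cdot)=\lambda_u$. For a subset $S\subset\bigcup_j d_j$ let $W_u(S)$ be the union of $S$ and of the set of points $p\notin\bigcup_j d_j$ whose backward $X_u$-trajectory exists in $\mathbb C^2\setminus\bigcup_j d_j$ on some interval $[0,T)$, $0<T<\infty$, and converges to a point of $S$ as time tends to $T$. Put $$B_u=B((\kappa_j);(a_j);(u_j)):=W_u\Big(\bigcup_j u_j\{z_2=0,\ R_1<a_j\}\Big),\qquad \partial^{\circ}B_u:=W_u\Big(\bigcup_j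 u_j\{z_2=0,\ R_1=a_j\}\Big);$$ thus $B_u$ is the basin of attraction of the anisotropic standard cross formed by the open discs of areas $a_j$ in the lines $d_j$, and $\partial^\circ B_u$ is the hypersurface swept out by the boundary circles of these discs. Proposition. Let $u=(u_j)$ and $v=(v_j)$ be two such families. Then $B_u$ and $B_v$ are domains (connected nonempty open sets) of $\mathbb C^2$; the sets $\partial^\circ B_u$ and $\partial^\circ B_v$ are dense in the topological boundaries $\partial B_u$ and $\partial B_v$, i.e. $\overline{\partial^\circ B_u}=\partial B_u$ and $\overline{\partial^\circ B_v}=\partial B_v$; and there is a smooth symplectic diffeomorphism $\Phi$ from an open neighbourhood of $B_u\cup\partial^\circ B_u$ onto an open neighbourhood of $B_v\cup\partial^\circ B_v$ such that $\Phi(B_u)=B_v$ and $\Phi(\partial^\circ B_u)=\partial^\circ B_v$. In particular, up to symplectomorphism which is smooth across the regular part of the boundary, the basins do not depend on the position parameters. -/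

import Mathlib

open scoped Matrix Topology ContDiff

noncomputable section

/-- The complex plane `ℂ²` with its Euclidean norm; coordinates `z 0 = z₁`, `z 1 = z₂`. -/
abbrev C2 : Type := EuclideanSpace ℂ (Fin 2)

/-- Action of a unitary matrix on `ℂ²`. -/
def unitaryAct (u : Matrix.unitaryGroup (Fin 2) ℂ) (z : C2) : C2 :=
  WithLp.toLp 2 ((u : Matrix (Fin 2) (Fin 2) ℂ) *ᵥ z.ofLp)

/-- `R_i = |z_i|²`. -/
def radSq (i : Fin 2) (z : C2) : ℝ := ‖z i‖ ^ 2

/-- The angular form `dθ_i` at `z`, applied to `w`, a full turn being counted as `1`.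
It is meaningful for `z i ≠ 0`; the product `R_i dθ_i` extends smoothly by `0` over `z i = 0`,
in agreement with `x / 0 = 0`. -/
def dAngle (i : Fin 2) (z w : C2) : ℝ := (w i / z i).im / (2 * Real.pi)

/-- The standard symplectic form `∑ dR_i ∧ dθ_i` in these conventions, that is
`π⁻¹ ∑ dx_i ∧ dy_i`: the ball of radius one has capacity one. -/
def omegaSt (v w : C2) : ℝ :=
  ∑ i : Fin 2, ((v i).re * (w i).im - (v i).im * (w i).re) / Real.pi

/-- The Liouville form `λ_τ = (τ - R₂) dθ₂ - R₁ dθ₁`, singular along `{z₂ = 0}`,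
where it has residue `τ`. -/
def stdLiouville (τ : ℝ) (z w : C2) : ℝ :=
  (τ - radSq 1 z) * dAngle 1 z w - radSq 0 z * dAngle 0 z w

/-- The average `m⁻¹ ∑ (u_j)_* λ_{m κ_j}`: a Liouville form on the complement of the lines
`u_j {z₂ = 0}`, with residue `κ_j` along the `j`-th line. -/
def crossLiouville {m : ℕ} (κ : Fin m → ℝ) (u : Fin m → Matrix.unitaryGroup (Fin 2) ℂ)
    (z w : C2) : ℝ :=
  (1 / (m : ℝ)) * ∑ j, stdLiouville (m * κ j) (unitaryAct (u j)⁻¹ z) (unitaryAct (u j)⁻¹ w)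

/-- The complex line `u {z₂ = 0}`. -/
def crossLine (u : Matrix.unitaryGroup (Fin 2) ℂ) : Set C2 :=
  unitaryAct u '' {z | z 1 = 0}

/-- The standard open disc of area `a` centred at the origin in the line `u {z₂ = 0}`. -/
def crossDisc (a : ℝ) (u : Matrix.unitaryGroup (Fin 2) ℂ) : Set C2 :=
  unitaryAct u '' {z | z 1 = 0 ∧ radSq 0 z < a}

/-- The boundary circle of that disc. -/
def crossCircle (a : ℝ) (u : Matrix.unitaryGroup (Fin 2) ℂ) : Set C2 :=
  unitaryAct u '' {z | z 1 = 0 ∧ radSq 0 z = a}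

/-- `V` is the value at `z` of the Liouville vector field of `lam`: `ω(V, ·) = lam_z`. -/
def IsLiouvilleVector (lam : C2 → C2 → ℝ) (z V : C2) : Prop :=
  ∀ w, omegaSt V w = lam z w

/-- The points of `S`, together with the points `p` outside the singular locus `L` whose backward
trajectory `γ t = Φ^{-t}(p)` under the Liouville vector field of `lam` is defined, outside `L`,
on some interval `[0, T)` and converges to a point of `S` as `t → T`. -/
def flowOut (lam : C2 → C2 → ℝ) (L S : Set C2) : Set C2 :=
  {p | p ∈ S ∨ ∃ (T : ℝ) (γ : ℝ → C2), 0 < T ∧ γ 0 = p ∧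
    (∀ t ∈ Set.Ico 0 T, γ t ∉ L ∧
      ∃ V, IsLiouvilleVector lam (γ t) V ∧ HasDerivWithinAt γ (-V) (Set.Ico 0 T) t) ∧
    ∃ q ∈ S, Filter.Tendsto γ (𝓝[<] T) (𝓝 q)}

/-- The basin of attraction `B((κ_j); (a_j); (u_j))` of the cross formed by the open discs of
areas `a_j` in the lines `u_j {z₂ = 0}`. -/
def crossBasin {m : ℕ} (κ a : Fin m → ℝ) (u : Fin m → Matrix.unitaryGroup (Fin 2) ℂ) : Set C2 :=
  flowOut (crossLiouville κ u) (⋃ j, crossLine (u j)) (⋃ j, crossDisc (a j) (u j))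

/-- The hypersurface swept out, under the same flow, by the boundary circles of the discs of the
cross: the regular part of the boundary of the basin. -/
def basinRegularBoundary {m : ℕ} (κ a : Fin m → ℝ)
    (u : Fin m → Matrix.unitaryGroup (Fin 2) ℂ) : Set C2 :=
  flowOut (crossLiouville κ u) (⋃ j, crossLine (u j)) (⋃ j, crossCircle (a j) (u j))

/-- `Φ` is a smooth symplectic diffeomorphism between the open sets `Φ.source` and `Φ.target`. -/
def IsSymplecticDiffeo (Φ : OpenPartialHomeomorph C2 C2) : Prop :=
  ContDiffOn ℝ ∞ Φ Φ.source ∧ ContDiffOn ℝ ∞ Φ.symm Φ.target ∧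
    ∀ z ∈ Φ.source, ∀ v w : C2, omegaSt (fderiv ℝ Φ z v) (fderiv ℝ Φ z w) = omegaSt v w

end

/-! Write K for the sum of the κ_i, ℓ_i for the linear form `cross (e i)` cutting out the i-th line,
and Φ for the potential ∑ κ_i log |ℓ_i|. The Liouville field is (grad Φ - z)/2
(`crossLiouville_eq`). It splits into a radial part depending on ‖z‖ only and a multiple of a
horizontal field `hopfField`, which is complex homogeneous of degree one, tangent to the spheres and
never decreases Φ. Liouville trajectories are thus trajectories of `hopfField`, up to a time change
and a rescaling governed by a scalar equation for ‖z‖².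

The field `hopfField` has a singularity of type 1/w̄ along each line. A time change removes it. The
trajectories issuing from the j-th line in the unit sphere then form a smooth disc, `petal`, with a
coordinate η for which ‖η‖² is the elapsed time. The multiples c • petal η with c ≠ 0 are smooth
coordinates (`coneMap`) on an open set of attracted points. These open sets are disjoint for
different lines (`coneMap_injective`).

In these coordinates backward trajectories are explicit. With h = exp(-K‖η‖²), the trajectory of c •
petal η reaches the j-th line exactly when K - ‖c‖²(1 - h) > 0, and its end point then has squared
norm K‖c‖²h / (K - ‖c‖²(1 - h)). Hence the basin is the sublevel set `shape` < K, and the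
hypersurface swept out by the circles is the attracted part of the level `shape` = K
(`attractedBy_discs`, `attractedBy_circles`). On points that are not attracted, `shape` is ‖z‖². It
is continuous and homogeneous of degree two, so the basin is open and star-shaped and its frontier
is the level set. Density of the regular boundary reduces to density of the attracted points
(`dense_attracted`). This holds because the flow of grad Φ / 2 is symplectic, the potential being
pluriharmonic off the lines, and lowers ‖z‖² at the constant rate K backwards. Comparing volumes of
shells shows that the cone of stray points is null.

For the comparison of two crosses the key fact is that the pull-back of the form Im⟨z, dz⟩ to a
petal depends on the residues only: it vanishes on radial vectors, and on the angular one equals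
κ_j(1 - h)/K (`im_inner_petalAngular`). When the lines move in a smooth family e r, keeping (c, η)
fixed is therefore a symplectic motion of the cones, with an explicit Hamiltonian invariant under
phases (`fderiv_coneHam`). This Hamiltonian is cut off away from collars containing the attracted
part of the level `shape` = K, where no information on the stray set is available. The resulting
flow is complete: on the collars it only moves r, and elsewhere it preserves the norm inside the
ball ‖z‖² < K. It preserves the basin since outside the collars `shape` is less than K
(`shape_flowRel`). Its time-one map is the required diffeomorphism. Finally, any two configurations
are joined by moving one line at a time, through an auxiliary configuration of real lines distinct
from all the given ones. -/

/-! ### Composition and Volterra operators on spaces of curves -/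

/-- A field modified away from a compact piece of trajectory becomes globally Lipschitz and defined
on the whole space, as needed for uniqueness of integral curves and for composition operators on
curves. -/
theorem exists_contDiff_cutoff {E F : Type*} [NormedAddCommGroup E] [NormedSpace ℝ E]
    [FiniteDimensional ℝ E] [NormedAddCommGroup F] [NormedSpace ℝ F] {f : E → F} {Ω C : Set E}
    (hΩ : IsOpen Ω) (hf : ContDiffOn ℝ ∞ f Ω) (hC : IsCompact C) (hCΩ : C ⊆ Ω) :
    ∃ g : E → F, ContDiff ℝ ∞ g ∧ HasCompactSupport g ∧
      ∃ U, IsOpen U ∧ C ⊆ U ∧ U ⊆ Ω ∧ Set.EqOn g f U := by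
  obtain ⟨C', hC', hCC', hC'Ω⟩ := exists_compact_between hC hΩ hCΩ
  obtain ⟨φ, h0, h1, -⟩ := exists_contMDiffMap_zero_one_nhds_of_isClosed (modelWithCornersSelf ℝ E)
    (s := (interior C')ᶜ) (t := C) isOpen_interior.isClosed_compl hC.isClosed
    (Set.disjoint_compl_left_iff_subset.2 hCC')
  have hφ : ContDiff ℝ ∞ (φ : E → ℝ) := φ.contMDiff.contDiff
  have hz : ∀ x ∉ interior C', ∀ᶠ y in 𝓝 x, φ y = 0 := by
    intro x hx
    exact (Filter.Eventually.filter_mono (nhds_le_nhdsSet (by simpa using hx)) h0)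
  refine ⟨fun x => φ x • f x, ?_, ?_, ?_⟩
  · rw [contDiff_iff_contDiffAt]
    intro x
    by_cases hx : x ∈ interior C'
    · exact hφ.contDiffAt.smul (hf.contDiffAt (hΩ.mem_nhds (hC'Ω (interior_subset hx))))
    · have : (fun x => φ x • f x) =ᶠ[𝓝 x] fun _ => 0 := by
        filter_upwards [hz x hx] with y hy
        simp [hy]
      exact contDiffAt_const.congr_of_eventuallyEq this
  · refine HasCompactSupport.intro hC' fun x hx => ?_
    rw [(hz x (fun h => hx (interior_subset h))).self_of_nhds, zero_smul]
  · obtain ⟨U, hU, hCU, hU1⟩ := mem_nhdsSet_iff_exists.1 h1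
    refine ⟨U ∩ Ω, hU.inter hΩ, Set.subset_inter hCU hCΩ, Set.inter_subset_right, fun x hx => ?_⟩
    have : φ x = 1 := hU1 hx.1
    simp [this]

/-- Composition with a fixed map, acting on continuous maps out of a compact space. -/
theorem ContinuousMap.hasFDerivAt_comp_left {I E F : Type*} [TopologicalSpace I] [CompactSpace I]
    [NormedAddCommGroup E] [NormedSpace ℝ E] [NormedAddCommGroup F] [NormedSpace ℝ F]
    (f : C(E, F)) (f' : C(E, E →L[ℝ] F)) (hf : ∀ x, HasFDerivAt f (f' x) x)
    (L : C(I, E →L[ℝ] F) →L[ℝ] C(I, E) →L[ℝ] C(I, F))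
    (hL : ∀ A u s, L A u s = A s (u s)) (u : C(I, E)) :
    HasFDerivAt (fun u : C(I, E) => f.comp u) (L (f'.comp u)) u := by
  rw [hasFDerivAt_iff_isLittleO_nhds_zero, Asymptotics.isLittleO_iff]
  intro c hc
  have hcont : Continuous fun v : C(I, E) => f'.comp v := ContinuousMap.continuous_postcomp _
  obtain ⟨ε, hε, hball⟩ := (Metric.continuous_iff (α := C(I, E)) (β := C(I, E →L[ℝ] F))).1 hcont u c hc
  filter_upwards [Metric.ball_mem_nhds (0 : C(I, E)) hε] with h hh
  rw [mem_ball_zero_iff] at hh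
  rw [ContinuousMap.norm_le _ (by positivity)]
  intro s
  simp only [ContinuousMap.sub_apply, ContinuousMap.comp_apply, ContinuousMap.add_apply, hL]
  -- Translating the whole curve by the constant y - u s keeps it within ε of u in the sup norm, so
  -- continuity of v ↦ f' ∘ v at u bounds f' y - f' (u s) uniformly in s.
  have key : ∀ y ∈ segment ℝ (u s) (u s + h s), ‖f' y - f' (u s)‖ ≤ c := by
    intro y hy
    have hys : ‖y - u s‖ ≤ ‖h s‖ := by
      have := norm_sub_le_of_mem_segment hy
      simpa using this
    have h1 : dist (u + ContinuousMap.const I (y - u s)) u < ε := by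
      rw [dist_eq_norm, add_sub_cancel_left]
      refine lt_of_le_of_lt ((ContinuousMap.norm_le _ (norm_nonneg h)).2 fun _ => ?_) hh
      exact hys.trans (h.norm_coe_le_norm s)
    have h2 := hball _ h1
    have h3 := (ContinuousMap.dist_apply_le_dist (f := f'.comp (u + ContinuousMap.const I (y - u s)))
      (g := f'.comp u) s).trans h2.le
    simpa [dist_eq_norm] using h3
  have := (convex_segment (u s) (u s + h s)).norm_image_sub_le_of_norm_hasFDerivWithin_le'
    (f := f) (f' := f') (φ := f' (u s)) (C := c)
    (fun y hy => (hf y).hasFDerivWithinAt) key (left_mem_segment ℝ _ _) (right_mem_segment ℝ _ _)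
  simp only [add_sub_cancel_left] at this
  exact this.trans (by gcongr; exact h.norm_coe_le_norm s)

/-- The action of a continuous family of operators on continuous maps. -/
noncomputable def ContinuousMap.applyFamily (I E F : Type*) [TopologicalSpace I] [CompactSpace I]
    [NormedAddCommGroup E] [NormedSpace ℝ E] [NormedAddCommGroup F] [NormedSpace ℝ F] :
    C(I, E →L[ℝ] F) →L[ℝ] C(I, E) →L[ℝ] C(I, F) :=
  LinearMap.mkContinuous₂
    (LinearMap.mk₂ ℝ (fun (A : C(I, E →L[ℝ] F)) (u : C(I, E)) =>
      (⟨fun s => A s (u s), A.continuous.clm_apply u.continuous⟩ : C(I, F)))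
      (fun A B u => by ext; simp) (fun c A u => by ext; simp)
      (fun A u v => by ext; simp) (fun c A u => by ext; simp)) 1 (by
    intro A u
    rw [ContinuousMap.norm_le _ (by positivity), one_mul]
    intro s
    exact (A s).le_of_opNorm_le_of_le (A.norm_coe_le_norm s) (u.norm_coe_le_norm s))

@[simp] theorem ContinuousMap.applyFamily_apply {I E F : Type*} [TopologicalSpace I]
    [CompactSpace I] [NormedAddCommGroup E] [NormedSpace ℝ E] [NormedAddCommGroup F]
    [NormedSpace ℝ F] (A : C(I, E →L[ℝ] F)) (u : C(I, E)) (s : I) :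
    ContinuousMap.applyFamily I E F A u s = A s (u s) := rfl

/-- The derivative of composition with f is composition with its derivative followed by the
continuous linear `applyFamily`, so one order of smoothness is gained at each step. The target must
vary in the induction, since f' takes values in operators. -/
theorem ContinuousMap.contDiff_comp_left_nat {I E : Type} [TopologicalSpace I] [CompactSpace I]
    [NormedAddCommGroup E] [NormedSpace ℝ E] (k : ℕ) :
    ∀ {F : Type} [NormedAddCommGroup F] [NormedSpace ℝ F] (f : C(E, F)), ContDiff ℝ ∞ f →
      ContDiff ℝ k (fun u : C(I, E) => f.comp u) := by
  induction k with
  | zero =>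
    intro F _ _ f _
    exact contDiff_zero.2 (ContinuousMap.continuous_postcomp _)
  | succ k ih =>
    intro F _ _ f hf
    have hd : ContDiff ℝ ∞ (fderiv ℝ f) := hf.fderiv_right (by simp)
    let f' : C(E, E →L[ℝ] F) := ⟨fderiv ℝ f, hd.continuous⟩
    push_cast
    rw [contDiff_succ_iff_hasFDerivAt]
    refine ⟨fun u => ContinuousMap.applyFamily I E F (f'.comp u), ?_, ?_⟩
    · exact (ContinuousMap.applyFamily I E F).contDiff.comp (ih f' hd)
    · intro u
      exact ContinuousMap.hasFDerivAt_comp_left f f'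
        (fun x => (hf.differentiable (by simp) x).hasFDerivAt) _ (fun _ _ _ => rfl) u

theorem ContinuousMap.contDiff_comp_left {I E F : Type} [TopologicalSpace I] [CompactSpace I]
    [NormedAddCommGroup E] [NormedSpace ℝ E] [NormedAddCommGroup F] [NormedSpace ℝ F]
    (f : C(E, F)) (hf : ContDiff ℝ ∞ f) : ContDiff ℝ ∞ (fun u : C(I, E) => f.comp u) :=
  contDiff_infty.2 fun k => ContinuousMap.contDiff_comp_left_nat k f hf

/-- Integration from the left endpoint, as an operator on continuous curves. -/
noncomputable def volterra (E : Type*) [NormedAddCommGroup E] [NormedSpace ℝ E] :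
    C(unitInterval, E) →L[ℝ] C(unitInterval, E) :=
  LinearMap.mkContinuous
    { toFun := fun u => ⟨fun s => ∫ σ in (0 : ℝ)..s, u (Set.projIcc 0 1 zero_le_one σ), by
        have h : Continuous fun σ : ℝ => u (Set.projIcc 0 1 zero_le_one σ) :=
          u.continuous.comp continuous_projIcc
        exact (intervalIntegral.continuous_primitive (fun a b => h.intervalIntegrable a b) 0).comp
          continuous_subtype_val⟩
      map_add' := fun u v => by
        ext s
        have h (u : C(unitInterval, E)) : Continuous fun σ : ℝ => u (Set.projIcc 0 1 zero_le_one σ) :=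
          u.continuous.comp continuous_projIcc
        simpa using intervalIntegral.integral_add ((h u).intervalIntegrable 0 s)
          ((h v).intervalIntegrable 0 s)
      map_smul' := fun c u => by
        ext s
        simp } 1 (by
    intro u
    rw [ContinuousMap.norm_le _ (by positivity), one_mul]
    intro s
    have := intervalIntegral.norm_integral_le_of_norm_le_const (a := 0) (b := (s : ℝ))
      (f := fun σ : ℝ => u (Set.projIcc 0 1 zero_le_one σ)) (C := ‖u‖)
      (fun σ _ => u.norm_coe_le_norm _)
    refine this.trans ?_
    rw [sub_zero, abs_of_nonneg s.2.1]
    exact mul_le_of_le_one_right (norm_nonneg _) s.2.2)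

theorem volterra_apply {E : Type*} [NormedAddCommGroup E] [NormedSpace ℝ E] (u : C(unitInterval, E)) (s : unitInterval) :
    volterra E u s = ∫ σ in (0 : ℝ)..s, u (Set.projIcc 0 1 zero_le_one σ) := rfl

/-- Volterra operators of the second kind are invertible. -/
theorem isUnit_one_sub_volterra {E : Type*} [NormedAddCommGroup E] [NormedSpace ℝ E]
    [CompleteSpace E] (A : C(unitInterval, E →L[ℝ] E)) :
    IsUnit (1 - volterra E ∘L ContinuousMap.applyFamily unitInterval E E A) := by
  let e (l : ℝ) : C(unitInterval, E →L[ℝ] E) :=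
    ⟨fun s => Real.exp (l * s) • ContinuousLinearMap.id ℝ E, by fun_prop⟩
  let P (l : ℝ) : C(unitInterval, E) →L[ℝ] C(unitInterval, E) := ContinuousMap.applyFamily unitInterval E E (e l)
  have hP (l : ℝ) (u : C(unitInterval, E)) (s : unitInterval) : P l u s = Real.exp (l * s) • u s := rfl
  have hPP (l : ℝ) : P l * P (-l) = 1 := by
    ext u s
    simp only [mul_apply_eq_comp, hP, smul_smul, ← Real.exp_add]
    simp
  -- Conjugation by the weight exp(l s) divides the bound on the Volterra operator by l. With l >
  -- ‖A‖ the conjugate has norm less than one and the Neumann series applies.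
  set l : ℝ := ‖A‖ + 1 with hl
  have hl0 : 0 < l := by positivity
  set W := P (-l) * (volterra E ∘L ContinuousMap.applyFamily unitInterval E E A) * P l with hW
  have hWn : ‖W‖ ≤ ‖A‖ / l := by
    refine ContinuousLinearMap.opNorm_le_bound _ (by positivity) fun u => ?_
    rw [ContinuousMap.norm_le _ (by positivity)]
    intro s
    simp only [hW, mul_apply_eq_comp, hP, ContinuousLinearMap.comp_apply,
      volterra_apply, ContinuousMap.applyFamily_apply]
    have h1 : ‖∫ σ in (0 : ℝ)..s, (A (Set.projIcc 0 1 zero_le_one σ))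
        (Real.exp (l * (Set.projIcc (0 : ℝ) 1 zero_le_one σ : ℝ)) •
          u (Set.projIcc 0 1 zero_le_one σ))‖ ≤
        ∫ σ in (0 : ℝ)..s, ‖A‖ * ‖u‖ * Real.exp (l * σ) := by
      refine intervalIntegral.norm_integral_le_of_norm_le s.2.1 (.of_forall fun σ hσ => ?_)
        (Continuous.intervalIntegrable (by fun_prop) _ _)
      have h2 : (Set.projIcc (0 : ℝ) 1 zero_le_one σ : ℝ) = σ := by
        rw [Set.projIcc_of_mem zero_le_one ⟨hσ.1.le, hσ.2.trans s.2.2⟩]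
      rw [h2, map_smul, norm_smul, Real.norm_eq_abs, Real.abs_exp, mul_comm]
      gcongr
      exact (A _).le_of_opNorm_le_of_le (A.norm_coe_le_norm _) (u.norm_coe_le_norm _)
    have h3 : ∫ σ in (0 : ℝ)..s, ‖A‖ * ‖u‖ * Real.exp (l * σ) =
        ‖A‖ * ‖u‖ * ((Real.exp (l * s) - 1) / l) := by
      rw [intervalIntegral.integral_const_mul,
        intervalIntegral.integral_comp_mul_left (fun x => Real.exp x) hl0.ne', integral_exp]
      simp [div_eq_inv_mul]
    rw [norm_smul, Real.norm_eq_abs, Real.abs_exp]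
    rw [h3] at h1
    refine (mul_le_mul_of_nonneg_left h1 (Real.exp_pos _).le).trans ?_
    have h4 : Real.exp (-l * s) * (‖A‖ * ‖u‖ * ((Real.exp (l * s) - 1) / l)) =
        ‖A‖ / l * ‖u‖ * (1 - Real.exp (-l * s)) := by
      have : Real.exp (-l * s) * Real.exp (l * s) = 1 := by rw [← Real.exp_add]; simp
      linear_combination (‖A‖ * ‖u‖ / l) * this
    rw [h4]
    exact mul_le_of_le_one_right (by positivity) (by linarith [Real.exp_pos (-l * s)])
  have hW1 : IsUnit (1 - W) := isUnit_one_sub_of_norm_lt_one (R := C(unitInterval, E) →L[ℝ] C(unitInterval, E))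
    (hWn.trans_lt ((div_lt_one hl0).2 (by linarith)))
  have hu1 : IsUnit (P l) := ⟨⟨P l, P (-l), hPP l, by simpa using hPP (-l)⟩, rfl⟩
  have hu2 : IsUnit (P (-l)) := ⟨⟨P (-l), P l, by simpa using hPP (-l), hPP l⟩, rfl⟩
  have : 1 - volterra E ∘L ContinuousMap.applyFamily unitInterval E E A = P l * (1 - W) * P (-l) := by
    rw [hW, mul_sub, sub_mul, mul_one, hPP]
    congr 1
    rw [← mul_assoc, ← mul_assoc, hPP, one_mul, mul_assoc, hPP, mul_one]
  rw [this]
  exact (hu1.mul hW1).mul hu2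

/-! ### Integral curves: uniqueness, smooth dependence, concatenation -/

/-- `y` is reached from `x` in time `t` along an integral curve of `f` inside `Ω`. -/
def FlowRel {E : Type} [NormedAddCommGroup E] [NormedSpace ℝ E] (f : E → E) (Ω : Set E)
    (t : ℝ) (x y : E) : Prop :=
  ∃ γ : ℝ → E, γ 0 = x ∧ γ t = y ∧ ∀ s ∈ Set.uIcc 0 t, γ s ∈ Ω ∧ HasDerivAt γ (f (γ s)) s

namespace FlowRel

variable {E : Type} [NormedAddCommGroup E] [NormedSpace ℝ E] {f : E → E} {Ω : Set E}

theorem mem_left {t : ℝ} {x y : E} (h : FlowRel f Ω t x y) : x ∈ Ω := by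
  obtain ⟨γ, rfl, -, h⟩ := h
  exact (h 0 Set.left_mem_uIcc).1

theorem mem_right {t : ℝ} {x y : E} (h : FlowRel f Ω t x y) : y ∈ Ω := by
  obtain ⟨γ, -, rfl, h⟩ := h
  exact (h t Set.right_mem_uIcc).1

theorem reverse {t : ℝ} {x y : E} (h : FlowRel f Ω t x y) : FlowRel f Ω (-t) y x := by
  obtain ⟨γ, h0, h1, h⟩ := h
  refine ⟨fun s => γ (s + t), by simpa using h1, by simpa using h0, fun s hs => ?_⟩
  have hs' : s + t ∈ Set.uIcc 0 t := by
    rcases le_total 0 t with ht | ht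
    · rw [Set.uIcc_of_ge (by linarith)] at hs
      rw [Set.uIcc_of_le ht]
      exact ⟨by linarith [hs.1], by linarith [hs.2]⟩
    · rw [Set.uIcc_of_le (by linarith)] at hs
      rw [Set.uIcc_of_ge ht]
      exact ⟨by linarith [hs.1], by linarith [hs.2]⟩
  exact ⟨(h _ hs').1, (h _ hs').2.comp_add_const s t⟩

/-- Integral curves with the same initial value agree. -/
theorem eqOn_of_integralCurve [FiniteDimensional ℝ E] (hΩ : IsOpen Ω) (hf : ContDiffOn ℝ ∞ f Ω)
    {t : ℝ} {γ δ : ℝ → E}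
    (hγ : ∀ s ∈ Set.Icc 0 t, γ s ∈ Ω ∧ HasDerivWithinAt γ (f (γ s)) (Set.Icc 0 t) s)
    (hδ : ∀ s ∈ Set.Icc 0 t, δ s ∈ Ω ∧ HasDerivWithinAt δ (f (δ s)) (Set.Icc 0 t) s)
    (h0 : γ 0 = δ 0) : Set.EqOn γ δ (Set.Icc 0 t) := by
  have hγc : ContinuousOn γ (Set.Icc 0 t) := fun s hs => (hγ s hs).2.continuousWithinAt
  have hδc : ContinuousOn δ (Set.Icc 0 t) := fun s hs => (hδ s hs).2.continuousWithinAt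
  obtain ⟨g, hg, hgc, U, hU, hCU, hUΩ, hgf⟩ := exists_contDiff_cutoff hΩ hf
    ((isCompact_Icc.image_of_continuousOn hγc).union (isCompact_Icc.image_of_continuousOn hδc))
    (by
      rintro x (⟨s, hs, rfl⟩ | ⟨s, hs, rfl⟩)
      exacts [(hγ s hs).1, (hδ s hs).1])
  obtain ⟨L, hL⟩ := hg.lipschitzWith_of_hasCompactSupport hgc (by simp)
  have hIci {ε : ℝ → E} {v : E} {s : ℝ} (hs : s ∈ Set.Ico 0 t)
      (h : HasDerivWithinAt ε v (Set.Icc 0 t) s) : HasDerivWithinAt ε v (Set.Ici s) s :=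
    h.mono_of_mem_nhdsWithin (Filter.mem_of_superset (Icc_mem_nhdsGE hs.2)
      (Set.Icc_subset_Icc_left hs.1))
  refine ODE_solution_unique (v := fun _ => g) (fun _ => hL) hγc (fun s hs => ?_) hδc
    (fun s hs => ?_) h0
  · have hs' := Set.Ico_subset_Icc_self hs
    rw [hgf (hCU (Or.inl ⟨s, hs', rfl⟩))]
    exact hIci hs (hγ s hs').2
  · have hs' := Set.Ico_subset_Icc_self hs
    rw [hgf (hCU (Or.inr ⟨s, hs', rfl⟩))]
    exact hIci hs (hδ s hs').2

theorem neg_field {t : ℝ} {x y : E} (h : FlowRel f Ω t x y) :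
    FlowRel (fun z => -f z) Ω (-t) x y := by
  obtain ⟨γ, h0, h1, h⟩ := h
  refine ⟨fun s => γ (-s), by simpa using h0, by simpa using h1, fun s hs => ?_⟩
  have hs' : -s ∈ Set.uIcc 0 t := by
    rcases le_total 0 t with ht | ht
    · rw [Set.uIcc_of_ge (by linarith)] at hs
      rw [Set.uIcc_of_le ht]
      exact ⟨by linarith [hs.2], by linarith [hs.1]⟩
    · rw [Set.uIcc_of_le (by linarith)] at hs
      rw [Set.uIcc_of_ge ht]
      exact ⟨by linarith [hs.2], by linarith [hs.1]⟩
  refine ⟨(h _ hs').1, ?_⟩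
  have := (h _ hs').2.scomp s (hasDerivAt_neg s)
  simpa [Function.comp_def] using this

theorem unique [FiniteDimensional ℝ E] (hΩ : IsOpen Ω) (hf : ContDiffOn ℝ ∞ f Ω)
    {t : ℝ} {x y y' : E} (h : FlowRel f Ω t x y) (h' : FlowRel f Ω t x y') : y = y' := by
  rcases le_total 0 t with ht | ht
  · obtain ⟨γ, h0, rfl, h⟩ := h
    obtain ⟨δ, h0', rfl, h'⟩ := h'
    rw [Set.uIcc_of_le ht] at h h'
    exact eqOn_of_integralCurve hΩ hf (fun s hs => ⟨(h s hs).1, (h s hs).2.hasDerivWithinAt⟩)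
      (fun s hs => ⟨(h' s hs).1, (h' s hs).2.hasDerivWithinAt⟩) (h0.trans h0'.symm)
      (Set.right_mem_Icc.2 ht)
  · obtain ⟨γ, h0, h1, h⟩ := h.neg_field
    obtain ⟨δ, h0', h1', h'⟩ := h'.neg_field
    rw [← h1, ← h1']
    rw [Set.uIcc_of_le (neg_nonneg.2 ht)] at h h'
    exact eqOn_of_integralCurve hΩ hf.neg (fun s hs => ⟨(h s hs).1, (h s hs).2.hasDerivWithinAt⟩)
      (fun s hs => ⟨(h' s hs).1, (h' s hs).2.hasDerivWithinAt⟩) (h0.trans h0'.symm)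
      (Set.right_mem_Icc.2 (neg_nonneg.2 ht))

/-- Existence of nearby integral curves, and smooth dependence on time and initial value. -/
theorem exists_contDiffAt [FiniteDimensional ℝ E] (hΩ : IsOpen Ω) (hf : ContDiffOn ℝ ∞ f Ω)
    {t : ℝ} {x y : E} (h : FlowRel f Ω t x y) :
    ∃ Φ : ℝ × E → E, ContDiffAt ℝ ∞ Φ (t, x) ∧
      ∀ᶠ p in 𝓝 (t, x), FlowRel f Ω p.1 p.2 (Φ p) := by
  have : CompleteSpace E := FiniteDimensional.complete ℝ E
  obtain ⟨γ, hγ0, hγ1, hγ⟩ := h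
  have hts (s : unitInterval) : t * s ∈ Set.uIcc 0 t := by
    rcases le_total 0 t with ht | ht
    · rw [Set.uIcc_of_le ht]
      exact ⟨mul_nonneg ht s.2.1, mul_le_of_le_one_right ht s.2.2⟩
    · rw [Set.uIcc_of_ge ht]
      exact ⟨by nlinarith [s.2.2], mul_nonpos_of_nonpos_of_nonneg ht s.2.1⟩
  let u₀ : C(unitInterval, E) := ⟨fun s => γ (t * s), by
    rw [continuous_iff_continuousAt]
    intro s
    exact ContinuousAt.comp (f := fun s : unitInterval => t * (s : ℝ)) (g := γ)
      (hγ _ (hts s)).2.continuousAt (by fun_prop)⟩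
  obtain ⟨g, hg, hgc, U, hU, hCU, hUΩ, hgf⟩ := exists_contDiff_cutoff hΩ hf
    (isCompact_range u₀.continuous) (by rintro _ ⟨s, rfl⟩; exact (hγ _ (hts s)).1)
  let gC : C(E, E) := ⟨g, hg.continuous⟩
  let gC' : C(E, E →L[ℝ] E) := ⟨fderiv ℝ g, hg.continuous_fderiv (by simp)⟩
  let cst : E →L[ℝ] C(unitInterval, E) := LinearMap.mkContinuous
    ⟨⟨fun x => ContinuousMap.const _ x, fun _ _ => by ext; simp⟩, fun _ _ => by ext; simp⟩ 1
    (fun x => by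
      rw [one_mul]
      exact (ContinuousMap.norm_le _ (norm_nonneg x)).2 fun _ => le_rfl)
  -- With time rescaled to the unit interval, integral curves are the zeros of F(t, x, u) = u - x -
  -- t ∫ g(u). The implicit function theorem in the Banach space of curves then solves for u.
  let F : (ℝ × E) × C(unitInterval, E) → C(unitInterval, E) := fun p =>
    p.2 - cst p.1.2 - p.1.1 • volterra E (gC.comp p.2)
  have hF : ContDiff ℝ ∞ F := by
    have h1 : ContDiff ℝ ∞ fun u : C(unitInterval, E) => gC.comp u :=
      ContinuousMap.contDiff_comp_left gC hg
    have h2 : ContDiff ℝ ∞ fun p : (ℝ × E) × C(unitInterval, E) => gC.comp p.2 :=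
      h1.comp contDiff_snd
    have h3 : ContDiff ℝ ∞ fun p : (ℝ × E) × C(unitInterval, E) => volterra E (gC.comp p.2) :=
      (volterra E).contDiff.comp h2
    have h4 : ContDiff ℝ ∞ fun p : (ℝ × E) × C(unitInterval, E) => cst p.1.2 :=
      cst.contDiff.comp (contDiff_snd.comp contDiff_fst)
    exact (contDiff_snd.sub h4).sub ((contDiff_fst.comp contDiff_fst).smul h3)
  have hzero : F ((t, x), u₀) = 0 := by
    ext s
    have hint : ∫ r in (0 : ℝ)..s, t • g (u₀ (Set.projIcc 0 1 zero_le_one r)) =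
        γ (t * s) - γ (t * 0) := by
      refine intervalIntegral.integral_eq_sub_of_hasDerivAt (f := fun r => γ (t * r)) ?_ ?_
      · intro r hr
        rw [Set.uIcc_of_le s.2.1] at hr
        have hr' : r ∈ Set.Icc (0 : ℝ) 1 := ⟨hr.1, hr.2.trans s.2.2⟩
        rw [Set.projIcc_of_mem zero_le_one hr', hgf (hCU ⟨_, rfl⟩)]
        have := (hγ _ (hts ⟨r, hr'⟩)).2.scomp r ((hasDerivAt_id r).const_mul t)
        simpa [u₀, Function.comp_def] using this
      · refine Continuous.intervalIntegrable ?_ _ _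
        exact continuous_const.smul (hg.continuous.comp (u₀.continuous.comp continuous_projIcc))
    rw [intervalIntegral.integral_smul] at hint
    change γ (t * s) - x - t • (∫ r in (0 : ℝ)..s, g (u₀ (Set.projIcc 0 1 zero_le_one r))) = 0
    rw [hint, mul_zero, hγ0]
    abel
  have hinv : (fderiv ℝ F ((t, x), u₀) ∘L .inr ℝ (ℝ × E) C(unitInterval, E)).IsInvertible := by
    have h1 : HasFDerivAt (fun u : C(unitInterval, E) => F ((t, x), u))
        (fderiv ℝ F ((t, x), u₀) ∘L .inr ℝ (ℝ × E) C(unitInterval, E)) u₀ := by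
      have h2 : HasFDerivAt F (fderiv ℝ F ((t, x), u₀)) ((t, x), u₀) :=
        (hF.differentiable (by simp) _).hasFDerivAt
      exact h2.comp u₀ (hasFDerivAt_prodMk_right (t, x) u₀)
    have h3 : HasFDerivAt (fun u : C(unitInterval, E) => F ((t, x), u))
        (1 - volterra E ∘L ContinuousMap.applyFamily unitInterval E E (t • gC'.comp u₀)) u₀ := by
      have h4 : HasFDerivAt (fun u : C(unitInterval, E) => gC.comp u)
          (ContinuousMap.applyFamily unitInterval E E (gC'.comp u₀)) u₀ :=
        ContinuousMap.hasFDerivAt_comp_left gC gC'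
          (fun x => (hg.differentiable (by simp) x).hasFDerivAt) _ (fun _ _ _ => rfl) u₀
      have h5 := (((hasFDerivAt_id u₀).sub_const (cst x)).sub
        (((volterra E).hasFDerivAt.comp u₀ h4).const_smul t))
      refine h5.congr_fderiv ?_
      ext u s
      simp [volterra_apply]
    rw [h1.unique h3]
    -- The partial derivative of F in the curve is one minus a Volterra operator, hence invertible
    -- for every t, not only for small t.
    obtain ⟨e, he⟩ := isUnit_one_sub_volterra (t • gC'.comp u₀)
    exact ⟨ContinuousLinearEquiv.unitsEquiv ℝ _ e, by rw [← he]; rfl⟩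
  have hFat : ContDiffAt ℝ ∞ F ((t, x), u₀) := hF.contDiffAt
  let ψ := hFat.implicitFunction (by simp) hinv
  have hψ : ContDiffAt ℝ ∞ ψ (t, x) := hFat.contDiffAt_implicitFunction (by simp) hinv
  have hψ0 : ψ (t, x) = u₀ := hFat.implicitFunction_apply_self (by simp) hinv
  have hψF : ∀ᶠ p in 𝓝 (t, x), F (p, ψ p) = 0 := by
    rw [← hzero]
    exact hFat.eventually_apply_implicitFunction (by simp) hinv
  let ev : C(unitInterval, E) →L[ℝ] E := ContinuousMap.evalCLM ℝ (1 : unitInterval)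
  refine ⟨fun p => ev (ψ p), ev.contDiff.contDiffAt.comp _ hψ, ?_⟩
  have hnear : ∀ᶠ p in 𝓝 (t, x), Set.MapsTo (ψ p) Set.univ U := by
    have h1 : Filter.Tendsto ψ (𝓝 (t, x)) (𝓝 u₀) := by
      rw [← hψ0]; exact hψ.continuousAt
    exact h1 (ContinuousMap.eventually_mapsTo isCompact_univ hU
      (fun s _ => hCU ⟨s, rfl⟩))
  filter_upwards [hψF, hnear] with p hp hpU
  have hsol (s : unitInterval) :
      ψ p s = p.2 + p.1 • ∫ r in (0 : ℝ)..s, g (ψ p (Set.projIcc 0 1 zero_le_one r)) := by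
    have := DFunLike.congr_fun hp s
    change ψ p s - p.2 - p.1 • _ = 0 at this
    rw [sub_sub, sub_eq_zero] at this
    exact this
  have hcont : Continuous fun r : ℝ => g (ψ p (Set.projIcc 0 1 zero_le_one r)) :=
    hg.continuous.comp ((ψ p).continuous.comp continuous_projIcc)
  have hcont' : Continuous fun r : ℝ => g (ψ p (Set.projIcc 0 1 zero_le_one (r / p.1))) :=
    hcont.comp (continuous_id.div_const _)
  -- The solution in unscaled time. Since `projIcc` freezes the integrand outside [0, 1], the curve
  -- has two-sided derivatives at the end points. For p.1 = 0 the convention r / 0 = 0 makes it a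
  -- straight line through p.2.
  let δ : ℝ → E := fun s => p.2 + ∫ r in (0 : ℝ)..s, g (ψ p (Set.projIcc 0 1 zero_le_one (r / p.1)))
  have hδ (s : unitInterval) : δ (p.1 * s) = ψ p s := by
    rw [hsol s]
    simp only [δ]
    congr 1
    by_cases h0 : p.1 = 0
    · simp [h0]
    · have := intervalIntegral.smul_integral_comp_mul_left (a := 0) (b := (s : ℝ))
        (fun r => g (ψ p (Set.projIcc 0 1 zero_le_one (r / p.1)))) p.1
      rw [mul_zero] at this
      rw [← this]
      congr 1
      refine intervalIntegral.integral_congr fun r _ => ?_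
      rw [mul_div_cancel_left₀ _ h0]
  refine ⟨δ, by simp [δ], ?_, fun s hs => ?_⟩
  · have := hδ 1
    rwa [Set.Icc.coe_one, mul_one] at this
  · obtain ⟨r, hr⟩ : ∃ r : unitInterval, s = p.1 * r := by
      by_cases h0 : p.1 = 0
      · exact ⟨0, by simpa [h0] using hs⟩
      · refine ⟨⟨s / p.1, ?_⟩, by field_simp⟩
        rcases lt_or_gt_of_ne h0 with h1 | h1
        · rw [Set.uIcc_of_ge h1.le] at hs
          exact ⟨div_nonneg_of_nonpos hs.2 h1.le, (div_le_one_of_neg h1).2 hs.1⟩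
        · rw [Set.uIcc_of_le h1.le] at hs
          exact ⟨div_nonneg hs.1 h1.le, (div_le_one h1).2 hs.2⟩
    have hmem : δ s ∈ U := by rw [hr, hδ]; exact hpU (Set.mem_univ r)
    refine ⟨hUΩ hmem, ?_⟩
    have h1 : HasDerivAt δ (g (ψ p (Set.projIcc 0 1 zero_le_one (s / p.1)))) s :=
      (intervalIntegral.integral_hasDerivAt_right (hcont'.intervalIntegrable _ _)
        hcont'.aestronglyMeasurable.stronglyMeasurableAtFilter hcont'.continuousAt).const_add _
    have h2 : g (ψ p (Set.projIcc 0 1 zero_le_one (s / p.1))) = f (δ s) := by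
      rw [← hgf hmem]
      by_cases h0 : p.1 = 0
      · have hs0 : s = 0 := by simpa [h0] using hs
        rw [hs0]
        simp only [zero_div]
        rw [Set.projIcc_of_mem zero_le_one (Set.left_mem_Icc.2 zero_le_one)]
        have h3 := hδ 0
        simp only [Set.Icc.coe_zero, mul_zero] at h3
        rw [h3]
        rfl
      · rw [hr, mul_div_cancel_left₀ _ h0, Set.projIcc_of_mem zero_le_one r.2, hδ]
    rwa [h2] at h1

end FlowRel

namespace FlowRel

variable {E : Type} [NormedAddCommGroup E] [NormedSpace ℝ E] {f : E → E} {Ω : Set E}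

theorem refl {x : E} (hx : x ∈ Ω) : FlowRel f Ω 0 x x := by
  refine ⟨fun s => x + s • f x, by simp, by simp, fun s hs => ?_⟩
  obtain rfl : s = 0 := by simpa using hs
  refine ⟨by simpa using hx, ?_⟩
  simpa using ((hasDerivAt_id (0 : ℝ)).smul_const (f x)).const_add x

theorem split {t s : ℝ} {x y : E} (h : FlowRel f Ω t x y) (hs : s ∈ Set.uIcc 0 t) :
    ∃ w, FlowRel f Ω s x w ∧ FlowRel f Ω (t - s) w y := by
  obtain ⟨γ, h0, h1, h⟩ := h
  refine ⟨γ s, ⟨γ, h0, rfl, fun r hr => h r (Set.uIcc_subset_uIcc_left hs hr)⟩,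
    fun r => γ (r + s), by simp, by simpa using h1, fun r hr => ?_⟩
  have hr' : r + s ∈ Set.uIcc 0 t := by
    rcases le_total 0 t with ht | ht
    · rw [Set.uIcc_of_le ht] at hs ⊢
      rw [Set.uIcc_of_le (by linarith [hs.2])] at hr
      exact ⟨by linarith [hr.1, hs.1], by linarith [hr.2]⟩
    · rw [Set.uIcc_of_ge ht] at hs ⊢
      rw [Set.uIcc_of_ge (by linarith [hs.1])] at hr
      exact ⟨by linarith [hr.1], by linarith [hr.2, hs.2]⟩
  exact ⟨(h _ hr').1, (h _ hr').2.comp_add_const r s⟩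

theorem trans_nonneg {s t : ℝ} (hs : 0 ≤ s) (ht : 0 ≤ t) {x y z : E} (h : FlowRel f Ω s x y)
    (h' : FlowRel f Ω t y z) : FlowRel f Ω (s + t) x z := by
  obtain ⟨γ, h0, h1, h⟩ := h
  obtain ⟨δ, h0', h1', h'⟩ := h'
  rw [Set.uIcc_of_le hs] at h
  rw [Set.uIcc_of_le ht] at h'
  let ε : ℝ → E := fun r => if r ≤ s then γ r else δ (r - s)
  have hε2 : ∀ r, s ≤ r → ε r = δ (r - s) := by
    intro r hr
    rcases hr.eq_or_lt with rfl | hr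
    · simp [ε, h1, h0']
    · simp [ε, hr.not_ge]
  have hε1 : ∀ r, r ≤ s → ε r = γ r := fun r hr => by simp [ε, hr]
  refine ⟨ε, by simp [ε, hs, h0], ?_, fun r hr => ?_⟩
  · rw [hε2 _ (by linarith)]
    simpa using h1'
  rw [Set.uIcc_of_le (by linarith)] at hr
  have hA : ∀ r ∈ Set.Icc 0 s, HasDerivWithinAt ε (f (ε r)) (Set.Iic s) r := by
    intro r hr
    rw [hε1 r hr.2]
    exact (h r hr).2.hasDerivWithinAt.congr (fun q hq => hε1 q hq) (hε1 r hr.2)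
  have hB : ∀ r ∈ Set.Icc s (s + t), HasDerivWithinAt ε (f (ε r)) (Set.Ici s) r := by
    intro r hr
    rw [hε2 r hr.1]
    have := (h' (r - s) ⟨by linarith [hr.1], by linarith [hr.2]⟩).2.comp_sub_const r s
    exact this.hasDerivWithinAt.congr (fun q hq => hε2 q hq) (hε2 r hr.1)
  rcases lt_trichotomy r s with hrs | rfl | hrs
  · refine ⟨?_, (hA r ⟨hr.1, hrs.le⟩).hasDerivAt (Iic_mem_nhds hrs)⟩
    rw [hε1 r hrs.le]
    exact (h r ⟨hr.1, hrs.le⟩).1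
  · refine ⟨?_, ?_⟩
    · rw [hε1 r le_rfl]
      exact (h r ⟨hr.1, le_rfl⟩).1
    · have := (hA r ⟨hr.1, le_rfl⟩).union (hB r ⟨le_rfl, hr.2⟩)
      rwa [Set.Iic_union_Ici, hasDerivWithinAt_univ] at this
  · refine ⟨?_, (hB r ⟨hrs.le, hr.2⟩).hasDerivAt (Ici_mem_nhds hrs)⟩
    rw [hε2 r hrs.le]
    exact (h' _ ⟨by linarith, by linarith [hr.2]⟩).1

theorem of_neg_field {t : ℝ} {x y : E} (h : FlowRel (fun z => -f z) Ω (-t) x y) :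
    FlowRel f Ω t x y := by
  simpa using h.neg_field

/-- For times of opposite sign the two curves overlap instead of following one another, and
uniqueness cancels the common piece. This is why smoothness of the field enters here and not in
`trans_nonneg`. -/
theorem trans [FiniteDimensional ℝ E] (hΩ : IsOpen Ω) (hf : ContDiffOn ℝ ∞ f Ω)
    {s t : ℝ} {x y z : E} (h : FlowRel f Ω s x y)
    (h' : FlowRel f Ω t y z) : FlowRel f Ω (s + t) x z := by
  have key : ∀ {s t : ℝ} {x y z : E}, FlowRel f Ω s x y → FlowRel f Ω t y z → 0 ≤ s → t ≤ 0 →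
      FlowRel f Ω (s + t) x z := by
    intro s t x y z h h' hs ht
    rcases le_total 0 (s + t) with hst | hst
    · obtain ⟨w, hw, hw'⟩ := h.split (s := s + t) (by
        rw [Set.uIcc_of_le hs]; exact ⟨hst, by linarith⟩)
      have := hw'.reverse
      rw [show -(s - (s + t)) = t by ring] at this
      rwa [h'.unique hΩ hf this]
    · obtain ⟨w, hw, hw'⟩ := h'.split (s := -s) (by
        rw [Set.uIcc_of_ge ht]; exact ⟨by linarith, by linarith⟩)
      rw [h.reverse.unique hΩ hf hw, add_comm]
      simpa using hw'
  rcases le_total 0 s with hs | hs <;> rcases le_total 0 t with ht | ht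
  · exact trans_nonneg hs ht h h'
  · exact key h h' hs ht
  · rcases le_total 0 (s + t) with hst | hst
    · obtain ⟨w, hw, hw'⟩ := h'.split (s := -s) (by
        rw [Set.uIcc_of_le ht]; exact ⟨by linarith, by linarith⟩)
      rw [h.reverse.unique hΩ hf hw, add_comm]
      simpa using hw'
    · obtain ⟨w, hw, hw'⟩ := h.split (s := s + t) (by
        rw [Set.uIcc_of_ge hs]; exact ⟨by linarith, hst⟩)
      have := hw'.reverse
      rw [show -(s - (s + t)) = t by ring] at this
      rwa [h'.unique hΩ hf this]
  · refine of_neg_field ?_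
    rw [neg_add]
    exact trans_nonneg (by simpa using hs) (by simpa using ht) h.neg_field h'.neg_field

end FlowRel

/-! ### The flow as a smooth map -/

section flow

variable {E : Type} [NormedAddCommGroup E] [NormedSpace ℝ E]

/-- The time `t` flow of `f` inside `Ω`, extended by the identity where it is undefined. -/
noncomputable def flow (f : E → E) (Ω : Set E) (t : ℝ) (x : E) : E :=
  open Classical in if h : ∃ y, FlowRel f Ω t x y then h.choose else x

/-- The domain of the flow. -/
def flowDomain (f : E → E) (Ω : Set E) : Set (ℝ × E) := {p | ∃ y, FlowRel f Ω p.1 p.2 y}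

variable {f : E → E} {Ω : Set E}

theorem flowRel_flow {t : ℝ} {x : E} (h : (t, x) ∈ flowDomain f Ω) :
    FlowRel f Ω t x (flow f Ω t x) := by
  have h' : ∃ y, FlowRel f Ω t x y := h
  rw [flow, dif_pos h']
  exact h'.choose_spec

variable [FiniteDimensional ℝ E] (hΩ : IsOpen Ω) (hf : ContDiffOn ℝ ∞ f Ω)
include hΩ hf

theorem FlowRel.flow_eq {t : ℝ} {x y : E} (h : FlowRel f Ω t x y) : flow f Ω t x = y :=
  (flowRel_flow ⟨y, h⟩).unique hΩ hf h

theorem isOpen_flowDomain : IsOpen (flowDomain f Ω) := by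
  rw [isOpen_iff_mem_nhds]
  rintro ⟨t, x⟩ ⟨y, h⟩
  obtain ⟨Φ, -, hΦ⟩ := h.exists_contDiffAt hΩ hf
  filter_upwards [hΦ] with p hp using ⟨_, hp⟩

theorem contDiffAt_flow {t : ℝ} {x : E} (h : (t, x) ∈ flowDomain f Ω) :
    ContDiffAt ℝ ∞ (fun p : ℝ × E => flow f Ω p.1 p.2) (t, x) := by
  obtain ⟨y, h⟩ := h
  obtain ⟨Φ, h1, hΦ⟩ := h.exists_contDiffAt hΩ hf
  refine h1.congr_of_eventuallyEq ?_
  filter_upwards [hΦ] with p hp using hp.flow_eq hΩ hf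

theorem hasDerivAt_flow {t : ℝ} {x : E} (h : (t, x) ∈ flowDomain f Ω) :
    HasDerivAt (fun s => flow f Ω s x) (f (flow f Ω t x)) t := by
  have hy := flowRel_flow h
  have hloc := isOpen_flowDomain hΩ hf
  obtain ⟨δ, h0, -, hδ⟩ := FlowRel.refl (f := f) hy.mem_right
  have hdiff : ContDiffAt ℝ ∞ (fun s => flow f Ω s x) t :=
    (contDiffAt_flow hΩ hf h).comp t (contDiffAt_id.prodMk contDiffAt_const)
  have hd := (hdiff.differentiableAt (by simp)).hasDerivAt
  obtain ⟨γ, hγ0, hγ1, hγ⟩ := hy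
  -- The flow is already known to be differentiable in time, and its derivative is read off an
  -- integral curve. That curve agrees with the flow only on `uIcc 0 t`, which is a single point for
  -- t = 0. There a curve of small positive duration is used.
  rcases eq_or_ne t 0 with rfl | ht
  · have hD : ∀ᶠ s in 𝓝 (0 : ℝ), (s, x) ∈ flowDomain f Ω :=
      (continuous_id.prodMk continuous_const).continuousAt (hloc.mem_nhds h)
    obtain ⟨ε, hε, hball⟩ := Metric.eventually_nhds_iff.1 hD
    obtain ⟨y, γ', hγ0', hγ1', hγ'⟩ := hball (y := ε / 2) (by
      rw [Real.dist_eq, sub_zero, abs_of_pos (by linarith)]; linarith)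
    rw [Set.uIcc_of_le (by linarith)] at hγ'
    have h1 : HasDerivWithinAt (fun s => flow f Ω s x) (f (γ' 0)) (Set.Ici 0) 0 := by
      refine ((hγ' 0 ⟨le_rfl, by linarith⟩).2.hasDerivWithinAt (s := Set.Ici 0)).congr_of_eventuallyEq
        ?_ ?_
      · filter_upwards [Icc_mem_nhdsGE (show (0 : ℝ) < ε / 2 by linarith)] with s hs
        refine FlowRel.flow_eq hΩ hf ⟨γ', hγ0', rfl, fun r hr => hγ' r ?_⟩
        rw [Set.uIcc_of_le hs.1] at hr
        exact ⟨hr.1, hr.2.trans hs.2⟩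
      · refine FlowRel.flow_eq hΩ hf ⟨γ', hγ0', rfl, fun r hr => hγ' r ?_⟩
        rw [Set.uIcc_self] at hr
        rw [Set.mem_singleton_iff.1 hr]
        exact ⟨le_rfl, by linarith⟩
    have h2 : flow f Ω 0 x = x := (FlowRel.refl (hγ0 ▸ (hγ 0 Set.left_mem_uIcc).1)).flow_eq hΩ hf
    rw [h2]
    rw [hγ0'] at h1
    have := (uniqueDiffWithinAt_Ici (0 : ℝ)).eq_deriv _ h1 hd.hasDerivWithinAt
    rw [this]
    exact hd
  · have h1 : HasDerivWithinAt (fun s => flow f Ω s x) (f (γ t)) (Set.uIcc 0 t) t := by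
      have heq : ∀ s ∈ Set.uIcc 0 t, flow f Ω s x = γ s := fun s hs =>
        FlowRel.flow_eq hΩ hf ⟨γ, hγ0, rfl, fun r hr => hγ r (Set.uIcc_subset_uIcc_left hs hr)⟩
      exact (hγ t Set.right_mem_uIcc).2.hasDerivWithinAt.congr heq (heq t Set.right_mem_uIcc)
    have hu : UniqueDiffWithinAt ℝ (Set.uIcc 0 t) t :=
      uniqueDiffOn_uIcc ht.symm _ Set.right_mem_uIcc
    rw [hγ1] at h1
    rw [hu.eq_deriv _ h1 hd.hasDerivWithinAt]
    exact hd

/-- An integral curve that cannot leave a compact subset of `Ω` does not stop. -/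
theorem exists_flowRel_of_compact {C : Set E} (hC : IsCompact C) (hCΩ : C ⊆ Ω) {T : ℝ} (hT : 0 ≤ T)
    {x : E} (hx : x ∈ C) (h : ∀ t ∈ Set.Icc 0 T, ∀ y, FlowRel f Ω t x y → y ∈ C) :
    ∃ y, FlowRel f Ω T x y := by
  -- Compactness gives one existence time δ valid for all starting points in C. The curve is then
  -- prolonged by steps of at most δ / 2, capped at T.
  obtain ⟨u, v, hu, hv, h0u, hCv, huv⟩ := generalized_tube_lemma (s := {(0 : ℝ)}) (t := C)
    isCompact_singleton hC (isOpen_flowDomain hΩ hf) (by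
      rintro ⟨t, z⟩ ⟨rfl, hz⟩
      exact ⟨z, FlowRel.refl (hCΩ hz)⟩)
  obtain ⟨δ, hδ, hball⟩ := Metric.isOpen_iff.1 hu 0 (h0u rfl)
  have key : ∀ n : ℕ, ∃ y, FlowRel f Ω (min (n * (δ / 2)) T) x y := by
    intro n
    induction n with
    | zero => exact ⟨x, by simpa [hT] using FlowRel.refl (hCΩ hx)⟩
    | succ n ih =>
      obtain ⟨y, hy⟩ := ih
      have hyC := h _ ⟨le_min (by positivity) hT, min_le_right _ _⟩ y hy
      set s := min (((n + 1 : ℕ) : ℝ) * (δ / 2)) T - min (n * (δ / 2)) T with hs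
      have hs0 : 0 ≤ s := by
        rw [hs, sub_nonneg]
        push_cast
        exact min_le_min_right _ (by nlinarith)
      have hs1 : s ≤ δ / 2 := by
        rw [hs]
        push_cast
        rcases le_total (n * (δ / 2)) T with h1 | h1
        · rw [min_eq_left h1]
          have := min_le_left (((n : ℝ) + 1) * (δ / 2)) T
          linarith
        · rw [min_eq_right h1]
          have := min_le_right (((n : ℝ) + 1) * (δ / 2)) T
          linarith
      obtain ⟨z, hz⟩ := huv (show (s, y) ∈ u ×ˢ v from ⟨hball (by
        rw [Metric.mem_ball, Real.dist_eq, sub_zero, abs_of_nonneg hs0]; linarith), hCv hyC⟩)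
      refine ⟨z, ?_⟩
      have := hy.trans hΩ hf hz
      rwa [show min (n * (δ / 2)) T + s = min (((n + 1 : ℕ) : ℝ) * (δ / 2)) T by rw [hs]; ring]
        at this
  obtain ⟨n, hn⟩ := exists_nat_ge (T / (δ / 2))
  obtain ⟨y, hy⟩ := key n
  rw [min_eq_right ((div_le_iff₀ (by positivity)).1 hn)] at hy
  exact ⟨y, hy⟩

end flow

/-- Mixed partial derivatives commute. -/
theorem hasDerivAt_partial_fderiv {E F : Type*} [NormedAddCommGroup E] [NormedSpace ℝ E]
    [NormedAddCommGroup F] [NormedSpace ℝ F] {Ψ : ℝ × E → F} {t : ℝ} {x : E}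
    (h : ContDiffAt ℝ ∞ Ψ (t, x)) (v : E) :
    HasDerivAt (fun s => fderiv ℝ (fun y => Ψ (s, y)) x v)
      (fderiv ℝ (fun y => deriv (fun s => Ψ (s, y)) t) x v) t := by
  replace h : ContDiffAt ℝ 2 Ψ (t, x) := by exact_mod_cast contDiffAt_infty.1 h 2
  have hd : ∀ᶠ p in 𝓝 (t, x), DifferentiableAt ℝ Ψ p := by
    filter_upwards [h.eventually (by simp)] with p hp using hp.differentiableAt (by simp)
  have h2 : DifferentiableAt ℝ (fderiv ℝ Ψ) (t, x) :=
    (h.fderiv_right (m := 1) (by norm_num)).differentiableAt (by simp)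
  have hsymm : IsSymmSndFDerivAt ℝ Ψ (t, x) := h.isSymmSndFDerivAt (by simp)
  have e1 : (fun s => fderiv ℝ (fun y => Ψ (s, y)) x v) =ᶠ[𝓝 t]
      fun s => fderiv ℝ Ψ (s, x) (0, v) := by
    have : ∀ᶠ s in 𝓝 t, DifferentiableAt ℝ Ψ (s, x) :=
      (show ContinuousAt (fun s => (s, x)) t by fun_prop) hd
    filter_upwards [this] with s hs
    have := (hs.hasFDerivAt.comp x (hasFDerivAt_prodMk_right s x)).fderiv
    have h3 : fderiv ℝ (fun y => Ψ (s, y)) x = _ := this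
    rw [h3]
    simp
  have e2 : (fun y => deriv (fun s => Ψ (s, y)) t) =ᶠ[𝓝 x]
      fun y => fderiv ℝ Ψ (t, y) (1, 0) := by
    have : ∀ᶠ y in 𝓝 x, DifferentiableAt ℝ Ψ (t, y) :=
      (show ContinuousAt (fun y => (t, y)) x by fun_prop) hd
    filter_upwards [this] with y hy
    have := hy.hasFDerivAt.comp_hasDerivAt t ((hasDerivAt_id t).prodMk (hasDerivAt_const t y))
    exact this.deriv
  rw [e2.fderiv_eq]
  have d1' : HasDerivAt (fun s => fderiv ℝ Ψ (s, x)) (fderiv ℝ (fderiv ℝ Ψ) (t, x) (1, 0)) t :=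
    h2.hasFDerivAt.comp_hasDerivAt t ((hasDerivAt_id t).prodMk (hasDerivAt_const t x))
  have d1 : HasDerivAt (fun s => fderiv ℝ Ψ (s, x) (0, v))
      (fderiv ℝ (fderiv ℝ Ψ) (t, x) (1, 0) (0, v)) t := by
    have := d1'.clm_apply (hasDerivAt_const t ((0 : ℝ), v))
    rwa [map_zero, add_zero] at this
  have d2' : HasFDerivAt (fun y => fderiv ℝ Ψ (t, y))
      (fderiv ℝ (fderiv ℝ Ψ) (t, x) ∘L ContinuousLinearMap.inr ℝ ℝ E) x :=
    h2.hasFDerivAt.comp x (hasFDerivAt_prodMk_right t x)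
  have d2 : HasFDerivAt (fun y => fderiv ℝ Ψ (t, y) (1, 0))
      ((ContinuousLinearMap.apply ℝ F ((1 : ℝ), (0 : E))) ∘L
        (fderiv ℝ (fderiv ℝ Ψ) (t, x) ∘L ContinuousLinearMap.inr ℝ ℝ E)) x :=
    (ContinuousLinearMap.apply ℝ F ((1 : ℝ), (0 : E))).hasFDerivAt.comp x d2'
  rw [d2.fderiv]
  refine (d1.congr_of_eventuallyEq e1).congr_deriv ?_
  exact hsymm.eq (1, 0) (0, v)

/-! ### The Liouville field on ℂ² and its horizontal component -/

noncomputable section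

/-- The linear form vanishing on the line spanned by `e`. -/
def cross (e z : C2) : ℂ := e 0 * z 1 - e 1 * z 0

/-- The vector representing `cross e` under the Hermitian inner product. -/
def perp (e : C2) : C2 := !₂[-star (e 1), star (e 0)]

@[simp] theorem perp_zero (e : C2) : perp e 0 = -star (e 1) := rfl
@[simp] theorem perp_one (e : C2) : perp e 1 = star (e 0) := rfl

theorem inner_C2 (v w : C2) : inner ℂ v w = star (v 0) * w 0 + star (v 1) * w 1 := by
  simp [PiLp.inner_apply, Fin.sum_univ_two, mul_comm]

theorem inner_perp (e z : C2) : inner ℂ (perp e) z = cross e z := by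
  simp [inner_C2, cross]
  ring

theorem inner_perp_right (e z : C2) : inner ℂ z (perp e) = star (cross e z) := by
  rw [← inner_conj_symm, inner_perp]
  rfl

theorem cross_smul (e z : C2) (c : ℂ) : cross e (c • z) = c * cross e z := by
  simp [cross]; ring

theorem cross_add (e z w : C2) : cross e (z + w) = cross e z + cross e w := by
  simp [cross]; ring

@[simp] theorem cross_apply_self (e : C2) : cross e e = 0 := by
  simp [cross]; ring

@[simp] theorem cross_zero_right (e : C2) : cross e 0 = 0 := by
  simp [cross]

theorem cross_comm (e z : C2) : cross e z = -cross z e := by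
  simp [cross]
  ring

theorem norm_sq_C2 (z : C2) : ‖z‖ ^ 2 = ‖z 0‖ ^ 2 + ‖z 1‖ ^ 2 := by
  simp [EuclideanSpace.norm_sq_eq, Fin.sum_univ_two]

theorem inner_self_C2 (z : C2) : inner ℂ z z = ((‖z‖ ^ 2 : ℝ) : ℂ) := by
  rw [inner_self_eq_norm_sq_to_K]; norm_cast

theorem norm_sq_complex (z : C2) : ((‖z‖ ^ 2 : ℝ) : ℂ) = star (z 0) * z 0 + star (z 1) * z 1 := by
  rw [← inner_self_C2, inner_C2]

theorem cross_perp (e : C2) : cross e (perp e) = ((‖e‖ ^ 2 : ℝ) : ℂ) := by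
  rw [norm_sq_complex]; simp [cross]; ring

theorem real_smul_C2 (a : ℝ) (z : C2) : a • z = (a : ℂ) • z := by
  ext i; simp

/-- The real-linear map `w ↦ cross e w`. -/
def crossL (e : C2) : C2 →L[ℂ] ℂ := innerSL ℂ (perp e)

@[simp] theorem crossL_apply (e z : C2) : crossL e z = cross e z := by
  simp [crossL, inner_perp]

theorem contDiff_coord (i : Fin 2) : ContDiff ℝ ∞ fun z : C2 => z i :=
  ((EuclideanSpace.proj i : C2 →L[ℂ] ℂ).restrictScalars ℝ).contDiff

theorem contDiff_star : ContDiff ℝ ∞ (star : ℂ → ℂ) := Complex.conjCLE.contDiff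

theorem ContDiffOn.smul_C2 {E : Type*} [NormedAddCommGroup E] [NormedSpace ℝ E] {c : E → ℂ}
    {f : E → C2} {s : Set E} {n : WithTop ℕ∞} (hc : ContDiffOn ℝ n c s) (hf : ContDiffOn ℝ n f s) :
    ContDiffOn ℝ n (fun x => c x • f x) s :=
  ((ContinuousLinearMap.lsmul ℝ ℂ : ℂ →L[ℝ] C2 →L[ℝ] C2).isBoundedBilinearMap.contDiff).comp_contDiffOn
    (hc.prodMk hf)

theorem eq_smul_add_smul_C2 (z : C2) : z = z 0 • (!₂[1, 0] : C2) + z 1 • (!₂[0, 1] : C2) := by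
  ext i
  fin_cases i <;> simp

theorem contDiff_C2_mk {E : Type*} [NormedAddCommGroup E] [NormedSpace ℝ E] {f : E → C2} {s : Set E}
    {n : WithTop ℕ∞} (h : ∀ i, ContDiffOn ℝ n (fun x => f x i) s) : ContDiffOn ℝ n f s := by
  have : f = fun x => f x 0 • (!₂[1, 0] : C2) + f x 1 • (!₂[0, 1] : C2) :=
    funext fun x => eq_smul_add_smul_C2 (f x)
  rw [this]
  exact ((h 0).smul_C2 contDiffOn_const).add ((h 1).smul_C2 contDiffOn_const)

section fields

variable {m : ℕ} (κ : Fin m → ℝ) (e : Fin m → C2)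

/-- The gradient of `∑ κ_i log |cross e_i|`. -/
def gradLog (z : C2) : C2 := ∑ i, ((κ i : ℂ) / star (cross (e i) z)) • perp (e i)

/-- The Liouville vector field of the configuration. -/
def liouvilleField (z : C2) : C2 := (1 / 2 : ℝ) • (gradLog κ e z - z)

/-- The component of the Liouville vector field orthogonal to the Hopf fibration, rescaled so as to
be homogeneous of degree one. -/
def hopfField (z : C2) : C2 := (‖z‖ ^ 2 / 2) • gradLog κ e z - ((∑ i, κ i) / 2) • z

/-- The complement of the lines of the configuration. -/
def regularSet : Set C2 := {z | ∀ i, cross (e i) z ≠ 0}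

variable {κ e}

/-- Euler's relation: a linear form has logarithmic derivative one in the direction of z. -/
theorem inner_gradLog_self {z : C2} (hz : z ∈ regularSet e) :
    inner ℂ z (gradLog κ e z) = ((∑ i, κ i : ℝ) : ℂ) := by
  simp only [gradLog, inner_sum, inner_smul_right, inner_perp_right]
  push_cast
  refine Finset.sum_congr rfl fun i _ => ?_
  rw [div_mul_cancel₀]
  simpa using hz i

theorem inner_gradLog (z w : C2) :
    inner ℂ (gradLog κ e z) w = ∑ i, (κ i : ℂ) * (cross (e i) w / cross (e i) z) := by
  simp only [gradLog, sum_inner, inner_smul_left, inner_perp]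
  refine Finset.sum_congr rfl fun i _ => ?_
  simp
  ring

/-- The real part says that the field is tangent to the spheres, the imaginary part that it lies in
the standard contact planes. -/
theorem inner_hopfField {z : C2} (hz : z ∈ regularSet e) : inner ℂ z (hopfField κ e z) = 0 := by
  rw [hopfField, inner_sub_right, real_smul_C2, real_smul_C2, inner_smul_right, inner_smul_right,
    inner_gradLog_self hz, inner_self_C2]
  push_cast
  ring

/-- The left side is the derivative of ∑ κ_i log ℓ_i along the field. Its being real means that the
weighted phase is constant along trajectories. The right side is a Cauchy–Schwarz defect, so that
the potential cannot decrease. -/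
theorem inner_gradLog_hopfField {z : C2} (hz : z ∈ regularSet e) :
    inner ℂ (gradLog κ e z) (hopfField κ e z) =
      (((‖z‖ ^ 2 * ‖gradLog κ e z‖ ^ 2 - (∑ i, κ i) ^ 2) / 2 : ℝ) : ℂ) := by
  have h : inner ℂ (gradLog κ e z) z = ((∑ i, κ i : ℝ) : ℂ) := by
    rw [← inner_conj_symm, inner_gradLog_self hz, Complex.conj_ofReal]
  rw [hopfField, inner_sub_right, real_smul_C2, real_smul_C2, inner_smul_right, inner_smul_right,
    h, inner_self_C2]
  push_cast
  ring

theorem inner_gradLog_hopfField_re_nonneg {z : C2} (hz : z ∈ regularSet e) :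
    0 ≤ (inner ℂ (gradLog κ e z) (hopfField κ e z)).re := by
  rw [inner_gradLog_hopfField hz, Complex.ofReal_re]
  have h1 : |∑ i, κ i| ≤ ‖z‖ * ‖gradLog κ e z‖ := by
    have := norm_inner_le_norm (𝕜 := ℂ) z (gradLog κ e z)
    rwa [inner_gradLog_self hz, Complex.norm_real, Real.norm_eq_abs] at this
  have h2 : (∑ i, κ i) ^ 2 ≤ (‖z‖ * ‖gradLog κ e z‖) ^ 2 := by
    rw [← sq_abs]
    gcongr
  nlinarith

theorem regularSet_smul {z : C2} (hz : z ∈ regularSet e) {c : ℂ} (hc : c ≠ 0) :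
    c • z ∈ regularSet e := fun i => by
  rw [cross_smul]
  exact mul_ne_zero hc (hz i)

theorem hopfField_smul (z : C2) {c : ℂ} (hc : c ≠ 0) :
    hopfField κ e (c • z) = c • hopfField κ e z := by
  have hc' : star c ≠ 0 := by simpa using hc
  have h1 : gradLog κ e (c • z) = (star c)⁻¹ • gradLog κ e z := by
    simp only [gradLog, cross_smul, Finset.smul_sum, smul_smul]
    refine Finset.sum_congr rfl fun i _ => ?_
    congr 1
    rw [star_mul']
    field_simp
  have h2 : ((‖c‖ ^ 2 : ℝ) : ℂ) = c * star c := by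
    rw [← Complex.normSq_eq_norm_sq]
    exact Complex.normSq_eq_conj_mul_self.trans (mul_comm _ _)
  simp only [hopfField, h1, real_smul_C2, norm_smul, smul_sub, smul_smul]
  congr 2
  · rw [mul_pow, mul_div_assoc, Complex.ofReal_mul, h2]
    field_simp
  · ring

/-- The radial coefficient depends on the norm only, so Liouville trajectories are trajectories of
`hopfField` after a time change and a rescaling. -/
theorem liouvilleField_eq {z : C2} (hz : z ≠ 0) :
    liouvilleField κ e z = (‖z‖ ^ 2)⁻¹ • hopfField κ e z +
      (((∑ i, κ i) - ‖z‖ ^ 2) / (2 * ‖z‖ ^ 2)) • z := by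
  have h : ‖z‖ ≠ 0 := norm_ne_zero_iff.2 hz
  simp only [liouvilleField, hopfField, smul_sub, smul_smul]
  rw [show (‖z‖ ^ 2)⁻¹ * (‖z‖ ^ 2 / 2) = 1 / 2 by field_simp,
    show ((∑ i, κ i) - ‖z‖ ^ 2) / (2 * ‖z‖ ^ 2) = (‖z‖ ^ 2)⁻¹ * ((∑ i, κ i) / 2) - 1 / 2 by
      field_simp, sub_smul]
  abel

end fields

/-! ### Families of configurations and their total space -/

section family

variable {m : ℕ} (κ : Fin m → ℝ) (e : ℝ → Fin m → C2)

/-- The total space of the complements of the lines of a family of configurations. -/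
def regularTotal : Set (ℝ × C2) := {p | p.2 ∈ regularSet (e p.1)}

/-- The vector field on the total space restricting to `hopfField` on each fibre. -/
def totalField (p : ℝ × C2) : ℝ × C2 := (0, hopfField κ (e p.1) p.2)

variable {κ e} (he : ∀ i, ContDiff ℝ ∞ fun r => e r i)
include he

theorem contDiff_cross_total (i : Fin m) :
    ContDiff ℝ ∞ fun p : ℝ × C2 => cross (e p.1 i) p.2 := by
  have h1 (j : Fin 2) : ContDiff ℝ ∞ fun p : ℝ × C2 => e p.1 i j :=
    (contDiff_coord j).comp ((he i).comp contDiff_fst)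
  have h2 (j : Fin 2) : ContDiff ℝ ∞ fun p : ℝ × C2 => p.2 j :=
    (contDiff_coord j).comp contDiff_snd
  exact ((h1 0).mul (h2 1)).sub ((h1 1).mul (h2 0))

theorem contDiff_perp_total (i : Fin m) : ContDiff ℝ ∞ fun p : ℝ × C2 => perp (e p.1 i) := by
  have h1 (j : Fin 2) : ContDiff ℝ ∞ fun p : ℝ × C2 => e p.1 i j :=
    (contDiff_coord j).comp ((he i).comp contDiff_fst)
  rw [← contDiffOn_univ]
  refine contDiff_C2_mk fun j => ?_
  fin_cases j
  · exact (contDiff_star.comp (h1 1)).neg.contDiffOn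
  · exact (contDiff_star.comp (h1 0)).contDiffOn

theorem isOpen_regularTotal : IsOpen (regularTotal e) := by
  have : regularTotal e = ⋂ i, {p | cross (e p.1 i) p.2 ≠ 0} := by
    ext p; simp [regularTotal, regularSet]
  rw [this]
  exact isOpen_iInter_of_finite fun i =>
    isOpen_ne_fun (contDiff_cross_total he i).continuous continuous_const

theorem contDiffOn_gradLog_total :
    ContDiffOn ℝ ∞ (fun p : ℝ × C2 => gradLog κ (e p.1) p.2) (regularTotal e) := by
  refine ContDiffOn.sum fun i _ => ?_
  refine ContDiffOn.smul_C2 ?_ (contDiff_perp_total he i).contDiffOn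
  simp only [div_eq_mul_inv]
  refine contDiffOn_const.mul
    (ContDiffOn.inv (contDiff_star.comp (contDiff_cross_total he i)).contDiffOn fun p hp => ?_)
  simpa using hp i

theorem contDiffOn_totalField : ContDiffOn ℝ ∞ (totalField κ e) (regularTotal e) := by
  refine contDiffOn_const.prodMk ?_
  refine ContDiffOn.sub ?_ ?_
  · have h : ContDiffOn ℝ ∞ (fun p : ℝ × C2 => ‖p.2‖ ^ 2 / 2) (regularTotal e) :=
      ((contDiff_snd.norm_sq ℂ).div_const 2).contDiffOn
    exact h.smul (contDiffOn_gradLog_total he)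
  · have h : ContDiffOn ℝ ∞ (fun p : ℝ × C2 => (∑ i, κ i) / 2) (regularTotal e) := contDiffOn_const
    exact h.smul contDiffOn_snd

end family

end

/-! ### Conserved and monotone quantities, forward completeness -/

noncomputable section

theorem FlowRel.le_of_hasFDerivAt {E : Type} [NormedAddCommGroup E] [NormedSpace ℝ E] {f : E → E}
    {Ω : Set E} {t : ℝ} {x y : E} (h : FlowRel f Ω t x y) (ht : 0 ≤ t) {φ : E → ℝ}
    {φ' : E → E →L[ℝ] ℝ} (hφ : ∀ z ∈ Ω, HasFDerivAt φ (φ' z) z)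
    (hpos : ∀ z ∈ Ω, 0 ≤ φ' z (f z)) : φ x ≤ φ y := by
  obtain ⟨γ, rfl, rfl, hγ⟩ := h
  rw [Set.uIcc_of_le ht] at hγ
  have hd : ∀ s ∈ Set.Icc 0 t, HasDerivAt (fun s => φ (γ s)) (φ' (γ s) (f (γ s))) s :=
    fun s hs => (hφ _ (hγ s hs).1).comp_hasDerivAt s (hγ s hs).2
  refine monotoneOn_of_deriv_nonneg (convex_Icc 0 t)
    (fun s hs => (hd s hs).continuousAt.continuousWithinAt) (fun s hs => ?_) (fun s hs => ?_)
    (Set.left_mem_Icc.2 ht) (Set.right_mem_Icc.2 ht) ht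
  · exact (hd s (interior_subset hs)).differentiableAt.differentiableWithinAt
  · rw [(hd s (interior_subset hs)).deriv]
    exact hpos _ (hγ s (interior_subset hs)).1

theorem FlowRel.eq_of_hasFDerivAt {E : Type} [NormedAddCommGroup E] [NormedSpace ℝ E] {f : E → E}
    {Ω : Set E} {t : ℝ} {x y : E} (h : FlowRel f Ω t x y) {φ : E → ℝ}
    {φ' : E → E →L[ℝ] ℝ} (hφ : ∀ z ∈ Ω, HasFDerivAt φ (φ' z) z)
    (hzero : ∀ z ∈ Ω, φ' z (f z) = 0) : φ x = φ y := by
  have key : ∀ {t : ℝ} {x y : E}, FlowRel f Ω t x y → 0 ≤ t → φ x = φ y := by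
    intro t x y h ht
    refine le_antisymm (h.le_of_hasFDerivAt ht hφ fun z hz => (hzero z hz).ge) ?_
    have := h.le_of_hasFDerivAt (φ := fun z => -φ z) (φ' := fun z => -φ' z) ht
      (fun z hz => (hφ z hz).neg) fun z hz => by simp [hzero z hz]
    simpa using this
  rcases le_total 0 t with ht | ht
  · exact key h ht
  · exact (key h.reverse (by simpa using ht)).symm

variable {m : ℕ}

/-- The flow relation of `hopfField` outside the lines of a configuration. -/
def HopfRel (κ : Fin m → ℝ) (e : Fin m → C2) : ℝ → C2 → C2 → Prop :=
  FlowRel (hopfField κ e) (regularSet e)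

variable {κ : Fin m → ℝ}

/-- The parameter r does not move, so the flow on the total space is the family of the fibre flows.
Treating it as one flow gives smoothness jointly in r. -/
theorem flowRel_totalField {e : ℝ → Fin m → C2} {t r : ℝ} {x : C2} {q : ℝ × C2} :
    FlowRel (totalField κ e) (regularTotal e) t (r, x) q ↔ q.1 = r ∧ HopfRel κ (e r) t x q.2 := by
  constructor
  · intro h
    have h0 : ∀ {s : ℝ} {q : ℝ × C2}, FlowRel (totalField κ e) (regularTotal e) s (r, x) q →
        q.1 = r := fun h => (h.eq_of_hasFDerivAt (φ := Prod.fst)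
          (φ' := fun _ => ContinuousLinearMap.fst ℝ ℝ C2) (fun z _ => hasFDerivAt_fst)
          (fun z _ => rfl)).symm
    refine ⟨h0 h, ?_⟩
    obtain ⟨γ, h1, rfl, h2⟩ := h
    refine ⟨fun s => (γ s).2, by simp [h1], rfl, fun s hs => ?_⟩
    have h3 : (γ s).1 = r := h0 ⟨γ, h1, rfl, fun s' hs' => h2 s' (Set.uIcc_subset_uIcc_left hs hs')⟩
    obtain ⟨h4, h5⟩ := h2 s hs
    refine ⟨by rw [← h3]; exact h4, ?_⟩
    have := (ContinuousLinearMap.snd ℝ ℝ C2).hasFDerivAt.comp_hasDerivAt s h5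
    simp only [totalField, h3] at this
    exact this
  · rintro ⟨h1, γ, h2, h3, h4⟩
    refine ⟨fun s => (r, γ s), by simp [h2], by ext1 <;> simp [h1, h3], fun s hs => ⟨(h4 s hs).1, ?_⟩⟩
    exact (hasDerivAt_const s r).prodMk (h4 s hs).2

namespace HopfRel

variable {e : Fin m → C2} {t : ℝ} {x y : C2}

theorem norm_eq (h : HopfRel κ e t x y) : ‖y‖ = ‖x‖ := by
  have : ‖x‖ ^ 2 = ‖y‖ ^ 2 := by
    refine FlowRel.eq_of_hasFDerivAt h (φ := fun z => ‖z‖ ^ 2)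
      (φ' := fun z => 2 • (innerSL ℝ z)) (fun z _ => (hasStrictFDerivAt_norm_sq z).hasFDerivAt)
      fun z hz => ?_
    have h1 : inner ℝ z (hopfField κ e z) = (inner ℂ z (hopfField κ e z)).re :=
      real_inner_eq_re_inner ℂ _ _
    simp [h1, inner_hopfField hz]
  exact ((sq_eq_sq₀ (norm_nonneg _) (norm_nonneg _)).1 this).symm

theorem smul (h : HopfRel κ e t x y) {c : ℂ} (hc : c ≠ 0) : HopfRel κ e t (c • x) (c • y) := by
  obtain ⟨γ, rfl, rfl, hγ⟩ := h
  refine ⟨fun s => c • γ s, rfl, rfl, fun s hs => ⟨regularSet_smul (hγ s hs).1 hc, ?_⟩⟩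
  rw [hopfField_smul _ hc]
  exact (hγ s hs).2.const_smul c

/-- The derivative of the summed logarithms along the field is twice the real part in
`inner_gradLog_hopfField_re_nonneg`. -/
theorem potential_le (h : HopfRel κ e t x y) (ht : 0 ≤ t) :
    ∑ i, κ i * Real.log (‖cross (e i) x‖ ^ 2) ≤ ∑ i, κ i * Real.log (‖cross (e i) y‖ ^ 2) := by
  let ℓ : Fin m → C2 →L[ℝ] ℂ := fun i => (crossL (e i)).restrictScalars ℝ
  refine FlowRel.le_of_hasFDerivAt h ht
    (φ := fun z => ∑ i, κ i * Real.log (‖cross (e i) z‖ ^ 2))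
    (φ' := fun z => ∑ i, κ i • ((‖cross (e i) z‖ ^ 2)⁻¹ •
      ((2 • innerSL ℝ (cross (e i) z)) ∘L ℓ i))) (fun z hz => ?_) fun z hz => ?_
  · refine HasFDerivAt.fun_sum fun i _ => HasFDerivAt.const_mul ?_ _
    have h1 : HasFDerivAt (fun z => cross (e i) z) (ℓ i) z := by
      have := (ℓ i).hasFDerivAt (x := z)
      exact this.congr_of_eventuallyEq (.of_forall fun w => (crossL_apply _ _).symm)
    have h2 := (hasStrictFDerivAt_norm_sq (cross (e i) z)).hasFDerivAt.comp z h1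
    exact h2.log (by simpa using hz i)
  · have := inner_gradLog_hopfField_re_nonneg (κ := κ) hz
    rw [inner_gradLog, Complex.re_sum] at this
    have h3 : (∑ i, κ i • ((‖cross (e i) z‖ ^ 2)⁻¹ •
      ((2 • innerSL ℝ (cross (e i) z)) ∘L ℓ i))) (hopfField κ e z) =
        2 * ∑ i, ((κ i : ℂ) * (cross (e i) (hopfField κ e z) / cross (e i) z)).re := by
      rw [sum_apply, Finset.mul_sum]
      refine Finset.sum_congr rfl fun i _ => ?_
      have hne : cross (e i) z ≠ 0 := hz i
      simp only [ℓ, smul_apply, ContinuousLinearMap.comp_apply,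
        ContinuousLinearMap.coe_restrictScalars', crossL_apply, innerSL_apply_apply, smul_eq_mul,
        Complex.re_ofReal_mul, Complex.inner, nsmul_eq_mul, Complex.div_re]
      rw [← Complex.normSq_eq_norm_sq]
      have : Complex.normSq (cross (e i) z) ≠ 0 := by simpa using hne
      simp only [Complex.mul_re, Complex.conj_re, Complex.conj_im]
      field_simp
      push_cast
      ring
    rw [h3]
    positivity

end HopfRel

variable {e : ℝ → Fin m → C2}

/-- The flow of `hopfField` for the member `e r` of a family of configurations. -/
def hopfFlow (κ : Fin m → ℝ) (e : ℝ → Fin m → C2) (t r : ℝ) (x : C2) : C2 :=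
  (flow (totalField κ e) (regularTotal e) t (r, x)).2

section

variable (he : ∀ i, ContDiff ℝ ∞ fun r => e r i)
include he

theorem HopfRel.flow_eq {t r : ℝ} {x y : C2} (h : HopfRel κ (e r) t x y) :
    hopfFlow κ e t r x = y := by
  have h' : FlowRel (totalField κ e) (regularTotal e) t (r, x) (r, y) :=
    flowRel_totalField.2 ⟨rfl, h⟩
  rw [hopfFlow, h'.flow_eq (isOpen_regularTotal he) (contDiffOn_totalField he)]

theorem contDiffAt_hopfFlow {t r : ℝ} {x y : C2} (h : HopfRel κ (e r) t x y) :
    ContDiffAt ℝ ∞ (fun p : ℝ × ℝ × C2 => hopfFlow κ e p.1 p.2.1 p.2.2) (t, r, x) :=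
  contDiffAt_snd.comp _ (contDiffAt_flow (isOpen_regularTotal he) (contDiffOn_totalField he)
    (show (t, (r, x)) ∈ flowDomain _ _ from ⟨(r, y), flowRel_totalField.2 ⟨rfl, h⟩⟩))

theorem eventually_hopfRel {t r : ℝ} {x y : C2} (h : HopfRel κ (e r) t x y) :
    ∀ᶠ p : ℝ × ℝ × C2 in 𝓝 (t, r, x),
      HopfRel κ (e p.2.1) p.1 p.2.2 (hopfFlow κ e p.1 p.2.1 p.2.2) := by
  have := (isOpen_flowDomain (isOpen_regularTotal he) (contDiffOn_totalField (κ := κ) he)).mem_nhds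
    (show (t, (r, x)) ∈ flowDomain _ _ from ⟨(r, y), flowRel_totalField.2 ⟨rfl, h⟩⟩)
  filter_upwards [this] with p hp
  exact (flowRel_totalField.1 (flowRel_flow hp)).2

end

section fibre

variable {e : Fin m → C2}

theorem isOpen_regularSet : IsOpen (regularSet e) := by
  have := (isOpen_regularTotal (e := fun _ => e) fun i => contDiff_const).preimage
    (Continuous.prodMk_right (X := ℝ) (Y := C2) 0)
  exact this

theorem contDiffOn_hopfField : ContDiffOn ℝ ∞ (hopfField κ e) (regularSet e) := by
  have := (contDiffOn_totalField (κ := κ) (e := fun _ => e) fun i => contDiff_const).comp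
    (f := fun z : C2 => ((0 : ℝ), z)) (contDiff_prodMk_right 0).contDiffOn (s := regularSet e)
    (fun z hz => hz)
  exact contDiff_snd.comp_contDiffOn this

namespace HopfRel

theorem reverse {t : ℝ} {x y : C2} (h : HopfRel κ e t x y) : HopfRel κ e (-t) y x :=
  FlowRel.reverse h

theorem trans {s t : ℝ} {x y z : C2} (h : HopfRel κ e s x y) (h' : HopfRel κ e t y z) :
    HopfRel κ e (s + t) x z :=
  FlowRel.trans isOpen_regularSet contDiffOn_hopfField h h'

theorem unique {t : ℝ} {x y y' : C2} (h : HopfRel κ e t x y) (h' : HopfRel κ e t x y') : y = y' :=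
  FlowRel.unique isOpen_regularSet contDiffOn_hopfField h h'

/-- `hopfField` is forward complete outside the lines. -/
theorem exists_of_nonneg (hκ : ∀ i, 0 < κ i) {t : ℝ} (ht : 0 ≤ t) {x : C2}
    (hx : x ∈ regularSet e) : ∃ y, HopfRel κ e t x y := by
  -- The exponential of the potential is continuous across the lines and vanishes on them. On a
  -- sphere its superlevel sets at positive levels are therefore compact subsets of the regular set,
  -- and forward trajectories stay in them.
  let P : C2 → ℝ := fun z => ∏ i, (‖cross (e i) z‖ ^ 2) ^ κ i
  have hPc : Continuous P := by
    refine continuous_finsetProd _ fun i _ => ?_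
    refine Continuous.rpow_const ?_ fun _ => Or.inr (hκ i).le
    have : Continuous fun z => cross (e i) z :=
      (crossL (e i)).continuous.congr fun z => crossL_apply _ _
    exact this.norm.pow 2
  have hP (z : C2) (hz : z ∈ regularSet e) :
      P z = Real.exp (∑ i, κ i * Real.log (‖cross (e i) z‖ ^ 2)) := by
    rw [Real.exp_sum]
    refine Finset.prod_congr rfl fun i _ => ?_
    have : 0 < ‖cross (e i) z‖ ^ 2 := by
      have := norm_pos_iff.2 (hz i)
      positivity
    rw [Real.rpow_def_of_pos this, mul_comm]
  have hP0 : 0 < P x := by rw [hP x hx]; exact Real.exp_pos _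
  refine exists_flowRel_of_compact isOpen_regularSet contDiffOn_hopfField
    (C := Metric.sphere 0 ‖x‖ ∩ {z | P x ≤ P z}) ?_ ?_ ht ⟨by simp, le_refl (P x)⟩ ?_
  · exact (isCompact_sphere _ _).inter_right (isClosed_le continuous_const hPc)
  · rintro z ⟨-, hz⟩ i hi
    have : P z = 0 := by
      refine Finset.prod_eq_zero (Finset.mem_univ i) ?_
      rw [hi]
      simpa using Real.zero_rpow (hκ i).ne'
    rw [Set.mem_ofPred_eq, this] at hz
    exact hz.not_gt hP0
  · intro s hs y hy
    have hy' : HopfRel κ e s x y := hy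
    refine ⟨by simpa using hy'.norm_eq, ?_⟩
    rw [Set.mem_ofPred_eq, hP x hx, hP y (FlowRel.mem_right hy)]
    exact Real.exp_le_exp.2 (hy'.potential_le hs.1)

end HopfRel

end fibre

end

/-! ### Reparametrised integral curves and the field near a pole -/

noncomputable section

/-- An integral curve on a closed interval, up to a change of the time parameter. -/
theorem FlowRel.of_reparam {E : Type} [NormedAddCommGroup E] [NormedSpace ℝ E]
    [FiniteDimensional ℝ E] {f : E → E} {Ω : Set E} (hΩ : IsOpen Ω) (hf : ContDiffOn ℝ ∞ f Ω)
    {a b : ℝ} (hab : a ≤ b) {γ : ℝ → E} {τ τ' : ℝ → ℝ} (hτ' : ContinuousOn τ' (Set.Icc a b))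
    (hpos : ∀ s ∈ Set.Icc a b, 0 ≤ τ' s)
    (hτ : ∀ s ∈ Set.Icc a b, HasDerivWithinAt τ (τ' s) (Set.Icc a b) s)
    (hγ : ∀ s ∈ Set.Icc a b, γ s ∈ Ω ∧
      HasDerivWithinAt γ (τ' s • f (γ s)) (Set.Icc a b) s) :
    FlowRel f Ω (τ b - τ a) (γ a) (γ b) := by
  have hγc : ContinuousOn γ (Set.Icc a b) := fun s hs => (hγ s hs).2.continuousWithinAt
  have hτc : ContinuousOn τ (Set.Icc a b) := fun s hs => (hτ s hs).continuousWithinAt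
  have hIci {F : Type} [NormedAddCommGroup F] [NormedSpace ℝ F] {ε : ℝ → F} {v : F} {c s : ℝ}
      (hc : c ≤ b) (hs : s ∈ Set.Ico a c)
      (h : HasDerivWithinAt ε v (Set.Icc a b) s) : HasDerivWithinAt ε v (Set.Ici s) s :=
    h.mono_of_mem_nhdsWithin (Filter.mem_of_superset (Icc_mem_nhdsGE (hs.2.trans_le hc))
      (Set.Icc_subset_Icc_left hs.1))
  have hmono : MonotoneOn τ (Set.Icc a b) := by
    refine monotoneOn_of_hasDerivWithinAt_nonneg (f' := τ') (convex_Icc a b) hτc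
      (fun s hs => ?_) (fun s hs => hpos s (interior_subset hs))
    exact (hτ s (interior_subset hs)).mono interior_subset
  have ha := Set.left_mem_Icc.2 hab
  have hb := Set.right_mem_Icc.2 hab
  -- Since τ' may vanish, τ need not be invertible. The true integral curve is instead composed with
  -- τ and compared with γ as a solution of the same non-autonomous equation in s.
  have key : ∀ c ∈ Set.Icc a b, ∀ y, FlowRel f Ω (τ c - τ a) (γ a) y → y = γ c := by
    rintro c hc y ⟨δ, hδ0, hδ1, hδ⟩
    rw [Set.uIcc_of_le (sub_nonneg.2 (hmono ha hc hc.1))] at hδ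
    have hsub : Set.Icc a c ⊆ Set.Icc a b := Set.Icc_subset_Icc_right hc.2
    have hmem : ∀ s ∈ Set.Icc a c, τ s - τ a ∈ Set.Icc 0 (τ c - τ a) := fun s hs =>
      ⟨sub_nonneg.2 (hmono ha (hsub hs) hs.1), sub_le_sub_right (hmono (hsub hs) hc hs.2) _⟩
    have hεc : ContinuousOn (fun s => δ (τ s - τ a)) (Set.Icc a c) := fun s hs =>
      ContinuousAt.comp_continuousWithinAt (f := fun s => τ s - τ a) (g := δ)
        (hδ _ (hmem s hs)).2.continuousAt
        ((hτc.mono hsub s hs).sub continuousWithinAt_const)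
    obtain ⟨g, hg, hgc, U, hU, hCU, hUΩ, hgf⟩ := exists_contDiff_cutoff hΩ hf
      ((isCompact_Icc.image_of_continuousOn (hγc.mono hsub)).union
        (isCompact_Icc.image_of_continuousOn hεc)) (by
        rintro x (⟨s, hs, rfl⟩ | ⟨s, hs, rfl⟩)
        exacts [(hγ s (hsub hs)).1, (hδ _ (hmem s hs)).1])
    obtain ⟨L, hL⟩ := hg.lipschitzWith_of_hasCompactSupport hgc (by simp)
    obtain ⟨M, hM⟩ := isCompact_Icc.exists_bound_of_continuousOn hτ'
    lift M to NNReal using (norm_nonneg _).trans (hM a ha)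
    have hLM : ∀ s ∈ Set.Ico a c,
        LipschitzOnWith (M * L) (fun z => τ' s • g z) Set.univ := by
      intro s hs
      rw [lipschitzOnWith_univ]
      refine LipschitzWith.of_dist_le_mul fun z w => ?_
      rw [dist_smul₀, NNReal.coe_mul, mul_assoc]
      exact mul_le_mul (hM s (hsub (Set.Ico_subset_Icc_self hs))) (hL.dist_le_mul z w) dist_nonneg
        M.2
    have := ODE_solution_unique_of_mem_Icc_right hLM hεc (fun s hs => ?_)
      (fun _ _ => Set.mem_univ _) (hγc.mono hsub) (fun s hs => ?_) (fun _ _ => Set.mem_univ _)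
      (by simp [hδ0]) (Set.right_mem_Icc.2 hc.1)
    · simpa [hδ1] using this
    · have hs' := Set.Ico_subset_Icc_self hs
      rw [hgf (hCU (Or.inr ⟨s, hs', rfl⟩))]
      exact (hδ _ (hmem s hs')).2.scomp_hasDerivWithinAt s
        ((hIci hc.2 hs (hτ s (hsub hs'))).sub_const (τ a))
    · have hs' := Set.Ico_subset_Icc_self hs
      rw [hgf (hCU (Or.inl ⟨s, hs', rfl⟩))]
      exact hIci hc.2 hs (hγ s (hsub hs')).2
  have hex : ∃ y, FlowRel f Ω (τ b - τ a) (γ a) y := by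
    -- By the comparison above, the integral curve cannot leave the compact trace of γ before time τ
    -- b - τ a.
    refine exists_flowRel_of_compact hΩ hf (C := γ '' Set.Icc a b)
      (isCompact_Icc.image_of_continuousOn hγc) ?_ (sub_nonneg.2 (hmono ha hb hab)) ⟨a, ha, rfl⟩ ?_
    · rintro _ ⟨s, hs, rfl⟩
      exact (hγ s hs).1
    · intro t ht y hy
      obtain ⟨c, hc, hct⟩ : τ a + t ∈ τ '' Set.Icc a b :=
        intermediate_value_Icc hab hτc ⟨by linarith [ht.1], by linarith [ht.2]⟩
      refine ⟨c, hc, (key c hc y ?_).symm⟩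
      rwa [hct, add_sub_cancel_left]
  obtain ⟨y, hy⟩ := hex
  rwa [key b hb y hy] at hy

section pole

variable {m : ℕ} (κ : Fin m → ℝ) (e : Fin m → C2) (j : Fin m)

/-- The regular part of the projected vector field at the `j`-th pole, in the affine coordinate
`w` for which `e j + w • perp (e j)` spans the line. -/
def poleNormal (w : ℂ) : ℂ := ∑ i ∈ Finset.univ.erase j, ((κ i / κ j : ℝ) : ℂ) *
  ((star (cross (e i) (perp (e j))) - w * star (cross (e i) (e j))) *
    (star (cross (e i) (e j + w • perp (e j))))⁻¹)

/-- The tangential component of the vector field at the `j`-th pole. -/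
def poleTangent (w : ℂ) : ℂ := ∑ i ∈ Finset.univ.erase j, ((κ i / 2 : ℝ) : ℂ) *
  (star (cross (e i) (e j)) * (star (cross (e i) (e j + w • perp (e j))))⁻¹)

variable {κ e j}

theorem perp_decomp (hj : ‖e j‖ = 1) (v : C2) : perp v =
    star (cross v (e j)) • e j + star (cross v (perp (e j))) • perp (e j) := by
  have h : star (e j 0) * e j 0 + star (e j 1) * e j 1 = 1 := by
    rw [← norm_sq_complex, hj]; simp
  ext i
  fin_cases i
  · simp [cross]
    simp at h
    linear_combination ((starRingEnd ℂ) (v 1)) * h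
  · simp [cross]
    simp at h
    linear_combination (-(starRingEnd ℂ) (v 0)) * h

theorem norm_sq_affine (hj : ‖e j‖ = 1) (w : ℂ) : ‖e j + w • perp (e j)‖ ^ 2 = 1 + ‖w‖ ^ 2 := by
  have h : ‖perp (e j)‖ = 1 := by
    have : ‖perp (e j)‖ ^ 2 = 1 := by
      rw [norm_sq_C2]
      simp only [perp_zero, perp_one, norm_neg, norm_star]
      rw [add_comm, ← norm_sq_C2, hj, one_pow]
    exact (pow_eq_one_iff_of_nonneg (norm_nonneg _) (by norm_num)).1 this
  have h2 : inner ℂ (e j) (w • perp (e j)) = 0 := by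
    rw [inner_smul_right, inner_perp_right]
    simp
  have := norm_add_sq_eq_norm_sq_add_norm_sq_of_inner_eq_zero (𝕜 := ℂ) _ _ h2
  rw [norm_smul, h, hj] at this
  nlinarith

/-- The only singular term at the pole w = 0 is (star w)⁻¹, with coefficient tending to κ_j / 2. It
makes ‖w‖² grow at rate about κ_j, so w behaves like the square root of time. The two sums extend
smoothly over w = 0. -/
theorem hopfField_affine (hj : ‖e j‖ = 1) (hκj : κ j ≠ 0) (w : ℂ) :
    hopfField κ e (e j + w • perp (e j)) =
      ((1 + ‖w‖ ^ 2 : ℝ) * poleTangent κ e j w - ((∑ i, κ i) / 2 : ℝ)) •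
        (e j + w • perp (e j)) +
      (((1 + ‖w‖ ^ 2) * κ j / 2 : ℝ) * ((star w)⁻¹ + poleNormal κ e j w)) • perp (e j) := by
  have hjj : cross (e j) (e j + w • perp (e j)) = w := by
    rw [cross_add, cross_smul, cross_apply_self, cross_perp, hj]; simp
  have hg : gradLog κ e (e j + w • perp (e j)) =
      ((κ j : ℂ) * (star w)⁻¹) • perp (e j) + ((2 : ℂ) * poleTangent κ e j w) • e j +
      (∑ i ∈ Finset.univ.erase j, (κ i : ℂ) * (star (cross (e i) (perp (e j))) *
        (star (cross (e i) (e j + w • perp (e j))))⁻¹)) • perp (e j) := by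
    rw [gradLog, ← Finset.add_sum_erase _ _ (Finset.mem_univ j), hjj, div_eq_mul_inv, add_assoc]
    congr 1
    rw [poleTangent, Finset.mul_sum, Finset.sum_smul, Finset.sum_smul, ← Finset.sum_add_distrib]
    refine Finset.sum_congr rfl fun i _ => ?_
    conv_lhs => rw [perp_decomp hj (e i)]
    rw [smul_add, smul_smul, smul_smul]
    congr 2
    · push_cast; ring
    · ring
  have hn : (κ j : ℂ) * poleNormal κ e j w =
      (∑ i ∈ Finset.univ.erase j, (κ i : ℂ) * (star (cross (e i) (perp (e j))) *
        (star (cross (e i) (e j + w • perp (e j))))⁻¹)) - 2 * w * poleTangent κ e j w := by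
    have hk : (κ j : ℂ) ≠ 0 := by exact_mod_cast hκj
    rw [poleNormal, poleTangent, Finset.mul_sum, Finset.mul_sum, ← Finset.sum_sub_distrib]
    refine Finset.sum_congr rfl fun i _ => ?_
    push_cast
    field_simp
  rw [hopfField, norm_sq_affine hj, hg]
  rw [eq_add_of_sub_eq hn.symm]
  simp only [real_smul_C2]
  push_cast
  module

end pole

end

/-! ### The regularised flow at a pole -/

noncomputable section

variable {m : ℕ} (κ : Fin m → ℝ) (e : ℝ → Fin m → C2) (j : Fin m)

/-- States `(r, x, U, C, M, T)` of the regularised flow at a pole: the point of parameter `r` on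
the line through `exp C • (e j + (x U) • perp (e j))`, where `‖U‖² / exp M` is constant and `T` is
the elapsed time divided by that constant. -/
abbrev PoleState : Type := ℝ × ℝ × ℂ × ℂ × ℝ × ℝ

/-- The affine coordinate of a state. -/
def PoleState.w (p : PoleState) : ℂ := p.2.1 • p.2.2.1

/-- The domain of the regularised flow at a pole. -/
def poleDomain : Set PoleState :=
  {p | ∀ i, i ≠ j → cross (e p.1 i) (e p.1 j + p.w • perp (e p.1 j)) ≠ 0}

/-- The rate of the time change in the regularised flow. -/
def poleRate (p : PoleState) : ℝ := 2 * p.2.1 * (κ j * (1 + ‖p.w‖ ^ 2))⁻¹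

/-- The regularised flow at a pole. -/
def poleField (p : PoleState) : PoleState :=
  -- For w = x U these equations give dw/dx = x‖U‖²((star w)⁻¹ + `poleNormal`): a time change by a
  -- multiple of x‖U‖² turns the singular term into the finite velocity U. The last two components
  -- are arranged so that ‖U‖² = ‖ζ‖² exp M and the elapsed time is ‖ζ‖² T, with T smooth also at ζ
  -- = 0.
  (0, 1, ‖p.2.2.1‖ ^ 2 • poleNormal κ (e p.1) j p.w,
    (poleRate κ j p * ‖p.2.2.1‖ ^ 2) •
      ((1 + ‖p.w‖ ^ 2) • poleTangent κ (e p.1) j p.w - ((∑ i, κ i) / 2 : ℝ)),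
    2 * (star p.2.2.1 * poleNormal κ (e p.1) j p.w).re,
    poleRate κ j p * Real.exp p.2.2.2.2.1)

/-- The point of `ℂ²` represented by a state. -/
def polePoint (p : PoleState) : C2 :=
  Complex.exp p.2.2.2.1 • (e p.1 j + p.w • perp (e p.1 j))

/-- The initial state with transverse direction `ζ`. -/
def poleInit (r : ℝ) (ζ : ℂ) : PoleState := (r, 0, ζ, 0, 0, 0)

variable {κ e j}

section smooth

variable (he : ∀ i, ContDiff ℝ ∞ fun r => e r i)
include he

omit he in
theorem contDiff_poleState_w : ContDiff ℝ ∞ PoleState.w := by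
  unfold PoleState.w
  fun_prop

theorem contDiff_cross_pole (i : Fin m) : ContDiff ℝ ∞ fun p : PoleState =>
    cross (e p.1 i) (e p.1 j + p.w • perp (e p.1 j)) := by
  have h1 : ContDiff ℝ ∞ fun p : PoleState => (p.1, e p.1 j + p.w • perp (e p.1 j)) := by
    refine contDiff_fst.prodMk (((he j).comp contDiff_fst).add ?_)
    rw [← contDiffOn_univ]
    refine (contDiff_poleState_w).contDiffOn.smul_C2 ?_
    have := (contDiff_perp_total he j).comp
      (contDiff_fst.prodMk (contDiff_const (c := (0 : C2))) : ContDiff ℝ ∞ fun p : PoleState => (p.1, (0 : C2)))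
    exact this.contDiffOn
  exact (contDiff_cross_total he i).comp h1

theorem isOpen_poleDomain : IsOpen (poleDomain e j) := by
  have : poleDomain e j = ⋂ i, ⋂ (_ : i ≠ j),
      {p : PoleState | cross (e p.1 i) (e p.1 j + p.w • perp (e p.1 j)) ≠ 0} := by
    ext p; simp [poleDomain]
  rw [this]
  exact isOpen_iInter_of_finite fun i => isOpen_iInter_of_finite fun _ =>
    isOpen_ne_fun (contDiff_cross_pole he i).continuous continuous_const

theorem contDiffOn_poleField (hκ : 0 < κ j) :
    ContDiffOn ℝ ∞ (poleField κ e j) (poleDomain e j) := by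
  have hw := contDiff_poleState_w
  have hcr (i k : Fin m) : ContDiff ℝ ∞ fun p : PoleState => star (cross (e p.1 i) (e p.1 k)) := by
    refine contDiff_star.comp ((contDiff_cross_total he i).comp
      (contDiff_fst.prodMk ((he k).comp contDiff_fst)))
  have hcp (i k : Fin m) :
      ContDiff ℝ ∞ fun p : PoleState => star (cross (e p.1 i) (perp (e p.1 k))) := by
    have h2 := (contDiff_perp_total he k).comp
      (contDiff_fst.prodMk (contDiff_const (c := (0 : C2))) : ContDiff ℝ ∞ fun p : PoleState => (p.1, (0 : C2)))
    exact contDiff_star.comp ((contDiff_cross_total he i).comp (contDiff_fst.prodMk h2))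
  have hinv (i : Fin m) (hi : i ≠ j) : ContDiffOn ℝ ∞ (fun p : PoleState =>
      (star (cross (e p.1 i) (e p.1 j + p.w • perp (e p.1 j))))⁻¹) (poleDomain e j) := by
    refine ContDiffOn.inv (contDiff_star.comp (contDiff_cross_pole he i)).contDiffOn fun p hp => ?_
    simpa using hp i hi
  have hN : ContDiffOn ℝ ∞ (fun p : PoleState => poleNormal κ (e p.1) j p.w) (poleDomain e j) := by
    refine ContDiffOn.sum fun i hi => contDiffOn_const.mul (ContDiffOn.mul ?_
      (hinv i (Finset.ne_of_mem_erase hi)))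
    exact ((hcp i j).sub (hw.mul (hcr i j))).contDiffOn
  have hD : ContDiffOn ℝ ∞ (fun p : PoleState => poleTangent κ (e p.1) j p.w) (poleDomain e j) := by
    refine ContDiffOn.sum fun i hi => contDiffOn_const.mul (ContDiffOn.mul ?_
      (hinv i (Finset.ne_of_mem_erase hi)))
    exact (hcr i j).contDiffOn
  have hwn : ContDiff ℝ ∞ fun p : PoleState => 1 + ‖p.w‖ ^ 2 := contDiff_const.add (hw.norm_sq ℝ)
  have hrate : ContDiff ℝ ∞ (poleRate κ j) := by
    refine ContDiff.mul (by fun_prop) (ContDiff.inv (contDiff_const.mul hwn) fun p => ?_)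
    positivity
  have hU : ContDiff ℝ ∞ fun p : PoleState => p.2.2.1 := by fun_prop
  have hU2 : ContDiff ℝ ∞ fun p : PoleState => ‖p.2.2.1‖ ^ 2 := hU.norm_sq ℝ
  refine contDiffOn_const.prodMk (contDiffOn_const.prodMk (ContDiffOn.prodMk ?_
    (ContDiffOn.prodMk ?_ (ContDiffOn.prodMk ?_ ?_))))
  · exact hU2.contDiffOn.smul hN
  · exact (hrate.mul hU2).contDiffOn.smul ((hwn.contDiffOn.smul hD).sub contDiffOn_const)
  · refine contDiffOn_const.mul ?_
    exact Complex.reCLM.contDiff.comp_contDiffOn ((contDiff_star.comp hU).contDiffOn.mul hN)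
  · refine (hrate.mul ?_).contDiffOn
    exact Real.contDiff_exp.comp (by fun_prop)

theorem contDiff_polePoint : ContDiff ℝ ∞ (polePoint e j) := by
  rw [← contDiffOn_univ]
  have h1 : ContDiff ℝ ∞ fun p : PoleState => e p.1 j + p.w • perp (e p.1 j) := by
    refine ((he j).comp contDiff_fst).add ?_
    rw [← contDiffOn_univ]
    refine (contDiff_poleState_w).contDiffOn.smul_C2 ?_
    have := (contDiff_perp_total he j).comp
      (contDiff_fst.prodMk (contDiff_const (c := (0 : C2))) : ContDiff ℝ ∞ fun p : PoleState => (p.1, (0 : C2)))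
    exact this.contDiffOn
  refine ContDiffOn.smul_C2 ?_ h1.contDiffOn
  exact ((Complex.contDiff_exp (𝕜 := ℝ)).comp (by fun_prop)).contDiffOn

end smooth

/-- A solution of the regularised flow issuing from the pole, component by component. -/
structure PoleCurve (κ : Fin m → ℝ) (e : ℝ → Fin m → C2) (j : Fin m) (r : ℝ) (ζ : ℂ) (t : ℝ)
    (q : ℝ → PoleState) : Prop where
  zero : q 0 = poleInit r ζ
  fst : ∀ s ∈ Set.Icc 0 t, (q s).1 = r
  snd : ∀ s ∈ Set.Icc 0 t, (q s).2.1 = s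
  mem : ∀ s ∈ Set.Icc 0 t, q s ∈ poleDomain e j
  deriv : ∀ s ∈ Set.Icc 0 t, HasDerivAt q (poleField κ e j (q s)) s

theorem poleCurve_of_flowRel {r : ℝ} {ζ : ℂ} {t : ℝ} (ht : 0 ≤ t) {p : PoleState}
    (h : FlowRel (poleField κ e j) (poleDomain e j) t (poleInit r ζ) p) :
    ∃ q, PoleCurve κ e j r ζ t q ∧ q t = p := by
  obtain ⟨q, h0, h1, h2⟩ := h
  have h3 : ∀ s ∈ Set.Icc 0 t, FlowRel (poleField κ e j) (poleDomain e j) s (poleInit r ζ) (q s) :=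
    fun s hs => ⟨q, h0, rfl, fun s' hs' => h2 s' (Set.uIcc_subset_uIcc_left
      (by rwa [Set.uIcc_of_le ht]) hs')⟩
  rw [Set.uIcc_of_le ht] at h2
  refine ⟨q, ⟨h0, fun s hs => ?_, fun s hs => ?_, fun s hs => (h2 s hs).1,
    fun s hs => (h2 s hs).2⟩, h1⟩
  · exact ((h3 s hs).eq_of_hasFDerivAt (φ := Prod.fst)
      (φ' := fun _ => ContinuousLinearMap.fst ℝ ℝ _) (fun z _ => hasFDerivAt_fst)
      (fun z _ => rfl)).symm
  · have hd : ∀ s ∈ Set.Icc 0 t, HasDerivAt (fun s => (q s).2.1 - s) 0 s := by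
      intro s hs
      have := ((ContinuousLinearMap.fst ℝ ℝ _).comp
        (ContinuousLinearMap.snd ℝ ℝ (ℝ × ℂ × ℂ × ℝ × ℝ))).hasFDerivAt.comp_hasDerivAt s (h2 s hs).2
      have h4 := this.sub (hasDerivAt_id s)
      simp [poleField] at h4
      exact h4
    have := constant_of_has_deriv_right_zero (f := fun s => (q s).2.1 - s)
      (fun s hs => (hd s hs).continuousAt.continuousWithinAt)
      (fun s hs => (hd s (Set.Ico_subset_Icc_self hs)).hasDerivWithinAt) s hs
    simp only [h0, poleInit] at this
    linarith

namespace PoleCurve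

variable {r : ℝ} {ζ : ℂ} {t : ℝ} {q : ℝ → PoleState}

theorem flowRel (h : PoleCurve κ e j r ζ t q) {s : ℝ} (hs : s ∈ Set.Icc 0 t) :
    FlowRel (poleField κ e j) (poleDomain e j) s (poleInit r ζ) (q s) := by
  refine ⟨q, h.zero, rfl, fun s' hs' => ?_⟩
  rw [Set.uIcc_of_le hs.1] at hs'
  have : s' ∈ Set.Icc 0 t := ⟨hs'.1, hs'.2.trans hs.2⟩
  exact ⟨h.mem _ this, h.deriv _ this⟩

/-- The quantity ‖U‖² exp(-M) is conserved. Letting M have its own equation keeps it meaningful for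
ζ = 0. -/
theorem norm_sq (h : PoleCurve κ e j r ζ t q) {s : ℝ} (hs : s ∈ Set.Icc 0 t) :
    ‖(q s).2.2.1‖ ^ 2 = ‖ζ‖ ^ 2 * Real.exp (q s).2.2.2.2.1 := by
  let πU : PoleState →L[ℝ] ℂ := ContinuousLinearMap.fst ℝ ℂ _ ∘L ContinuousLinearMap.snd ℝ ℝ _ ∘L
    ContinuousLinearMap.snd ℝ ℝ _
  let πM : PoleState →L[ℝ] ℝ := ContinuousLinearMap.fst ℝ ℝ _ ∘L ContinuousLinearMap.snd ℝ ℂ _ ∘L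
    ContinuousLinearMap.snd ℝ ℂ _ ∘L ContinuousLinearMap.snd ℝ ℝ _ ∘L ContinuousLinearMap.snd ℝ ℝ _
  have h1 := (h.flowRel hs).eq_of_hasFDerivAt
    (φ := fun p => ‖πU p‖ ^ 2 * Real.exp (-πM p))
    (φ' := fun p => (‖πU p‖ ^ 2) • (Real.exp (-πM p) • (-πM)) +
      (Real.exp (-πM p)) • ((2 • innerSL ℝ (πU p)) ∘L πU)) (fun p _ => ?_) (fun p _ => ?_)
  · simp only [πU, πM, ContinuousLinearMap.comp_apply, ContinuousLinearMap.coe_fst',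
      ContinuousLinearMap.coe_snd', poleInit, neg_zero, Real.exp_zero, mul_one] at h1
    rw [h1, mul_assoc, ← Real.exp_add]
    simp
  · exact ((hasStrictFDerivAt_norm_sq (πU p)).hasFDerivAt.comp p πU.hasFDerivAt).mul
      (πM.hasFDerivAt.neg.exp)
  · have e1 : πU (poleField κ e j p) = ((‖πU p‖ ^ 2 : ℝ) : ℂ) * poleNormal κ (e p.1) j p.w := by
      simp [πU, poleField]
    have e2 : πM (poleField κ e j p) = 2 * (star (πU p) * poleNormal κ (e p.1) j p.w).re := rfl
    simp only [add_apply, smul_apply, neg_apply, ContinuousLinearMap.comp_apply, e1, e2,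
      innerSL_apply_apply, Complex.inner, smul_eq_mul, nsmul_eq_mul]
    generalize poleNormal κ (e p.1) j p.w = N
    generalize πU p = U
    simp [-Complex.ofReal_pow]
    ring

/-- Rescaling the transverse direction of a solution. -/
theorem scale (h : PoleCurve κ e j r ζ t q) {k : ℝ} (hk : 0 < k) :
    PoleCurve κ e j r (k • ζ) (t / k) fun s =>
      ((q (k * s)).1, k⁻¹ * (q (k * s)).2.1, k • (q (k * s)).2.2.1, (q (k * s)).2.2.2.1,
        (q (k * s)).2.2.2.2.1, (k ^ 2)⁻¹ * (q (k * s)).2.2.2.2.2) := by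
  have hmem : ∀ s ∈ Set.Icc 0 (t / k), k * s ∈ Set.Icc 0 t := fun s hs =>
    ⟨mul_nonneg hk.le hs.1, by rw [mul_comm]; exact (le_div_iff₀ hk).1 hs.2⟩
  -- The scaling x ↦ x / k, U ↦ k U fixes w = x U, through which alone the configuration enters the
  -- equations.
  have hw (p : PoleState) : PoleState.w (p.1, k⁻¹ * p.2.1, k • p.2.2.1, p.2.2.2.1, p.2.2.2.2.1,
      (k ^ 2)⁻¹ * p.2.2.2.2.2) = p.w := by
    simp only [PoleState.w, smul_smul]
    congr 1
    field_simp
  refine ⟨by simp [h.zero, poleInit], fun s hs => h.fst _ (hmem s hs), fun s hs => ?_,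
    fun s hs i hi => ?_, fun s hs => ?_⟩
  · simp only [h.snd _ (hmem s hs)]
    field_simp
  · rw [hw]
    exact h.mem _ (hmem s hs) i hi
  · have hd : HasDerivAt (fun s => q (k * s)) (k • poleField κ e j (q (k * s))) s := by
      have := (h.deriv _ (hmem s hs)).scomp s ((hasDerivAt_id s).const_mul k)
      rwa [mul_one] at this
    let L : PoleState →L[ℝ] PoleState :=
      (ContinuousLinearMap.fst ℝ ℝ _).prod ((k⁻¹ • ContinuousLinearMap.fst ℝ ℝ _ ∘L
        ContinuousLinearMap.snd ℝ ℝ _).prod ((k • ContinuousLinearMap.fst ℝ ℂ _ ∘L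
        ContinuousLinearMap.snd ℝ ℝ _ ∘L ContinuousLinearMap.snd ℝ ℝ _).prod
        ((ContinuousLinearMap.fst ℝ ℂ _ ∘L ContinuousLinearMap.snd ℝ ℂ _ ∘L
          ContinuousLinearMap.snd ℝ ℝ _ ∘L ContinuousLinearMap.snd ℝ ℝ _).prod
        ((ContinuousLinearMap.fst ℝ ℝ _ ∘L ContinuousLinearMap.snd ℝ ℂ _ ∘L
          ContinuousLinearMap.snd ℝ ℂ _ ∘L ContinuousLinearMap.snd ℝ ℝ _ ∘L
          ContinuousLinearMap.snd ℝ ℝ _).prod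
        ((k ^ 2)⁻¹ • ContinuousLinearMap.snd ℝ ℝ _ ∘L ContinuousLinearMap.snd ℝ ℂ _ ∘L
          ContinuousLinearMap.snd ℝ ℂ _ ∘L ContinuousLinearMap.snd ℝ ℝ _ ∘L
          ContinuousLinearMap.snd ℝ ℝ _)))))
    have hL (p : PoleState) : L p = (p.1, k⁻¹ * p.2.1, k • p.2.2.1, p.2.2.2.1, p.2.2.2.2.1,
      (k ^ 2)⁻¹ * p.2.2.2.2.2) := rfl
    have h2 : HasDerivAt (fun s => L (q (k * s))) (L (k • poleField κ e j (q (k * s)))) s :=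
      L.hasFDerivAt.comp_hasDerivAt s hd
    have h3 (p : PoleState) : L (k • poleField κ e j p) = poleField κ e j (L p) := by
      have hkk : ‖k • p.2.2.1‖ ^ 2 = k ^ 2 * ‖p.2.2.1‖ ^ 2 := by
        rw [norm_smul, mul_pow, Real.norm_eq_abs, sq_abs]
      rw [map_smul, hL, hL]
      simp only [poleField, hw, poleRate, hkk, Prod.smul_mk, smul_eq_mul, mul_one,
        mul_inv_cancel₀ hk.ne', star_smul, star_trivial, smul_mul_assoc, Complex.smul_re, smul_smul]
      generalize poleNormal κ (e p.1) j p.w = N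
      generalize poleTangent κ (e p.1) j p.w = D
      refine Prod.ext (mul_zero k) (Prod.ext rfl (Prod.ext ?_ (Prod.ext ?_ (Prod.ext ?_ ?_))))
      · simp only [Complex.real_smul]
        push_cast
        ring
      · simp only
        congr 1
        field_simp
      · simp only
        ring
      · simp only
        field_simp
    rw [h3] at h2
    exact h2

end PoleCurve

end

/-! ### Solutions of the regularised flow as trajectories of `hopfField` -/

noncomputable section

variable {m : ℕ} {κ : Fin m → ℝ} {e : ℝ → Fin m → C2} {j : Fin m}

/-- A smooth one-parameter family of configurations of distinct lines, each given by a unit vector,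
together with positive residues. -/
structure IsCrossFamily (κ : Fin m → ℝ) (e : ℝ → Fin m → C2) : Prop where
  pos : ∀ i, 0 < κ i
  smooth : ∀ i, ContDiff ℝ ∞ fun r => e r i
  norm : ∀ r i, ‖e r i‖ = 1
  cross_ne : ∀ r i k, i ≠ k → cross (e r i) (e r k) ≠ 0

theorem cross_affine_self {v : C2} (hv : ‖v‖ = 1) (w : ℂ) : cross v (v + w • perp v) = w := by
  rw [cross_add, cross_smul, cross_apply_self, cross_perp, hv]; simp

theorem hasDerivWithinAt_smul_C2 {c : ℝ → ℂ} {c' : ℂ} {f : ℝ → C2} {f' : C2} {S : Set ℝ} {s : ℝ}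
    (hc : HasDerivWithinAt c c' S s) (hf : HasDerivWithinAt f f' S s) :
    HasDerivWithinAt (fun s => c s • f s) (c s • f' + c' • f s) S s := by
  have h := (ContinuousLinearMap.lsmul ℝ ℂ : ℂ →L[ℝ] C2 →L[ℝ] C2).isBoundedBilinearMap.hasFDerivAt
    (c s, f s)
  exact h.comp_hasDerivWithinAt s (hc.prodMk hf)

namespace PoleCurve

variable {r : ℝ} {ζ : ℂ} {t : ℝ} {q : ℝ → PoleState}

theorem w_eq (h : PoleCurve κ e j r ζ t q) {s : ℝ} (hs : s ∈ Set.Icc 0 t) :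
    (q s).w = s * (q s).2.2.1 := by
  rw [PoleState.w, h.snd s hs, Complex.real_smul]

theorem ne_zero (h : PoleCurve κ e j r ζ t q) (hζ : ζ ≠ 0) {s : ℝ} (hs : s ∈ Set.Icc 0 t) :
    (q s).2.2.1 ≠ 0 := by
  have : 0 < ‖(q s).2.2.1‖ ^ 2 := by
    rw [h.norm_sq hs]; positivity
  intro h0
  simp [h0] at this

theorem polePoint_eq (h : PoleCurve κ e j r ζ t q) {s : ℝ} (hs : s ∈ Set.Icc 0 t) :
    polePoint e j (q s) =
      Complex.exp (q s).2.2.2.1 • (e r j + ((s : ℂ) * (q s).2.2.1) • perp (e r j)) := by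
  rw [polePoint, h.w_eq hs, h.fst s hs]

theorem hasDerivAt_U (h : PoleCurve κ e j r ζ t q) {s : ℝ} (hs : s ∈ Set.Icc 0 t) :
    HasDerivAt (fun s => (q s).2.2.1) (‖(q s).2.2.1‖ ^ 2 • poleNormal κ (e r) j (q s).w) s := by
  have := ((ContinuousLinearMap.fst ℝ ℂ _ ∘L ContinuousLinearMap.snd ℝ ℝ _ ∘L
    ContinuousLinearMap.snd ℝ ℝ _ : PoleState →L[ℝ] ℂ)).hasFDerivAt.comp_hasDerivAt s (h.deriv s hs)
  rw [← h.fst s hs]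
  exact this

theorem hasDerivAt_C (h : PoleCurve κ e j r ζ t q) {s : ℝ} (hs : s ∈ Set.Icc 0 t) :
    HasDerivAt (fun s => (q s).2.2.2.1) ((poleRate κ j (q s) * ‖(q s).2.2.1‖ ^ 2) •
      ((1 + ‖(q s).w‖ ^ 2) • poleTangent κ (e r) j (q s).w - ((∑ i, κ i) / 2 : ℝ))) s := by
  have := ((ContinuousLinearMap.fst ℝ ℂ _ ∘L ContinuousLinearMap.snd ℝ ℂ _ ∘L
    ContinuousLinearMap.snd ℝ ℝ _ ∘L
    ContinuousLinearMap.snd ℝ ℝ _ : PoleState →L[ℝ] ℂ)).hasFDerivAt.comp_hasDerivAt s (h.deriv s hs)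
  rw [← h.fst s hs]
  exact this

theorem hasDerivAt_T (h : PoleCurve κ e j r ζ t q) {s : ℝ} (hs : s ∈ Set.Icc 0 t) :
    HasDerivAt (fun s => (q s).2.2.2.2.2) (poleRate κ j (q s) * Real.exp (q s).2.2.2.2.1) s :=
  ((ContinuousLinearMap.snd ℝ ℝ _ ∘L ContinuousLinearMap.snd ℝ ℂ _ ∘L
    ContinuousLinearMap.snd ℝ ℂ _ ∘L ContinuousLinearMap.snd ℝ ℝ _ ∘L
    ContinuousLinearMap.snd ℝ ℝ _ : PoleState →L[ℝ] ℝ)).hasFDerivAt.comp_hasDerivAt s (h.deriv s hs)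

theorem hasDerivWithinAt_polePoint (h : PoleCurve κ e j r ζ t q) {s : ℝ} (hs : s ∈ Set.Icc 0 t) :
    HasDerivWithinAt (fun s => polePoint e j (q s))
      (Complex.exp (q s).2.2.2.1 • (((s : ℂ) * (‖(q s).2.2.1‖ ^ 2 • poleNormal κ (e r) j (q s).w) +
        (q s).2.2.1) • perp (e r j)) +
      (Complex.exp (q s).2.2.2.1 * ((poleRate κ j (q s) * ‖(q s).2.2.1‖ ^ 2) •
      ((1 + ‖(q s).w‖ ^ 2) • poleTangent κ (e r) j (q s).w - ((∑ i, κ i) / 2 : ℝ)))) •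
        (e r j + ((s : ℂ) * (q s).2.2.1) • perp (e r j))) (Set.Icc 0 t) s := by
  refine HasDerivWithinAt.congr_of_mem (f := fun s => Complex.exp (q s).2.2.2.1 •
    (e r j + ((s : ℂ) * (q s).2.2.1) • perp (e r j))) ?_ (fun s hs => h.polePoint_eq hs) hs
  refine hasDerivWithinAt_smul_C2 (h.hasDerivAt_C hs).cexp.hasDerivWithinAt ?_
  have h1 : HasDerivAt (fun s : ℝ => (s : ℂ) * (q s).2.2.1)
      ((s : ℂ) * (‖(q s).2.2.1‖ ^ 2 • poleNormal κ (e r) j (q s).w) + (q s).2.2.1) s := by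
    have := ((hasDerivAt_id s).ofReal_comp).mul (h.hasDerivAt_U hs)
    refine this.congr_deriv ?_
    rw [Complex.ofReal_one, one_mul, add_comm]
    rfl
  have := hasDerivWithinAt_smul_C2 h1.hasDerivWithinAt (hasDerivWithinAt_const s (Set.Icc 0 t) (perp (e r j)))
  simp only [smul_zero, zero_add] at this
  exact this.const_add _

theorem polePoint_mem (h : PoleCurve κ e j r ζ t q) (he : IsCrossFamily κ e) (hζ : ζ ≠ 0) {s : ℝ}
    (hs : s ∈ Set.Icc 0 t) (hs0 : s ≠ 0) : polePoint e j (q s) ∈ regularSet (e r) := by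
  intro i
  rw [polePoint, h.fst s hs, cross_smul]
  refine mul_ne_zero (Complex.exp_ne_zero _) ?_
  rcases eq_or_ne i j with rfl | hi
  · rw [cross_affine_self (he.norm r i), h.w_eq hs]
    exact mul_ne_zero (by exact_mod_cast hs0) (h.ne_zero hζ hs)
  · have := h.mem s hs i hi
    rwa [h.fst s hs] at this

/-- The time change has rate ‖ζ‖² T', which vanishes at the pole. The initial parameter a must be
positive because the pole itself is outside the regular set. -/
theorem hopfRel (h : PoleCurve κ e j r ζ t q) (he : IsCrossFamily κ e) (hζ : ζ ≠ 0) {a b : ℝ}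
    (ha : 0 < a) (hab : a ≤ b) (hb : b ≤ t) :
    HopfRel κ (e r) (‖ζ‖ ^ 2 * (q b).2.2.2.2.2 - ‖ζ‖ ^ 2 * (q a).2.2.2.2.2)
      (polePoint e j (q a)) (polePoint e j (q b)) := by
  have hsub : ∀ s ∈ Set.Icc a b, s ∈ Set.Icc 0 t := fun s hs =>
    ⟨ha.le.trans hs.1, hs.2.trans hb⟩
  have hqc : ContinuousOn q (Set.Icc a b) := fun s hs =>
    (h.deriv s (hsub s hs)).continuousAt.continuousWithinAt
  have hwc : Continuous fun p : PoleState => p.w := contDiff_poleState_w.continuous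
  have hκj := he.pos j
  refine FlowRel.of_reparam (τ := fun s => ‖ζ‖ ^ 2 * (q s).2.2.2.2.2)
    (γ := fun s => polePoint e j (q s))
    (τ' := fun s => ‖ζ‖ ^ 2 * (poleRate κ j (q s) * Real.exp (q s).2.2.2.2.1))
    isOpen_regularSet contDiffOn_hopfField hab ?_ ?_ ?_ ?_
  · have : Continuous fun p : PoleState =>
        ‖ζ‖ ^ 2 * (poleRate κ j p * Real.exp p.2.2.2.2.1) := by
      refine continuous_const.mul (Continuous.mul ?_ (Real.continuous_exp.comp (by fun_prop)))
      refine Continuous.mul (by fun_prop) (Continuous.inv₀ ?_ fun p => ?_)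
      · exact continuous_const.mul (continuous_const.add ((continuous_norm.comp hwc).pow 2))
      · positivity
    exact this.comp_continuousOn hqc
  · intro s hs
    have : 0 ≤ (q s).2.1 := by rw [h.snd s (hsub s hs)]; exact (hsub s hs).1
    simp only [poleRate]
    positivity
  · intro s hs
    exact ((h.hasDerivAt_T (hsub s hs)).const_mul _).hasDerivWithinAt
  · intro s hs
    have hs0 : s ≠ 0 := (ha.trans_le hs.1).ne'
    refine ⟨h.polePoint_mem he hζ (hsub s hs) hs0, ?_⟩
    have h1 := (h.hasDerivWithinAt_polePoint (hsub s hs)).mono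
      (Set.Icc_subset_Icc ha.le hb)
    convert h1 using 1
    have hw := h.w_eq (hsub s hs)
    have hU := h.ne_zero hζ (hsub s hs)
    rw [mul_left_comm, ← h.norm_sq (hsub s hs), h.polePoint_eq (hsub s hs), ← hw,
      hopfField_smul _ (Complex.exp_ne_zero _), hopfField_affine (he.norm r j) hκj.ne', poleRate,
      h.snd s (hsub s hs)]
    have hn : (1 + ‖(q s).w‖ ^ 2 : ℝ) ≠ 0 := by positivity
    have hUU : ((‖(q s).2.2.1‖ ^ 2 : ℝ) : ℂ) = star (q s).2.2.1 * (q s).2.2.1 := by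
      simp [Complex.normSq_eq_conj_mul_self, ← Complex.normSq_eq_norm_sq]
    have hst : star (q s).2.2.1 ≠ 0 := by simpa using hU
    -- Multiplied by the rate, (star w)⁻¹ becomes exactly U, since w = s U and ‖U‖² = star U * U.
    have key : ((2 * s * (κ j * (1 + ‖(q s).w‖ ^ 2))⁻¹ * ‖(q s).2.2.1‖ ^ 2 : ℝ) : ℂ) *
        (((1 + ‖(q s).w‖ ^ 2) * κ j / 2 : ℝ) *
          ((star (q s).w)⁻¹ + poleNormal κ (e r) j (q s).w)) =
        (s : ℂ) * (‖(q s).2.2.1‖ ^ 2 • poleNormal κ (e r) j (q s).w) + (q s).2.2.1 := by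
      have e1 : (2 * s * (κ j * (1 + ‖(q s).w‖ ^ 2))⁻¹ * ‖(q s).2.2.1‖ ^ 2) *
          ((1 + ‖(q s).w‖ ^ 2) * κ j / 2) = s * ‖(q s).2.2.1‖ ^ 2 := by
        field_simp
      rw [← mul_assoc, ← Complex.ofReal_mul, e1, mul_add, Complex.real_smul, add_comm]
      have hsc : (s : ℂ) ≠ 0 := by exact_mod_cast hs0
      congr 1
      · push_cast; ring
      · rw [Complex.ofReal_mul, hUU, hw, star_mul']
        simp only [RCLike.star_def, Complex.conj_ofReal] at hst ⊢
        field_simp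
    rw [← key]
    simp only [real_smul_C2, Complex.real_smul]
    push_cast
    module

theorem time_strictMono (h : PoleCurve κ e j r ζ t q) (hκ : 0 < κ j) :
    StrictMonoOn (fun s => (q s).2.2.2.2.2) (Set.Icc 0 t) := by
  refine strictMonoOn_of_deriv_pos (convex_Icc 0 t) (fun s hs =>
    (h.hasDerivAt_T hs).continuousAt.continuousWithinAt) fun s hs => ?_
  rw [(h.hasDerivAt_T (interior_subset hs)).deriv]
  rw [interior_Icc] at hs
  have : 0 < (q s).2.1 := by rw [h.snd s (Set.Ioo_subset_Icc_self hs)]; exact hs.1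
  simp only [poleRate]
  positivity

theorem time_pos (h : PoleCurve κ e j r ζ t q) (hκ : 0 < κ j) {s : ℝ} (hs0 : 0 < s) (hs : s ≤ t) :
    0 < (q s).2.2.2.2.2 := by
  have := h.time_strictMono hκ ⟨le_rfl, hs0.le.trans hs⟩ ⟨hs0.le, hs⟩ hs0
  simpa [h.zero, poleInit] using this

end PoleCurve

end

/-! ### Petals: trajectories issuing from a pole -/

noncomputable section

theorem ContDiffAt.exists_localInverse {E F : Type*} [NormedAddCommGroup E] [NormedSpace ℝ E]
    [FiniteDimensional ℝ E] [NormedAddCommGroup F] [NormedSpace ℝ F] [FiniteDimensional ℝ F]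
    (hEF : Module.finrank ℝ E = Module.finrank ℝ F) {f : E → F} {a : E} (hf : ContDiffAt ℝ ∞ f a)
    (hinj : ∀ v, fderiv ℝ f a v = 0 → v = 0) :
    ∃ g : F → E, ContDiffAt ℝ ∞ g (f a) ∧ g (f a) = a ∧ (∀ᶠ x in 𝓝 a, g (f x) = x) ∧
      ∀ᶠ y in 𝓝 (f a), f (g y) = y := by
  have := FiniteDimensional.complete ℝ E
  let L := (LinearEquiv.ofInjectiveOfFinrankEq (fderiv ℝ f a : E →ₗ[ℝ] F)
    ((injective_iff_map_eq_zero _).2 hinj) hEF).toContinuousLinearEquiv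
  have hL : HasFDerivAt f (L : E →L[ℝ] F) a := by
    have h1 := (hf.differentiableAt (by simp)).hasFDerivAt
    have h2 : (L : E →L[ℝ] F) = fderiv ℝ f a := by ext v; rfl
    rwa [h2]
  have hs : HasStrictFDerivAt f (L : E →L[ℝ] F) a := hf.hasStrictFDerivAt' hL (by simp)
  refine ⟨hf.localInverse hL (by simp), hf.to_localInverse hL (by simp),
    hf.localInverse_apply_image hL (by simp), ?_, ?_⟩
  · exact hs.eventually_left_inverse
  · exact hs.eventually_right_inverse

/-- The inverse function theorem for smooth maps between spaces of the same finite dimension. -/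
theorem ContDiffOn.exists_localInverse {E F : Type*} [NormedAddCommGroup E] [NormedSpace ℝ E]
    [FiniteDimensional ℝ E] [NormedAddCommGroup F] [NormedSpace ℝ F] [FiniteDimensional ℝ F]
    (hEF : Module.finrank ℝ E = Module.finrank ℝ F) {f : E → F} {a : E} {U : Set E}
    (hU : IsOpen U) (ha : a ∈ U) (hf : ContDiffOn ℝ ∞ f U)
    (hinj : ∀ v, fderiv ℝ f a v = 0 → v = 0) :
    ∃ g : F → E, g (f a) = a ∧ (∀ᶠ x in 𝓝 a, g (f x) = x) ∧
      ∀ᶠ y in 𝓝 (f a), f (g y) = y ∧ ContDiffAt ℝ ∞ g y := by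
  have hfU : ∀ x ∈ U, ContDiffAt ℝ ∞ f x := fun x hx => hf.contDiffAt (hU.mem_nhds hx)
  obtain ⟨g, hg, hga, hgl, hgr⟩ := (hfU a ha).exists_localInverse hEF hinj
  refine ⟨g, hga, hgl, hgr.and ?_⟩
  have := FiniteDimensional.complete ℝ E
  let L := (LinearEquiv.ofInjectiveOfFinrankEq (fderiv ℝ f a : E →ₗ[ℝ] F)
    ((injective_iff_map_eq_zero _).2 hinj) hEF).toContinuousLinearEquiv
  have hL : (L : E →L[ℝ] F) = fderiv ℝ f a := by ext v; rfl
  have h1 : ∀ᶠ x in 𝓝 a, x ∈ U ∧ ∀ v, fderiv ℝ f x v = 0 → v = 0 := by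
    have hc : ContinuousAt (fderiv ℝ f) a :=
      ((hf.continuousOn_fderiv_of_isOpen hU (by simp)).continuousAt (hU.mem_nhds ha))
    have h2 := L.nhds
    rw [hL] at h2
    filter_upwards [hU.mem_nhds ha, hc.eventually h2] with x hx hx2
    refine ⟨hx, ?_⟩
    obtain ⟨M, hM⟩ := hx2
    intro v hv
    rw [← hM] at hv
    exact (map_eq_zero_iff M M.injective).1 hv
  -- Smoothness of infinite order at one point does not spread to a neighbourhood, which may shrink
  -- with the order. At each nearby y, g is instead identified with the local inverse based at g y,
  -- which is smooth at y.
  have hc1 : ∀ᶠ y in 𝓝 (f a), ContinuousAt g y := by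
    have : ContDiffAt ℝ 1 g (f a) := hg.of_le (by exact_mod_cast le_top)
    filter_upwards [this.eventually (by simp)] with y hy using hy.continuousAt
  have h1' := (hg.continuousAt.tendsto.eventually (hga.symm ▸ h1))
  have hgl' := hg.continuousAt.tendsto.eventually (hga.symm ▸ hgl.eventually_nhds)
  filter_upwards [h1', hc1, hgr.eventually_nhds] with y ⟨hyU, hyi⟩ hyc hyr
  obtain ⟨g', hg', hga', hgl', -⟩ := (hfU _ hyU).exists_localInverse hEF hyi
  rw [hyr.self_of_nhds] at hg'
  refine hg'.congr_of_eventuallyEq ?_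
  filter_upwards [hyr, hyc.eventually hgl'] with y' h3 h4
  rw [← h4, h3]

variable {m : ℕ} (κ : Fin m → ℝ) (e : ℝ → Fin m → C2) (j : Fin m)

/-- The parameters and directions for which the regularised flow exists up to time one. -/
def poleSource : Set (ℝ × ℂ) :=
  {p | ((1 : ℝ), poleInit p.1 p.2) ∈ flowDomain (poleField κ e j) (poleDomain e j)}

/-- The endpoint of the regularised flow. -/
def poleEnd (p : ℝ × ℂ) : PoleState :=
  flow (poleField κ e j) (poleDomain e j) 1 (poleInit p.1 p.2)

/-- The transverse coordinate whose squared norm is the time elapsed since the pole. -/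
def poleCoord (p : ℝ × ℂ) : ℂ := √(poleEnd κ e j p).2.2.2.2.2 • p.2

/-- `z` is the point of transverse coordinate `η` on the trajectories issuing from the `j`-th
pole. -/
def PetalRel (r : ℝ) (η : ℂ) (z : C2) : Prop :=
  -- The regularised flow reaches only small transverse coordinates. The factor k brings η into that
  -- range, and the remaining time ‖η‖² - ‖k η‖² is spent on the forward complete flow.
  (η = 0 ∧ z = e r j) ∨ (η ≠ 0 ∧ ∃ (ζ : ℂ) (k : ℝ), (r, ζ) ∈ poleSource κ e j ∧ 0 < k ∧ k ≤ 1 ∧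
    poleCoord κ e j (r, ζ) = k • η ∧
    HopfRel κ (e r) ((1 - k ^ 2) * ‖η‖ ^ 2) (polePoint e j (poleEnd κ e j (r, ζ))) z)

/-- The parametrisation of the trajectories issuing from the `j`-th pole, by a transverse
coordinate whose squared norm is the elapsed time. -/
def petal (r : ℝ) (η : ℂ) : C2 := Classical.epsilon (PetalRel κ e j r η)

variable {κ e j} {r : ℝ} {ζ : ℂ}

theorem exists_poleCurve (h : (r, ζ) ∈ poleSource κ e j) :
    ∃ q, PoleCurve κ e j r ζ 1 q ∧ q 1 = poleEnd κ e j (r, ζ) :=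
  poleCurve_of_flowRel zero_le_one (flowRel_flow h)

section

variable (he : IsCrossFamily κ e)
include he

/-- By the scaling symmetry, shortening ζ by k amounts to stopping its curve at parameter k. Rays of
initial directions thus trace out trajectories. -/
theorem PoleCurve.poleEnd_smul {q : ℝ → PoleState} (h : PoleCurve κ e j r ζ 1 q) {k : ℝ}
    (hk : 0 < k) (hk1 : k ≤ 1) : (r, k • ζ) ∈ poleSource κ e j ∧
      poleEnd κ e j (r, k • ζ) = ((q k).1, k⁻¹ * (q k).2.1, k • (q k).2.2.1, (q k).2.2.2.1,
        (q k).2.2.2.2.1, (k ^ 2)⁻¹ * (q k).2.2.2.2.2) := by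
  have := (h.scale hk).flowRel (s := 1) ⟨zero_le_one, (one_le_div hk).2 hk1⟩
  refine ⟨⟨_, this⟩, ?_⟩
  have := this.flow_eq (isOpen_poleDomain he.smooth) (contDiffOn_poleField he.smooth (he.pos j))
  rw [mul_one] at this
  exact this

theorem PoleCurve.polePoint_smul {q : ℝ → PoleState} (h : PoleCurve κ e j r ζ 1 q) {k : ℝ}
    (hk : 0 < k) (hk1 : k ≤ 1) :
    polePoint e j (poleEnd κ e j (r, k • ζ)) = polePoint e j (q k) := by
  rw [(h.poleEnd_smul he hk hk1).2]
  simp only [polePoint, PoleState.w, smul_smul]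
  congr 4
  field_simp

theorem PoleCurve.poleCoord_smul {q : ℝ → PoleState} (h : PoleCurve κ e j r ζ 1 q) {k : ℝ}
    (hk : 0 < k) (hk1 : k ≤ 1) :
    poleCoord κ e j (r, k • ζ) = √(q k).2.2.2.2.2 • ζ := by
  rw [poleCoord, (h.poleEnd_smul he hk hk1).2, smul_smul]
  congr 1
  simp only
  rw [Real.sqrt_mul (by positivity), Real.sqrt_inv, Real.sqrt_sq hk.le]
  field_simp

theorem poleCurve_zero (r : ℝ) (t : ℝ) : PoleCurve κ e j r 0 t
    fun s => (r, s, 0, 0, 0, s ^ 2 / κ j) := by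
  refine ⟨by simp [poleInit], fun s _ => rfl, fun s _ => rfl, fun s _ i hi => ?_, fun s _ => ?_⟩
  · simpa [PoleState.w] using he.cross_ne r i j hi
  · have h1 : HasDerivAt (fun s : ℝ => s ^ 2 / κ j) (2 * s / κ j) s := by
      simpa using (hasDerivAt_pow 2 s).div_const (κ j)
    have := (hasDerivAt_const s r).prodMk ((hasDerivAt_id s).prodMk ((hasDerivAt_const s (0 : ℂ)).prodMk
      ((hasDerivAt_const s (0 : ℂ)).prodMk ((hasDerivAt_const s (0 : ℝ)).prodMk h1))))
    refine this.congr_deriv ?_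
    simp [poleField, poleRate, PoleState.w, div_eq_mul_inv]

theorem zero_mem_poleSource (r : ℝ) : (r, (0 : ℂ)) ∈ poleSource κ e j :=
  ⟨_, (poleCurve_zero he r 1).flowRel ⟨zero_le_one, le_rfl⟩⟩

theorem poleEnd_zero (r : ℝ) : poleEnd κ e j (r, 0) = (r, 1, 0, 0, 0, (κ j)⁻¹) := by
  have := ((poleCurve_zero he r 1).flowRel ⟨zero_le_one, le_rfl⟩).flow_eq
    (isOpen_poleDomain he.smooth) (contDiffOn_poleField he.smooth (he.pos j))
  rw [one_pow, one_div] at this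
  exact this

theorem isOpen_poleSource : IsOpen (poleSource κ e j) :=
  (isOpen_flowDomain (isOpen_poleDomain he.smooth)
    (contDiffOn_poleField he.smooth (he.pos j))).preimage
    (show Continuous fun p : ℝ × ℂ => ((1 : ℝ), poleInit p.1 p.2) by unfold poleInit; fun_prop)

theorem contDiffAt_poleEnd {p : ℝ × ℂ} (h : p ∈ poleSource κ e j) :
    ContDiffAt ℝ ∞ (poleEnd κ e j) p :=
  ContDiffAt.comp (f := fun p : ℝ × ℂ => ((1 : ℝ), poleInit p.1 p.2)) p
    (contDiffAt_flow (isOpen_poleDomain he.smooth) (contDiffOn_poleField he.smooth (he.pos j)) h)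
    (show ContDiff ℝ ∞ fun p : ℝ × ℂ => ((1 : ℝ), poleInit p.1 p.2) by
      unfold poleInit; fun_prop).contDiffAt

theorem poleEnd_time_pos {p : ℝ × ℂ} (h : p ∈ poleSource κ e j) :
    0 < (poleEnd κ e j p).2.2.2.2.2 := by
  obtain ⟨q, hq, hq1⟩ := exists_poleCurve h
  rw [← hq1]
  exact hq.time_pos (he.pos j) one_pos le_rfl

theorem contDiffAt_poleEnd_sqrt {p : ℝ × ℂ} (h : p ∈ poleSource κ e j) :
    ContDiffAt ℝ ∞ (fun p => √(poleEnd κ e j p).2.2.2.2.2) p :=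
  ContDiffAt.sqrt (contDiffAt_snd.comp p (contDiffAt_snd.comp p (contDiffAt_snd.comp p
    (contDiffAt_snd.comp p (contDiffAt_snd.comp p (contDiffAt_poleEnd he h))))))
    (poleEnd_time_pos he h).ne'

theorem contDiffAt_poleCoord {p : ℝ × ℂ} (h : p ∈ poleSource κ e j) :
    ContDiffAt ℝ ∞ (poleCoord κ e j) p :=
  (contDiffAt_poleEnd_sqrt he h).smul contDiffAt_snd

theorem norm_sq_poleCoord {p : ℝ × ℂ} (h : p ∈ poleSource κ e j) :
    ‖poleCoord κ e j p‖ ^ 2 = ‖p.2‖ ^ 2 * (poleEnd κ e j p).2.2.2.2.2 := by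
  rw [poleCoord, norm_smul, mul_pow, Real.norm_eq_abs, sq_abs,
    Real.sq_sqrt (poleEnd_time_pos he h).le, mul_comm]

theorem poleCoord_eq_zero {p : ℝ × ℂ} (h : p ∈ poleSource κ e j) :
    poleCoord κ e j p = 0 ↔ p.2 = 0 := by
  rw [poleCoord, smul_eq_zero, or_iff_right (Real.sqrt_pos.2 (poleEnd_time_pos he h)).ne']

theorem hopfRel_poleEnd (h : (r, ζ) ∈ poleSource κ e j) (hζ : ζ ≠ 0) {k : ℝ} (hk : 0 < k)
    (hk1 : k ≤ 1) : HopfRel κ (e r)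
      (‖poleCoord κ e j (r, ζ)‖ ^ 2 - ‖poleCoord κ e j (r, k • ζ)‖ ^ 2)
      (polePoint e j (poleEnd κ e j (r, k • ζ))) (polePoint e j (poleEnd κ e j (r, ζ))) := by
  obtain ⟨q, hq, hq1⟩ := exists_poleCurve h
  have h1 := hq.hopfRel he hζ hk hk1 le_rfl
  have h2 : ‖poleCoord κ e j (r, k • ζ)‖ ^ 2 = ‖ζ‖ ^ 2 * (q k).2.2.2.2.2 := by
    rw [hq.poleCoord_smul he hk hk1, norm_smul, mul_pow, Real.norm_eq_abs, sq_abs,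
      Real.sq_sqrt (hq.time_pos (he.pos j) hk hk1).le, mul_comm]
  rwa [hq.polePoint_smul he hk hk1, h2, norm_sq_poleCoord he h, ← hq1]

theorem hasFDerivAt_poleCoord (r : ℝ) : HasFDerivAt (poleCoord κ e j)
    (√(κ j)⁻¹ • ContinuousLinearMap.snd ℝ ℝ ℂ) (r, 0) := by
  have h1 := ((contDiffAt_poleEnd_sqrt (j := j) he (zero_mem_poleSource he r)).differentiableAt
    (by simp)).hasFDerivAt.smul (hasFDerivAt_snd (𝕜 := ℝ) (p := (r, (0 : ℂ))) (E := ℝ) (F := ℂ))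
  refine h1.congr_fderiv ?_
  ext v <;> simp [poleEnd_zero he]

/-- Near the pole, the transverse coordinate is a smooth coordinate. -/
theorem exists_inverse_poleCoord (r : ℝ) : ∃ g : ℝ × ℂ → ℂ, g (r, 0) = 0 ∧
    ∀ᶠ p in 𝓝 (r, (0 : ℂ)), ContDiffAt ℝ ∞ g p ∧ (p.1, g p) ∈ poleSource κ e j ∧
      poleCoord κ e j (p.1, g p) = p.2 := by
  have h0 := zero_mem_poleSource (j := j) he r
  let F : ℝ × ℂ → ℝ × ℂ := fun p => (p.1, poleCoord κ e j p)
  have hF : ContDiffOn ℝ ∞ F (poleSource κ e j) := fun p hp =>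
    (contDiffAt_fst.prodMk (contDiffAt_poleCoord he hp)).contDiffWithinAt
  have hF0 : F (r, 0) = (r, 0) := by simp [F, poleCoord]
  have hκ : 0 < √(κ j)⁻¹ := Real.sqrt_pos.2 (inv_pos.2 (he.pos j))
  obtain ⟨g, hg0, -, hgr⟩ := hF.exists_localInverse rfl (isOpen_poleSource he) h0 (fun v hv => by
    have : fderiv ℝ F (r, 0) =
        (ContinuousLinearMap.fst ℝ ℝ ℂ).prod (√(κ j)⁻¹ • ContinuousLinearMap.snd ℝ ℝ ℂ) :=
      (hasFDerivAt_fst.prodMk (hasFDerivAt_poleCoord he r)).fderiv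
    rw [this] at hv
    simp only [ContinuousLinearMap.prod_apply, ContinuousLinearMap.coe_fst', smul_apply,
      ContinuousLinearMap.coe_snd', Prod.mk_eq_zero, smul_eq_zero, hκ.ne', false_or] at hv
    exact Prod.ext hv.1 hv.2)
  rw [hF0] at hg0 hgr
  refine ⟨fun p => (g p).2, congrArg Prod.snd hg0, ?_⟩
  have hs := hgr.self_of_nhds.2.continuousAt.eventually_mem (by
    rw [hg0]; exact (isOpen_poleSource he).mem_nhds h0)
  filter_upwards [hgr, hs] with p ⟨hp, hpc⟩ hps
  have h1 : (F (g p)).1 = p.1 := congrArg Prod.fst hp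
  have h2 : (p.1, (g p).2) = g p := Prod.ext h1.symm rfl
  refine ⟨contDiffAt_snd.comp p hpc, ?_⟩
  rw [h2]
  exact ⟨hps, congrArg Prod.snd hp⟩

/-- The map `poleCoord` multiplies ζ by a positive number, so two admissible choices of ζ for the
same η lie on one ray. The trajectory from the shorter one passes through the end point of the
longer one, and the remaining times match. -/
theorem PetalRel.unique {η : ℂ} {z z' : C2} (h : PetalRel κ e j r η z)
    (h' : PetalRel κ e j r η z') : z = z' := by
  rcases h with ⟨h0, rfl⟩ | ⟨h0, ζ, k, hζ, hk, hk1, hη, hz⟩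
  · rcases h' with ⟨-, rfl⟩ | ⟨h0', -⟩
    · rfl
    · exact absurd h0 h0'
  rcases h' with ⟨h0', rfl⟩ | ⟨-, ζ', k', hζ', hk', hk1', hη', hz'⟩
  · exact absurd h0' h0
  have key : ∀ {ζ ζ' : ℂ} {k k' : ℝ} {z z' : C2}, (r, ζ) ∈ poleSource κ e j → 0 < k →
      poleCoord κ e j (r, ζ) = k • η →
      HopfRel κ (e r) ((1 - k ^ 2) * ‖η‖ ^ 2) (polePoint e j (poleEnd κ e j (r, ζ))) z →
      (r, ζ') ∈ poleSource κ e j → 0 < k' → poleCoord κ e j (r, ζ') = k' • η →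
      HopfRel κ (e r) ((1 - k' ^ 2) * ‖η‖ ^ 2) (polePoint e j (poleEnd κ e j (r, ζ'))) z' →
      (∃ c : ℝ, 0 < c ∧ c ≤ 1 ∧ ζ' = c • ζ) → z = z' := by
    rintro ζ _ k k' z z' hζ hk hη hz hζ' hk' hη' hz' ⟨c, hc, hc1, rfl⟩
    have hζ0 : ζ ≠ 0 := by
      rintro rfl
      exact smul_ne_zero hk.ne' h0 (hη ▸ (poleCoord_eq_zero he hζ).2 rfl)
    have h1 := hopfRel_poleEnd he hζ hζ0 hc hc1
    rw [hη, hη', norm_smul, norm_smul, mul_pow, mul_pow, Real.norm_eq_abs, Real.norm_eq_abs,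
      sq_abs, sq_abs] at h1
    have h2 := h1.trans hz
    rw [show k ^ 2 * ‖η‖ ^ 2 - k' ^ 2 * ‖η‖ ^ 2 + (1 - k ^ 2) * ‖η‖ ^ 2 =
      (1 - k' ^ 2) * ‖η‖ ^ 2 by ring] at h2
    exact h2.unique hz'
  have hpos (ζ : ℂ) (hζ : (r, ζ) ∈ poleSource κ e j) :
      0 < √(poleEnd κ e j (r, ζ)).2.2.2.2.2 := Real.sqrt_pos.2 (poleEnd_time_pos he hζ)
  have hrel : ∀ {ζ ζ' : ℂ} {k k' : ℝ}, (r, ζ) ∈ poleSource κ e j → 0 < k →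
      poleCoord κ e j (r, ζ) = k • η → (r, ζ') ∈ poleSource κ e j → 0 < k' →
      poleCoord κ e j (r, ζ') = k' • η → ∃ c : ℝ, 0 < c ∧ ζ' = c • ζ := by
    intro ζ ζ' k k' hζ hk hη hζ' hk' hη'
    have h1 := hpos ζ hζ
    have h2 := hpos ζ' hζ'
    simp only [poleCoord] at hη hη'
    refine ⟨(√(poleEnd κ e j (r, ζ')).2.2.2.2.2)⁻¹ * k' * k⁻¹ *
      √(poleEnd κ e j (r, ζ)).2.2.2.2.2, by positivity, ?_⟩
    rw [mul_smul, hη, smul_smul, mul_assoc _ k⁻¹, inv_mul_cancel₀ hk.ne', mul_one, mul_smul, ← hη',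
      smul_smul, inv_mul_cancel₀ h2.ne', one_smul]
  obtain ⟨c, hc, hcc⟩ := hrel hζ hk hη hζ' hk' hη'
  rcases le_total c 1 with h | h
  · exact key hζ hk hη hz hζ' hk' hη' hz' ⟨c, hc, h, hcc⟩
  · refine (key hζ' hk' hη' hz' hζ hk hη hz ⟨c⁻¹, inv_pos.2 hc, inv_le_one_of_one_le₀ h, ?_⟩).symm
    rw [hcc, smul_smul, inv_mul_cancel₀ hc.ne', one_smul]

theorem PetalRel.petal_eq {η : ℂ} {z : C2} (h : PetalRel κ e j r η z) : petal κ e j r η = z :=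
  PetalRel.unique he (Classical.epsilon_spec ⟨z, h⟩) h

theorem polePoint_poleEnd_mem (h : (r, ζ) ∈ poleSource κ e j) (hζ : ζ ≠ 0) :
    polePoint e j (poleEnd κ e j (r, ζ)) ∈ regularSet (e r) :=
  FlowRel.mem_right (hopfRel_poleEnd he h hζ one_pos le_rfl)

/-- The local inverse near η = 0 is used at a point k • η close to the pole, together with a whole
neighbourhood of that point. Smoothness of the petal at η then follows by transport along the flow.
-/
theorem exists_small_poleCoord (r : ℝ) (η : ℂ) : ∃ k : ℝ, 0 < k ∧ k ≤ 1 ∧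
    ∃ g : ℝ × ℂ → ℂ, ∀ᶠ p in 𝓝 (r, k • η), ContDiffAt ℝ ∞ g p ∧
      (p.1, g p) ∈ poleSource κ e j ∧ poleCoord κ e j (p.1, g p) = p.2 := by
  obtain ⟨g, -, hgr⟩ := exists_inverse_poleCoord (j := j) he r
  have h2 : Filter.Tendsto (fun k : ℝ => (r, k • η)) (𝓝[>] 0) (𝓝 (r, 0)) := by
    have : Continuous fun k : ℝ => (r, k • η) := by fun_prop
    have := this.tendsto 0
    rw [zero_smul] at this
    exact this.mono_left nhdsWithin_le_nhds
  have h3 := (h2.eventually hgr.eventually_nhds).and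
    (show ∀ᶠ k : ℝ in 𝓝[>] 0, k ∈ Set.Ioc 0 1 from Ioc_mem_nhdsGT one_pos)
  obtain ⟨k, h4, h6, h7⟩ := h3.exists
  exact ⟨k, h6, h7, g, h4⟩

theorem petalRel_petal (r : ℝ) (η : ℂ) : PetalRel κ e j r η (petal κ e j r η) := by
  refine Classical.epsilon_spec (p := PetalRel κ e j r η) ?_
  rcases eq_or_ne η 0 with rfl | hη
  · exact ⟨_, Or.inl ⟨rfl, rfl⟩⟩
  obtain ⟨k, hk, hk1, g, hg⟩ := exists_small_poleCoord (j := j) he r η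
  obtain ⟨-, h1, h2⟩ := hg.self_of_nhds
  have h0 : g (r, k • η) ≠ 0 := by
    intro h0
    rw [(poleCoord_eq_zero he h1).2 h0] at h2
    exact smul_ne_zero hk.ne' hη h2.symm
  obtain ⟨z, hz⟩ := HopfRel.exists_of_nonneg he.pos
    (mul_nonneg (sub_nonneg.2 (pow_le_one₀ hk.le hk1)) (sq_nonneg ‖η‖))
    (polePoint_poleEnd_mem he h1 h0)
  exact ⟨z, Or.inr ⟨hη, _, k, h1, hk, hk1, h2, hz⟩⟩

theorem petal_zero (r : ℝ) : petal κ e j r 0 = e r j := PetalRel.petal_eq he (Or.inl ⟨rfl, rfl⟩)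

theorem petal_poleCoord (h : (r, ζ) ∈ poleSource κ e j) :
    petal κ e j r (poleCoord κ e j (r, ζ)) = polePoint e j (poleEnd κ e j (r, ζ)) := by
  rcases eq_or_ne ζ 0 with rfl | hζ
  · rw [(poleCoord_eq_zero he h).2 rfl, petal_zero he, poleEnd_zero he]
    simp [polePoint, PoleState.w]
  · refine PetalRel.petal_eq he (Or.inr ⟨fun h0 => hζ ((poleCoord_eq_zero he h).1 h0), ζ, 1, h,
      one_pos, le_rfl, (one_smul _ _).symm, ?_⟩)
    rw [one_pow, sub_self, zero_mul]
    exact FlowRel.refl (polePoint_poleEnd_mem he h hζ)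

theorem petal_mem {η : ℂ} (hη : η ≠ 0) : petal κ e j r η ∈ regularSet (e r) := by
  rcases petalRel_petal (j := j) he r η with ⟨h, -⟩ | ⟨-, _, _, -, -, -, -, h⟩
  · exact absurd h hη
  · exact FlowRel.mem_right h

theorem hopfRel_petal {η : ℂ} (hη : η ≠ 0) {k : ℝ} (hk : 0 < k) (hk1 : k ≤ 1) :
    HopfRel κ (e r) ((1 - k ^ 2) * ‖η‖ ^ 2) (petal κ e j r (k • η)) (petal κ e j r η) := by
  rcases petalRel_petal (j := j) he r (k • η) with ⟨h, -⟩ | ⟨-, ζ, l, h1, hl, hl1, h2, h3⟩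
  · exact absurd h (smul_ne_zero hk.ne' hη)
  have hnn : 0 ≤ (1 - k ^ 2) * ‖η‖ ^ 2 :=
    mul_nonneg (sub_nonneg.2 (pow_le_one₀ hk.le hk1)) (sq_nonneg ‖η‖)
  obtain ⟨z, hz⟩ := HopfRel.exists_of_nonneg he.pos hnn h3.mem_right
  have h4 : PetalRel κ e j r η z := by
    refine Or.inr ⟨hη, ζ, l * k, h1, mul_pos hl hk, mul_le_one₀ hl1 hk.le hk1,
      by rw [h2, smul_smul], ?_⟩
    have := h3.trans hz
    rwa [norm_smul, mul_pow, Real.norm_eq_abs, sq_abs, show (1 - l ^ 2) * (k ^ 2 * ‖η‖ ^ 2) +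
      (1 - k ^ 2) * ‖η‖ ^ 2 = (1 - (l * k) ^ 2) * ‖η‖ ^ 2 by ring] at this
  rwa [PetalRel.petal_eq he h4]

/-- Near η = 0 the petal is the end point of the regularised flow in the smooth coordinate
`poleCoord`. Elsewhere it is a point near the pole moved by the smooth flow of `hopfField` for the
time (1 - k²)‖η‖². -/
theorem contDiff_petal : ContDiff ℝ ∞ fun p : ℝ × ℂ => petal κ e j p.1 p.2 := by
  rw [contDiff_iff_contDiffAt]
  rintro ⟨r, η⟩
  have hpt : ∀ {g : ℝ × ℂ → ℂ} {p : ℝ × ℂ}, ContDiffAt ℝ ∞ g p → (p.1, g p) ∈ poleSource κ e j →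
      ContDiffAt ℝ ∞ (fun p => polePoint e j (poleEnd κ e j (p.1, g p))) p := fun {g p} hg hp =>
    (contDiff_polePoint he.smooth).contDiffAt.comp _
      (ContDiffAt.comp (f := fun p : ℝ × ℂ => (p.1, g p)) p (contDiffAt_poleEnd he hp)
        (contDiffAt_fst.prodMk hg))
  rcases eq_or_ne η 0 with rfl | hη
  · obtain ⟨g, hg0, hgr⟩ := exists_inverse_poleCoord (j := j) he r
    refine (hpt hgr.self_of_nhds.1 hgr.self_of_nhds.2.1).congr_of_eventuallyEq ?_
    filter_upwards [hgr] with p hp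
    rw [← petal_poleCoord he hp.2.1, hp.2.2]
  · obtain ⟨k, hk, hk1, g, hg⟩ := exists_small_poleCoord (j := j) he r η
    have hk' : ContDiff ℝ ∞ fun p : ℝ × ℂ => (p.1, k • p.2) := by fun_prop
    have hh := hopfRel_petal (j := j) (r := r) he hη hk hk1
    have h1 : ContDiffAt ℝ ∞ (fun p : ℝ × ℂ => ((1 - k ^ 2) * ‖p.2‖ ^ 2, p.1,
        polePoint e j (poleEnd κ e j (p.1, g (p.1, k • p.2))))) (r, η) := by
      refine ContDiffAt.prodMk (contDiff_const.mul (contDiff_snd.norm_sq ℝ)).contDiffAt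
        (contDiffAt_fst.prodMk ?_)
      exact ContDiffAt.comp (r, η) (f := fun p : ℝ × ℂ => (p.1, k • p.2))
        (hpt hg.self_of_nhds.1 hg.self_of_nhds.2.1) hk'.contDiffAt
    have h2 : polePoint e j (poleEnd κ e j (r, g (r, k • η))) = petal κ e j r (k • η) := by
      rw [← petal_poleCoord he hg.self_of_nhds.2.1, hg.self_of_nhds.2.2]
    have h3 := (h2 ▸ contDiffAt_hopfFlow he.smooth hh : ContDiffAt ℝ ∞ _ _).comp (r, η) h1
    refine h3.congr_of_eventuallyEq ?_
    have h4 := (hk'.continuous.tendsto (r, η)).eventually hg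
    have h5 : ∀ᶠ p : ℝ × ℂ in 𝓝 (r, η), p.2 ≠ 0 :=
      continuous_snd.continuousAt.eventually_ne hη
    filter_upwards [h4, h5] with p hp hp0
    have h6 := hopfRel_petal (j := j) (r := p.1) he hp0 hk hk1
    rw [← (h6.flow_eq he.smooth)]
    simp only [Function.comp]
    rw [← petal_poleCoord he hp.2.1, hp.2.2]

theorem norm_petal (r : ℝ) (η : ℂ) : ‖petal κ e j r η‖ = 1 := by
  rcases eq_or_ne η 0 with rfl | hη
  · rw [petal_zero he, he.norm]
  have h1 : Continuous fun k : ℝ => ‖petal κ e j r (k • η)‖ :=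
    ((contDiff_petal he).continuous.comp
      (show Continuous fun k : ℝ => (r, k • η) by fun_prop)).norm
  have h2 : Filter.Tendsto (fun k : ℝ => ‖petal κ e j r (k • η)‖) (𝓝[>] 0) (𝓝 1) := by
    have := h1.tendsto 0
    rw [zero_smul, petal_zero he, he.norm] at this
    exact this.mono_left nhdsWithin_le_nhds
  refine tendsto_nhds_unique (tendsto_const_nhds.congr' ?_) h2
  filter_upwards [Ioc_mem_nhdsGT (show (0 : ℝ) < 1 by norm_num)] with k hk
  exact (hopfRel_petal he hη hk.1 hk.2).norm_eq

/-- Along the ray of ζ the petal is a regularised curve with initial velocity ζ • perp (e r j),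
while `poleCoord` has derivative √(κ_j)⁻¹ at ζ = 0. The factor √(κ_j) reflects ‖w‖² ≈ κ_j ‖η‖². -/
theorem fderiv_petal_zero (r : ℝ) (v : ℂ) :
    fderiv ℝ (fun η => petal κ e j r η) 0 v = ((√(κ j) : ℂ) * v) • perp (e r j) := by
  have hd : DifferentiableAt ℝ (fun η => petal κ e j r η) 0 :=
    ((contDiff_petal he).comp (contDiff_prodMk_right r)).differentiable (by simp) 0
  have hκ := he.pos j
  have key : ∀ ζ : ℂ, (r, ζ) ∈ poleSource κ e j →
      fderiv ℝ (fun η => petal κ e j r η) 0 (√(κ j)⁻¹ • ζ) = ζ • perp (e r j) := by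
    intro ζ hζ
    obtain ⟨q, hq, hq1⟩ := exists_poleCurve hζ
    have h0 : (0 : ℝ) ∈ Set.Icc (0 : ℝ) 1 := ⟨le_rfl, zero_le_one⟩
    have h1 := hq.hasDerivWithinAt_polePoint h0
    have h2 : HasDerivAt (fun k : ℝ => poleCoord κ e j (r, k • ζ)) (√(κ j)⁻¹ • ζ) 0 := by
      have h3 : HasDerivAt (fun k : ℝ => (r, k • ζ)) (0, ζ) 0 := by
        have := (hasDerivAt_const (0 : ℝ) r).prodMk ((hasDerivAt_id (0 : ℝ)).smul_const ζ)
        simpa using this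
      have h4 := hasFDerivAt_poleCoord (j := j) he r
      rw [← zero_smul ℝ ζ] at h4
      exact h4.comp_hasDerivAt (0 : ℝ) h3
    have h5 : HasDerivWithinAt (fun k : ℝ => petal κ e j r (poleCoord κ e j (r, k • ζ)))
        (fderiv ℝ (fun η => petal κ e j r η) 0 (√(κ j)⁻¹ • ζ)) (Set.Icc 0 1) 0 := by
      refine HasFDerivAt.comp_hasDerivWithinAt (l := fun η => petal κ e j r η) (0 : ℝ) ?_ h2.hasDerivWithinAt
      rw [zero_smul, (poleCoord_eq_zero he (zero_mem_poleSource he r)).2 rfl]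
      exact hd.hasFDerivAt
    have h6 : HasDerivWithinAt (fun k : ℝ => polePoint e j (q k))
        (fderiv ℝ (fun η => petal κ e j r η) 0 (√(κ j)⁻¹ • ζ)) (Set.Icc 0 1) 0 := by
      refine h5.congr_of_mem (fun k hk => ?_) h0
      rcases hk.1.eq_or_lt with rfl | hk0
      · rw [zero_smul, petal_poleCoord he (zero_mem_poleSource he r), poleEnd_zero he, hq.zero]
        simp [polePoint, PoleState.w, poleInit]
      · rw [petal_poleCoord he (hq.poleEnd_smul he hk0 hk.2).1, hq.polePoint_smul he hk0 hk.2]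
    rw [(uniqueDiffOn_Icc zero_lt_one 0 h0).eq_deriv _ h6 h1]
    simp [hq.zero, poleInit, poleRate]
  -- By linearity, knowing the derivative on small vectors of each direction is enough.
  have hev : ∀ᶠ t : ℝ in 𝓝[>] 0, (r, t • v) ∈ poleSource κ e j := by
    have hc : Continuous fun t : ℝ => (r, t • v) := by fun_prop
    have := hc.tendsto 0
    rw [zero_smul] at this
    exact (this.mono_left nhdsWithin_le_nhds).eventually_mem
      ((isOpen_poleSource he).mem_nhds (zero_mem_poleSource he r))
  obtain ⟨t, ht, ht0⟩ := (hev.and self_mem_nhdsWithin).exists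
  have ht0 : t ≠ 0 := (show 0 < t from ht0).ne'
  have h1 := key _ ht
  rw [smul_comm, map_smul, smul_assoc] at h1
  have h2 := smul_right_injective C2 ht0 h1
  rw [map_smul] at h2
  have hs : √(κ j) ≠ 0 := (Real.sqrt_pos.2 hκ).ne'
  rw [Real.sqrt_inv] at h2
  rw [mul_smul, ← h2, ← real_smul_C2, smul_smul, mul_inv_cancel₀ hs, one_smul]

end

end

/-! ### Cone coordinates on the attracted set -/

noncomputable section

variable {m : ℕ} (κ : Fin m → ℝ) (e : ℝ → Fin m → C2) (j : Fin m)

/-- Polar type coordinates `(r, c, η)` on the part of the total space attracted by the `j`-th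
lines under the backward flow. -/
def coneMap (p : ℝ × ℂ × ℂ) : ℝ × C2 := (p.1, p.2.1 • petal κ e j p.1 p.2.2)

/-- The domain of the polar type coordinates. -/
def coneSource : Set (ℝ × ℂ × ℂ) := {p | p.2.1 ≠ 0}

/-- The part of the total space attracted by the `j`-th lines under the backward flow. -/
def attracted : Set (ℝ × C2) := coneMap κ e j '' coneSource

/-- The polar type coordinates of an attracted point. -/
def coneInv : ℝ × C2 → ℝ × ℂ × ℂ := Function.invFunOn (coneMap κ e j) coneSource

variable {κ e j} {r : ℝ}

theorem isOpen_coneSource : IsOpen coneSource :=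
  isOpen_ne_fun (by fun_prop) continuous_const

section

variable (he : IsCrossFamily κ e)
include he

theorem contDiff_coneMap : ContDiff ℝ ∞ (coneMap κ e j) := by
  refine contDiff_fst.prodMk ?_
  rw [← contDiffOn_univ]
  refine ContDiffOn.smul_C2 (by fun_prop) (ContDiff.contDiffOn ?_)
  exact (contDiff_petal he).comp (show ContDiff ℝ ∞ fun p : ℝ × ℂ × ℂ => (p.1, p.2.2) by fun_prop)

theorem differentiable_petal (r : ℝ) : Differentiable ℝ fun η => petal κ e j r η :=
  ((contDiff_petal he).comp (contDiff_prodMk_right r)).differentiable (by simp)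

theorem fderiv_coneMap (p : ℝ × ℂ × ℂ) (v w : ℂ) : fderiv ℝ (coneMap κ e j) p (0, v, w) =
    (0, v • petal κ e j p.1 p.2.2 + p.2.1 • fderiv ℝ (fun η => petal κ e j p.1 η) p.2.2 w) := by
  have h1 : HasDerivAt (fun t : ℝ => p + t • ((0 : ℝ), v, w)) (0, v, w) 0 := by
    simpa using ((hasDerivAt_id (0 : ℝ)).smul_const ((0 : ℝ), v, w)).const_add p
  have h2 := ((contDiff_coneMap (j := j) he).differentiable (by simp) p).hasFDerivAt
  rw [show p = p + (0 : ℝ) • ((0 : ℝ), v, w) by simp] at h2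
  have h3 := h2.comp_hasDerivAt (0 : ℝ) h1
  have h4 : HasDerivAt (fun t : ℝ => p.2.1 + t • v) v 0 := by
    simpa using ((hasDerivAt_id (0 : ℝ)).smul_const v).const_add p.2.1
  have h5 : HasDerivAt (fun t : ℝ => p.2.2 + t • w) w 0 := by
    simpa using ((hasDerivAt_id (0 : ℝ)).smul_const w).const_add p.2.2
  have h6 : HasDerivAt (fun t : ℝ => petal κ e j p.1 (p.2.2 + t • w))
      (fderiv ℝ (fun η => petal κ e j p.1 η) p.2.2 w) 0 := by
    have := (differentiable_petal (j := j) he p.1 p.2.2).hasFDerivAt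
    rw [show p.2.2 = p.2.2 + (0 : ℝ) • w by simp] at this
    have h := this.comp_hasDerivAt (0 : ℝ) h5
    simp only [zero_smul, add_zero] at h
    exact h
  have h7 := (hasDerivAt_const (0 : ℝ) p.1).prodMk (hasDerivWithinAt_univ.1
    (hasDerivWithinAt_smul_C2 h4.hasDerivWithinAt h6.hasDerivWithinAt))
  have h8 : coneMap κ e j ∘ (fun t : ℝ => p + t • ((0 : ℝ), v, w)) =
      fun t : ℝ => (p.1, (p.2.1 + t • v) • petal κ e j p.1 (p.2.2 + t • w)) := by
    funext t
    simp [coneMap]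
  rw [h8] at h3
  have := h3.unique h7
  simpa [add_comm] using this

theorem fst_fderiv_coneMap (p v : ℝ × ℂ × ℂ) : (fderiv ℝ (coneMap κ e j) p v).1 = v.1 := by
  have h2 := ((contDiff_coneMap (j := j) he).differentiable (by simp) p).hasFDerivAt
  have h3 := (hasFDerivAt_fst (𝕜 := ℝ) (p := coneMap κ e j p)).comp p h2
  have h4 : HasFDerivAt (Prod.fst ∘ coneMap κ e j) (ContinuousLinearMap.fst ℝ ℝ (ℂ × ℂ)) p :=
    hasFDerivAt_fst
  exact congrArg (fun L => L v) (h3.unique h4)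

/-- At η = 0 the fibre derivative sends (v, w) to v e_j + c √(κ_j) w perp(e_j), in an orthogonal
basis. Applying `cross (e r j)` isolates w, and then v vanishes too. -/
theorem exists_inverse_coneMap_pole (r : ℝ) {c : ℂ} (hc : c ≠ 0) : ∃ g : ℝ × C2 → ℝ × ℂ × ℂ,
    (∀ᶠ p in 𝓝 (r, c, (0 : ℂ)), g (coneMap κ e j p) = p) ∧
      ∀ᶠ q in 𝓝 (coneMap κ e j (r, c, 0)), coneMap κ e j (g q) = q ∧ ContDiffAt ℝ ∞ g q := by
  have hfin : Module.finrank ℝ (ℝ × ℂ × ℂ) = Module.finrank ℝ (ℝ × C2) := by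
    have : Module.finrank ℝ C2 = Module.finrank ℝ ℂ * Module.finrank ℂ C2 :=
      (Module.finrank_mul_finrank ℝ ℂ C2).symm
    rw [Module.finrank_prod, Module.finrank_prod, Module.finrank_prod, this]
    simp
  obtain ⟨g, -, h1, h2⟩ := (contDiff_coneMap (j := j) he).contDiffOn.exists_localInverse hfin
    isOpen_univ (Set.mem_univ (r, c, (0 : ℂ))) (fun v hv => by
      have h0 : v.1 = 0 := by rw [← fst_fderiv_coneMap (j := j) he (r, c, 0) v, hv]; rfl
      obtain ⟨_, v, w⟩ := v
      obtain rfl : _ = 0 := h0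
      rw [fderiv_coneMap he] at hv
      have hv2 := (Prod.ext_iff.1 hv).2
      simp only [petal_zero he, fderiv_petal_zero he, Prod.snd_zero] at hv2
      have h3 := congrArg (cross (e r j)) hv2
      rw [cross_add, cross_smul, cross_smul, cross_smul, cross_apply_self, cross_perp, he.norm,
        cross_zero_right] at h3
      have hs : (√(κ j) : ℂ) ≠ 0 := by
        exact_mod_cast (Real.sqrt_pos.2 (he.pos j)).ne'
      have hw : w = 0 := by simpa [hc, hs] using h3
      have hn : e r j ≠ 0 := by
        rw [← norm_ne_zero_iff, he.norm]; exact one_ne_zero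
      subst hw
      simp only [mul_zero, zero_smul, smul_zero, add_zero, smul_eq_zero, hn, or_false] at hv2
      simp [hv2])
  exact ⟨g, h1, h2⟩

/-- A local coordinate formula transporting the inverse chart along the flow. -/
theorem petal_stretch (r : ℝ) {η : ℂ} (hη : η ≠ 0) {s : ℝ} (hs : 0 ≤ s) :
    HopfRel κ (e r) s (petal κ e j r η) (petal κ e j r ((√(‖η‖ ^ 2 + s) * ‖η‖⁻¹) • η)) := by
  have hn : 0 < ‖η‖ := norm_pos_iff.2 hη
  have hq : 0 < ‖η‖ ^ 2 + s := by positivity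
  have hq' := Real.sqrt_pos.2 hq
  have hd := Real.sq_sqrt hq.le
  set d := √(‖η‖ ^ 2 + s) with hdd
  have hk : ‖η‖ / d ≤ 1 := by
    rw [div_le_one hq', hdd]
    exact Real.le_sqrt_of_sq_le (by linarith)
  have := hopfRel_petal (j := j) (r := r) he (η := (d * ‖η‖⁻¹) • η)
    (smul_ne_zero (by positivity) hη) (k := ‖η‖ / d) (by positivity) hk
  rw [smul_smul, show ‖η‖ / d * (d * ‖η‖⁻¹) = 1 by field_simp, one_smul, norm_smul, norm_mul,
    Real.norm_of_nonneg hq'.le, Real.norm_of_nonneg (by positivity : (0 : ℝ) ≤ ‖η‖⁻¹)] at this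
  convert this using 1
  field_simp
  linarith

theorem exists_inverse_coneMap {p : ℝ × ℂ × ℂ} (hp : p ∈ coneSource) :
    ∃ g : ℝ × C2 → ℝ × ℂ × ℂ, ∀ᶠ q in 𝓝 (coneMap κ e j p), g q ∈ coneSource ∧
      coneMap κ e j (g q) = q ∧ ContDiffAt ℝ ∞ g q := by
  obtain ⟨r, c, η⟩ := p
  have hc : c ≠ 0 := hp
  obtain ⟨g, hgl, hgr⟩ := exists_inverse_coneMap_pole (j := j) he r hc
  have hcont := (contDiff_coneMap (j := j) he).continuous
  rcases eq_or_ne η 0 with rfl | hη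
  · refine ⟨g, ?_⟩
    have h1 := hgr.self_of_nhds.2.continuousAt.eventually_mem (s := coneSource)
      (by rw [hgl.self_of_nhds]; exact isOpen_coneSource.mem_nhds hc)
    filter_upwards [hgr, h1] with q hq hq1 using ⟨hq1, hq⟩
  have h1 : Filter.Tendsto (fun k : ℝ => (r, c, k • η)) (𝓝[>] 0) (𝓝 (r, c, 0)) := by
    have : Continuous fun k : ℝ => (r, c, k • η) := by fun_prop
    have := this.tendsto 0
    rw [zero_smul] at this
    exact this.mono_left nhdsWithin_le_nhds
  obtain ⟨k, ⟨hk1, hk2⟩, hk0, hk3⟩ := ((h1.eventually hgl).and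
    ((hcont.continuousAt.tendsto.comp h1).eventually hgr.eventually_nhds)|>.and
    (show ∀ᶠ k : ℝ in 𝓝[>] 0, k ∈ Set.Ioc 0 1 from Ioc_mem_nhdsGT one_pos)).exists
  replace hk2 : ∀ᶠ q in 𝓝 (coneMap κ e j (r, c, k • η)),
    coneMap κ e j (g q) = q ∧ ContDiffAt ℝ ∞ g q := hk2
  have hkη : k • η ≠ 0 := smul_ne_zero hk0.ne' hη
  set s := (1 - k ^ 2) * ‖η‖ ^ 2 with hs
  have hs0 : 0 ≤ s := mul_nonneg (sub_nonneg.2 (pow_le_one₀ hk0.le hk3)) (sq_nonneg ‖η‖)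
  have hrel : HopfRel κ (e r) s (c • petal κ e j r (k • η)) (c • petal κ e j r η) :=
    (hopfRel_petal he hη hk0 hk3).smul hc
  let b : ℝ × C2 → ℝ × C2 := fun q => (q.1, hopfFlow κ e (-s) q.1 q.2)
  have hb : ∀ᶠ q in 𝓝 (coneMap κ e j (r, c, η)), ContDiffAt ℝ ∞ b q ∧
      HopfRel κ (e q.1) (-s) q.2 (b q).2 := by
    have h2 := eventually_hopfRel he.smooth hrel.reverse
    have h3 : Filter.Tendsto (fun q : ℝ × C2 => (-s, q.1, q.2)) (𝓝 (r, c • petal κ e j r η))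
        (𝓝 (-s, r, c • petal κ e j r η)) :=
      (show Continuous fun q : ℝ × C2 => (-s, q.1, q.2) by fun_prop).tendsto _
    filter_upwards [h3.eventually h2] with q hq
    refine ⟨contDiffAt_fst.prodMk ?_, hq⟩
    exact ContDiffAt.comp (f := fun q : ℝ × C2 => (-s, q.1, q.2)) q
      (contDiffAt_hopfFlow he.smooth hq) (by fun_prop)
  have hb0 : b (coneMap κ e j (r, c, η)) = coneMap κ e j (r, c, k • η) :=
    Prod.ext rfl (hrel.reverse.flow_eq he.smooth)
  have hbt : Filter.Tendsto b (𝓝 (coneMap κ e j (r, c, η))) (𝓝 (coneMap κ e j (r, c, k • η))) := by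
    rw [← hb0]
    exact hb.self_of_nhds.1.continuousAt.tendsto
  have hgt : Filter.Tendsto g (𝓝 (coneMap κ e j (r, c, k • η))) (𝓝 (r, c, k • η)) := by
    have := hk2.self_of_nhds.2.continuousAt.tendsto
    rwa [hk1] at this
  have hne : ∀ᶠ p : ℝ × ℂ × ℂ in 𝓝 (r, c, k • η), p.2.1 ≠ 0 ∧ p.2.2 ≠ 0 :=
    ((show Continuous fun p : ℝ × ℂ × ℂ => p.2.1 by fun_prop).continuousAt.eventually_ne hc).and
      ((show Continuous fun p : ℝ × ℂ × ℂ => p.2.2 by fun_prop).continuousAt.eventually_ne hkη)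
  let d : ℝ × ℂ × ℂ → ℝ × ℂ × ℂ := fun p => (p.1, p.2.1, (√(‖p.2.2‖ ^ 2 + s) * ‖p.2.2‖⁻¹) • p.2.2)
  -- The inverse away from the pole: flow back by time s with b, invert near the pole with g, and
  -- lengthen ‖η‖² by s with d.
  refine ⟨d ∘ g ∘ b, ?_⟩
  filter_upwards [hb, hbt.eventually hk2, (hgt.comp hbt).eventually hne] with q hq1 hq2 hq3
  replace hq3 : (g (b q)).2.1 ≠ 0 ∧ (g (b q)).2.2 ≠ 0 := hq3
  refine ⟨hq3.1, ?_, ?_⟩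
  · have h5 := (petal_stretch (κ := κ) (j := j) he (g (b q)).1 hq3.2 hs0).smul hq3.1
    have h6 : (g (b q)).1 = q.1 := congrArg Prod.fst hq2.1
    have h7 : (g (b q)).2.1 • petal κ e j (g (b q)).1 (g (b q)).2.2 = (b q).2 :=
      congrArg Prod.snd hq2.1
    rw [h7, h6] at h5
    have h8 := hq1.2.reverse
    rw [neg_neg] at h8
    refine Prod.ext h6 ?_
    simp only [coneMap, d, Function.comp, h6]
    exact h5.unique h8
  · refine ContDiffAt.comp q ?_ (hq2.2.comp q hq1.1)
    have hn : ContDiffAt ℝ ∞ (fun p : ℝ × ℂ × ℂ => p.2.2) (g (b q)) := by fun_prop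
    refine contDiffAt_fst.prodMk (ContDiffAt.prodMk (by fun_prop) (ContDiffAt.smul
      (ContDiffAt.mul (ContDiffAt.sqrt ((hn.norm_sq ℝ).add contDiffAt_const) ?_)
        (ContDiffAt.inv (hn.norm ℝ hq3.2) (norm_ne_zero_iff.2 hq3.2))) hn))
    have := norm_pos_iff.2 hq3.2
    positivity

theorem coneMap_snd_mem {i : Fin m} {c η : ℂ} (hc : c ≠ 0) :
    c • petal κ e i r η ∈ regularSet (e r) ↔ η ≠ 0 := by
  refine ⟨?_, fun h => regularSet_smul (petal_mem he h) hc⟩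
  rintro h rfl
  apply h i
  rw [petal_zero he, cross_smul, cross_apply_self, mul_zero]

theorem hopfRel_petal_back {s : ℝ} {η c : ℂ} (hη : η ≠ 0) (hc : c ≠ 0) (hs : 0 ≤ s)
    (hs1 : s < ‖η‖ ^ 2) : HopfRel κ (e r) s (c • petal κ e j r (√(1 - s / ‖η‖ ^ 2) • η))
      (c • petal κ e j r η) := by
  have hn : 0 < ‖η‖ := norm_pos_iff.2 hη
  have h1 : 0 < 1 - s / ‖η‖ ^ 2 := by rw [sub_pos, div_lt_one (by positivity)]; exact hs1
  have h2 : 1 - s / ‖η‖ ^ 2 ≤ 1 := sub_le_self _ (by positivity)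
  have := (hopfRel_petal (j := j) (r := r) he hη (Real.sqrt_pos.2 h1)
    (Real.sqrt_le_one.2 h2)).smul hc
  rw [Real.sq_sqrt h1.le] at this
  convert this using 1
  field_simp
  ring

/-- Both representations follow the same backward trajectory. It meets the lines after time ‖η‖² and
after time ‖η'‖², so these agree. The common limit point determines the line and c, and local
injectivity at that pole, applied just before the limit, determines η. -/
theorem coneMap_injective {i : Fin m} {c c' η η' : ℂ} (hc : c ≠ 0) (hc' : c' ≠ 0)
    (h : c • petal κ e j r η = c' • petal κ e i r η') : j = i ∧ c = c' ∧ η = η' := by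
  have hpole : ∀ {c c' : ℂ}, c ≠ 0 → c • e r j = c' • e r i → j = i ∧ c = c' := by
    intro c c' hc h
    have h1 := congrArg (cross (e r i)) h
    rw [cross_smul, cross_smul, cross_apply_self, mul_zero] at h1
    have hji : j = i := by
      by_contra hne
      exact mul_ne_zero hc (he.cross_ne r i j (Ne.symm hne)) h1
    subst hji
    refine ⟨rfl, ?_⟩
    have hn : e r j ≠ 0 := by
      rw [← norm_ne_zero_iff, he.norm]; exact one_ne_zero
    exact smul_left_injective ℂ hn h
  have hiff := (coneMap_snd_mem (r := r) (i := j) (η := η) he hc).symm.trans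
    (h ▸ coneMap_snd_mem (i := i) (η := η') he hc')
  rcases eq_or_ne η 0 with rfl | hη
  · have hη' : η' = 0 := by simpa using hiff
    subst hη'
    rw [petal_zero he, petal_zero he] at h
    exact ⟨(hpole hc h).1, (hpole hc h).2, rfl⟩
  have hη' : η' ≠ 0 := hiff.1 hη
  have back : ∀ {s : ℝ}, 0 ≤ s → s < ‖η‖ ^ 2 → s < ‖η'‖ ^ 2 →
      c • petal κ e j r (√(1 - s / ‖η‖ ^ 2) • η) = c' • petal κ e i r (√(1 - s / ‖η'‖ ^ 2) • η') := by
    intro s hs h1 h2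
    have h3 := (hopfRel_petal_back (κ := κ) (r := r) he (j := j) hη hc hs h1).reverse
    have h4 := (hopfRel_petal_back (κ := κ) (r := r) he (j := i) hη' hc' hs h2).reverse
    rw [h] at h3
    exact h3.unique h4
  have hn : 0 < ‖η‖ := norm_pos_iff.2 hη
  have hn' : 0 < ‖η'‖ := norm_pos_iff.2 hη'
  have hcj (l : Fin m) : Continuous fun η => petal κ e l r η :=
    (differentiable_petal he r).continuous
  have hlim : c • petal κ e j r (√(1 - (min (‖η‖ ^ 2) (‖η'‖ ^ 2)) / ‖η‖ ^ 2) • η) =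
      c' • petal κ e i r (√(1 - (min (‖η‖ ^ 2) (‖η'‖ ^ 2)) / ‖η'‖ ^ 2) • η') := by
    set τ := min (‖η‖ ^ 2) (‖η'‖ ^ 2) with hτ
    have hτ0 : 0 < τ := lt_min (by positivity) (by positivity)
    have cont (l : Fin m) (c η : ℂ) : Filter.Tendsto
        (fun s : ℝ => c • petal κ e l r (√(1 - s / ‖η‖ ^ 2) • η)) (𝓝[<] τ)
        (𝓝 (c • petal κ e l r (√(1 - τ / ‖η‖ ^ 2) • η))) := by
      have : Continuous fun s : ℝ => c • petal κ e l r (√(1 - s / ‖η‖ ^ 2) • η) :=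
        ((hcj l).const_smul c).comp
          (show Continuous fun s : ℝ => √(1 - s / ‖η‖ ^ 2) • η by fun_prop)
      exact (this.tendsto τ).mono_left nhdsWithin_le_nhds
    refine tendsto_nhds_unique ((cont j c η).congr' ?_) (cont i c' η')
    filter_upwards [Ioo_mem_nhdsLT hτ0] with s hs
    exact back hs.1.le (hs.2.trans_le (min_le_left _ _)) (hs.2.trans_le (min_le_right _ _))
  have hpos : ∀ {a b : ℝ}, 0 < b → a < b → 0 < √(1 - a / b) := by
    intro a b hb hab
    rw [Real.sqrt_pos, sub_pos, div_lt_one hb]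
    exact hab
  have hmm := (coneMap_snd_mem (r := r) (i := j)
    (η := √(1 - (min (‖η‖ ^ 2) (‖η'‖ ^ 2)) / ‖η‖ ^ 2) • η) he hc).symm.trans
    (hlim ▸ coneMap_snd_mem (i := i)
      (η := √(1 - (min (‖η‖ ^ 2) (‖η'‖ ^ 2)) / ‖η'‖ ^ 2) • η') he hc')
  have heq : ‖η‖ ^ 2 = ‖η'‖ ^ 2 := by
    rcases lt_trichotomy (‖η‖ ^ 2) (‖η'‖ ^ 2) with hlt | heq | hlt
    · rw [min_eq_left hlt.le, div_self (by positivity), sub_self, Real.sqrt_zero, zero_smul] at hmm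
      exact absurd rfl (hmm.2 (smul_ne_zero (hpos (by positivity) hlt).ne' hη'))
    · exact heq
    · rw [min_eq_right hlt.le, div_self (a := ‖η'‖ ^ 2) (by positivity), sub_self, Real.sqrt_zero,
        zero_smul] at hmm
      exact absurd rfl (hmm.1 (smul_ne_zero (hpos (by positivity) hlt).ne' hη))
  rw [← heq, min_self, div_self (by positivity), sub_self, Real.sqrt_zero, zero_smul, zero_smul,
    petal_zero he, petal_zero he] at hlim
  obtain ⟨rfl, rfl⟩ := hpole hc hlim
  refine ⟨rfl, rfl, ?_⟩
  obtain ⟨g, hgl, -⟩ := exists_inverse_coneMap_pole (j := j) he r hc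
  have h1 (η : ℂ) : Filter.Tendsto (fun s : ℝ => (r, c, √(1 - s / ‖η‖ ^ 2) • η))
      (𝓝[<] (‖η‖ ^ 2)) (𝓝 (r, c, √(1 - ‖η‖ ^ 2 / ‖η‖ ^ 2) • η)) := by
    have : Continuous fun s : ℝ => (r, c, √(1 - s / ‖η‖ ^ 2) • η) := by fun_prop
    exact (this.tendsto _).mono_left nhdsWithin_le_nhds
  have h2 := h1 η
  have h2' := h1 η'
  rw [div_self (by positivity), sub_self, Real.sqrt_zero, zero_smul] at h2 h2'
  rw [← heq] at h2'
  obtain ⟨s, ⟨h3, h4⟩, hs⟩ := ((h2.eventually hgl).and (h2'.eventually hgl) |>.and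
    (show ∀ᶠ s in 𝓝[<] (‖η‖ ^ 2), s ∈ Set.Ioo 0 (‖η‖ ^ 2) from
      Ioo_mem_nhdsLT (by positivity))).exists
  have h5 := back hs.1.le hs.2 (heq ▸ hs.2)
  have h6 : coneMap κ e j (r, c, √(1 - s / ‖η‖ ^ 2) • η) =
      coneMap κ e j (r, c, √(1 - s / ‖η‖ ^ 2) • η') := Prod.ext rfl (by
        simpa only [coneMap, ← heq] using h5)
  rw [h6, h4] at h3
  have h7 := congrArg (fun p : ℝ × ℂ × ℂ => p.2.2) h3
  exact (smul_right_injective ℂ (hpos (by positivity) hs.2).ne' h7).symm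

theorem injOn_coneMap : Set.InjOn (coneMap κ e j) coneSource := by
  rintro ⟨r, c, η⟩ hp ⟨r', c', η'⟩ hp' h
  obtain rfl : r = r' := congrArg Prod.fst h
  obtain ⟨-, rfl, rfl⟩ := coneMap_injective he hp hp' (congrArg Prod.snd h)
  rfl

theorem coneInv_coneMap {p : ℝ × ℂ × ℂ} (hp : p ∈ coneSource) :
    coneInv κ e j (coneMap κ e j p) = p :=
  (injOn_coneMap he).leftInvOn_invFunOn hp

omit he in
theorem coneInv_mem {q : ℝ × C2} (hq : q ∈ attracted κ e j) : coneInv κ e j q ∈ coneSource :=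
  Function.invFunOn_mem hq

omit he in
theorem coneMap_coneInv {q : ℝ × C2} (hq : q ∈ attracted κ e j) :
    coneMap κ e j (coneInv κ e j q) = q :=
  Function.invFunOn_eq hq

theorem isOpen_attracted : IsOpen (attracted κ e j) := by
  rw [isOpen_iff_mem_nhds]
  rintro _ ⟨p, hp, rfl⟩
  obtain ⟨g, hg⟩ := exists_inverse_coneMap (j := j) he hp
  filter_upwards [hg] with q hq using ⟨g q, hq.1, hq.2.1⟩

theorem contDiffOn_coneInv : ContDiffOn ℝ ∞ (coneInv κ e j) (attracted κ e j) := by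
  rintro _ ⟨p, hp, rfl⟩
  obtain ⟨g, hg⟩ := exists_inverse_coneMap (j := j) he hp
  refine (hg.self_of_nhds.2.2.congr_of_eventuallyEq ?_).contDiffWithinAt
  filter_upwards [hg] with q hq
  conv_lhs => rw [← hq.2.1]
  exact coneInv_coneMap he hq.1

theorem disjoint_attracted {i : Fin m} (hij : i ≠ j) :
    Disjoint (attracted κ e i) (attracted κ e j) := by
  rw [Set.disjoint_left]
  rintro _ ⟨⟨r, c, η⟩, hp, rfl⟩ ⟨⟨r', c', η'⟩, hp', h⟩
  obtain rfl : r' = r := congrArg Prod.fst h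
  exact hij (coneMap_injective he hp' hp (congrArg Prod.snd h)).1.symm

omit he in
theorem norm_coneMap (he : IsCrossFamily κ e) (p : ℝ × ℂ × ℂ) :
    ‖(coneMap κ e j p).2‖ = ‖p.2.1‖ := by
  rw [coneMap, norm_smul, norm_petal he, mul_one]

end

end

/-! ### Symplectic flows and volume -/

noncomputable section

section symplectic

/-- The derivative of the flow solves the linearised equation. -/
theorem hasDerivAt_fderiv_flow {E : Type} [NormedAddCommGroup E] [NormedSpace ℝ E]
    [FiniteDimensional ℝ E] {f : E → E} {Ω : Set E} (hΩ : IsOpen Ω) (hf : ContDiffOn ℝ ∞ f Ω)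
    {t : ℝ} {x : E} (h : (t, x) ∈ flowDomain f Ω) (v : E) :
    HasDerivAt (fun s => fderiv ℝ (flow f Ω s) x v)
      (fderiv ℝ f (flow f Ω t x) (fderiv ℝ (flow f Ω t) x v)) t := by
  have h1 := hasDerivAt_partial_fderiv (contDiffAt_flow hΩ hf h) v
  refine h1.congr_deriv ?_
  have h2 : (fun y => deriv (fun s => flow f Ω s y) t) =ᶠ[𝓝 x] fun y => f (flow f Ω t y) := by
    have h3 : ∀ᶠ y in 𝓝 x, (t, y) ∈ flowDomain f Ω :=
      (Continuous.prodMk_right t).continuousAt.eventually_mem ((isOpen_flowDomain hΩ hf).mem_nhds h)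
    filter_upwards [h3] with y hy using (hasDerivAt_flow hΩ hf hy).deriv
  rw [h2.fderiv_eq]
  have h4 : ContDiffAt ℝ ∞ (fun y => flow f Ω t y) x :=
    (contDiffAt_flow hΩ hf h).comp x (contDiffAt_const.prodMk contDiffAt_id)
  have h5 : ContDiffAt ℝ ∞ f (flow f Ω t x) :=
    hf.contDiffAt (hΩ.mem_nhds (flowRel_flow h).mem_right)
  have := (h5.differentiableAt (by simp)).hasFDerivAt.comp x
    (h4.differentiableAt (by simp)).hasFDerivAt
  exact congrArg (fun L => L v) this.fderiv

theorem mem_flowDomain_of_mem_uIcc {E : Type} [NormedAddCommGroup E] [NormedSpace ℝ E] {f : E → E}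
    {Ω : Set E} {t s : ℝ} {x : E} (h : (t, x) ∈ flowDomain f Ω) (hs : s ∈ Set.uIcc 0 t) :
    (s, x) ∈ flowDomain f Ω := by
  obtain ⟨y, hy⟩ := h
  obtain ⟨w, hw, -⟩ := hy.split hs
  exact ⟨w, hw⟩

theorem eq_of_hasDerivAt_zero {F : Type*} [NormedAddCommGroup F] [NormedSpace ℝ F] {g : ℝ → F}
    {t : ℝ} (h : ∀ s ∈ Set.uIcc 0 t, HasDerivAt g 0 s) : g t = g 0 := by
  have := (convex_uIcc 0 t).norm_image_sub_le_of_norm_hasDerivWithin_le (f := g) (f' := fun _ => 0)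
    (C := 0) (fun s hs => (h s hs).hasDerivWithinAt) (by simp) Set.left_mem_uIcc Set.right_mem_uIcc
  rw [zero_mul] at this
  exact sub_eq_zero.1 (norm_le_zero_iff.1 this)

theorem hasFDerivAt_flow_zero {E : Type} [NormedAddCommGroup E] [NormedSpace ℝ E]
    [FiniteDimensional ℝ E] {f : E → E} {Ω : Set E} (hΩ : IsOpen Ω) (hf : ContDiffOn ℝ ∞ f Ω)
    {x : E} (hx : x ∈ Ω) : HasFDerivAt (flow f Ω 0) (ContinuousLinearMap.id ℝ E) x := by
  refine (hasFDerivAt_id x).congr_of_eventuallyEq ?_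
  filter_upwards [hΩ.mem_nhds hx] with y hy
  exact (FlowRel.refl hy).flow_eq hΩ hf

/-- The flow of a vector field on the total space which has a constant first component and is
infinitesimally symplectic along the fibres maps fibres to fibres symplectically. -/
theorem fderiv_flow_symplectic {f : ℝ × C2 → ℝ × C2} {Ω : Set (ℝ × C2)} (hΩ : IsOpen Ω)
    (hf : ContDiffOn ℝ ∞ f Ω) {c : ℝ} (hc : ∀ q ∈ Ω, (f q).1 = c)
    (hs : ∀ q ∈ Ω, ∀ v w : C2, (inner ℂ (fderiv ℝ f q (0, v)).2 w).im +
      (inner ℂ v (fderiv ℝ f q (0, w)).2).im = 0) {t : ℝ} {q : ℝ × C2}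
    (h : (t, q) ∈ flowDomain f Ω) (v w : C2) :
    (fderiv ℝ (flow f Ω t) q (0, v)).1 = 0 ∧
    (inner ℂ (fderiv ℝ (flow f Ω t) q (0, v)).2 (fderiv ℝ (flow f Ω t) q (0, w)).2).im =
      (inner ℂ v w).im := by
  have hq : q ∈ Ω := (flowRel_flow h).mem_left
  have hmem : ∀ s ∈ Set.uIcc 0 t, (s, q) ∈ flowDomain f Ω := fun s hs =>
    mem_flowDomain_of_mem_uIcc h hs
  have hder (v : C2) : ∀ s ∈ Set.uIcc 0 t, HasDerivAt (fun s => fderiv ℝ (flow f Ω s) q (0, v))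
      (fderiv ℝ f (flow f Ω s q) (fderiv ℝ (flow f Ω s) q (0, v))) s := fun s hs =>
    hasDerivAt_fderiv_flow hΩ hf (hmem s hs) _
  have hfst : ∀ q ∈ Ω, ∀ v, (fderiv ℝ f q v).1 = 0 := by
    intro q hq v
    have h1 := ((hf.contDiffAt (hΩ.mem_nhds hq)).differentiableAt (by simp)).hasFDerivAt
    have h2 := (hasFDerivAt_fst (𝕜 := ℝ) (p := f q)).comp q h1
    have h3 : HasFDerivAt (Prod.fst ∘ f) (0 : ℝ × C2 →L[ℝ] ℝ) q := by
      refine (hasFDerivAt_const c q).congr_of_eventuallyEq ?_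
      filter_upwards [hΩ.mem_nhds hq] with y hy using hc y hy
    exact congrArg (fun L => L v) (h2.unique h3)
  have hzero : fderiv ℝ (flow f Ω 0) q = ContinuousLinearMap.id ℝ _ :=
    (hasFDerivAt_flow_zero hΩ hf hq).fderiv
  have h1 (v : C2) : ∀ s ∈ Set.uIcc 0 t, (fderiv ℝ (flow f Ω s) q (0, v)).1 = 0 := by
    intro s hs
    have := eq_of_hasDerivAt_zero (g := fun s => (fderiv ℝ (flow f Ω s) q (0, v)).1) (t := s)
      fun s' hs' => by
        have hs'' := Set.uIcc_subset_uIcc_left hs hs'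
        have h2 := (ContinuousLinearMap.fst ℝ ℝ C2).hasFDerivAt.comp_hasDerivAt s' (hder v s' hs'')
        refine h2.congr_deriv ?_
        exact hfst _ (flowRel_flow (hmem s' hs'')).mem_right _
    rw [this, hzero]
    rfl
  refine ⟨h1 v t Set.right_mem_uIcc, ?_⟩
  have := eq_of_hasDerivAt_zero (g := fun s => (inner ℂ (fderiv ℝ (flow f Ω s) q (0, v)).2
    (fderiv ℝ (flow f Ω s) q (0, w)).2).im) (t := t) fun s hs' => by
      have h2 (v : C2) := (ContinuousLinearMap.snd ℝ ℝ C2).hasFDerivAt.comp_hasDerivAt s (hder v s hs')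
      have h3 := Complex.imCLM.hasFDerivAt.comp_hasDerivAt s ((h2 v).inner ℂ (h2 w))
      refine h3.congr_deriv ?_
      have h4 (v : C2) : fderiv ℝ (flow f Ω s) q (0, v) =
        (0, (fderiv ℝ (flow f Ω s) q (0, v)).2) := Prod.ext (h1 v s hs') rfl
      simp only [Complex.imCLM_apply, Complex.add_im, ContinuousLinearMap.coe_snd',
        Function.comp]
      have h5 := hs _ (flowRel_flow (hmem s hs')).mem_right (fderiv ℝ (flow f Ω s) q (0, v)).2
        (fderiv ℝ (flow f Ω s) q (0, w)).2
      rw [← h4, ← h4] at h5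
      linarith
  rw [this, hzero]
  rfl

/-- A real linear map of `ℂ²` preserving the imaginary part of the inner product has determinant
of absolute value one. -/
theorem abs_det_eq_one_of_symplectic (A : C2 →L[ℝ] C2)
    (h : ∀ v w, (inner ℂ (A v) (A w)).im = (inner ℂ v w).im) : |A.det| = 1 := by
  let b₂ : LinearMap.BilinForm ℝ C2 := LinearMap.mk₂ ℝ (fun v w : C2 => (inner ℂ v w).im)
    (fun _ _ _ => by rw [inner_add_left, Complex.add_im])
    (fun c v w => by
      rw [real_smul_C2, inner_smul_left, Complex.conj_ofReal, Complex.im_ofReal_mul, smul_eq_mul])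
    (fun _ _ _ => by rw [inner_add_right, Complex.add_im])
    (fun c v w => by rw [real_smul_C2, inner_smul_right, Complex.im_ofReal_mul, smul_eq_mul])
  have hb : ∀ v w, b₂ v w = (inner ℂ v w).im := fun v w => rfl
  let b := Module.finBasis ℝ C2
  have hcomp : b₂.comp A A = b₂ := by
    ext v w; exact h v w
  -- If B is the matrix of the form, Aᵀ B A = B with B invertible, so det A has square one.
  have hmat := congrArg Matrix.det (LinearMap.BilinForm.toMatrix_comp b b b₂ (A : C2 →ₗ[ℝ] C2) A)
  rw [hcomp, Matrix.det_mul, Matrix.det_mul, Matrix.det_transpose, LinearMap.det_toMatrix] at hmat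
  have hnd : (LinearMap.BilinForm.toMatrix b b₂).det ≠ 0 := by
    rw [← LinearMap.BilinForm.nondegenerate_iff_det_ne_zero b]
    have key : ∀ v : C2, inner ℂ v (Complex.I • v) = Complex.I * ((‖v‖ ^ 2 : ℝ) : ℂ) := fun v => by
      rw [inner_smul_right, inner_self_C2]
    have h0 : ∀ v : C2, ‖v‖ ^ 2 = 0 → v = 0 := fun v hv => by simpa using hv
    refine ⟨fun v hv => h0 v ?_, fun v hv => h0 v ?_⟩
    · have := hv (Complex.I • v)
      rwa [hb, key, Complex.im_mul_ofReal, Complex.I_im, one_mul] at this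
    · have := hv (Complex.I • v)
      rw [hb, ← inner_conj_symm, key, Complex.conj_im, Complex.im_mul_ofReal, Complex.I_im, one_mul] at this
      linarith
  have : A.det ^ 2 = 1 := by
    have h2 : (LinearMap.BilinForm.toMatrix b b₂).det * (A.det ^ 2 - 1) = 0 := by
      change _ = A.det * _ * A.det at hmat
      linear_combination -hmat
    have := (mul_eq_zero.1 h2).resolve_left hnd
    linarith
  rw [← sq_abs] at this
  exact (pow_eq_one_iff_of_nonneg (abs_nonneg _) two_ne_zero).1 this

end symplectic

end

/-! ### Backward trajectories and the gradient of the potential -/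

noncomputable section

variable {m : ℕ} {κ : Fin m → ℝ}

section gradient

variable {e : Fin m → C2}

theorem eq_smul_of_cross_eq_zero {v z : C2} (hv : ‖v‖ = 1) (h : cross v z = 0) :
    z = (inner ℂ v z : ℂ) • v := by
  have h1 : star (v 0) * v 0 + star (v 1) * v 1 = 1 := by
    rw [← norm_sq_complex, hv]; simp
  rw [cross] at h
  rw [inner_C2]
  simp only [RCLike.star_def] at h1 ⊢
  ext i
  fin_cases i
  · simp
    linear_combination (-z 0) * h1 - ((starRingEnd ℂ) (v 1)) * h
  · simp
    linear_combination (-z 1) * h1 + ((starRingEnd ℂ) (v 0)) * h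

/-- The squared norm along a backward trajectory. -/
theorem hasDerivWithinAt_norm_sq_backward {γ : ℝ → C2} {a s : ℝ} {S : Set ℝ}
    (hmem : γ s ∈ regularSet e)
    (hγ : HasDerivWithinAt γ (-((1 / 2 : ℝ) • (gradLog κ e (γ s) - a • γ s))) S s) :
    HasDerivWithinAt (fun s => ‖γ s‖ ^ 2) (a * ‖γ s‖ ^ 2 - ∑ i, κ i) S s := by
  have h1 : inner ℝ (γ s) (gradLog κ e (γ s)) = ∑ i, κ i := by
    have : inner ℝ (γ s) (gradLog κ e (γ s)) = (inner ℂ (γ s) (gradLog κ e (γ s)) : ℂ).re :=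
      real_inner_eq_re_inner ℂ _ _
    rw [this, inner_gradLog_self hmem, Complex.ofReal_re]
  refine hγ.norm_sq.congr_deriv ?_
  rw [inner_neg_right, real_inner_smul_right, inner_sub_right, real_inner_smul_right,
    real_inner_self_eq_norm_sq, h1]
  ring

/-- Up to normalisation and a time change, backward trajectories follow `hopfField`. -/
theorem hopfRel_of_backward {γ : ℝ → C2} {a t : ℝ} (ht : 0 ≤ t) (hK : 0 < ∑ i, κ i)
    (hγ : ∀ s ∈ Set.Icc 0 t, γ s ≠ 0 ∧ γ s ∈ regularSet e ∧
      HasDerivWithinAt γ (-((1 / 2 : ℝ) • (gradLog κ e (γ s) - a • γ s))) (Set.Icc 0 t) s) :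
    HopfRel κ e (-((a * t - Real.log (‖γ t‖ ^ 2 / ‖γ 0‖ ^ 2)) / ∑ i, κ i)) (γ 0)
      ((‖γ 0‖ / ‖γ t‖) • γ t) := by
  set K := ∑ i, κ i with hKdef
  have hpos : ∀ s ∈ Set.Icc 0 t, 0 < ‖γ s‖ := fun s hs => norm_pos_iff.2 (hγ s hs).1
  have h0 := hpos 0 ⟨le_rfl, ht⟩
  have hN : ∀ s ∈ Set.Icc 0 t, HasDerivWithinAt (fun s => ‖γ s‖ ^ 2) (a * ‖γ s‖ ^ 2 - K)
      (Set.Icc 0 t) s := fun s hs => hasDerivWithinAt_norm_sq_backward (hγ s hs).2.1 (hγ s hs).2.2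
  have hcont : ContinuousOn γ (Set.Icc 0 t) := fun s hs => (hγ s hs).2.2.continuousWithinAt
  -- The rescaled curve has constant norm. Since (‖γ‖²)' = a‖γ‖² - K, the chosen τ has derivative
  -- ‖γ‖⁻². The value a = 1 gives the Liouville field and a = 0 the half gradient.
  have main := FlowRel.of_reparam (f := fun z => -hopfField κ e z) (Ω := regularSet e)
    (γ := fun s => (‖γ 0‖ / ‖γ s‖) • γ s)
    (τ := fun s => (a * s - Real.log (‖γ s‖ ^ 2 / ‖γ 0‖ ^ 2)) / K) (τ' := fun s => (‖γ s‖ ^ 2)⁻¹)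
    isOpen_regularSet contDiffOn_hopfField.neg ht
    (ContinuousOn.inv₀ (hcont.norm.pow 2) fun s hs => (pow_pos (hpos s hs) 2).ne')
    (fun s hs => by positivity) (fun s hs => ?_) (fun s hs => ⟨?_, ?_⟩)
  · have h1 : Real.log (‖γ 0‖ ^ 2 / ‖γ 0‖ ^ 2) = 0 := by
      rw [div_self (by positivity), Real.log_one]
    simp only [h1, mul_zero, sub_zero, zero_div, div_self h0.ne', one_smul] at main
    apply FlowRel.of_neg_field
    rwa [neg_neg]
  · have hs0 := hpos s hs
    have h1 := ((hN s hs).div_const (‖γ 0‖ ^ 2)).log (by positivity)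
    have h2 := (((hasDerivWithinAt_id s (Set.Icc 0 t)).const_mul a).sub h1).div_const K
    refine h2.congr_deriv ?_
    field_simp
    ring
  · rw [real_smul_C2]
    refine regularSet_smul (hγ s hs).2.1 ?_
    have := hpos s hs
    exact_mod_cast (div_pos h0 this).ne'
  · have hs0 := hpos s hs
    have h1 := (hN s hs).sqrt (by positivity)
    simp only [Real.sqrt_sq (norm_nonneg _)] at h1
    have h2 : HasDerivWithinAt (fun s => (‖γ 0‖ / ‖γ s‖) • γ s) ((‖γ 0‖ / ‖γ s‖) •
        (-((1 / 2 : ℝ) • (gradLog κ e (γ s) - a • γ s))) + ((0 * ‖γ s‖ - ‖γ 0‖ *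
        ((a * ‖γ s‖ ^ 2 - K) / (2 * ‖γ s‖))) / ‖γ s‖ ^ 2) • γ s) (Set.Icc 0 t) s :=
      ((hasDerivWithinAt_const s (Set.Icc 0 t) ‖γ 0‖).div h1 hs0.ne').smul (hγ s hs).2.2
    refine h2.congr_deriv ?_
    have hne : ((‖γ 0‖ / ‖γ s‖ : ℝ) : ℂ) ≠ 0 := by exact_mod_cast (div_pos h0 hs0).ne'
    rw [real_smul_C2 (‖γ 0‖ / ‖γ s‖) (γ s), hopfField_smul _ hne, ← real_smul_C2, hopfField]
    match_scalars
    · field_simp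
    · rw [← hKdef]
      field_simp
      ring

end gradient

variable {e : ℝ → Fin m → C2} {j : Fin m} {r : ℝ}

/-- Half the gradient field of the potential, on the total space. -/
def gradTotal (κ : Fin m → ℝ) (e : ℝ → Fin m → C2) (q : ℝ × C2) : ℝ × C2 :=
  (0, (1 / 2 : ℝ) • gradLog κ (e q.1) q.2)

theorem contDiffOn_gradTotal (he : ∀ i, ContDiff ℝ ∞ fun r => e r i) :
    ContDiffOn ℝ ∞ (gradTotal κ e) (regularTotal e) :=
  contDiffOn_const.prodMk ((contDiffOn_gradLog_total he).const_smul (1 / 2 : ℝ))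

/-- The potential is locally the real part of a holomorphic function. Hence the derivative of the
field in direction v, paired with w, is a complex bilinear form symmetric in v and w (`key`), and
the two imaginary parts cancel. -/
theorem gradTotal_symplectic (he : ∀ i, ContDiff ℝ ∞ fun r => e r i) {q : ℝ × C2}
    (hq : q ∈ regularTotal e) (v w : C2) :
    (inner ℂ (fderiv ℝ (gradTotal κ e) q (0, v)).2 w).im +
      (inner ℂ v (fderiv ℝ (gradTotal κ e) q (0, w)).2).im = 0 := by
  have hd : DifferentiableAt ℝ (gradTotal κ e) q :=
    ((contDiffOn_gradTotal he).contDiffAt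
      ((isOpen_regularTotal he).mem_nhds hq)).differentiableAt (by simp)
  have key (v w : C2) : inner ℂ (fderiv ℝ (gradTotal κ e) q (0, v)).2 w =
      -(1 / 2 : ℂ) * ∑ i, (κ i : ℂ) *
        (cross (e q.1 i) v * cross (e q.1 i) w / cross (e q.1 i) q.2 ^ 2) := by
    have h1 : HasDerivAt (fun t : ℝ => q + t • ((0 : ℝ), v)) (0, v) 0 := by
      simpa using ((hasDerivAt_id (0 : ℝ)).smul_const ((0 : ℝ), v)).const_add q
    have h2 := hd.hasFDerivAt
    rw [show q = q + (0 : ℝ) • ((0 : ℝ), v) by simp] at h2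
    have h3 := (ContinuousLinearMap.snd ℝ ℝ C2).hasFDerivAt.comp_hasDerivAt (0 : ℝ)
      (h2.comp_hasDerivAt (0 : ℝ) h1)
    have h4 := h3.inner ℂ (hasDerivAt_const (0 : ℝ) w)
    have h5 : HasDerivAt (fun t : ℝ => (1 / 2 : ℂ) * ∑ i, (κ i : ℂ) *
        (cross (e q.1 i) w / (cross (e q.1 i) q.2 + t * cross (e q.1 i) v)))
        (-(1 / 2 : ℂ) * ∑ i, (κ i : ℂ) *
        (cross (e q.1 i) v * cross (e q.1 i) w / cross (e q.1 i) q.2 ^ 2)) 0 := by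
      have h6 : ∀ i, HasDerivAt (fun t : ℝ => (κ i : ℂ) *
          (cross (e q.1 i) w / (cross (e q.1 i) q.2 + t * cross (e q.1 i) v)))
          (-((κ i : ℂ) * (cross (e q.1 i) v * cross (e q.1 i) w / cross (e q.1 i) q.2 ^ 2))) 0 := by
        intro i
        have h7 : HasDerivAt (fun t : ℝ => cross (e q.1 i) q.2 + t * cross (e q.1 i) v)
            (cross (e q.1 i) v) 0 := by
          simpa using ((hasDerivAt_id (0 : ℝ)).ofReal_comp.mul_const
            (cross (e q.1 i) v)).const_add (cross (e q.1 i) q.2)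
        have h8 := ((hasDerivAt_const (0 : ℝ) (cross (e q.1 i) w)).div h7
          (by simpa using hq i)).const_mul (κ i : ℂ)
        refine h8.congr_deriv ?_
        simp
        ring
      have h9 := (HasDerivAt.fun_sum (u := Finset.univ) fun i _ => h6 i).const_mul (1 / 2 : ℂ)
      refine h9.congr_deriv ?_
      rw [Finset.sum_neg_distrib]
      ring
    have h10 := h4.unique (h5.congr_of_eventuallyEq (Filter.Eventually.of_forall fun t => ?_))
    · rw [← h10]
      simp
    · simp only [Function.comp, ContinuousLinearMap.coe_snd', gradTotal, Prod.fst_add, Prod.smul_fst,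
        smul_zero, add_zero, Prod.snd_add, Prod.smul_snd]
      rw [real_smul_C2, inner_smul_left, inner_gradLog]
      simp only [cross_add, real_smul_C2, cross_smul, Complex.conj_ofReal]
      push_cast
      rfl
  rw [← inner_conj_symm v, key, key, Complex.conj_im]
  simp only [mul_comm (cross _ v)]
  ring

/-! ### Density of the attracted points -/

section density

variable (he : IsCrossFamily κ e)
include he

theorem HopfRel.attracted_of_nonneg {s : ℝ} {x y : C2} (h : HopfRel κ (e r) s x y) (hs : 0 ≤ s)
    (hx : (r, x) ∈ attracted κ e j) : (r, y) ∈ attracted κ e j := by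
  obtain ⟨⟨r', c, η⟩, hc, hp⟩ := hx
  obtain rfl : r' = r := congrArg Prod.fst hp
  obtain rfl : c • petal κ e j r' η = x := congrArg Prod.snd hp
  have hη : η ≠ 0 := (coneMap_snd_mem he hc).1 h.mem_left
  have h1 := (petal_stretch (κ := κ) (j := j) he r' hη hs).smul hc
  exact ⟨(r', c, (√(‖η‖ ^ 2 + s) * ‖η‖⁻¹) • η), hc, Prod.ext rfl (h1.unique h)⟩

omit he in
theorem attracted_smul {x : C2} (hx : (r, x) ∈ attracted κ e j) {c : ℂ} (hc : c ≠ 0) :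
    (r, c • x) ∈ attracted κ e j := by
  obtain ⟨⟨r', d, η⟩, hd, hp⟩ := hx
  obtain rfl : r' = r := congrArg Prod.fst hp
  obtain rfl : d • petal κ e j r' η = x := congrArg Prod.snd hp
  exact ⟨(r', c * d, η), mul_ne_zero hc hd, by simp [coneMap, mul_smul]⟩

theorem attracted_of_cross_eq_zero {z : C2} (hz : z ≠ 0) (h : cross (e r j) z = 0) :
    (r, z) ∈ attracted κ e j := by
  have h1 := eq_smul_of_cross_eq_zero (he.norm r j) h
  refine ⟨(r, inner ℂ (e r j) z, 0), ?_, ?_⟩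
  · intro h0
    simp only at h0
    rw [h0, zero_smul] at h1
    exact hz h1
  · simp only [coneMap, petal_zero he]
    rw [← h1]

/-- The nonzero points which are not attracted by a line under the backward flow. -/
def stray (κ : Fin m → ℝ) (e : ℝ → Fin m → C2) (r : ℝ) : Set C2 :=
  {z | z ≠ 0 ∧ ∀ j, (r, z) ∉ attracted κ e j}

theorem stray_subset : stray κ e r ⊆ regularSet (e r) := fun _ hz j h =>
  hz.2 j (attracted_of_cross_eq_zero he hz.1 h)

omit he in
theorem stray_smul {z : C2} (hz : z ∈ stray κ e r) {c : ℂ} (hc : c ≠ 0) : c • z ∈ stray κ e r := by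
  refine ⟨smul_ne_zero hc hz.1, fun j hj => hz.2 j ?_⟩
  have := attracted_smul hj (inv_ne_zero hc)
  rwa [smul_smul, inv_mul_cancel₀ hc, one_smul] at this

theorem isClosed_stray_union : IsClosed {z : C2 | ∀ j, (r, z) ∉ attracted κ e j} := by
  simp only [Set.ofPred_forall]
  refine isClosed_iInter fun j => ?_
  exact ((isOpen_attracted he).preimage (Continuous.prodMk_right r)).isClosed_compl

theorem isCompact_stray {a b : ℝ} (ha : 0 < a) :
    IsCompact {z : C2 | z ∈ stray κ e r ∧ a ≤ ‖z‖ ^ 2 ∧ ‖z‖ ^ 2 ≤ b} := by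
  have : {z : C2 | z ∈ stray κ e r ∧ a ≤ ‖z‖ ^ 2 ∧ ‖z‖ ^ 2 ≤ b} =
      {z : C2 | ∀ j, (r, z) ∉ attracted κ e j} ∩ {z : C2 | a ≤ ‖z‖ ^ 2 ∧ ‖z‖ ^ 2 ≤ b} := by
    ext z
    refine ⟨fun h => ⟨h.1.2, h.2⟩, fun h => ⟨⟨?_, h.1⟩, h.2⟩⟩
    rintro rfl
    have := h.2.1
    rw [norm_zero] at this
    norm_num at this
    linarith
  rw [this]
  refine Metric.isCompact_of_isClosed_isBounded ((isClosed_stray_union he).inter ?_) ?_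
  · exact isClosed_Icc.preimage (show Continuous fun z : C2 => ‖z‖ ^ 2 by fun_prop)
  · refine (Metric.isBounded_closedBall (x := (0 : C2)) (r := √b)).subset fun z hz => ?_
    rw [mem_closedBall_zero_iff]
    exact Real.le_sqrt_of_sq_le hz.2.2

/-- A backward trajectory of half the gradient field from a stray point. -/
theorem backward_gradTotal {z : C2} (hz : z ∈ stray κ e r) {t : ℝ} (ht : 0 ≤ t)
    (htz : t * ∑ i, κ i < ‖z‖ ^ 2) {q : ℝ × C2}
    (h : FlowRel (fun q => -gradTotal κ e q) (regularTotal e) t (r, z) q) :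
    q.1 = r ∧ q.2 ∈ stray κ e r ∧ ‖q.2‖ ^ 2 = ‖z‖ ^ 2 - t * ∑ i, κ i := by
  obtain ⟨γ, h0, h1, hγ⟩ := h
  rw [Set.uIcc_of_le ht] at hγ
  have hfst : ∀ s ∈ Set.Icc 0 t, (γ s).1 = r := by
    intro s hs
    have := eq_of_hasDerivAt_zero (g := fun s => (γ s).1) (t := s) fun s' hs' => by
      rw [Set.uIcc_of_le hs.1] at hs'
      have h2 := (ContinuousLinearMap.fst ℝ ℝ C2).hasFDerivAt.comp_hasDerivAt s'
        (hγ s' ⟨hs'.1, hs'.2.trans hs.2⟩).2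
      refine h2.congr_deriv ?_
      simp [gradTotal]
    rw [this, h0]
  have hsnd : ∀ s ∈ Set.Icc 0 t, (γ s).2 ∈ regularSet (e r) ∧ HasDerivWithinAt (fun s => (γ s).2)
      (-((1 / 2 : ℝ) • (gradLog κ (e r) (γ s).2 - (0 : ℝ) • (γ s).2))) (Set.Icc 0 t) s := by
    intro s hs
    have h2 := (ContinuousLinearMap.snd ℝ ℝ C2).hasFDerivAt.comp_hasDerivAt s (hγ s hs).2
    rw [← hfst s hs, zero_smul, sub_zero]
    exact ⟨(hγ s hs).1, h2.hasDerivWithinAt⟩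
  have hnorm : ∀ s ∈ Set.Icc 0 t, ‖(γ s).2‖ ^ 2 = ‖z‖ ^ 2 - s * ∑ i, κ i := by
    intro s hs
    have h3 : ∀ s ∈ Set.Icc 0 t, HasDerivWithinAt (fun s => ‖(γ s).2‖ ^ 2 + s * ∑ i, κ i) 0
        (Set.Icc 0 t) s := by
      intro s hs
      have h4 := hasDerivWithinAt_norm_sq_backward (hsnd s hs).1 (hsnd s hs).2
      have h5 := h4.add ((hasDerivWithinAt_id s _).mul_const (∑ i, κ i))
      refine h5.congr_deriv ?_
      ring
    have := (convex_Icc 0 t).norm_image_sub_le_of_norm_hasDerivWithin_le (C := 0) h3 (by simp)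
      (Set.left_mem_Icc.2 ht) hs
    simp only [zero_mul, norm_le_zero_iff, h0, add_zero] at this
    linarith [sub_eq_zero.1 this]
  have hq : q = γ t := h1.symm
  have ht' := Set.right_mem_Icc.2 ht
  have hne : ∀ s ∈ Set.Icc 0 t, (γ s).2 ≠ 0 := by
    intro s hs h6
    have h7 := hnorm s hs
    rw [h6, norm_zero] at h7
    have : s * ∑ i, κ i ≤ t * ∑ i, κ i :=
      mul_le_mul_of_nonneg_right hs.2 (Finset.sum_nonneg fun i _ => (he.pos i).le)
    norm_num at h7
    linarith
  subst hq
  refine ⟨hfst t ht', ⟨hne t ht', fun j hj => ?_⟩, hnorm t ht'⟩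
  have hKpos : 0 < ∑ i, κ i := Finset.sum_pos (fun i _ => he.pos i) ⟨j, Finset.mem_univ j⟩
  -- If the end point were attracted, running `hopfField` forward from its normalisation would make
  -- z attracted as well.
  have h8 := hopfRel_of_backward ht hKpos (e := e r) fun s hs =>
    ⟨hne s hs, (hsnd s hs).1, (hsnd s hs).2⟩
  have h9 := h8.reverse
  rw [neg_neg, h0] at h9
  have hz0 : 0 < ‖z‖ := norm_pos_iff.2 hz.1
  have hγ0 : 0 < ‖(γ t).2‖ := norm_pos_iff.2 (hne t ht')
  refine hz.2 j (HopfRel.attracted_of_nonneg he h9 ?_ ?_)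
  · refine div_nonneg ?_ hKpos.le
    rw [zero_mul, zero_sub, neg_nonneg]
    refine Real.log_nonpos (by positivity) ?_
    rw [div_le_one (by positivity), hnorm t ht']
    have := mul_nonneg ht hKpos.le
    linarith
  · rw [real_smul_C2]
    refine attracted_smul hj ?_
    exact_mod_cast (div_pos hz0 hγ0).ne'

-- The stray points form a cone in real dimension four, so those with ‖z‖² < t K have measure t² μ₁,
-- where μ₁ is the measure for t = 1. The half gradient flow run backwards for time one preserves
-- volume and stray points and lowers ‖z‖² by K. It embeds the shell from 2K to 3K into the shell
-- from K to 2K, so (9 - 4) μ₁ ≤ (4 - 1) μ₁, and μ₁ = 0.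
open MeasureTheory Pointwise in
theorem dense_attracted [NeZero m] (r : ℝ) : Dense {z : C2 | ∃ j, (r, z) ∈ attracted κ e j} := by
  let K := ∑ i, κ i
  have hK : 0 < K := Finset.sum_pos (fun i _ => he.pos i) ⟨0, Finset.mem_univ 0⟩
  borelize C2
  let μ : Measure C2 := Measure.addHaar
  have hNmeas : MeasurableSet (stray κ e r) := by
    have : stray κ e r = {0}ᶜ ∩ {z : C2 | ∀ j, (r, z) ∉ attracted κ e j} := rfl
    rw [this]
    exact (measurableSet_singleton 0).compl.inter (isClosed_stray_union he).measurableSet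
  let V : ℝ → Set C2 := fun a => stray κ e r ∩ {z | ‖z‖ ^ 2 < a}
  let M : ℝ → ℝ → Set C2 := fun a b => stray κ e r ∩ {z | a ≤ ‖z‖ ^ 2 ∧ ‖z‖ ^ 2 < b}
  have hMmeas (a b : ℝ) : MeasurableSet (M a b) := by
    exact hNmeas.inter ((measurable_norm.pow_const 2) measurableSet_Ico)
  have hVM {a b : ℝ} (hab : a ≤ b) : μ (V b) = μ (V a) + μ (M a b) := by
    rw [← measure_union _ (hMmeas a b)]
    · congr 1
      ext z
      simp only [V, M, Set.mem_inter_iff, Set.mem_ofPred_eq, Set.mem_union]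
      constructor
      · rintro ⟨h1, h2⟩
        rcases lt_or_ge (‖z‖ ^ 2) a with h | h
        exacts [Or.inl ⟨h1, h⟩, Or.inr ⟨h1, h, h2⟩]
      · rintro (⟨h1, h2⟩ | ⟨h1, h2, h3⟩)
        exacts [⟨h1, h2.trans_le hab⟩, ⟨h1, h3⟩]
    · rw [Set.disjoint_left]
      rintro z ⟨-, h1⟩ ⟨-, h2, -⟩
      exact absurd h1 (not_lt.2 h2)
  have hfin : Module.finrank ℝ C2 = 4 := by
    have : Module.finrank ℝ C2 = Module.finrank ℝ ℂ * Module.finrank ℂ C2 :=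
      (Module.finrank_mul_finrank ℝ ℂ C2).symm
    rw [this]; simp
  have hscale {k : ℝ} (hk : 0 < k) : μ (V (k ^ 2 * K)) = ENNReal.ofReal (k ^ 4) * μ (V K) := by
    have h1 : V (k ^ 2 * K) = k • V K := by
      ext z
      rw [Set.mem_smul_set_iff_inv_smul_mem₀ hk.ne']
      simp only [V, Set.mem_inter_iff, Set.mem_ofPred_eq, norm_smul, norm_inv,
        Real.norm_of_nonneg hk.le, mul_pow, inv_pow]
      refine and_congr ?_ ?_
      · have hk' : ((k : ℝ) : ℂ) ≠ 0 := by exact_mod_cast hk.ne'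
        rw [real_smul_C2]
        push_cast
        refine ⟨fun h => stray_smul h (inv_ne_zero hk'), fun h => ?_⟩
        have := stray_smul h hk'
        rwa [smul_smul, mul_inv_cancel₀ hk', one_smul] at this
      · rw [inv_mul_lt_iff₀ (by positivity)]
    rw [h1, Measure.addHaar_smul, hfin, abs_of_nonneg (by positivity)]
  have hVfin (a : ℝ) : μ (V a) ≠ ⊤ := by
    refine ((measure_mono (t := Metric.ball 0 (√a)) ?_).trans_lt measure_ball_lt_top).ne
    rintro z ⟨-, hz⟩
    rw [mem_ball_zero_iff]
    exact Real.lt_sqrt_of_sq_lt hz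
  have hle : μ (M (2 * K) (3 * K)) ≤ μ (M K (2 * K)) := by
    let F := gradTotal κ e
    have hΩ := isOpen_regularTotal he.smooth
    have hF : ContDiffOn ℝ ∞ F (regularTotal e) := contDiffOn_gradTotal he.smooth
    have hdom : ∀ z ∈ M (2 * K) (3 * K), ((-1 : ℝ), (r, z)) ∈ flowDomain F (regularTotal e) := by
      rintro z ⟨hz, hz1, hz2⟩
      have hC := (isCompact_singleton (x := r)).prod (isCompact_stray (r := r) he (b := 3 * K) hK)
      -- Starting from ‖z‖² ≥ 2K, a backward time of at most one leaves ‖z‖² ≥ K. The curve stays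
      -- among the stray points of a closed shell, a compact subset of the regular set.
      obtain ⟨y, hy⟩ := exists_flowRel_of_compact hΩ hF.neg hC (by
        rintro ⟨r', z⟩ ⟨h1, h2⟩
        obtain rfl : r' = r := h1
        exact stray_subset he h2.1) zero_le_one (x := (r, z))
        ⟨rfl, hz, by linarith, hz2.le⟩ (fun t ht q hq => by
          have h4 : t * K ≤ K := mul_le_of_le_one_left hK.le ht.2
          have h5 : 0 ≤ t * K := mul_nonneg ht.1 hK.le
          obtain ⟨h1, h2, h3⟩ := backward_gradTotal he hz ht.1 (show t * K < _ by linarith) hq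
          change _ = _ - t * K at h3
          refine ⟨h1, h2, ?_, ?_⟩ <;> rw [h3] <;> linarith)
      exact ⟨y, FlowRel.of_neg_field (by rwa [neg_neg])⟩
    let g : C2 → C2 := fun z => (flow F (regularTotal e) (-1) (r, z)).2
    have hg1 : ∀ z ∈ M (2 * K) (3 * K), FlowRel F (regularTotal e) (-1) (r, z) (r, g z) ∧
        g z ∈ M K (2 * K) := by
      rintro z hz
      have h1 := flowRel_flow (hdom z hz)
      have h2 := h1.neg_field
      rw [neg_neg] at h2
      obtain ⟨h3, h4, h5⟩ := backward_gradTotal he hz.1 zero_le_one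
        (show 1 * K < _ by linarith [hz.2.1]) h2
      have h6 : flow F (regularTotal e) (-1) (r, z) = (r, g z) := Prod.ext h3 rfl
      rw [h6] at h1
      change ‖g z‖ ^ 2 = _ - 1 * K at h5
      refine ⟨h1, h4, ?_, ?_⟩ <;> rw [h5] <;> linarith [hz.2.1, hz.2.2]
    let g' : C2 → C2 →L[ℝ] C2 := fun z => ContinuousLinearMap.snd ℝ ℝ C2 ∘L
      (fderiv ℝ (flow F (regularTotal e) (-1)) (r, z)) ∘L ContinuousLinearMap.inr ℝ ℝ C2
    have hg' : ∀ z ∈ M (2 * K) (3 * K), HasFDerivWithinAt g (g' z) (M (2 * K) (3 * K)) z := by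
      intro z hz
      have h1 : ContDiffAt ℝ ∞ (flow F (regularTotal e) (-1)) (r, z) :=
        (contDiffAt_flow hΩ hF (hdom z hz)).comp (r, z) (contDiffAt_const.prodMk contDiffAt_id)
      have h2 := (h1.differentiableAt (by simp)).hasFDerivAt
      exact ((ContinuousLinearMap.snd ℝ ℝ C2).hasFDerivAt.comp z
        (h2.comp z (hasFDerivAt_prodMk_right r z))).hasFDerivWithinAt
    have hdet : ∀ z ∈ M (2 * K) (3 * K), |(g' z).det| = 1 := fun z hz =>
      abs_det_eq_one_of_symplectic _ fun v w => (fderiv_flow_symplectic hΩ hF (c := 0)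
        (fun q _ => rfl) (fun q hq => gradTotal_symplectic he.smooth hq) (hdom z hz) v w).2
    have hinj : Set.InjOn g (M (2 * K) (3 * K)) := by
      intro z hz z' hz' h
      have h1 := (hg1 z hz).1.reverse
      have h2 := (hg1 z' hz').1.reverse
      rw [h] at h1
      exact congrArg Prod.snd (h1.unique hΩ hF h2)
    have key := lintegral_abs_det_fderiv_eq_addHaar_image μ (hMmeas _ _) hg' hinj
    rw [setLIntegral_congr_fun (g := fun _ => 1) (hMmeas _ _) (fun z hz => by
      simp only [hdet z hz, ENNReal.ofReal_one]), setLIntegral_one] at key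
    rw [key]
    refine measure_mono ?_
    rintro _ ⟨z, hz, rfl⟩
    exact (hg1 z hz).2
  have hV0 : μ (V K) = 0 := by
    have h1 := hVM (show 2 * K ≤ 3 * K by linarith)
    have h2 := hVM (show K ≤ 2 * K by linarith)
    have h3 := hscale (k := √3) (by positivity)
    have h4 := hscale (k := √2) (by positivity)
    rw [Real.sq_sqrt (by norm_num), show √3 ^ 4 = (√3 ^ 2) ^ 2 by ring,
      Real.sq_sqrt (by norm_num)] at h3
    rw [Real.sq_sqrt (by norm_num), show √2 ^ 4 = (√2 ^ 2) ^ 2 by ring,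
      Real.sq_sqrt (by norm_num)] at h4
    have hv := hVfin K
    have hM1 : μ (M (2 * K) (3 * K)) ≠ ⊤ := fun h => by
      rw [h, add_top] at h1; exact hVfin _ h1
    have hM0 : μ (M K (2 * K)) ≠ ⊤ := fun h => by
      rw [h, add_top] at h2; exact hVfin _ h2
    have e1 := congrArg ENNReal.toReal h1
    have e2 := congrArg ENNReal.toReal h2
    have e3 := congrArg ENNReal.toReal h3
    have e4 := congrArg ENNReal.toReal h4
    have e5 := ENNReal.toReal_mono hM0 hle
    rw [ENNReal.toReal_add (hVfin _) (by assumption)] at e1 e2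
    rw [ENNReal.toReal_mul, ENNReal.toReal_ofReal (by positivity)] at e3 e4
    have e6 : (μ (V K)).toReal = 0 := by
      have := ENNReal.toReal_nonneg (a := μ (V K))
      linarith
    exact (ENNReal.toReal_eq_zero_iff _).1 e6 |>.resolve_right hv
  have hN0 : μ (stray κ e r) = 0 := by
    have h1 : stray κ e r ⊆ ⋃ n : ℕ, V (((n : ℝ) + 1) ^ 2 * K) := by
      intro z hz
      obtain ⟨n, hn⟩ := exists_nat_gt (‖z‖ ^ 2 / K)
      rw [div_lt_iff₀ hK] at hn
      refine Set.mem_iUnion.2 ⟨n, hz, hn.trans_le ?_⟩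
      have : (n : ℝ) ≤ ((n : ℝ) + 1) ^ 2 := by nlinarith [Nat.cast_nonneg (α := ℝ) n]
      exact mul_le_mul_of_nonneg_right this hK.le
    refine measure_mono_null h1 (measure_iUnion_null fun n => ?_)
    rw [hscale (by positivity), hV0, mul_zero]
  have hae : ∀ᵐ z ∂μ, ∃ j, (r, z) ∈ attracted κ e j := by
    have h0 : ∀ᵐ z ∂μ, z ≠ 0 := by
      have : μ {(0 : C2)} = 0 := measure_singleton 0
      exact measure_eq_zero_iff_ae_notMem.1 this
    filter_upwards [h0, measure_eq_zero_iff_ae_notMem.1 hN0] with z hz hz'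
    by_contra hcon
    exact hz' ⟨hz, fun j hj => hcon ⟨j, hj⟩⟩
  exact Measure.dense_of_ae hae

end density

end

/-! ### The function `shape` and the topology of its sublevel set -/

noncomputable section

variable {m : ℕ} {κ : Fin m → ℝ} {e : ℝ → Fin m → C2} {j : Fin m} {r : ℝ}

open Classical in
/-- The exponential of minus the backward travel time to the `j`-th line, in units of the total
residue. -/
def decay (κ : Fin m → ℝ) (e : ℝ → Fin m → C2) (j : Fin m) (q : ℝ × C2) : ℝ :=
  if q ∈ attracted κ e j then Real.exp (-(∑ i, κ i) * ‖(coneInv κ e j q).2.2‖ ^ 2) else 0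

/-- The function whose sublevel set of level `∑ i, κ i` is the basin. -/
def shape (κ a : Fin m → ℝ) (e : ℝ → Fin m → C2) (q : ℝ × C2) : ℝ :=
  ‖q.2‖ ^ 2 * (1 + ∑ j, ((∑ i, κ i) / a j - 1) * decay κ e j q)

theorem decay_of_notMem {q : ℝ × C2} (h : q ∉ attracted κ e j) : decay κ e j q = 0 := if_neg h

theorem decay_nonneg (q : ℝ × C2) : 0 ≤ decay κ e j q := by
  unfold decay; split_ifs <;> positivity

variable (he : IsCrossFamily κ e)
include he

theorem decay_le_one (q : ℝ × C2) : decay κ e j q ≤ 1 := by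
  unfold decay
  split_ifs
  · rw [Real.exp_le_one_iff, neg_mul, neg_nonpos]
    exact mul_nonneg (Finset.sum_nonneg fun i _ => (he.pos i).le) (sq_nonneg _)
  · exact zero_le_one

theorem decay_coneMap {p : ℝ × ℂ × ℂ} (hp : p ∈ coneSource) :
    decay κ e j (coneMap κ e j p) = Real.exp (-(∑ i, κ i) * ‖p.2.2‖ ^ 2) := by
  rw [decay, if_pos ⟨p, hp, rfl⟩, coneInv_coneMap he hp]

/-- For bounded η the map is proper, as it preserves the norm of c. The vertex c = 0 is kept in the
set, for otherwise its points would be missing limits. -/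
theorem isClosed_coneMap_image (T : ℝ) :
    IsClosed (coneMap κ e j '' {p | ‖p.2.2‖ ^ 2 ≤ T}) := by
  refine isClosed_of_closure_subset fun q hq => ?_
  let C : Set (ℝ × ℂ × ℂ) := Metric.closedBall q.1 1 ×ˢ
    (Metric.closedBall 0 (‖q.2‖ + 1) ×ˢ Metric.closedBall 0 (√T))
  have hC : IsCompact C := (isCompact_closedBall _ _).prod
    ((isCompact_closedBall _ _).prod (isCompact_closedBall _ _))
  have h1 : IsCompact ({p : ℝ × ℂ × ℂ | ‖p.2.2‖ ^ 2 ≤ T} ∩ C) :=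
    hC.inter_left (isClosed_le (by fun_prop) continuous_const)
  have h2 := (h1.image (contDiff_coneMap (j := j) he).continuous).isClosed
  have h3 : q ∈ closure (Metric.ball q 1 ∩ coneMap κ e j '' {p | ‖p.2.2‖ ^ 2 ≤ T}) :=
    Metric.isOpen_ball.inter_closure ⟨Metric.mem_ball_self one_pos, hq⟩
  have h4 : Metric.ball q 1 ∩ coneMap κ e j '' {p | ‖p.2.2‖ ^ 2 ≤ T} ⊆
      coneMap κ e j '' ({p | ‖p.2.2‖ ^ 2 ≤ T} ∩ C) := by
    rintro _ ⟨hb, p, hp, rfl⟩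
    refine ⟨p, ⟨hp, ?_⟩, rfl⟩
    rw [Metric.mem_ball, Prod.dist_eq, max_lt_iff] at hb
    refine ⟨hb.1.le, ?_, ?_⟩
    · rw [mem_closedBall_zero_iff, ← norm_coneMap (j := j) he p]
      have h5 := norm_le_norm_add_norm_sub' (coneMap κ e j p).2 q.2
      rw [← dist_eq_norm] at h5
      linarith [hb.2]
    · rw [mem_closedBall_zero_iff]
      exact Real.le_sqrt_of_sq_le hp
  have h5 := closure_minimal h4 h2 h3
  exact Set.image_mono Set.inter_subset_left h5

/-- Points of bounded travel time, with the vertex added, form a closed set. Near a nonzero point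
that is not attracted, travel times are therefore arbitrarily long and `decay` tends to zero. -/
theorem continuousAt_decay [NeZero m] {q : ℝ × C2} (hq : q.2 ≠ 0) :
    ContinuousAt (decay κ e j) q := by
  have hK : 0 < ∑ i, κ i := Finset.sum_pos (fun i _ => he.pos i) ⟨0, Finset.mem_univ 0⟩
  by_cases hA : q ∈ attracted κ e j
  · have h1 := (contDiffOn_coneInv (j := j) he).continuousOn.continuousAt
      ((isOpen_attracted he).mem_nhds hA)
    have h2 : ContinuousAt (fun q => Real.exp (-(∑ i, κ i) * ‖(coneInv κ e j q).2.2‖ ^ 2)) q := by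
      have h3 : Continuous fun p : ℝ × ℂ × ℂ => Real.exp (-(∑ i, κ i) * ‖p.2.2‖ ^ 2) := by fun_prop
      exact h3.continuousAt.comp h1
    refine h2.congr ?_
    filter_upwards [(isOpen_attracted he).mem_nhds hA] with y hy
    rw [decay, if_pos hy]
  · rw [Metric.continuousAt_iff']
    intro ε hε
    have hcl := isClosed_coneMap_image (j := j) he (-Real.log ε / ∑ i, κ i)
    have hqn : q ∉ coneMap κ e j '' {p | ‖p.2.2‖ ^ 2 ≤ -Real.log ε / ∑ i, κ i} := by
      rintro ⟨p, -, hp⟩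
      refine hA ⟨p, fun h0 => hq ?_, hp⟩
      rw [← hp]
      simp [coneMap, h0]
    filter_upwards [hcl.isOpen_compl.mem_nhds hqn] with y hy
    rw [decay_of_notMem hA, Real.dist_eq, sub_zero, abs_of_nonneg (decay_nonneg y)]
    by_cases hyA : y ∈ attracted κ e j
    · obtain ⟨p, hp, rfl⟩ := hyA
      rw [decay_coneMap he hp]
      have h1 : ¬ ‖p.2.2‖ ^ 2 ≤ -Real.log ε / ∑ i, κ i := fun h => hy ⟨p, h, rfl⟩
      rw [not_le, div_lt_iff₀ hK] at h1
      rw [← Real.lt_log_iff_exp_lt hε]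
      linarith
    · rwa [decay_of_notMem hyA]

theorem continuous_shape [NeZero m] (a : Fin m → ℝ) : Continuous (shape κ a e) := by
  rw [continuous_iff_continuousAt]
  intro q
  -- Continuity of `decay` is not available on the zero section. There the factor ‖q.2‖² and the
  -- bound by one suffice.
  rcases eq_or_ne q.2 0 with h0 | h0
  · have h1 : shape κ a e q = 0 := by simp [shape, h0]
    rw [ContinuousAt, h1]
    let B := 1 + ∑ j, |(∑ i, κ i) / a j - 1|
    have h2 : Filter.Tendsto (fun p : ℝ × C2 => ‖p.2‖ ^ 2 * B) (𝓝 q) (𝓝 0) := by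
      have : Continuous fun p : ℝ × C2 => ‖p.2‖ ^ 2 * B := by fun_prop
      have h3 := this.tendsto q
      simpa [h0] using h3
    refine squeeze_zero_norm (fun p => ?_) h2
    rw [shape, norm_mul, Real.norm_of_nonneg (by positivity)]
    refine mul_le_mul_of_nonneg_left ((norm_add_le _ _).trans ?_) (by positivity)
    rw [norm_one]
    refine add_le_add_right ((norm_sum_le _ _).trans (Finset.sum_le_sum fun j _ => ?_)) 1
    rw [norm_mul, Real.norm_eq_abs, Real.norm_of_nonneg (decay_nonneg p)]
    exact mul_le_of_le_one_right (abs_nonneg _) (decay_le_one he p)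
  · refine ContinuousAt.mul (by fun_prop) (continuousAt_const.add ?_)
    refine tendsto_finsetSum _ fun j _ => ?_
    exact continuousAt_const.mul (continuousAt_decay he h0)

theorem shape_coneMap (a : Fin m → ℝ) {p : ℝ × ℂ × ℂ} (hp : p ∈ coneSource) :
    shape κ a e (coneMap κ e j p) = ‖p.2.1‖ ^ 2 *
      (1 + ((∑ i, κ i) / a j - 1) * Real.exp (-(∑ i, κ i) * ‖p.2.2‖ ^ 2)) := by
  rw [shape, norm_coneMap he, Finset.sum_eq_single j, decay_coneMap he hp]
  · intro i _ hij
    rw [decay_of_notMem, mul_zero]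
    exact fun h => (disjoint_attracted he hij).le_bot ⟨h, ⟨p, hp, rfl⟩⟩
  · simp

omit he in
theorem shape_stray (a : Fin m → ℝ) {z : C2} (hz : z ∈ stray κ e r) :
    shape κ a e (r, z) = ‖z‖ ^ 2 := by
  rw [shape, Finset.sum_eq_zero fun j _ => by rw [decay_of_notMem (hz.2 j), mul_zero]]
  simp

omit he in
theorem stray_or_exists_coneMap {z : C2} (hz : z ≠ 0) : z ∈ stray κ e r ∨
    ∃ (j : Fin m) (c η : ℂ), c ≠ 0 ∧ z = c • petal κ e j r η := by
  by_cases h : ∀ j, (r, z) ∉ attracted κ e j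
  · exact Or.inl ⟨hz, h⟩
  · push Not at h
    obtain ⟨j, ⟨r', c, η⟩, hc, hp⟩ := h
    obtain rfl : r' = r := congrArg Prod.fst hp
    exact Or.inr ⟨j, c, η, hc, (congrArg Prod.snd hp).symm⟩

theorem shape_smul (a : Fin m → ℝ) (z : C2) (t : ℝ) :
    shape κ a e (r, t • z) = t ^ 2 * shape κ a e (r, z) := by
  rcases eq_or_ne t 0 with rfl | ht
  · simp [shape]
  rcases eq_or_ne z 0 with rfl | hz
  · simp [shape]
  have htc : (t : ℂ) ≠ 0 := by exact_mod_cast ht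
  rcases stray_or_exists_coneMap (κ := κ) (e := e) (r := r) hz with h | ⟨j, c, η, hc, rfl⟩
  · rw [shape_stray a h, real_smul_C2, shape_stray a (stray_smul h htc), norm_smul]
    rw [Complex.norm_real, mul_pow, Real.norm_eq_abs, sq_abs]
  · have h1 := shape_coneMap (j := j) he a (p := (r, c, η)) hc
    have h2 := shape_coneMap (j := j) he a (p := (r, t * c, η)) (mul_ne_zero htc hc)
    simp only [coneMap] at h1 h2
    rw [real_smul_C2, smul_smul, h1, h2, norm_mul, Complex.norm_real, mul_pow, Real.norm_eq_abs,
      sq_abs, mul_assoc]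

section topology

variable [NeZero m] {a : Fin m → ℝ}

theorem isOpen_shape_lt (r : ℝ) : IsOpen {z | shape κ a e (r, z) < ∑ i, κ i} :=
  isOpen_lt ((continuous_shape he a).comp (Continuous.prodMk_right r)) continuous_const

theorem isConnected_shape_lt (r : ℝ) :
    IsConnected {z | shape κ a e (r, z) < ∑ i, κ i} := by
  have hK : 0 < ∑ i, κ i := Finset.sum_pos (fun i _ => he.pos i) ⟨0, Finset.mem_univ 0⟩
  have h0 : (0 : C2) ∈ {z | shape κ a e (r, z) < ∑ i, κ i} := by simpa [shape] using hK
  -- Homogeneity of degree two makes a sublevel set of positive level star-shaped about the origin.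
  have hstar : StarConvex ℝ 0 {z | shape κ a e (r, z) < ∑ i, κ i} := by
    rw [starConvex_zero_iff]
    intro z hz t ht0 ht1
    simp only [Set.mem_ofPred_eq] at hz ⊢
    rw [shape_smul he]
    have h1 : t ^ 2 ≤ 1 := pow_le_one₀ ht0 ht1
    rcases le_total (shape κ a e (r, z)) 0 with h2 | h2
    · exact (mul_nonpos_of_nonneg_of_nonpos (sq_nonneg t) h2).trans_lt hK
    · exact (mul_le_of_le_one_left h2 h1).trans_lt hz
  exact (hstar.isPathConnected h0).isConnected

theorem frontier_shape_lt (r : ℝ) : frontier {z | shape κ a e (r, z) < ∑ i, κ i} =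
    {z | shape κ a e (r, z) = ∑ i, κ i} := by
  have hK : 0 < ∑ i, κ i := Finset.sum_pos (fun i _ => he.pos i) ⟨0, Finset.mem_univ 0⟩
  have hc := (continuous_shape he a).comp (Continuous.prodMk_right r)
  refine Set.Subset.antisymm (frontier_lt_subset_eq hc continuous_const) fun z hz => ?_
  rw [(isOpen_shape_lt he r).frontier_eq]
  refine ⟨?_, fun h => (ne_of_lt h) hz⟩
  have h1 : Filter.Tendsto (fun t : ℝ => t • z) (𝓝[<] 1) (𝓝 z) := by
    have : Continuous fun t : ℝ => t • z := by fun_prop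
    have h2 := this.tendsto 1
    rw [one_smul] at h2
    exact h2.mono_left nhdsWithin_le_nhds
  refine mem_closure_of_tendsto h1 ?_
  filter_upwards [Ioo_mem_nhdsLT zero_lt_one] with t ht
  simp only [Set.mem_ofPred_eq] at hz ⊢
  rw [shape_smul he, hz]
  have : t ^ 2 < 1 := pow_lt_one₀ ht.1.le ht.2 two_ne_zero
  nlinarith

/-- Attracted points are dense near a point of the level set. They form a cone, so they can be
rescaled onto the level, by a factor tending to one. -/
theorem closure_shape_eq (r : ℝ) :
    closure {z | shape κ a e (r, z) = (∑ i, κ i) ∧ ∃ j, (r, z) ∈ attracted κ e j} =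
      frontier {z | shape κ a e (r, z) < ∑ i, κ i} := by
  have hK : 0 < ∑ i, κ i := Finset.sum_pos (fun i _ => he.pos i) ⟨0, Finset.mem_univ 0⟩
  have hc : Continuous fun z => shape κ a e (r, z) :=
    (continuous_shape he a).comp (Continuous.prodMk_right r)
  rw [frontier_shape_lt he]
  refine Set.Subset.antisymm (closure_minimal (fun z hz => hz.1)
    (isClosed_eq hc continuous_const)) fun z hz => ?_
  have hz : shape κ a e (r, z) = ∑ i, κ i := hz
  let g : C2 → C2 := fun y => √((∑ i, κ i) / shape κ a e (r, y)) • y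
  have hg : ContinuousAt g z := by
    refine ContinuousAt.smul (ContinuousAt.sqrt (continuousAt_const.div hc.continuousAt ?_))
      continuousAt_id
    rw [hz]; exact hK.ne'
  have hgz : g z = z := by
    simp only [g, hz, div_self hK.ne', Real.sqrt_one, one_smul]
  have hcl : z ∈ closure {z : C2 | ∃ j, (r, z) ∈ attracted κ e j} := (dense_attracted he r) z
  rw [mem_closure_iff_frequently]
  have h2 : ∃ᶠ y in 𝓝 z, ∃ j, (r, y) ∈ attracted κ e j := mem_closure_iff_frequently.1 hcl
  have h3 : ∃ᶠ y in 𝓝 z, g y ∈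
      {z | shape κ a e (r, z) = (∑ i, κ i) ∧ ∃ j, (r, z) ∈ attracted κ e j} := by
    have h4 : ∀ᶠ y in 𝓝 z, 0 < shape κ a e (r, y) :=
      hc.continuousAt.eventually (lt_mem_nhds (show 0 < shape κ a e (r, z) by rw [hz]; exact hK))
    refine (h2.and_eventually h4).mono ?_
    rintro y ⟨⟨j, hj⟩, hy⟩
    refine ⟨?_, j, ?_⟩
    · simp only [g]
      rw [shape_smul he, Real.sq_sqrt (div_pos hK hy).le]
      field_simp
    · simp only [g]
      rw [real_smul_C2]
      refine attracted_smul hj ?_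
      exact_mod_cast (Real.sqrt_pos.2 (div_pos hK hy)).ne'
  have h5 := hg.tendsto
  rw [hgz] at h5
  exact h5.frequently h3

end topology

end

/-! ### Backward trajectories of the Liouville field and their limits -/

noncomputable section

variable {m : ℕ} {κ : Fin m → ℝ}

/-- The backward trajectory of `p` under the Liouville field runs in the complement of the lines
and converges to `q` in finite time. -/
def BackwardTo (κ : Fin m → ℝ) (e : Fin m → C2) (p q : C2) : Prop :=
  ∃ (T : ℝ) (γ : ℝ → C2), 0 < T ∧ γ 0 = p ∧ (∀ t ∈ Set.Ico 0 T, γ t ∈ regularSet e ∧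
    HasDerivWithinAt γ (-liouvilleField κ e (γ t)) (Set.Ico 0 T) t) ∧
    Filter.Tendsto γ (𝓝[<] T) (𝓝 q)

theorem regularSet_ne_zero [NeZero m] {e : Fin m → C2} {z : C2} (hz : z ∈ regularSet e) : z ≠ 0 := by
  rintro rfl
  exact hz 0 (cross_zero_right _)

section general

variable [NeZero m] {e : Fin m → C2}

omit [NeZero m] in
/-- The squared norm along a backward trajectory of the Liouville field. -/
theorem norm_sq_backward {T : ℝ} {γ : ℝ → C2} (hγ : ∀ t ∈ Set.Ico 0 T, γ t ∈ regularSet e ∧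
    HasDerivWithinAt γ (-liouvilleField κ e (γ t)) (Set.Ico 0 T) t) {t : ℝ}
    (ht : t ∈ Set.Ico 0 T) :
    ‖γ t‖ ^ 2 = (∑ i, κ i) - ((∑ i, κ i) - ‖γ 0‖ ^ 2) * Real.exp t := by
  set K := ∑ i, κ i
  have h1 : ∀ s ∈ Set.Icc 0 t, HasDerivWithinAt
      (fun s => (‖γ s‖ ^ 2 - K) * Real.exp (-s)) 0 (Set.Icc 0 t) s := by
    intro s hs
    have hs' : s ∈ Set.Ico 0 T := ⟨hs.1, hs.2.trans_lt ht.2⟩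
    have h2 : HasDerivWithinAt (fun s => ‖γ s‖ ^ 2) (1 * ‖γ s‖ ^ 2 - K) (Set.Ico 0 T) s :=
      hasDerivWithinAt_norm_sq_backward (hγ s hs').1 (by
        rw [one_smul]; exact (hγ s hs').2)
    have h3 := ((h2.sub_const K).mul ((hasDerivAt_neg s).exp.hasDerivWithinAt)).mono
      (show Set.Icc 0 t ⊆ Set.Ico 0 T from fun x hx => ⟨hx.1, hx.2.trans_lt ht.2⟩)
    refine h3.congr_deriv ?_
    ring
  have := (convex_Icc 0 t).norm_image_sub_le_of_norm_hasDerivWithin_le (C := 0) h1 (by simp)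
    (Set.left_mem_Icc.2 ht.1) (Set.right_mem_Icc.2 ht.1)
  simp only [zero_mul, norm_le_zero_iff, sub_eq_zero, neg_zero, Real.exp_zero, mul_one] at this
  have h4 : Real.exp (-t) * Real.exp t = 1 := by rw [← Real.exp_add]; simp
  linear_combination Real.exp t * this - (‖γ t‖ ^ 2 - K) * h4

/-- The backward trajectories of the Liouville field follow `hopfField`. -/
theorem hopfRel_of_backwardTo (hκ : ∀ i, 0 < κ i) {T : ℝ} {γ : ℝ → C2}
    (hγ : ∀ t ∈ Set.Ico 0 T, γ t ∈ regularSet e ∧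
      HasDerivWithinAt γ (-liouvilleField κ e (γ t)) (Set.Ico 0 T) t) {t : ℝ}
    (ht : t ∈ Set.Ico 0 T) :
    HopfRel κ e (-((t - Real.log (‖γ t‖ ^ 2 / ‖γ 0‖ ^ 2)) / ∑ i, κ i)) (γ 0)
      ((‖γ 0‖ / ‖γ t‖) • γ t) ∧
    0 ≤ (t - Real.log (‖γ t‖ ^ 2 / ‖γ 0‖ ^ 2)) / ∑ i, κ i := by
  have hK : 0 < ∑ i, κ i := Finset.sum_pos (fun i _ => hκ i) ⟨0, Finset.mem_univ 0⟩
  have h1 := hopfRel_of_backward (e := e) (a := 1) ht.1 hK fun s hs => by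
    have hs' : s ∈ Set.Ico 0 T := ⟨hs.1, hs.2.trans_lt ht.2⟩
    refine ⟨regularSet_ne_zero (hγ s hs').1, (hγ s hs').1, ?_⟩
    rw [one_smul]
    exact (hγ s hs').2.mono fun x hx => ⟨hx.1, hx.2.trans_lt ht.2⟩
  rw [one_mul] at h1
  refine ⟨h1, div_nonneg ?_ hK.le⟩
  have h0 : 0 < ‖γ 0‖ := norm_pos_iff.2 (regularSet_ne_zero (hγ 0 ⟨le_rfl, ht.1.trans_lt ht.2⟩).1)
  have ht0 : 0 < ‖γ t‖ := norm_pos_iff.2 (regularSet_ne_zero (hγ t ht).1)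
  rw [sub_nonneg, Real.log_le_iff_le_exp (by positivity), div_le_iff₀ (by positivity),
    norm_sq_backward hγ ht]
  have := Real.one_le_exp ht.1
  nlinarith

/-- Construction of backward trajectories of the Liouville field. -/
theorem hasDerivAt_backward (hκ : ∀ i, 0 < κ i) {p : C2} (hp : p ∈ regularSet e) {N s : ℝ → ℝ}
    (hN : N = fun t => (∑ i, κ i) - ((∑ i, κ i) - ‖p‖ ^ 2) * Real.exp t)
    (hs : s = fun t => (t - Real.log (N t / ‖p‖ ^ 2)) / ∑ i, κ i) {t : ℝ} (hNt : 0 < N t)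
    (ht : (-(s t), p) ∈ flowDomain (hopfField κ e) (regularSet e)) :
    √(N t / ‖p‖ ^ 2) • flow (hopfField κ e) (regularSet e) (-(s t)) p ∈ regularSet e ∧
    HasDerivAt (fun t => √(N t / ‖p‖ ^ 2) • flow (hopfField κ e) (regularSet e) (-(s t)) p)
      (-liouvilleField κ e (√(N t / ‖p‖ ^ 2) •
        flow (hopfField κ e) (regularSet e) (-(s t)) p)) t := by
  have hK : 0 < ∑ i, κ i := Finset.sum_pos (fun i _ => hκ i) ⟨0, Finset.mem_univ 0⟩
  have hp0 : 0 < ‖p‖ := norm_pos_iff.2 (regularSet_ne_zero hp)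
  have hsq : 0 < √(N t / ‖p‖ ^ 2) := Real.sqrt_pos.2 (by positivity)
  have hrel : HopfRel κ e (-(s t)) p (flow (hopfField κ e) (regularSet e) (-(s t)) p) :=
    flowRel_flow ht
  have hmem : √(N t / ‖p‖ ^ 2) • flow (hopfField κ e) (regularSet e) (-(s t)) p ∈ regularSet e := by
    rw [real_smul_C2]
    exact regularSet_smul hrel.mem_right (by exact_mod_cast hsq.ne')
  refine ⟨hmem, ?_⟩
  -- N is the squared norm at backward time t, with N' = N - K, and s is the elapsed time of
  -- `hopfField`, with s' = 1 / N.
  have h1 : HasDerivAt N (N t - ∑ i, κ i) t := by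
    rw [hN]
    refine (((Real.hasDerivAt_exp t).const_mul _).const_sub _).congr_deriv ?_
    ring
  have h2 := h1.div_const (‖p‖ ^ 2)
  have h3 : HasDerivAt s (1 / N t) t := by
    have := ((hasDerivAt_id t).sub (h2.log (by positivity))).div_const (∑ i, κ i)
    rw [hs]
    refine this.congr_deriv ?_
    field_simp
    ring
  have h4 := (hasDerivAt_flow isOpen_regularSet contDiffOn_hopfField ht).scomp t h3.neg
  have h5 := (h2.sqrt (by positivity)).smul h4
  refine h5.congr_deriv ?_
  rw [liouvilleField_eq (regularSet_ne_zero hmem), norm_smul, mul_pow, hrel.norm_eq,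
    Real.norm_of_nonneg hsq.le, Real.sq_sqrt (by positivity), real_smul_C2 (√(N t / ‖p‖ ^ 2))
    (flow _ _ _ _), hopfField_smul _ (by exact_mod_cast hsq.ne'), ← real_smul_C2, ← real_smul_C2]
  have hq := Real.sq_sqrt (show 0 ≤ N t / ‖p‖ ^ 2 by positivity)
  have hN2 : N t = √(N t / ‖p‖ ^ 2) ^ 2 * ‖p‖ ^ 2 := by rw [hq]; field_simp
  simp only [Function.comp]
  generalize hopfField κ e (flow (hopfField κ e) (regularSet e) (-(s t)) p) = Z
  generalize flow (hopfField κ e) (regularSet e) (-(s t)) p = y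
  generalize √(N t / ‖p‖ ^ 2) = d at *
  rw [hN2]
  match_scalars
  · field_simp
  · field_simp
    ring

end general

variable [NeZero m] {e : ℝ → Fin m → C2} {j : Fin m} {r : ℝ}

section

variable (he : IsCrossFamily κ e)
include he

-- By uniqueness the backward trajectory follows the petal, which converges to c • e r j at time
-- ‖η‖². That point lies on a line, so the trajectory cannot last so long.
omit [NeZero m] in
theorem HopfRel.lt_of_petal {c η : ℂ} (hc : c ≠ 0) {s : ℝ} {y : C2}
    (h : HopfRel κ (e r) (-s) (c • petal κ e j r η) y) : s < ‖η‖ ^ 2 := by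
  by_contra hcon
  rw [not_lt] at hcon
  have hη : η ≠ 0 := (coneMap_snd_mem he hc).1 h.mem_left
  have hτ : 0 < ‖η‖ ^ 2 := by have := norm_pos_iff.2 hη; positivity
  obtain ⟨w, hw, -⟩ := FlowRel.split h (s := -‖η‖ ^ 2) (by
    rw [Set.uIcc_of_ge (by linarith)]; constructor <;> linarith)
  obtain ⟨γ, h0, h1, hγ⟩ := hw
  have h2 : ∀ s' ∈ Set.Ico 0 (‖η‖ ^ 2), γ (-s') = c • petal κ e j r (√(1 - s' / ‖η‖ ^ 2) • η) := by
    intro s' hs'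
    have h3 : HopfRel κ (e r) (-s') (c • petal κ e j r η) (γ (-s')) := ⟨γ, h0, rfl, fun x hx =>
      hγ x (Set.uIcc_subset_uIcc_left (by
        rw [Set.uIcc_of_ge (by linarith)]; constructor <;> linarith [hs'.1, hs'.2]) hx)⟩
    exact h3.unique (hopfRel_petal_back he hη hc hs'.1 hs'.2).reverse
  have h4 : Filter.Tendsto (fun s' => γ (-s')) (𝓝[<] (‖η‖ ^ 2)) (𝓝 w) := by
    have h5 : ContinuousAt γ (-‖η‖ ^ 2) := (hγ _ Set.right_mem_uIcc).2.continuousAt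
    have h6 := h5.tendsto.comp ((continuous_neg.tendsto (‖η‖ ^ 2)).mono_left
      (nhdsWithin_le_nhds (s := Set.Iio (‖η‖ ^ 2))))
    rwa [h1] at h6
  have h7 : Filter.Tendsto (fun s' : ℝ => c • petal κ e j r (√(1 - s' / ‖η‖ ^ 2) • η))
      (𝓝[<] (‖η‖ ^ 2)) (𝓝 (c • e r j)) := by
    have h8 : Continuous fun s' : ℝ => c • petal κ e j r (√(1 - s' / ‖η‖ ^ 2) • η) :=
      ((differentiable_petal he r).continuous.const_smul c).comp
        (show Continuous fun s : ℝ => √(1 - s / ‖η‖ ^ 2) • η by fun_prop)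
    have h9 := h8.tendsto (‖η‖ ^ 2)
    rw [div_self hτ.ne', sub_self, Real.sqrt_zero, zero_smul, petal_zero he] at h9
    exact h9.mono_left nhdsWithin_le_nhds
  have h10 : w = c • e r j := by
    refine tendsto_nhds_unique (h4.congr' ?_) h7
    filter_upwards [Ioo_mem_nhdsLT hτ] with s' hs' using h2 s' (Set.Ioo_subset_Ico_self hs')
  have h11 := (hγ _ Set.right_mem_uIcc).1 j
  rw [h1, h10, cross_smul, cross_apply_self, mul_zero] at h11
  exact h11 rfl

/-- When the norm tends to zero, the logarithm in the time change makes the elapsed time of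
`hopfField` infinite, while an attracted point has only the time ‖η‖² available. Vanishing of the
squared norm at a finite time also forces ‖p‖² < K. -/
theorem BackwardTo.stray {p : C2} (h : BackwardTo κ (e r) p 0) :
    p ∈ stray κ e r ∧ ‖p‖ ^ 2 < ∑ i, κ i := by
  have hK : 0 < ∑ i, κ i := Finset.sum_pos (fun i _ => he.pos i) ⟨0, Finset.mem_univ 0⟩
  obtain ⟨T, γ, hT, rfl, hγ, hlim⟩ := h
  have hp0 := regularSet_ne_zero (hγ 0 ⟨le_rfl, hT⟩).1
  have hev : ∀ᶠ t in 𝓝[<] T, t ∈ Set.Ioo 0 T := Ioo_mem_nhdsLT hT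
  have h1 : Filter.Tendsto (fun t => ‖γ t‖ ^ 2) (𝓝[<] T) (𝓝 0) := by
    simpa using hlim.norm.pow 2
  have h2 : Filter.Tendsto (fun t => (∑ i, κ i) - ((∑ i, κ i) - ‖γ 0‖ ^ 2) * Real.exp t) (𝓝[<] T)
      (𝓝 ((∑ i, κ i) - ((∑ i, κ i) - ‖γ 0‖ ^ 2) * Real.exp T)) :=
    ((show Continuous fun t => (∑ i, κ i) - ((∑ i, κ i) - ‖γ 0‖ ^ 2) * Real.exp t by
      fun_prop).tendsto T).mono_left nhdsWithin_le_nhds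
  have h3 := tendsto_nhds_unique (h1.congr' (hev.mono fun t ht =>
    norm_sq_backward hγ (Set.Ioo_subset_Ico_self ht))) h2
  refine ⟨⟨hp0, ?_⟩, ?_⟩
  · rintro j ⟨⟨r', c, η⟩, hc, hpq⟩
    obtain rfl : r' = r := congrArg Prod.fst hpq
    have hp : c • petal κ e j r' η = γ 0 := congrArg Prod.snd hpq
    have h0 : 0 < ‖γ 0‖ := norm_pos_iff.2 hp0
    have h4 : Filter.Tendsto (fun t => ‖γ t‖ ^ 2 / ‖γ 0‖ ^ 2) (𝓝[<] T) (𝓝[>] 0) := by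
      rw [tendsto_nhdsWithin_iff]
      constructor
      · simpa using h1.div_const (‖γ 0‖ ^ 2)
      · filter_upwards [hev] with t ht
        have := norm_pos_iff.2 (regularSet_ne_zero (hγ t (Set.Ioo_subset_Ico_self ht)).1)
        exact Set.mem_Ioi.2 (by positivity)
    have h5 := (Real.tendsto_log_nhdsGT_zero.comp h4).eventually
      (Filter.eventually_le_atBot (-((∑ i, κ i) * ‖η‖ ^ 2)))
    obtain ⟨t, ht1, ht2⟩ := (h5.and hev).exists
    have h6 := (hopfRel_of_backwardTo he.pos hγ (Set.Ioo_subset_Ico_self ht2)).1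
    rw [← hp] at h6
    have h7 := HopfRel.lt_of_petal he hc h6
    rw [div_lt_iff₀ hK, hp] at h7
    simp only [Function.comp] at ht1
    have := ht2.1
    linarith
  · have : 0 < (∑ i, κ i) - ‖γ 0‖ ^ 2 := by
      by_contra hcon
      have := Real.exp_pos T
      nlinarith
    linarith

/-- The limit is an attracted point with η = 0. The attracted set being open, the trajectory enters
it, and flowing forward shows that p is attracted. The travel time equals ‖η‖², and eliminating T
between this and the equation of the squared norm gives the last relation. -/
theorem BackwardTo.exists_petal {p q : C2} (h : BackwardTo κ (e r) p q) (hq0 : q ≠ 0)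
    (hq : cross (e r j) q = 0) : ∃ c η : ℂ, c ≠ 0 ∧ p = c • petal κ e j r η ∧
      0 < (∑ i, κ i) - ‖c‖ ^ 2 * (1 - Real.exp (-(∑ i, κ i) * ‖η‖ ^ 2)) ∧
      ‖q‖ ^ 2 * ((∑ i, κ i) - ‖c‖ ^ 2 * (1 - Real.exp (-(∑ i, κ i) * ‖η‖ ^ 2))) =
        (∑ i, κ i) * ‖c‖ ^ 2 * Real.exp (-(∑ i, κ i) * ‖η‖ ^ 2) := by
  have hK : 0 < ∑ i, κ i := Finset.sum_pos (fun i _ => he.pos i) ⟨0, Finset.mem_univ 0⟩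
  set K := ∑ i, κ i
  obtain ⟨T, γ, hT, rfl, hγ, hlim⟩ := h
  have hp0 := regularSet_ne_zero (hγ 0 ⟨le_rfl, hT⟩).1
  have h0 : 0 < ‖γ 0‖ := norm_pos_iff.2 hp0
  have hqn : 0 < ‖q‖ := norm_pos_iff.2 hq0
  have hev : ∀ᶠ t in 𝓝[<] T, t ∈ Set.Ioo 0 T := Ioo_mem_nhdsLT hT
  have h1 : Filter.Tendsto (fun t => ‖γ t‖ ^ 2) (𝓝[<] T) (𝓝 (‖q‖ ^ 2)) := hlim.norm.pow 2
  have h2 : Filter.Tendsto (fun t => K - (K - ‖γ 0‖ ^ 2) * Real.exp t) (𝓝[<] T)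
      (𝓝 (K - (K - ‖γ 0‖ ^ 2) * Real.exp T)) :=
    ((show Continuous fun t => K - (K - ‖γ 0‖ ^ 2) * Real.exp t by
      fun_prop).tendsto T).mono_left nhdsWithin_le_nhds
  have h3 := tendsto_nhds_unique (h1.congr' (hev.mono fun t ht =>
    norm_sq_backward hγ (Set.Ioo_subset_Ico_self ht))) h2
  let s : ℝ → ℝ := fun t => (t - Real.log (‖γ t‖ ^ 2 / ‖γ 0‖ ^ 2)) / K
  let y : ℝ → C2 := fun t => (‖γ 0‖ / ‖γ t‖) • γ t
  have hs : Filter.Tendsto s (𝓝[<] T) (𝓝 ((T - Real.log (‖q‖ ^ 2 / ‖γ 0‖ ^ 2)) / K)) := by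
    have h4 : Filter.Tendsto (fun t : ℝ => t) (𝓝[<] T) (𝓝 T) := nhdsWithin_le_nhds
    exact (h4.sub ((h1.div_const _).log (by positivity))).div_const K
  have hy : Filter.Tendsto y (𝓝[<] T) (𝓝 ((‖γ 0‖ / ‖q‖) • q)) :=
    (tendsto_const_nhds.div hlim.norm hqn.ne').smul hlim
  have hqA : (r, (‖γ 0‖ / ‖q‖) • q) ∈ attracted κ e j := by
    rw [real_smul_C2]
    refine attracted_smul (attracted_of_cross_eq_zero he hq0 hq) ?_
    exact_mod_cast (div_pos h0 hqn).ne'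
  have hq2 : (coneInv κ e j (r, (‖γ 0‖ / ‖q‖) • q)).2.2 = 0 := by
    have h5 := coneInv_mem hqA
    have h6 := coneMap_coneInv hqA
    by_contra hne
    have h7 := (coneMap_snd_mem (κ := κ) (r := (coneInv κ e j (r, (‖γ 0‖ / ‖q‖) • q)).1)
      (i := j) he h5).2 hne
    have h8 : (coneInv κ e j (r, (‖γ 0‖ / ‖q‖) • q)).1 = r := congrArg Prod.fst h6
    have h9 := congrArg Prod.snd h6
    simp only [coneMap] at h9
    rw [h9, h8] at h7
    apply h7 j
    rw [real_smul_C2, cross_smul, hq, mul_zero]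
  have hyr : Filter.Tendsto (fun t => (r, y t)) (𝓝[<] T) (𝓝 (r, (‖γ 0‖ / ‖q‖) • q)) :=
    tendsto_const_nhds.prodMk_nhds hy
  have hyA := hyr.eventually ((isOpen_attracted he).mem_nhds hqA)
  have hcont := ((contDiffOn_coneInv (j := j) he).continuousOn.continuousAt
    ((isOpen_attracted he).mem_nhds hqA)).tendsto.comp hyr
  have key : ∀ᶠ t in 𝓝[<] T, ∃ c η : ℂ, c ≠ 0 ∧ γ 0 = c • petal κ e j r η ∧
      ‖η‖ ^ 2 = ‖(coneInv κ e j (r, y t)).2.2‖ ^ 2 + s t := by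
    filter_upwards [hyA, hev] with t ht1 ht2
    obtain ⟨h4, h5⟩ := hopfRel_of_backwardTo he.pos hγ (Set.Ioo_subset_Ico_self ht2)
    have h6 := coneInv_mem ht1
    have h7 := coneMap_coneInv ht1
    set p := coneInv κ e j (r, y t)
    have h8 : p.1 = r := congrArg Prod.fst h7
    have h9 : p.2.1 • petal κ e j p.1 p.2.2 = y t := congrArg Prod.snd h7
    rw [h8] at h9
    have h10 : p.2.2 ≠ 0 := by
      have : y t ∈ regularSet (e r) := h4.mem_right
      rw [← h9] at this
      exact (coneMap_snd_mem he h6).1 this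
    have h11 := (petal_stretch (κ := κ) (j := j) he r h10 h5).smul h6
    rw [h9] at h11
    have h12 := h4.reverse
    rw [neg_neg] at h12
    have hpn := norm_pos_iff.2 h10
    refine ⟨p.2.1, _, h6, h12.unique h11, ?_⟩
    rw [norm_smul, norm_mul, Real.norm_of_nonneg (Real.sqrt_nonneg _),
      Real.norm_of_nonneg (inv_nonneg.2 hpn.le), mul_assoc, inv_mul_cancel₀ hpn.ne', mul_one,
      Real.sq_sqrt (by positivity)]
  obtain ⟨t0, c, η, hc, hp, -⟩ := key.exists
  -- Near the limit the transverse coordinate tends to zero, so ‖η‖² is the limit of the elapsed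
  -- time s t.
  have hτ : ‖η‖ ^ 2 = (T - Real.log (‖q‖ ^ 2 / ‖γ 0‖ ^ 2)) / K := by
    have h4 : Filter.Tendsto (fun t => ‖(coneInv κ e j (r, y t)).2.2‖ ^ 2 + s t) (𝓝[<] T)
        (𝓝 (0 + (T - Real.log (‖q‖ ^ 2 / ‖γ 0‖ ^ 2)) / K)) := by
      refine Filter.Tendsto.add ?_ hs
      have h5 : Continuous fun p : ℝ × ℂ × ℂ => ‖p.2.2‖ ^ 2 := by fun_prop
      have h6 := (h5.tendsto _).comp hcont
      rw [hq2, norm_zero, zero_pow two_ne_zero] at h6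
      exact h6
    rw [zero_add] at h4
    refine tendsto_nhds_unique (tendsto_const_nhds.congr' ?_) h4
    filter_upwards [key] with t ht
    obtain ⟨c', η', hc', hp', h5⟩ := ht
    rw [← h5, (coneMap_injective he hc hc' (hp.symm.trans hp')).2.2]
  have hN0 : ‖γ 0‖ ^ 2 = ‖c‖ ^ 2 := by rw [hp, norm_smul, norm_petal he, mul_one]
  have hexp : Real.exp (-K * ‖η‖ ^ 2) = Real.exp (-T) * (‖q‖ ^ 2 / ‖γ 0‖ ^ 2) := by
    rw [hτ, show -K * ((T - Real.log (‖q‖ ^ 2 / ‖γ 0‖ ^ 2)) / K) =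
      -T + Real.log (‖q‖ ^ 2 / ‖γ 0‖ ^ 2) by field_simp; ring, Real.exp_add,
      Real.exp_log (by positivity)]
  have hTT : Real.exp (-T) * Real.exp T = 1 := by rw [← Real.exp_add]; simp
  -- This expression is K exp(-T), so its positivity records that T is finite.
  have hfin : K - ‖c‖ ^ 2 * (1 - Real.exp (-K * ‖η‖ ^ 2)) = Real.exp (-T) * K := by
    rw [hexp, ← hN0]
    have : ‖γ 0‖ ^ 2 * (Real.exp (-T) * (‖q‖ ^ 2 / ‖γ 0‖ ^ 2)) = Real.exp (-T) * ‖q‖ ^ 2 := by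
      field_simp
    rw [mul_sub, this]
    linear_combination Real.exp (-T) * h3 - (K - ‖γ 0‖ ^ 2) * hTT
  refine ⟨c, η, hc, hp, ?_, ?_⟩
  · rw [hfin]; positivity
  · rw [hfin, hexp, ← hN0]
    field_simp

end

end

/-! ### Basins as sublevel sets of `shape` -/

noncomputable section

variable {m : ℕ} [NeZero m] {κ : Fin m → ℝ}

theorem backwardTo_of_flow {e : Fin m → C2} (hκ : ∀ i, 0 < κ i) {p q : C2} (hp : p ∈ regularSet e)
    {N s : ℝ → ℝ} (hN : N = fun t => (∑ i, κ i) - ((∑ i, κ i) - ‖p‖ ^ 2) * Real.exp t)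
    (hs : s = fun t => (t - Real.log (N t / ‖p‖ ^ 2)) / ∑ i, κ i) {T : ℝ} (hT : 0 < T)
    (h : ∀ t ∈ Set.Ico 0 T, 0 < N t ∧ (-(s t), p) ∈ flowDomain (hopfField κ e) (regularSet e))
    (hq : Filter.Tendsto (fun t => √(N t / ‖p‖ ^ 2) •
      flow (hopfField κ e) (regularSet e) (-(s t)) p) (𝓝[<] T) (𝓝 q)) :
    BackwardTo κ e p q := by
  refine ⟨T, _, hT, ?_, fun t ht => ?_, hq⟩
  · have hp0 : 0 < ‖p‖ := norm_pos_iff.2 (regularSet_ne_zero hp)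
    have h1 : N 0 = ‖p‖ ^ 2 := by rw [hN]; simp
    have h2 : s 0 = 0 := by rw [hs]; simp [h1, hp0.ne']
    rw [h1, h2, neg_zero, (FlowRel.refl hp).flow_eq isOpen_regularSet contDiffOn_hopfField,
      div_self (by positivity), Real.sqrt_one, one_smul]
  · have := hasDerivAt_backward hκ hp hN hs (h t ht).1 (h t ht).2
    exact ⟨this.1, this.2.hasDerivWithinAt⟩

variable {e : ℝ → Fin m → C2} {j : Fin m} {r : ℝ} (he : IsCrossFamily κ e)
include he

theorem sum_weights_pos : 0 < ∑ i, κ i :=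
  Finset.sum_pos (fun i _ => he.pos i) ⟨0, Finset.mem_univ 0⟩

-- Stray points of a given norm form a compact subset of the regular set. Backward trajectories do
-- not leave it, since attraction propagates forward.
omit [NeZero m] in
theorem exists_hopfRel_of_stray {p : C2} (hp : p ∈ stray κ e r) {s : ℝ} (hs : 0 ≤ s) :
    ∃ y, HopfRel κ (e r) (-s) p y := by
  have hp0 := norm_pos_iff.2 hp.1
  obtain ⟨y, hy⟩ := exists_flowRel_of_compact (f := fun z => -hopfField κ (e r) z)
    isOpen_regularSet contDiffOn_hopfField.neg
    (isCompact_stray (r := r) (a := ‖p‖ ^ 2) (b := ‖p‖ ^ 2) he (by positivity))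
    (fun z hz => stray_subset he hz.1) hs (x := p) ⟨hp, le_rfl, le_rfl⟩ (by
      intro t ht y hy
      have h1 : HopfRel κ (e r) (-t) p y := FlowRel.of_neg_field (by rwa [neg_neg])
      have hn := h1.norm_eq
      refine ⟨⟨?_, fun j hj => hp.2 j ?_⟩, ?_⟩
      · rw [← norm_pos_iff, hn]; exact hp0
      · have h2 := h1.reverse
        rw [neg_neg] at h2
        exact h2.attracted_of_nonneg he ht.1 hj
      · rw [hn]; exact ⟨le_rfl, le_rfl⟩)
  exact ⟨y, FlowRel.of_neg_field (by rwa [neg_neg])⟩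

theorem backwardTo_zero_of_stray {p : C2} (hp : p ∈ stray κ e r) (h : ‖p‖ ^ 2 < ∑ i, κ i) :
    BackwardTo κ (e r) p 0 := by
  have hK := sum_weights_pos he
  have hp0 := norm_pos_iff.2 hp.1
  set K := ∑ i, κ i with hKdef
  have hd : 0 < K - ‖p‖ ^ 2 := by linarith
  -- The squared norm K - (K - ‖p‖²) exp t vanishes exactly at t = log(K / (K - ‖p‖²)).
  have hexp : Real.exp (Real.log (K / (K - ‖p‖ ^ 2))) = K / (K - ‖p‖ ^ 2) :=
    Real.exp_log (by positivity)
  have hT : 0 < Real.log (K / (K - ‖p‖ ^ 2)) := by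
    apply Real.log_pos
    rw [one_lt_div hd]
    have : 0 < ‖p‖ ^ 2 := by positivity
    linarith
  have hdom : ∀ t ∈ Set.Ico 0 (Real.log (K / (K - ‖p‖ ^ 2))),
      0 < K - (K - ‖p‖ ^ 2) * Real.exp t ∧
      (-((t - Real.log ((K - (K - ‖p‖ ^ 2) * Real.exp t) / ‖p‖ ^ 2)) / K), p) ∈
        flowDomain (hopfField κ (e r)) (regularSet (e r)) := by
    intro t ht
    have h1 := Real.exp_lt_exp.2 ht.2
    rw [hexp, lt_div_iff₀ hd] at h1
    have h2 : 0 < K - (K - ‖p‖ ^ 2) * Real.exp t := by linarith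
    refine ⟨h2, ?_⟩
    refine exists_hopfRel_of_stray he hp (div_nonneg ?_ hK.le)
    rw [sub_nonneg, Real.log_le_iff_le_exp (by positivity), div_le_iff₀ (by positivity)]
    have := Real.one_le_exp ht.1
    nlinarith
  refine backwardTo_of_flow he.pos (stray_subset he hp) rfl rfl hT hdom ?_
  rw [tendsto_zero_iff_norm_tendsto_zero]
  have hc : Continuous fun t => √(K - (K - ‖p‖ ^ 2) * Real.exp t) := by fun_prop
  have hc := (hc.tendsto (Real.log (K / (K - ‖p‖ ^ 2)))).mono_left
    (nhdsWithin_le_nhds (s := Set.Iio (Real.log (K / (K - ‖p‖ ^ 2)))))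
  rw [hexp, mul_div_cancel₀ _ hd.ne', sub_self, Real.sqrt_zero] at hc
  refine hc.congr' ?_
  filter_upwards [Ioo_mem_nhdsLT hT] with t ht
  obtain ⟨h1, h2⟩ := hdom t (Set.Ioo_subset_Ico_self ht)
  have h3 : HopfRel κ (e r) _ p _ := flowRel_flow h2
  rw [norm_smul, h3.norm_eq, Real.norm_of_nonneg (Real.sqrt_nonneg _),
    Real.sqrt_div h1.le, Real.sqrt_sq hp0.le, div_mul_cancel₀ _ hp0.ne']

theorem exists_backwardTo_of_petal {c η : ℂ} (hc : c ≠ 0) (hη : η ≠ 0)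
    (hL : 0 < (∑ i, κ i) - ‖c‖ ^ 2 * (1 - Real.exp (-(∑ i, κ i) * ‖η‖ ^ 2))) :
    ∃ q, BackwardTo κ (e r) (c • petal κ e j r η) q ∧ cross (e r j) q = 0 ∧
      ‖q‖ ^ 2 * ((∑ i, κ i) - ‖c‖ ^ 2 * (1 - Real.exp (-(∑ i, κ i) * ‖η‖ ^ 2))) =
        (∑ i, κ i) * ‖c‖ ^ 2 * Real.exp (-(∑ i, κ i) * ‖η‖ ^ 2) := by
  have hK := sum_weights_pos he
  have hc0 := norm_pos_iff.2 hc
  have hη0 := norm_pos_iff.2 hη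
  set K := ∑ i, κ i with hKdef
  set τ := ‖η‖ ^ 2 with hτdef
  have hτ : 0 < τ := by positivity
  set h := Real.exp (-K * τ) with hh
  set L := K - ‖c‖ ^ 2 * (1 - h) with hLdef
  have hh0 : 0 < h := Real.exp_pos _
  have hh1 : h < 1 := by rw [hh, Real.exp_lt_one_iff]; nlinarith
  have hKh : Real.exp (K * τ) * h = 1 := by rw [hh, ← Real.exp_add]; simp
  have hpn : ‖c • petal κ e j r η‖ = ‖c‖ := by rw [norm_smul, norm_petal he, mul_one]
  -- The equation s T = τ reads N T = ‖c‖² h exp T, which is linear in exp T and has the solution K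
  -- / L. Positivity of L is what makes it solvable.
  set T := Real.log (K / L) with hTdef
  have hexp : Real.exp T = K / L := Real.exp_log (by positivity)
  have hLK : L < K := by
    have : 0 < ‖c‖ ^ 2 * (1 - h) := mul_pos (by positivity) (by linarith)
    linarith
  have hT : 0 < T := Real.log_pos (by rw [one_lt_div hL]; exact hLK)
  let N : ℝ → ℝ := fun t => K - (K - ‖c‖ ^ 2) * Real.exp t
  let s : ℝ → ℝ := fun t => (t - Real.log (N t / ‖c‖ ^ 2)) / K
  have hNT : N T * L = K * ‖c‖ ^ 2 * h := by
    simp only [N, hexp]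
    field_simp
    rw [hLdef]
    ring
  have hNT0 : 0 < N T := by
    have : 0 < N T * L := by rw [hNT]; positivity
    exact pos_of_mul_pos_left this hL.le
  have hsT : s T = τ := by
    have : N T / ‖c‖ ^ 2 = Real.exp T * h := by
      rw [hexp]; field_simp; linarith
    simp only [s]
    rw [this, hh, ← Real.exp_add, Real.log_exp]
    field_simp
    ring
  have hN : ∀ t ∈ Set.Ico 0 T, 0 < N t ∧ 0 ≤ s t ∧ s t < τ := by
    intro t ht
    have hX := Real.one_le_exp ht.1
    have hXT : Real.exp t * L < K := by
      have := Real.exp_lt_exp.2 ht.2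
      rwa [hexp, lt_div_iff₀ hL] at this
    have h1 : ‖c‖ ^ 2 * h * Real.exp t < N t := by
      simp only [N]
      have : Real.exp t * L = Real.exp t * K - Real.exp t * ‖c‖ ^ 2 * (1 - h) := by
        rw [hLdef]; ring
      linarith
    have h2 : 0 < N t := lt_trans (by positivity) h1
    refine ⟨h2, div_nonneg ?_ hK.le, ?_⟩
    · rw [sub_nonneg, Real.log_le_iff_le_exp (by positivity), div_le_iff₀ (by positivity)]
      simp only [N]
      nlinarith
    · rw [div_lt_iff₀ hK, sub_lt_comm, Real.lt_log_iff_exp_lt (by positivity),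
        lt_div_iff₀ (by positivity), show t - τ * K = t + -K * τ by ring, Real.exp_add]
      linarith
  have hrel : ∀ t ∈ Set.Ico 0 T, HopfRel κ (e r) (-(s t)) (c • petal κ e j r η)
      (c • petal κ e j r (√(1 - s t / τ) • η)) := fun t ht =>
    (hopfRel_petal_back he hη hc (hN t ht).2.1 (hN t ht).2.2).reverse
  refine ⟨√(N T / ‖c‖ ^ 2) • c • e r j, ?_, ?_, ?_⟩
  · refine backwardTo_of_flow he.pos (N := N) (s := s) (regularSet_smul (petal_mem he hη) hc)
      (by rw [hpn]) (by rw [hpn]) hT (fun t ht => ⟨(hN t ht).1, ⟨_, hrel t ht⟩⟩) ?_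
    have hcont : ContinuousAt (fun t => √(N t / ‖c‖ ^ 2) •
        c • petal κ e j r (√(1 - s t / τ) • η)) T := by
      have hNc : Continuous N := by fun_prop
      have hsc : ContinuousAt s T :=
        (continuousAt_id.sub ((hNc.continuousAt.div_const _).log (by positivity))).div_const _
      refine ContinuousAt.smul (f := fun t => √(N t / ‖c‖ ^ 2))
        (Continuous.continuousAt (by fun_prop)) (ContinuousAt.const_smul ?_ c)
      exact ContinuousAt.comp (f := fun t => √(1 - s t / τ) • η)
        (differentiable_petal he r).continuous.continuousAt
        (show ContinuousAt (fun t => √(1 - s t / τ) • η) T by fun_prop)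
    have hlim := hcont.tendsto.mono_left (nhdsWithin_le_nhds (s := Set.Iio T))
    rw [hsT, div_self hτ.ne', sub_self, Real.sqrt_zero, zero_smul, petal_zero he] at hlim
    refine hlim.congr' ?_
    filter_upwards [Ioo_mem_nhdsLT hT] with t ht
    rw [FlowRel.flow_eq isOpen_regularSet contDiffOn_hopfField
      (hrel t (Set.Ioo_subset_Ico_self ht)), hpn]
  · rw [real_smul_C2, cross_smul, cross_smul, cross_apply_self, mul_zero, mul_zero]
  · rw [norm_smul, norm_smul, he.norm, Real.norm_of_nonneg (Real.sqrt_nonneg _), mul_one, mul_pow,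
      Real.sq_sqrt (by positivity), div_mul_cancel₀ _ (by positivity), hNT]

/-- The points of the `j`-th line whose squared norm satisfies `P j`. -/
def crossPart (e : Fin m → C2) (P : Fin m → ℝ → Prop) : Set C2 :=
  {z | ∃ j, cross (e j) z = 0 ∧ P j (‖z‖ ^ 2)}

/-- The points attracted by `S`. -/
def attractedBy (κ : Fin m → ℝ) (e : Fin m → C2) (S : Set C2) : Set C2 :=
  {p | p ∈ S ∨ ∃ q ∈ S, BackwardTo κ e p q}

omit he [NeZero m] in
theorem BackwardTo.mem_regularSet {e : Fin m → C2} {p q : C2} (h : BackwardTo κ e p q) :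
    p ∈ regularSet e := by
  obtain ⟨T, γ, hT, rfl, hγ, -⟩ := h
  exact (hγ 0 ⟨le_rfl, hT⟩).1

theorem stray_mem_attractedBy {P : Fin m → ℝ → Prop} {p : C2} (hp : p ∈ stray κ e r) :
    p ∈ attractedBy κ (e r) (crossPart (e r) P) ↔ ‖p‖ ^ 2 < ∑ i, κ i ∧ ∃ j, P j 0 := by
  constructor
  · rintro (⟨j, hj, -⟩ | ⟨q, ⟨j, hj, hP⟩, hq⟩)
    · exact absurd hj (stray_subset he hp j)
    · rcases eq_or_ne q 0 with rfl | hq0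
      · exact ⟨(hq.stray he).2, j, by simpa using hP⟩
      · obtain ⟨c, η, hc, rfl, -⟩ := hq.exists_petal he hq0 hj
        exact absurd ⟨(r, c, η), hc, rfl⟩ (hp.2 j)
  · rintro ⟨h, j, hj⟩
    exact Or.inr ⟨0, ⟨j, cross_zero_right _, by simpa using hj⟩, backwardTo_zero_of_stray he hp h⟩

/-- The number ρ is the squared norm of the limit on the line, so membership reduces to a condition
on the j-th disc alone. For η = 0 the point is on the line already and ρ = ‖c‖². -/
theorem petal_mem_attractedBy {P : Fin m → ℝ → Prop} {c η : ℂ} (hc : c ≠ 0) :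
    c • petal κ e j r η ∈ attractedBy κ (e r) (crossPart (e r) P) ↔
    0 < (∑ i, κ i) - ‖c‖ ^ 2 * (1 - Real.exp (-(∑ i, κ i) * ‖η‖ ^ 2)) ∧ ∃ ρ, P j ρ ∧
      ρ * ((∑ i, κ i) - ‖c‖ ^ 2 * (1 - Real.exp (-(∑ i, κ i) * ‖η‖ ^ 2))) =
        (∑ i, κ i) * ‖c‖ ^ 2 * Real.exp (-(∑ i, κ i) * ‖η‖ ^ 2) := by
  have hK := sum_weights_pos he
  rcases eq_or_ne η 0 with rfl | hη
  · simp only [norm_zero, ne_eq, OfNat.ofNat_ne_zero, not_false_eq_true, zero_pow, mul_zero,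
      Real.exp_zero, sub_self, sub_zero, mul_one]
    rw [petal_zero he]
    have hn : ‖c • e r j‖ ^ 2 = ‖c‖ ^ 2 := by rw [norm_smul, he.norm, mul_one]
    have hzero : cross (e r j) (c • e r j) = 0 := by rw [cross_smul, cross_apply_self, mul_zero]
    constructor
    · rintro (⟨i, hi, hP⟩ | ⟨q, hq, hq'⟩)
      · have hij : i = j := by
          by_contra hij
          rw [cross_smul] at hi
          exact mul_ne_zero hc (he.cross_ne r i j hij) hi
        subst hij
        exact ⟨hK, _, hP, by rw [hn]; ring⟩
      · exact absurd hzero (hq'.mem_regularSet j)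
    · rintro ⟨-, ρ, hP, h⟩
      refine Or.inl ⟨j, hzero, ?_⟩
      have : ρ = ‖c‖ ^ 2 := mul_right_cancel₀ hK.ne' (by linarith)
      rwa [hn, ← this]
  · constructor
    · rintro (⟨i, hi, -⟩ | ⟨q, ⟨i, hi, hP⟩, hq⟩)
      · exact absurd hi (regularSet_smul (petal_mem he hη) hc i)
      · rcases eq_or_ne q 0 with rfl | hq0
        · exact absurd ⟨(r, c, η), hc, rfl⟩ ((hq.stray he).1.2 j)
        · obtain ⟨c', η', hc', h1, h2, h3⟩ := hq.exists_petal he hq0 hi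
          obtain ⟨rfl, rfl, rfl⟩ := coneMap_injective he hc hc' h1
          exact ⟨h2, _, hP, h3⟩
    · rintro ⟨hL, ρ, hP, h⟩
      obtain ⟨q, hq1, hq2, hq3⟩ := exists_backwardTo_of_petal (j := j) (r := r) he hc hη hL
      refine Or.inr ⟨q, ⟨j, hq2, ?_⟩, hq1⟩
      rwa [mul_right_cancel₀ hL.ne' (hq3.trans h.symm)]

variable {a : Fin m → ℝ} (ha : ∀ j, 0 < a j)
include ha

/-- With L = K - ‖c‖²(1 - h), the limit has squared norm K‖c‖²h / L, and `shape` equals K - L +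
K‖c‖²h / a_j. Both conditions say K‖c‖²h / a_j < L, which also forces L > 0. -/
theorem attractedBy_discs : attractedBy κ (e r) (crossPart (e r) fun j ρ => ρ < a j) =
    {z | shape κ a e (r, z) < ∑ i, κ i} := by
  have hK := sum_weights_pos he
  ext p
  rcases eq_or_ne p 0 with rfl | hp
  · have : shape κ a e (r, 0) = 0 := by simp [shape]
    refine iff_of_true (Or.inl ⟨0, cross_zero_right _, by simpa using ha 0⟩) ?_
    rw [Set.mem_ofPred_eq, this]
    exact hK
  · rcases stray_or_exists_coneMap (κ := κ) (e := e) (r := r) hp with h | ⟨j, c, η, hc, rfl⟩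
    · rw [stray_mem_attractedBy he h, Set.mem_ofPred_eq, shape_stray a h]
      exact and_iff_left ⟨0, ha 0⟩
    · have hsh := shape_coneMap (j := j) he a (p := (r, c, η)) hc
      simp only [coneMap] at hsh
      rw [petal_mem_attractedBy he hc, Set.mem_ofPred_eq, hsh]
      have haj := ha j
      set K := ∑ i, κ i
      set h := Real.exp (-K * ‖η‖ ^ 2) with hh
      have hh0 : 0 < h := Real.exp_pos _
      have hc0 := norm_pos_iff.2 hc
      have hpos : 0 < K * ‖c‖ ^ 2 * h := by positivity
      have hid : ‖c‖ ^ 2 * (1 + (K / a j - 1) * h) =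
          K - (K - ‖c‖ ^ 2 * (1 - h)) + K * ‖c‖ ^ 2 * h / a j := by field_simp; ring
      rw [hid]
      constructor
      · rintro ⟨hL, ρ, hρ, h1⟩
        rw [← h1]
        have : ρ * (K - ‖c‖ ^ 2 * (1 - h)) / a j < K - ‖c‖ ^ 2 * (1 - h) := by
          rw [div_lt_iff₀ haj]; nlinarith
        linarith
      · intro h1
        have h2 : K * ‖c‖ ^ 2 * h / a j < K - ‖c‖ ^ 2 * (1 - h) := by linarith
        have hL : 0 < K - ‖c‖ ^ 2 * (1 - h) := lt_trans (by positivity) h2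
        refine ⟨hL, K * ‖c‖ ^ 2 * h / (K - ‖c‖ ^ 2 * (1 - h)), ?_, by field_simp⟩
        rw [div_lt_iff₀ haj] at h2
        rw [div_lt_iff₀ hL]
        linarith

theorem attractedBy_circles : attractedBy κ (e r) (crossPart (e r) fun j ρ => ρ = a j) =
    {z | shape κ a e (r, z) = ∑ i, κ i ∧ ∃ j, (r, z) ∈ attracted κ e j} := by
  have hK := sum_weights_pos he
  ext p
  rcases eq_or_ne p 0 with rfl | hp
  · have : shape κ a e (r, 0) = 0 := by simp [shape]
    refine iff_of_false ?_ ?_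
    · rintro (⟨j, -, h⟩ | ⟨q, -, h⟩)
      · simp only [norm_zero, ne_eq, OfNat.ofNat_ne_zero, not_false_eq_true, zero_pow] at h
        exact (ha j).ne h
      · exact regularSet_ne_zero h.mem_regularSet rfl
    · rw [Set.mem_ofPred_eq, this]
      exact fun h => hK.ne h.1
  · rcases stray_or_exists_coneMap (κ := κ) (e := e) (r := r) hp with h | ⟨j, c, η, hc, rfl⟩
    · rw [stray_mem_attractedBy he h, Set.mem_ofPred_eq]
      refine iff_of_false ?_ ?_
      · rintro ⟨-, j, hj⟩
        exact (ha j).ne hj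
      · rintro ⟨-, j, hj⟩
        exact h.2 j hj
    · have hsh := shape_coneMap (j := j) he a (p := (r, c, η)) hc
      simp only [coneMap] at hsh
      rw [petal_mem_attractedBy he hc, Set.mem_ofPred_eq, hsh,
        and_iff_left (⟨j, (r, c, η), hc, rfl⟩ : ∃ i, (r, c • petal κ e j r η) ∈ attracted κ e i)]
      have haj := ha j
      set K := ∑ i, κ i
      set h := Real.exp (-K * ‖η‖ ^ 2) with hh
      have hh0 : 0 < h := Real.exp_pos _
      have hc0 := norm_pos_iff.2 hc
      have hpos : 0 < K * ‖c‖ ^ 2 * h := by positivity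
      have hid : a j * (‖c‖ ^ 2 * (1 + (K / a j - 1) * h)) =
          a j * K - (a j * (K - ‖c‖ ^ 2 * (1 - h)) - K * ‖c‖ ^ 2 * h) := by field_simp; ring
      constructor
      · rintro ⟨hL, ρ, rfl, h1⟩
        rw [h1, sub_self, sub_zero] at hid
        exact mul_left_cancel₀ haj.ne' hid
      · intro h1
        rw [h1] at hid
        have h2 : a j * (K - ‖c‖ ^ 2 * (1 - h)) = K * ‖c‖ ^ 2 * h := by linarith
        exact ⟨pos_of_mul_pos_right (h2 ▸ hpos) haj.le, _, rfl, h2⟩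

end

/-! ### Unitary matrices, lines and the Liouville form -/

noncomputable section

/-- The first column of a unitary matrix, a unit vector of the line `crossLine u`. -/
def firstColumn (u : Matrix.unitaryGroup (Fin 2) ℂ) : C2 :=
  WithLp.toLp 2 fun i => (u : Matrix (Fin 2) (Fin 2) ℂ) i 0

/-- `e` is a unit vector of the line `crossLine u`. -/
def IsUnitVectorOf (e : C2) (u : Matrix.unitaryGroup (Fin 2) ℂ) : Prop :=
  ∃ ζ : ℂ, ‖ζ‖ = 1 ∧ e = ζ • firstColumn u

theorem unitaryAct_mul (u v : Matrix.unitaryGroup (Fin 2) ℂ) (z : C2) :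
    unitaryAct (u * v) z = unitaryAct u (unitaryAct v z) := by
  unfold unitaryAct
  rw [Matrix.mulVec_mulVec]
  rfl

theorem unitaryAct_inv_apply (u : Matrix.unitaryGroup (Fin 2) ℂ) (z : C2) :
    unitaryAct u⁻¹ (unitaryAct u z) = z := by
  rw [← unitaryAct_mul, inv_mul_cancel]
  simp [unitaryAct]

theorem unitaryAct_apply_inv (u : Matrix.unitaryGroup (Fin 2) ℂ) (z : C2) :
    unitaryAct u (unitaryAct u⁻¹ z) = z := by
  rw [← unitaryAct_mul, mul_inv_cancel]
  simp [unitaryAct]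

theorem inner_unitaryAct (u : Matrix.unitaryGroup (Fin 2) ℂ) (z w : C2) :
    inner ℂ (unitaryAct u z) (unitaryAct u w) = inner ℂ z w := by
  have h := Matrix.UnitaryGroup.star_mul_self u
  have e := fun i j => congrFun (congrFun h i) j
  have h00 := e 0 0
  have h01 := e 0 1
  have h10 := e 1 0
  have h11 := e 1 1
  simp [Matrix.mul_apply, Fin.sum_univ_two, Matrix.star_apply] at h00 h01 h10 h11
  simp [unitaryAct, inner_C2]
  linear_combination ((starRingEnd ℂ) (z 0) * w 0) * h00 + ((starRingEnd ℂ) (z 0) * w 1) * h01 +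
    ((starRingEnd ℂ) (z 1) * w 0) * h10 + ((starRingEnd ℂ) (z 1) * w 1) * h11

theorem norm_unitaryAct (u : Matrix.unitaryGroup (Fin 2) ℂ) (z : C2) : ‖unitaryAct u z‖ = ‖z‖ := by
  rw [norm_eq_sqrt_re_inner (𝕜 := ℂ), inner_unitaryAct, ← norm_eq_sqrt_re_inner]

theorem cross_firstColumn (u : Matrix.unitaryGroup (Fin 2) ℂ) (z : C2) :
    cross (firstColumn u) (unitaryAct u z) = (u : Matrix (Fin 2) (Fin 2) ℂ).det * z 1 := by
  simp [unitaryAct, cross, firstColumn, Matrix.det_fin_two]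
  ring

theorem unitary_det_ne_zero (u : Matrix.unitaryGroup (Fin 2) ℂ) :
    (u : Matrix (Fin 2) (Fin 2) ℂ).det ≠ 0 := by
  have h := congrArg Matrix.det (Matrix.UnitaryGroup.star_mul_self u)
  rw [Matrix.det_mul, Matrix.det_one] at h
  exact right_ne_zero_of_mul_eq_one h

theorem omegaSt_eq (v w : C2) : omegaSt v w = (inner ℂ v w).im / Real.pi := by
  simp [omegaSt, inner_C2, Fin.sum_univ_two]
  ring

theorem norm_firstColumn (u : Matrix.unitaryGroup (Fin 2) ℂ) : ‖firstColumn u‖ = 1 := by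
  have : firstColumn u = unitaryAct u !₂[1, 0] := by
    ext i; fin_cases i <;> simp [firstColumn, unitaryAct]
  rw [this, norm_unitaryAct, ← sq_eq_sq₀ (norm_nonneg _) zero_le_one, norm_sq_C2]
  simp

theorem radSq_mul_dAngle (i : Fin 2) (z w : C2) :
    radSq i z * dAngle i z w = (star (z i) * w i).im / (2 * Real.pi) := by
  rcases eq_or_ne (z i) 0 with h | h
  · simp [radSq, dAngle, h]
  · have h1 : ((‖z i‖ ^ 2 : ℝ) : ℂ) = star (z i) * z i := by
      rw [← Complex.normSq_eq_norm_sq, Complex.normSq_eq_conj_mul_self]; rfl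
    have h2 : star (z i) * w i = ((‖z i‖ ^ 2 : ℝ) : ℂ) * (w i / z i) := by
      rw [h1]; field_simp
    rw [h2, radSq, dAngle, Complex.im_ofReal_mul]
    ring

theorem stdLiouville_eq (τ : ℝ) (z w : C2) : stdLiouville τ z w =
    (τ * (w 1 / z 1).im - (inner ℂ z w).im) / (2 * Real.pi) := by
  have h0 := radSq_mul_dAngle 0 z w
  have h1 := radSq_mul_dAngle 1 z w
  rw [stdLiouville, sub_mul, h0, h1, inner_C2, Complex.add_im, dAngle]
  ring

section IsUnitVectorOf

variable {e : C2} {u : Matrix.unitaryGroup (Fin 2) ℂ} (h : IsUnitVectorOf e u)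
include h

theorem IsUnitVectorOf.exists_cross : ∃ c : ℂ, c ≠ 0 ∧ ∀ z, cross e z = c * unitaryAct u⁻¹ z 1 := by
  obtain ⟨ζ, hζ, rfl⟩ := h
  refine ⟨ζ * (u : Matrix (Fin 2) (Fin 2) ℂ).det, mul_ne_zero ?_ (unitary_det_ne_zero u),
    fun z => ?_⟩
  · rintro rfl; simp at hζ
  · rw [mul_assoc, ← cross_firstColumn, unitaryAct_apply_inv]
    simp [cross]; ring

theorem IsUnitVectorOf.mem_image {P : ℝ → Prop} {z : C2} :
    z ∈ unitaryAct u '' {z | z 1 = 0 ∧ P (radSq 0 z)} ↔ cross e z = 0 ∧ P (‖z‖ ^ 2) := by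
  obtain ⟨c, hc, hcross⟩ := h.exists_cross
  have hn : ∀ w : C2, w 1 = 0 → radSq 0 w = ‖w‖ ^ 2 := fun w hw => by
    rw [norm_sq_C2, hw, radSq]; simp
  constructor
  · rintro ⟨w, ⟨hw, hP⟩, rfl⟩
    rw [hcross, unitaryAct_inv_apply, hw, mul_zero, norm_unitaryAct, ← hn w hw]
    exact ⟨rfl, hP⟩
  · rintro ⟨h1, h2⟩
    rw [hcross, mul_eq_zero_iff_left hc] at h1
    refine ⟨unitaryAct u⁻¹ z, ⟨h1, ?_⟩, unitaryAct_apply_inv u z⟩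
    rwa [hn _ h1, norm_unitaryAct]

theorem IsUnitVectorOf.mem_crossLine {z : C2} : z ∈ crossLine u ↔ cross e z = 0 := by
  have := h.mem_image (P := fun _ => True) (z := z)
  simpa [crossLine] using this

end IsUnitVectorOf

variable {m : ℕ} [NeZero m] {κ a : Fin m → ℝ} {e : Fin m → C2}
  {u : Fin m → Matrix.unitaryGroup (Fin 2) ℂ} (h : ∀ j, IsUnitVectorOf (e j) (u j))
include h

/-- The part -∑ R_i dθ_i is invariant under unitary maps. The residue m κ_j compensates the
averaging, and dθ₂ moved by u_j is the imaginary part of d log ℓ_j, up to the factor 2π. -/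
theorem crossLiouville_eq (z w : C2) :
    crossLiouville κ u z w = omegaSt (liouvilleField κ e z) w := by
  have hm : (m : ℝ) ≠ 0 := NeZero.ne _
  have h1 : ∀ j, stdLiouville (m * κ j) (unitaryAct (u j)⁻¹ z) (unitaryAct (u j)⁻¹ w) =
      (m * (κ j * (cross (e j) w / cross (e j) z)).im - (inner ℂ z w).im) / (2 * Real.pi) := by
    intro j
    obtain ⟨c, hc, hcross⟩ := (h j).exists_cross
    rw [stdLiouville_eq, inner_unitaryAct, hcross, hcross, mul_div_mul_left _ _ hc,
      Complex.im_ofReal_mul]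
    ring
  rw [crossLiouville, Finset.sum_congr rfl fun j _ => h1 j, omegaSt_eq, liouvilleField,
    real_smul_C2, inner_smul_left, inner_sub_left, inner_gradLog, Complex.conj_ofReal,
    Complex.im_ofReal_mul, Complex.sub_im, Complex.im_sum, ← Finset.sum_div,
    Finset.sum_sub_distrib, ← Finset.mul_sum, Finset.sum_const, Finset.card_univ, Fintype.card_fin,
    nsmul_eq_mul]
  field_simp

theorem isLiouvilleVector_iff {z V : C2} :
    IsLiouvilleVector (crossLiouville κ u) z V ↔ V = liouvilleField κ e z := by
  constructor
  · intro hV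
    have h1 := hV (Complex.I • (V - liouvilleField κ e z))
    rw [crossLiouville_eq h, ← sub_eq_zero, omegaSt_eq, omegaSt_eq, ← sub_div, ← Complex.sub_im,
      ← inner_sub_left, inner_smul_right, inner_self_C2, div_eq_zero_iff] at h1
    have h2 := h1.resolve_right Real.pi_ne_zero
    rw [Complex.I_mul_im, Complex.ofReal_re] at h2
    rw [← sub_eq_zero, ← norm_eq_zero]
    exact pow_eq_zero_iff two_ne_zero |>.1 h2
  · rintro rfl w
    exact (crossLiouville_eq h z w).symm

theorem flowOut_eq (S : Set C2) :
    flowOut (crossLiouville κ u) (⋃ j, crossLine (u j)) S = attractedBy κ e S := by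
  ext p
  have hreg : ∀ z, z ∉ ⋃ j, crossLine (u j) ↔ z ∈ regularSet e := fun z => by
    simp [(h _).mem_crossLine, regularSet]
  simp only [flowOut, attractedBy, BackwardTo, hreg, isLiouvilleVector_iff h, Set.mem_ofPred_eq,
    exists_eq_left]
  refine or_congr Iff.rfl ⟨?_, ?_⟩
  · rintro ⟨T, γ, h1, h2, h3, q, hq, h4⟩
    exact ⟨q, hq, T, γ, h1, h2, h3, h4⟩
  · rintro ⟨q, hq, T, γ, h1, h2, h3, h4⟩
    exact ⟨T, γ, h1, h2, h3, q, hq, h4⟩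

end

noncomputable section

variable {m : ℕ} [NeZero m] {κ a : Fin m → ℝ} {e : ℝ → Fin m → C2} (he : IsCrossFamily κ e)
  (ha : ∀ j, 0 < a j) {u : Fin m → Matrix.unitaryGroup (Fin 2) ℂ} {r : ℝ}
  (h : ∀ j, IsUnitVectorOf (e r j) (u j))
include he ha h

theorem crossBasin_eq : crossBasin κ a u = {z | shape κ a e (r, z) < ∑ i, κ i} := by
  rw [crossBasin, flowOut_eq h, ← attractedBy_discs he ha]
  congr 1
  ext z
  rw [Set.mem_iUnion]
  exact exists_congr fun j => (h j).mem_image (P := fun ρ => ρ < a j)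

theorem basinRegularBoundary_eq : basinRegularBoundary κ a u =
    {z | shape κ a e (r, z) = ∑ i, κ i ∧ ∃ j, (r, z) ∈ attracted κ e j} := by
  rw [basinRegularBoundary, flowOut_eq h, ← attractedBy_circles he ha]
  congr 1
  ext z
  rw [Set.mem_iUnion]
  exact exists_congr fun j => (h j).mem_image (P := fun ρ => ρ = a j)

end

/-! ### The contact form on a petal -/

noncomputable section

section calculus

variable {E F : Type*} [NormedAddCommGroup E] [NormedSpace ℝ E] [NormedAddCommGroup F]
  [NormedSpace ℝ F]

theorem DifferentiableAt.hasDerivAt_line {f : E → F} {x : E} (hf : DifferentiableAt ℝ f x) (v : E) :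
    HasDerivAt (fun t : ℝ => f (x + t • v)) (fderiv ℝ f x v) 0 := by
  have h1 : HasDerivAt (fun t : ℝ => x + t • v) v 0 := by
    simpa using ((hasDerivAt_id (0 : ℝ)).smul_const v).const_add x
  have h2 := hf.hasFDerivAt
  rw [show x = x + (0 : ℝ) • v by simp] at h2
  have h3 := h2.comp_hasDerivAt (0 : ℝ) h1
  rw [zero_smul, add_zero] at h3
  exact h3

/-- The derivatives along two commuting linear vector fields commute. -/
theorem fderiv_fderiv_apply_comm {f : E → F} {x : E} (hf : ContDiffAt ℝ ∞ f x) (L M : E →L[ℝ] E)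
    (hLM : L (M x) = M (L x)) :
    fderiv ℝ (fun y => fderiv ℝ f y (L y)) x (M x) =
      fderiv ℝ (fun y => fderiv ℝ f y (M y)) x (L x) := by
  replace hf : ContDiffAt ℝ 2 f x := by exact_mod_cast contDiffAt_infty.1 hf 2
  have h2 : DifferentiableAt ℝ (fderiv ℝ f) x :=
    (hf.fderiv_right (m := 1) (by norm_num)).differentiableAt (by simp)
  have hsymm : IsSymmSndFDerivAt ℝ f x := hf.isSymmSndFDerivAt (by simp)
  rw [(h2.hasFDerivAt.clm_apply L.hasFDerivAt).fderiv,
    (h2.hasFDerivAt.clm_apply M.hasFDerivAt).fderiv]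
  simp [hLM, hsymm.eq (M x) (L x)]

theorem eq_of_tendsto_of_hasDerivAt_zero {f : ℝ → ℝ} (h : ∀ k > 0, HasDerivAt f 0 k) {l : ℝ}
    (hl : Filter.Tendsto f (𝓝[>] 0) (𝓝 l)) : f 1 = l := by
  refine tendsto_nhds_unique (tendsto_const_nhds.congr' ?_) hl
  filter_upwards [self_mem_nhdsWithin] with k hk
  have := (convex_Ioi (0 : ℝ)).norm_image_sub_le_of_norm_hasDerivWithin_le (C := 0)
    (fun x hx => (h x hx).hasDerivWithinAt) (by simp) hk (Set.mem_Ioi.2 one_pos)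
  rw [zero_mul, norm_le_zero_iff, sub_eq_zero] at this
  exact this

theorem HasDerivAt.cross {f : ℝ → C2} {f' : C2} {x : ℝ} (hf : HasDerivAt f f' x) (v : C2) :
    HasDerivAt (fun t => cross v (f t)) (cross v f') x := by
  have := ((crossL v).restrictScalars ℝ).hasFDerivAt.comp_hasDerivAt x hf
  simpa [Function.comp_def] using this

theorem DifferentiableAt.cross {f : E → C2} {x : E} (hf : DifferentiableAt ℝ f x) (v : C2) :
    DifferentiableAt ℝ (fun t => cross v (f t)) x := by
  have := ((crossL v).restrictScalars ℝ).differentiableAt.comp x hf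
  simpa [Function.comp_def] using this

theorem DifferentiableAt.cross_div {f g : E → C2} {x : E} (hf : DifferentiableAt ℝ f x)
    (hg : DifferentiableAt ℝ g x) {v : C2} (h : _root_.cross v (g x) ≠ 0) :
    DifferentiableAt ℝ (fun t => _root_.cross v (f t) / _root_.cross v (g t)) x := by
  simp only [div_eq_mul_inv]
  exact (hf.cross v).fun_mul ((hg.cross v).fun_inv h)

omit [NormedSpace ℝ E] in
theorem Continuous.cross {f : E → C2} (hf : Continuous f) (v : C2) :
    Continuous fun t => cross v (f t) := by
  simpa [Function.comp_def] using (crossL v).continuous.comp hf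

end calculus

variable {m : ℕ} {κ : Fin m → ℝ} {e : ℝ → Fin m → C2} {j : Fin m} (he : IsCrossFamily κ e) (r : ℝ)
include he

theorem contDiff_petal_snd : ContDiff ℝ ∞ fun η => petal κ e j r η :=
  (contDiff_petal he).comp (contDiff_prodMk_right r)

/-- Elapsed time is ‖η‖², which grows at rate 2‖η‖² when η moves with velocity η. -/
theorem fderiv_petal_radial {η : ℂ} (hη : η ≠ 0) : fderiv ℝ (fun η => petal κ e j r η) η η =
    (2 * ‖η‖ ^ 2) • hopfField κ (e r) (petal κ e j r η) := by
  have hn : 0 < ‖η‖ := norm_pos_iff.2 hη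
  have h1 : HasDerivAt (fun s : ℝ => (√(‖η‖ ^ 2 + s) * ‖η‖⁻¹) • η) ((1 / (2 * ‖η‖ ^ 2)) • η) 0 := by
    have h2 : HasDerivAt (fun s : ℝ => √(‖η‖ ^ 2 + s)) (1 / (2 * ‖η‖)) 0 := by
      have := ((hasDerivAt_id (0 : ℝ)).const_add (‖η‖ ^ 2)).sqrt (by simp; exact hη)
      simpa [Real.sqrt_sq hn.le] using this
    have h3 := (h2.mul_const ‖η‖⁻¹).smul_const η
    refine h3.congr_deriv ?_
    congr 1
    field_simp
  have h0 : (√(‖η‖ ^ 2 + 0) * ‖η‖⁻¹) • η = η := by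
    rw [add_zero, Real.sqrt_sq hn.le, mul_inv_cancel₀ hn.ne', one_smul]
  have h4 := ((contDiff_petal_snd (j := j) he r).differentiable (by simp) η).hasFDerivAt
  rw [← h0] at h4
  have h5 := h4.comp_hasDerivAt (0 : ℝ) h1
  rw [h0] at h5
  have hmem := petal_mem (r := r) (j := j) he hη
  have h6 := hasDerivAt_flow isOpen_regularSet (contDiffOn_hopfField (κ := κ))
    (t := 0) (x := petal κ e j r η) ⟨_, FlowRel.refl hmem⟩
  rw [(FlowRel.refl hmem).flow_eq isOpen_regularSet contDiffOn_hopfField] at h6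
  have h7 : HasDerivWithinAt (fun s : ℝ => petal κ e j r ((√(‖η‖ ^ 2 + s) * ‖η‖⁻¹) • η))
      (hopfField κ (e r) (petal κ e j r η)) (Set.Ici 0) 0 := by
    refine h6.hasDerivWithinAt.congr (fun s hs => ?_) ?_
    · exact (FlowRel.flow_eq isOpen_regularSet contDiffOn_hopfField (petal_stretch he r hη hs)).symm
    · exact (FlowRel.flow_eq isOpen_regularSet contDiffOn_hopfField
        (petal_stretch he r hη le_rfl)).symm
  have h8 := (uniqueDiffWithinAt_Ici (0 : ℝ)).eq_deriv _ h5.hasDerivWithinAt h7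
  rw [map_smul] at h8
  rw [← h8, smul_smul]
  rw [mul_one_div_cancel (by positivity), one_smul]

theorem im_inner_petal_radial (η : ℂ) :
    (inner ℂ (petal κ e j r η) (fderiv ℝ (fun η => petal κ e j r η) η η)).im = 0 := by
  rcases eq_or_ne η 0 with rfl | hη
  · simp
  · rw [fderiv_petal_radial he r hη, real_smul_C2, inner_smul_right,
      inner_hopfField (petal_mem he hη)]
    simp

theorem im_inner_gradLog_petal_radial {η : ℂ} (hη : η ≠ 0) :
    (∑ i, (κ i : ℂ) * (cross (e r i) (fderiv ℝ (fun η => petal κ e j r η) η η) /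
      cross (e r i) (petal κ e j r η))).im = 0 := by
  rw [← inner_gradLog, fderiv_petal_radial he r hη, real_smul_C2, inner_smul_right,
      inner_gradLog_hopfField (petal_mem he hη), ← Complex.ofReal_mul, Complex.ofReal_im]

/-- The angular derivative of the petal. -/
def petalAngular (κ : Fin m → ℝ) (e : ℝ → Fin m → C2) (j : Fin m) (r : ℝ) (η : ℂ) : C2 :=
  fderiv ℝ (fun η => petal κ e j r η) η (Complex.I * η)

theorem contDiff_fderiv_petal (L : ℂ →L[ℝ] ℂ) :
    ContDiff ℝ ∞ fun η => fderiv ℝ (fun η => petal κ e j r η) η (L η) :=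
  ((contDiff_petal_snd he r).fderiv_right (m := ∞) (by simp)).clm_apply L.contDiff

/-- Multiplication by the imaginary unit. -/
def mulIL : ℂ →L[ℝ] ℂ := Complex.I • ContinuousLinearMap.id ℝ ℂ

omit he in
theorem mulIL_apply (η : ℂ) : mulIL η = Complex.I * η := rfl

theorem contDiff_petalAngular : ContDiff ℝ ∞ fun η => petalAngular κ e j r η :=
  contDiff_fderiv_petal he r mulIL

theorem fderiv_petalAngular_radial (η : ℂ) : fderiv ℝ (fun η => petalAngular κ e j r η) η η =
    fderiv ℝ (fun η => fderiv ℝ (fun η => petal κ e j r η) η η) η (Complex.I * η) :=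
  fderiv_fderiv_apply_comm (contDiff_petal_snd he r).contDiffAt mulIL (ContinuousLinearMap.id ℝ ℂ) rfl

/-- Differentiating the vanishing radial component in the angular direction shows that the radial
derivative of the angular component is twice the symplectic pairing of the radial and angular
derivatives. The radial derivative is 2‖η‖² times `hopfField`, whose two terms give the right side.
-/
theorem fderiv_im_inner_petalAngular {η : ℂ} (hη : η ≠ 0) :
    fderiv ℝ (fun η => (inner ℂ (petal κ e j r η) (petalAngular κ e j r η)).im) η η =
    2 * ‖η‖ ^ 2 * ((∑ i, (κ i : ℂ) * (cross (e r i) (petalAngular κ e j r η) /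
      cross (e r i) (petal κ e j r η))).im -
      (∑ i, κ i) * (inner ℂ (petal κ e j r η) (petalAngular κ e j r η)).im) := by
  have hg := (contDiff_petal_snd (j := j) he r).differentiable (by simp) η
  have h2 := (contDiff_petalAngular (j := j) he r).differentiable (by simp) η
  have h1 := (contDiff_fderiv_petal (j := j) he r (ContinuousLinearMap.id ℝ ℂ)).differentiable
    (by simp) η
  simp only [ContinuousLinearMap.id_apply] at h1
  have hA := Complex.imCLM.hasFDerivAt.comp_hasDerivAt 0
    ((hg.hasDerivAt_line η).inner ℂ (h2.hasDerivAt_line η))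
  have hB := Complex.imCLM.hasFDerivAt.comp_hasDerivAt 0
    ((hg.hasDerivAt_line (Complex.I * η)).inner ℂ (h1.hasDerivAt_line (Complex.I * η)))
  have hB0 : (fun t : ℝ => (inner ℂ (petal κ e j r (η + t • (Complex.I * η)))
      (fderiv ℝ (fun η => petal κ e j r η) (η + t • (Complex.I * η))
        (η + t • (Complex.I * η)))).im) = fun _ => 0 := by
    funext t; exact im_inner_petal_radial he r _
  have hB' := hB.unique (by
    have := hasDerivAt_const (0 : ℝ) (0 : ℝ)
    rw [← hB0] at this
    exact this)
  have hd : DifferentiableAt ℝ (fun η => (inner ℂ (petal κ e j r η) (petalAngular κ e j r η)).im) η :=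
    Complex.imCLM.differentiableAt.comp η (hg.inner ℂ h2)
  have hA' := (hd.hasDerivAt_line η).unique hA
  rw [hA']
  simp only [zero_smul, add_zero, Complex.imCLM_apply, Complex.add_im,
    fderiv_petalAngular_radial he r η] at hB' ⊢
  have hsw : (inner ℂ (fderiv ℝ (fun η => petal κ e j r η) η (Complex.I * η))
      (fderiv ℝ (fun η => petal κ e j r η) η η)).im =
      -(inner ℂ (fderiv ℝ (fun η => petal κ e j r η) η η) (petalAngular κ e j r η)).im := by
    rw [← inner_conj_symm, Complex.conj_im]; rfl
  rw [hsw] at hB'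
  have : (inner ℂ (fderiv ℝ (fun η => petal κ e j r η) η η) (petalAngular κ e j r η)).im =
      ‖η‖ ^ 2 * ((∑ i, (κ i : ℂ) * (cross (e r i) (petalAngular κ e j r η) /
      cross (e r i) (petal κ e j r η))).im -
      (∑ i, κ i) * (inner ℂ (petal κ e j r η) (petalAngular κ e j r η)).im) := by
    rw [fderiv_petal_radial he r hη, hopfField, norm_petal he, ← inner_gradLog]
    simp only [real_smul_C2, inner_smul_left, inner_sub_left, Complex.conj_ofReal,
      Complex.im_ofReal_mul, Complex.sub_im]
    ring
  linarith


/-- The form Im ∑ κ_i d log ℓ_i is closed and vanishes on radial vectors. Radial and angular fields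
commute, so its angular component is constant along rays. -/
theorem fderiv_im_cross_petalAngular {η : ℂ} (hη : η ≠ 0) :
    fderiv ℝ (fun η => (∑ i, (κ i : ℂ) * (cross (e r i) (petalAngular κ e j r η) /
      cross (e r i) (petal κ e j r η))).im) η η = 0 := by
  have hg := (contDiff_petal_snd (j := j) he r).differentiable (by simp) η
  have h2 := (contDiff_petalAngular (j := j) he r).differentiable (by simp) η
  have h1 := (contDiff_fderiv_petal (j := j) he r (ContinuousLinearMap.id ℝ ℂ)).differentiable
    (by simp) η
  simp only [ContinuousLinearMap.id_apply] at h1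
  have hmem := petal_mem (r := r) (j := j) he hη
  have hdiv : ∀ {a b : ℝ → C2} {a' b' : C2}, HasDerivAt a a' 0 → HasDerivAt b b' 0 →
      b 0 ∈ regularSet (e r) →
      HasDerivAt (fun t => (∑ i, (κ i : ℂ) * (cross (e r i) (a t) / cross (e r i) (b t))).im)
        (∑ i, (κ i : ℂ) * ((cross (e r i) a' * cross (e r i) (b 0) -
          cross (e r i) (a 0) * cross (e r i) b') / cross (e r i) (b 0) ^ 2)).im 0 := by
    intro a b a' b' ha hb h0
    refine Complex.imCLM.hasFDerivAt.comp_hasDerivAt 0 (HasDerivAt.fun_sum fun i _ => ?_)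
    exact ((ha.cross _).div (hb.cross _) (h0 i)).const_mul _
  have hA := hdiv (h2.hasDerivAt_line η) (hg.hasDerivAt_line η) (by simpa using hmem)
  have hB := hdiv (h1.hasDerivAt_line (Complex.I * η)) (hg.hasDerivAt_line (Complex.I * η))
    (by simpa using hmem)
  have hB0 : (fun t : ℝ => (∑ i, (κ i : ℂ) * (cross (e r i)
      (fderiv ℝ (fun η => petal κ e j r η) (η + t • (Complex.I * η)) (η + t • (Complex.I * η))) /
      cross (e r i) (petal κ e j r (η + t • (Complex.I * η))))).im) =ᶠ[𝓝 0] fun _ => 0 := by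
    have : ContinuousAt (fun t : ℝ => η + t • (Complex.I * η)) 0 := by fun_prop
    filter_upwards [this.eventually_ne (by simpa using hη)] with t ht using
      im_inner_gradLog_petal_radial he r ht
  have hB' := hB.unique ((hasDerivAt_const (0 : ℝ) (0 : ℝ)).congr_of_eventuallyEq hB0)
  have hd : DifferentiableAt ℝ (fun η => (∑ i, (κ i : ℂ) * (cross (e r i) (petalAngular κ e j r η) /
      cross (e r i) (petal κ e j r η))).im) η := by
    refine Complex.imCLM.differentiableAt.comp η (DifferentiableAt.fun_sum fun i _ => ?_)
    exact (h2.cross_div hg (hmem i)).const_mul _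
  rw [(hd.hasDerivAt_line η).unique hA]
  simp only [zero_smul, add_zero, fderiv_petalAngular_radial he r η] at hB' ⊢
  rw [← hB']
  refine congrArg Complex.im ?_
  refine Finset.sum_congr rfl fun i _ => ?_
  rw [petalAngular]
  ring

/-- On its own petal ℓ_j vanishes to first order at η = 0, with a derivative proportional to η, so
its logarithmic angular derivative tends to i. The other forms do not vanish at the pole. -/
theorem cross_petal_tendsto {η : ℂ} (hη : η ≠ 0) (i : Fin m) :
    Filter.Tendsto (fun k : ℝ => cross (e r i) (petalAngular κ e j r (k • η)) /
      cross (e r i) (petal κ e j r (k • η))) (𝓝[>] 0) (𝓝 (if i = j then Complex.I else 0)) := by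
  have hray : HasDerivAt (fun k : ℝ => k • η) η 0 := by
    simpa using (hasDerivAt_id (0 : ℝ)).smul_const η
  have hq0 : petalAngular κ e j r 0 = 0 := by simp [petalAngular]
  split_ifs with hij
  · subst hij
    have hne : cross (e r i) (perp (e r i)) ≠ 0 := by
      rw [← inner_perp, inner_self_C2]
      have := he.norm r i
      have h2 : ‖perp (e r i)‖ ^ 2 = 1 := by
        rw [norm_sq_C2]; simp
        rw [add_comm, ← norm_sq_C2, this, one_pow]
      rw [h2]; simp
    have hd : ∀ {f : ℂ → C2} {v : C2}, cross (e r i) (f 0) = 0 → DifferentiableAt ℝ f 0 →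
        fderiv ℝ f 0 η = v → Filter.Tendsto (fun k : ℝ => cross (e r i) (f (k • η)) / (k : ℂ))
          (𝓝[>] 0) (𝓝 (cross (e r i) v)) := by
      intro f v h0 hf hv
      have h1 := hf.hasDerivAt_line η
      simp only [zero_add] at h1
      have h3 := (h1.cross (e r i)).tendsto_slope_zero_right
      rw [hv] at h3
      refine h3.congr fun k => ?_
      simp [h0, div_eq_inv_mul]
    have h1 := hd (by rw [petal_zero he, cross_apply_self])
      ((contDiff_petal_snd (j := i) he r).differentiable (by simp) 0) (fderiv_petal_zero he r η)
    have h2 := hd (by rw [hq0, cross_zero_right])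
      ((contDiff_petalAngular (j := i) he r).differentiable (by simp) 0) (v :=
        ((√(κ i) : ℂ) * (Complex.I * η)) • perp (e r i)) (by
      rw [← fderiv_petal_zero he]
      have h3 : ContDiff ℝ ∞ (fderiv ℝ fun η => petal κ e i r η) :=
        (contDiff_petal_snd he r).fderiv_right (by simp)
      have h4 := ((h3.differentiable (by simp) 0).hasFDerivAt.clm_apply
        (mulIL.hasFDerivAt (x := (0 : ℂ)))).fderiv
      have h5 := congrArg (fun L => L η) h4
      simp only [mulIL_apply, mul_zero] at h5
      refine h5.trans ?_
      simp [mulIL_apply])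
    have hκ : (√(κ i) : ℂ) ≠ 0 := by exact_mod_cast (Real.sqrt_pos.2 (he.pos i)).ne'
    have h3 := h2.div h1 (by
      rw [cross_smul]; exact mul_ne_zero (mul_ne_zero hκ hη) hne)
    have h4 : cross (e r i) (((√(κ i) : ℂ) * (Complex.I * η)) • perp (e r i)) /
        cross (e r i) (((√(κ i) : ℂ) * η) • perp (e r i)) = Complex.I := by
      rw [cross_smul, cross_smul]; field_simp
    rw [h4] at h3
    refine h3.congr' ?_
    filter_upwards [self_mem_nhdsWithin] with k hk
    have : (k : ℂ) ≠ 0 := by exact_mod_cast (Set.mem_Ioi.1 hk).ne'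
    rw [Pi.div_apply, div_div_div_cancel_right₀ this]
  · have hc1 : Continuous fun k : ℝ => cross (e r i) (petalAngular κ e j r (k • η)) :=
      ((contDiff_petalAngular (κ := κ) (j := j) he r).continuous.comp
        (show Continuous fun k : ℝ => k • η by fun_prop)).cross _
    have hc2 : Continuous fun k : ℝ => cross (e r i) (petal κ e j r (k • η)) :=
      ((contDiff_petal_snd (κ := κ) (j := j) he r).continuous.comp
        (show Continuous fun k : ℝ => k • η by fun_prop)).cross _
    have h1 := hc1.tendsto 0
    have h2 := hc2.tendsto 0
    rw [zero_smul, hq0, cross_zero_right] at h1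
    rw [zero_smul, petal_zero he] at h2
    have := h1.div h2 (he.cross_ne r i j hij)
    rw [zero_div] at this
    exact this.mono_left nhdsWithin_le_nhds

theorem im_cross_petalAngular {η : ℂ} (hη : η ≠ 0) :
    (∑ i, (κ i : ℂ) * (cross (e r i) (petalAngular κ e j r η) /
      cross (e r i) (petal κ e j r η))).im = κ j := by
  have h1 := eq_of_tendsto_of_hasDerivAt_zero (l := κ j) (f := fun k : ℝ =>
    (∑ i, (κ i : ℂ) * (cross (e r i) (petalAngular κ e j r (k • η)) /
      cross (e r i) (petal κ e j r (k • η)))).im) (fun k hk => ?_) ?_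
  · simpa using h1
  · have hkη : k • η ≠ 0 := smul_ne_zero (ne_of_gt hk) hη
    have hd : DifferentiableAt ℝ (fun η => (∑ i, (κ i : ℂ) * (cross (e r i)
        (petalAngular κ e j r η) / cross (e r i) (petal κ e j r η))).im) (k • η) := by
      refine Complex.imCLM.differentiableAt.comp _ (DifferentiableAt.fun_sum fun i _ => ?_)
      exact (((contDiff_petalAngular he r).differentiable (by simp) _).cross_div
        ((contDiff_petal_snd he r).differentiable (by simp) _) (petal_mem he hkη i)).const_mul _
    have h2 := hd.hasFDerivAt.comp_hasDerivAt k ((hasDerivAt_id k).smul_const η)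
    refine h2.congr_deriv ?_
    have h3 := fderiv_im_cross_petalAngular (j := j) he r hkη
    rw [map_smul, smul_eq_mul] at h3
    rw [one_smul]
    exact (mul_eq_zero.1 h3).resolve_left (ne_of_gt hk)
  · have := tendsto_finsetSum Finset.univ fun i _ =>
      (cross_petal_tendsto (j := j) he r hη i).const_mul (κ i : ℂ)
    have := (Complex.continuous_im.tendsto _).comp this
    simp only [mul_ite, mul_zero, Finset.sum_ite_eq', Finset.mem_univ, if_true] at this
    rw [Complex.im_ofReal_mul, Complex.I_im, mul_one] at this
    exact this

/-- The angular component of the pull-back of the contact form under a petal. -/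
theorem im_inner_petalAngular (η : ℂ) : (∑ i, κ i) *
    (inner ℂ (petal κ e j r η) (petalAngular κ e j r η)).im =
    κ j * (1 - Real.exp (-(∑ i, κ i) * ‖η‖ ^ 2)) := by
  rcases eq_or_ne η 0 with rfl | hη
  · simp [petalAngular]
  set K := ∑ i, κ i
  let A : ℂ → ℝ := fun η => (inner ℂ (petal κ e j r η) (petalAngular κ e j r η)).im
  have hA : Differentiable ℝ A := fun η => Complex.imCLM.differentiableAt.comp η
    (((contDiff_petal_snd he r).differentiable (by simp) η).inner ℂ
      ((contDiff_petalAngular he r).differentiable (by simp) η))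
  -- Along the ray, dA/dk = 2k‖η‖²(κ_j - K A). The integrating factor exp(K k²‖η‖²) makes E
  -- constant, and its value at k = 0 is -κ_j.
  let E : ℝ → ℝ := fun k => Real.exp (K * (k ^ 2 * ‖η‖ ^ 2)) * (K * A (k • η) - κ j)
  have hE : Continuous E := by
    have := hA.continuous
    fun_prop
  have hderiv : ∀ k > 0, HasDerivAt E 0 k := by
    intro k hk
    have hkη : k • η ≠ 0 := smul_ne_zero (ne_of_gt hk) hη
    have h2 := (hA (k • η)).hasFDerivAt.comp_hasDerivAt k ((hasDerivAt_id k).smul_const η)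
    rw [one_smul] at h2
    have h3 := fderiv_im_inner_petalAngular (j := j) he r hkη
    rw [im_cross_petalAngular he r hkη, map_smul, smul_eq_mul, norm_smul, mul_pow,
      Real.norm_of_nonneg (le_of_lt hk)] at h3
    have h4 : fderiv ℝ A (k • η) η = 2 * k * ‖η‖ ^ 2 * (κ j - K * A (k • η)) := by
      refine mul_left_cancel₀ (ne_of_gt hk) (h3.trans ?_)
      ring
    have h5 : HasDerivAt (fun k : ℝ => K * (k ^ 2 * ‖η‖ ^ 2)) (K * (2 * k * ‖η‖ ^ 2)) k := by
      have := ((hasDerivAt_pow 2 k).mul_const (‖η‖ ^ 2)).const_mul K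
      simpa using this
    have h6 := h5.exp.mul ((h2.const_mul K).sub_const (κ j))
    refine h6.congr_deriv ?_
    rw [h4]
    simp only [Function.comp, id]
    ring
  have h1 := eq_of_tendsto_of_hasDerivAt_zero hderiv
    ((hE.tendsto 0).mono_left nhdsWithin_le_nhds)
  have hA0 : A 0 = 0 := by simp [A, petalAngular]
  simp only [E, zero_smul, hA0, one_smul, one_pow, one_mul, zero_pow two_ne_zero, zero_mul,
    mul_zero, Real.exp_zero, zero_sub] at h1
  change K * A η = _
  have h2 : Real.exp (-K * ‖η‖ ^ 2) * Real.exp (K * ‖η‖ ^ 2) = 1 := by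
    rw [← Real.exp_add]; simp
  linear_combination Real.exp (-K * ‖η‖ ^ 2) * h1 - (K * A η - κ j) * h2

theorem im_inner_fderiv_petal {η : ℂ} (hη : η ≠ 0) (v : ℂ) : (∑ i, κ i) *
    (inner ℂ (petal κ e j r η) (fderiv ℝ (fun η => petal κ e j r η) η v)).im =
    (v / η).im * (κ j * (1 - Real.exp (-(∑ i, κ i) * ‖η‖ ^ 2))) := by
  have hv : v = (v / η).re • η + (v / η).im • (Complex.I * η) := by
    have h1 : v = (v / η) * η := (div_mul_cancel₀ v hη).symm
    conv_lhs => rw [h1, ← Complex.re_add_im (v / η)]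
    simp only [Complex.real_smul]
    ring
  conv_lhs => rw [hv]
  rw [map_add, map_smul, map_smul, real_smul_C2, real_smul_C2, inner_add_right, inner_smul_right,
    inner_smul_right, Complex.add_im, Complex.im_ofReal_mul, Complex.im_ofReal_mul,
    im_inner_petal_radial he, mul_zero, zero_add, mul_left_comm]
  congr 1
  exact im_inner_petalAngular he r η

/-- The pull-back of the contact form under a petal does not depend on the parameter. -/
theorem im_inner_fderiv_petal_eq [NeZero m] (r' : ℝ) (η v : ℂ) :
    (inner ℂ (petal κ e j r η) (fderiv ℝ (fun η => petal κ e j r η) η v)).im =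
    (inner ℂ (petal κ e j r' η) (fderiv ℝ (fun η => petal κ e j r' η) η v)).im := by
  rcases eq_or_ne η 0 with rfl | hη
  · rw [fderiv_petal_zero he, fderiv_petal_zero he, petal_zero he, petal_zero he, inner_smul_right,
      inner_smul_right, inner_perp_right, inner_perp_right, cross_apply_self, cross_apply_self]
  · refine mul_left_cancel₀ (sum_weights_pos he).ne' ?_
    rw [im_inner_fderiv_petal he r hη, im_inner_fderiv_petal he r' hη]

end

/-! ### The Hamiltonian of the moving cone -/

noncomputable section

theorem HasDerivAt.snd_prod {E F : Type*} [NormedAddCommGroup E] [NormedSpace ℝ E]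
    [NormedAddCommGroup F] [NormedSpace ℝ F] {γ : ℝ → E × F} {γ' : E × F} {t : ℝ}
    (h : HasDerivAt γ γ' t) : HasDerivAt (fun t => (γ t).2) γ'.2 t :=
  (ContinuousLinearMap.snd ℝ E F).hasFDerivAt.comp_hasDerivAt t h

variable {m : ℕ} (κ : Fin m → ℝ) (e : ℝ → Fin m → C2) (j : Fin m)

/-- The velocity of the points of a cone when the parameter moves. -/
def coneDrift (p : ℝ × ℂ × ℂ) : C2 := (fderiv ℝ (coneMap κ e j) p (1, 0, 0)).2

/-- The velocity field of the moving cone. -/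
def coneField (q : ℝ × C2) : C2 := coneDrift κ e j (coneInv κ e j q)

/-- The Hamiltonian function of the moving cone. -/
def coneHam (q : ℝ × C2) : ℝ := (inner ℂ (coneField κ e j q) q.2).im

variable {κ e j}

section

variable (he : IsCrossFamily κ e)
include he

theorem contDiff_coneDrift : ContDiff ℝ ∞ (coneDrift κ e j) :=
  contDiff_snd.comp (((contDiff_coneMap he).fderiv_right (m := ∞) (by simp)).clm_apply
    contDiff_const)

theorem contDiffOn_coneField : ContDiffOn ℝ ∞ (coneField κ e j) (attracted κ e j) :=
  (contDiff_coneDrift he).comp_contDiffOn (contDiffOn_coneInv he)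

theorem contDiffOn_coneHam : ContDiffOn ℝ ∞ (coneHam κ e j) (attracted κ e j) :=
  Complex.imCLM.contDiff.comp_contDiffOn
    ((contDiffOn_coneField he).inner ℂ contDiff_snd.contDiffOn)

theorem hasDerivAt_coneMap_fst (p : ℝ × ℂ × ℂ) :
    HasDerivAt (fun r => (coneMap κ e j (r, p.2)).2) (coneDrift κ e j p) p.1 := by
  have h1 : HasDerivAt (fun r : ℝ => (r, p.2)) ((1 : ℝ), ((0 : ℂ), (0 : ℂ))) p.1 :=
    (hasDerivAt_id p.1).prodMk (hasDerivAt_const _ _)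
  have h2 := ((contDiff_coneMap (j := j) he).differentiable (by simp) p).hasFDerivAt
  exact (ContinuousLinearMap.snd ℝ ℝ C2).hasFDerivAt.comp_hasDerivAt p.1
    (h2.comp_hasDerivAt p.1 h1)

theorem hasDerivAt_coneMap_fst' (r : ℝ) (x : ℂ × ℂ) : HasDerivAt (fun r => coneMap κ e j (r, x))
    (1, coneDrift κ e j (r, x)) r :=
  (hasDerivAt_id r).prodMk (hasDerivAt_coneMap_fst he (r, x))

/-- The fibre maps of `coneMap` pull Im⟨z, dz⟩ back to a form independent of r (`hinv`). The drift
thus preserves a primitive of twice the symplectic form Im⟨·, ·⟩, and by Cartan's formula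
contraction with that primitive yields the Hamiltonian. The computation is this argument with mixed
partials exchanged. -/
theorem fderiv_im_inner_coneDrift [NeZero m] (p : ℝ × ℂ × ℂ) (v w : ℂ) :
    fderiv ℝ (fun p => (inner ℂ (coneDrift κ e j p) (coneMap κ e j p).2).im) p (0, v, w) =
      2 * (inner ℂ (coneDrift κ e j p) (fderiv ℝ (coneMap κ e j) p (0, v, w)).2).im := by
  set W : ℝ × ℂ × ℂ := (0, v, w)
  set U : ℝ × ℂ × ℂ := (1, 0, 0)
  have hG := contDiff_coneMap (j := j) he
  have hGd := hG.differentiable (by simp) p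
  have hP := (contDiff_coneDrift (j := j) he).differentiable (by simp) p
  have hD2 : DifferentiableAt ℝ (fderiv ℝ (coneMap κ e j)) p :=
    (hG.fderiv_right (m := ∞) (by simp)).differentiable (by simp) p
  have hsymm : fderiv ℝ (fderiv ℝ (coneMap κ e j)) p W U =
      fderiv ℝ (fderiv ℝ (coneMap κ e j)) p U W :=
    ContDiffAt.isSymmSndFDerivAt (n := 2) (by exact_mod_cast contDiffAt_infty.1 hG.contDiffAt 2)
      (by simp) W U
  have hPW : fderiv ℝ (coneDrift κ e j) p W = (fderiv ℝ (fderiv ℝ (coneMap κ e j)) p U W).2 := by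
    rw [← hsymm]
    have := ((ContinuousLinearMap.snd ℝ ℝ C2).hasFDerivAt.comp p
      (hD2.hasFDerivAt.clm_apply (hasFDerivAt_const U p))).fderiv
    have h2 := congrArg (fun L => L W) this
    simp only [ContinuousLinearMap.comp_apply] at h2
    refine h2.trans ?_
    simp
  have hinv : ∀ t : ℝ, (inner ℂ (coneMap κ e j (p + t • U)).2
      (fderiv ℝ (coneMap κ e j) (p + t • U) W).2).im =
      (inner ℂ (coneMap κ e j p).2 (fderiv ℝ (coneMap κ e j) p W).2).im := by
    intro t
    have hx : ∀ q : ℝ × ℂ × ℂ, (inner ℂ (coneMap κ e j q).2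
        (fderiv ℝ (coneMap κ e j) q W).2).im = (star q.2.1 * v).im + ‖q.2.1‖ ^ 2 *
        (inner ℂ (petal κ e j q.1 q.2.2)
          (fderiv ℝ (fun η => petal κ e j q.1 η) q.2.2 w)).im := by
      intro q
      have h1 : star q.2.1 * q.2.1 = ((‖q.2.1‖ ^ 2 : ℝ) : ℂ) := by
        rw [← Complex.normSq_eq_norm_sq, Complex.normSq_eq_conj_mul_self]; rfl
      rw [fderiv_coneMap he, coneMap, inner_add_right, inner_smul_left, inner_smul_left,
        inner_smul_right, inner_smul_right, inner_self_C2, norm_petal he, ← mul_assoc, ← mul_assoc]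
      simp only [← Complex.star_def]
      rw [h1, Complex.add_im, Complex.im_ofReal_mul]
      simp
    rw [hx, hx, im_inner_fderiv_petal_eq he _ p.1]
    simp [U]
  have hS := Complex.imCLM.hasFDerivAt.comp_hasDerivAt 0
    ((hGd.hasDerivAt_line U).snd_prod.inner ℂ
      ((hD2.hasDerivAt_line U).clm_apply (hasDerivAt_const (0 : ℝ) W)).snd_prod)
  have hS' := hS.unique ((hasDerivAt_const (0 : ℝ) _).congr_of_eventuallyEq
    (Filter.Eventually.of_forall hinv))
  have hh : DifferentiableAt ℝ
      (fun p => (inner ℂ (coneDrift κ e j p) (coneMap κ e j p).2).im) p :=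
    Complex.imCLM.differentiableAt.comp p (hP.inner ℂ hGd.snd)
  rw [(hh.hasDerivAt_line W).unique (Complex.imCLM.hasFDerivAt.comp_hasDerivAt 0
    ((hP.hasDerivAt_line W).inner ℂ (hGd.hasDerivAt_line W).snd_prod))]
  simp only [zero_smul, add_zero, map_zero, Complex.imCLM_apply, Complex.add_im, hPW] at hS' ⊢
  have hsw : (inner ℂ (fderiv ℝ (fderiv ℝ (coneMap κ e j)) p U W).2 (coneMap κ e j p).2).im =
      -(inner ℂ (coneMap κ e j p).2 (fderiv ℝ (fderiv ℝ (coneMap κ e j)) p U W).2).im := by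
    rw [← inner_conj_symm, Complex.conj_im]
  rw [hsw]
  change _ + (inner ℂ (coneDrift κ e j p) _).im = 0 at hS'
  linarith

theorem fderiv_coneHam [NeZero m] {q : ℝ × C2} (hq : q ∈ attracted κ e j) (w : C2) :
    fderiv ℝ (coneHam κ e j) q (0, w) = 2 * (inner ℂ (coneField κ e j q) w).im := by
  have hop := (isOpen_attracted (j := j) he).mem_nhds hq
  have hK := (((contDiffOn_coneInv (j := j) he).contDiffAt hop).differentiableAt
    (by simp)).hasFDerivAt
  have hGK := coneMap_coneInv hq
  have hG := ((contDiff_coneMap (j := j) he).differentiable (by simp) (coneInv κ e j q)).hasFDerivAt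
  have h1 : HasFDerivAt (coneMap κ e j ∘ coneInv κ e j) (ContinuousLinearMap.id ℝ _) q := by
    refine (hasFDerivAt_id q).congr_of_eventuallyEq ?_
    filter_upwards [hop] with x hx using coneMap_coneInv hx
  have h2 := congrArg (fun L => L ((0 : ℝ), w)) ((hG.comp q hK).unique h1)
  simp only [ContinuousLinearMap.comp_apply, ContinuousLinearMap.id_apply] at h2
  have h3 := fst_fderiv_coneMap (j := j) he (coneInv κ e j q)
    (fderiv ℝ (coneInv κ e j) q (0, w))
  rw [h2] at h3
  have hh : DifferentiableAt ℝ (fun p => (inner ℂ (coneDrift κ e j p) (coneMap κ e j p).2).im)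
      (coneInv κ e j q) :=
    Complex.imCLM.differentiableAt.comp _ (((contDiff_coneDrift he).differentiable
      (by simp) _).inner ℂ hG.differentiableAt.snd)
  have h4 : HasFDerivAt (coneHam κ e j) _ q :=
    (hh.hasFDerivAt.comp q hK).congr_of_eventuallyEq (by
      filter_upwards [hop] with x hx
      simp only [Function.comp, coneMap_coneInv hx]
      rfl)
  have h5 : fderiv ℝ (coneInv κ e j) q (0, w) = (0, (fderiv ℝ (coneInv κ e j) q (0, w)).2.1,
      (fderiv ℝ (coneInv κ e j) q (0, w)).2.2) := Prod.ext h3.symm rfl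
  rw [h4.fderiv, ContinuousLinearMap.comp_apply, h5, fderiv_im_inner_coneDrift he, ← h5, h2]
  rfl

theorem coneInv_smul {q : ℝ × C2} (hq : q ∈ attracted κ e j) {c : ℂ} (hc : c ≠ 0) :
    coneInv κ e j (q.1, c • q.2) =
      ((coneInv κ e j q).1, c * (coneInv κ e j q).2.1, (coneInv κ e j q).2.2) := by
  have h1 := coneMap_coneInv hq
  have h2 := coneInv_mem hq
  conv_lhs => rw [← h1]
  have := coneInv_coneMap (j := j) he (p := ((coneInv κ e j q).1, c * (coneInv κ e j q).2.1,
    (coneInv κ e j q).2.2)) (mul_ne_zero hc h2)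
  rw [← this]
  simp only [coneMap, mul_smul]


/-- Multiplication by c acts on the cone coordinates through their second entry only and commutes
with the drift. This phase invariance is what later makes the flow preserve norms. -/
theorem coneHam_smul {q : ℝ × C2} (hq : q ∈ attracted κ e j) {c : ℂ} (hc : ‖c‖ = 1) :
    coneHam κ e j (q.1, c • q.2) = coneHam κ e j q := by
  have hc0 : c ≠ 0 := by rw [← norm_pos_iff, hc]; exact one_pos
  set p := coneInv κ e j q
  have h1 : coneDrift κ e j (p.1, c * p.2.1, p.2.2) = c • coneDrift κ e j p := by
    refine (hasDerivAt_coneMap_fst he (p.1, c * p.2.1, p.2.2)).unique ?_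
    have := (hasDerivAt_coneMap_fst (j := j) he p).const_smul c
    refine this.congr_of_eventuallyEq (Filter.Eventually.of_forall fun r => ?_)
    simp only [coneMap, mul_smul, Pi.smul_apply]
  rw [coneHam, coneField, coneInv_smul he hq hc0, h1, inner_smul_left, inner_smul_right,
    ← mul_assoc, ← Complex.normSq_eq_conj_mul_self, Complex.normSq_eq_norm_sq, hc]
  simp [coneHam, coneField, p]

end

/-- The vector representing half a real linear form under the standard symplectic form. -/
def hamVec (l : C2 →L[ℝ] ℝ) : C2 :=
  !₂[(1 / 2 : ℂ) * ((l !₂[Complex.I, 0] : ℝ) - Complex.I * (l !₂[1, 0] : ℝ)),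
    (1 / 2 : ℂ) * ((l !₂[0, Complex.I] : ℝ) - Complex.I * (l !₂[0, 1] : ℝ))]

theorem im_inner_hamVec (l : C2 →L[ℝ] ℝ) (w : C2) : 2 * (inner ℂ (hamVec l) w).im = l w := by
  have hw : w = (w 0).re • (!₂[1, 0] : C2) + (w 0).im • (!₂[Complex.I, 0] : C2) +
      (w 1).re • (!₂[0, 1] : C2) + (w 1).im • (!₂[0, Complex.I] : C2) := by
    ext i
    fin_cases i <;> simp [Complex.re_add_im]
  conv_rhs => rw [hw]
  simp only [map_add, map_smul, smul_eq_mul]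
  simp [inner_C2, hamVec]
  ring

theorem eq_of_im_inner_eq {x y : C2} (h : ∀ w, (inner ℂ x w).im = (inner ℂ y w).im) : x = y := by
  have h1 := h (Complex.I • (x - y))
  rw [← sub_eq_zero, ← Complex.sub_im, ← inner_sub_left, inner_smul_right, inner_self_C2,
    Complex.I_mul_im, Complex.ofReal_re] at h1
  rw [← sub_eq_zero, ← norm_eq_zero]
  exact pow_eq_zero_iff two_ne_zero |>.1 h1

theorem contDiffOn_hamVec {E : Type*} [NormedAddCommGroup E] [NormedSpace ℝ E]
    {f : E → C2 →L[ℝ] ℝ} {s : Set E} (hf : ContDiffOn ℝ ∞ f s) :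
    ContDiffOn ℝ ∞ (fun x => hamVec (f x)) s := by
  have h (v : C2) : ContDiffOn ℝ ∞ (fun x => ((f x v : ℝ) : ℂ)) s :=
    Complex.ofRealCLM.contDiff.comp_contDiffOn (hf.clm_apply contDiffOn_const)
  refine contDiff_C2_mk fun i => ?_
  fin_cases i
  · exact contDiffOn_const.mul ((h _).sub (contDiffOn_const.mul (h _)))
  · exact contDiffOn_const.mul ((h _).sub (contDiffOn_const.mul (h _)))

end

/-! ### Cutting off the Hamiltonian -/

noncomputable section

section hamiltonian

/-- The vector field on the total space with first component one whose fibre component is the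
Hamiltonian vector field of `H`. -/
def hamField (H : ℝ × C2 → ℝ) (q : ℝ × C2) : ℝ × C2 :=
  (1, hamVec ((fderiv ℝ H q).comp (ContinuousLinearMap.inr ℝ ℝ C2)))

variable {H : ℝ × C2 → ℝ} {Ω : Set (ℝ × C2)}

theorem im_inner_hamField (q : ℝ × C2) (w : C2) :
    2 * (inner ℂ (hamField H q).2 w).im = fderiv ℝ H q (0, w) := by
  rw [hamField, im_inner_hamVec]
  simp

variable (hΩ : IsOpen Ω) (hH : ContDiffOn ℝ ∞ H Ω)
include hΩ hH

theorem contDiffOn_hamField : ContDiffOn ℝ ∞ (hamField H) Ω :=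
  contDiffOn_const.prodMk (contDiffOn_hamVec
    ((hH.fderiv_of_isOpen hΩ (m := ∞) (by simp)).clm_comp contDiffOn_const))

theorem hamField_symplectic {q : ℝ × C2} (hq : q ∈ Ω) (v w : C2) :
    (inner ℂ (fderiv ℝ (hamField H) q (0, v)).2 w).im +
      (inner ℂ v (fderiv ℝ (hamField H) q (0, w)).2).im = 0 := by
  have hF := ((contDiffOn_hamField hΩ hH).contDiffAt (hΩ.mem_nhds hq)).differentiableAt (by simp)
  have hH' := hH.contDiffAt (hΩ.mem_nhds hq)
  have hsymm : IsSymmSndFDerivAt ℝ H q :=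
    ContDiffAt.isSymmSndFDerivAt (n := 2) (by exact_mod_cast contDiffAt_infty.1 hH' 2) (by simp)
  have hD : DifferentiableAt ℝ (fderiv ℝ H) q :=
    (hH'.fderiv_right (m := ∞) (by simp)).differentiableAt (by simp)
  have key (v w : C2) : 2 * (inner ℂ (fderiv ℝ (hamField H) q (0, v)).2 w).im =
      fderiv ℝ (fderiv ℝ H) q (0, v) (0, w) := by
    have h1 := Complex.imCLM.hasFDerivAt.comp_hasDerivAt 0
      ((hF.hasDerivAt_line (0, v)).snd_prod.inner ℂ (hasDerivAt_const (0 : ℝ) w))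
    have h2 := (hD.hasDerivAt_line (0, v)).clm_apply (hasDerivAt_const (0 : ℝ) ((0 : ℝ), w))
    have h3 := (h1.const_mul 2).unique (h2.congr_of_eventuallyEq
      (Filter.Eventually.of_forall fun t => im_inner_hamField _ w))
    simpa using h3
  have h1 := key v w
  have h2 := key w v
  rw [← hsymm.eq] at h2
  have h3 : (inner ℂ v (fderiv ℝ (hamField H) q (0, w)).2).im =
      -(inner ℂ (fderiv ℝ (hamField H) q (0, w)).2 v).im := by
    rw [← inner_conj_symm, Complex.conj_im]
  linarith

/-- The norm of the fibre component is preserved if the Hamiltonian is invariant under phases. -/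
theorem norm_eq_of_flowRel_hamField (hinv : ∀ q ∈ Ω, ∀ c : ℂ, ‖c‖ = 1 → H (q.1, c • q.2) = H q)
    {t : ℝ} {x y : ℝ × C2} (h : FlowRel (hamField H) Ω t x y) : ‖y.2‖ = ‖x.2‖ := by
  -- Differentiating the invariance gives dH(i z) = 0, which says that the Hamiltonian vector field
  -- is orthogonal to z.
  have key : ∀ q ∈ Ω, (inner ℂ q.2 (hamField H q).2).re = 0 := by
    intro q hq
    have h1 : HasDerivAt (fun t : ℝ => Complex.exp (t * Complex.I)) Complex.I 0 := by
      have := ((Complex.ofRealCLM.hasDerivAt (x := (0 : ℝ))).mul_const Complex.I).cexp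
      simpa using this
    have h2 : HasDerivAt (fun t : ℝ => (q.1, Complex.exp (t * Complex.I) • q.2))
        ((0 : ℝ), Complex.I • q.2) 0 :=
      (hasDerivAt_const _ _).prodMk (h1.smul_const q.2)
    have h3 := ((hH.contDiffAt (hΩ.mem_nhds hq)).differentiableAt (by simp)).hasFDerivAt
    rw [show q = (q.1, Complex.exp ((0 : ℝ) * Complex.I) • q.2) by simp] at h3
    have h4 := (h3.comp_hasDerivAt (0 : ℝ) h2).unique
      ((hasDerivAt_const (0 : ℝ) (H q)).congr_of_eventuallyEq
        (Filter.Eventually.of_forall fun t => hinv q hq _ (Complex.norm_exp_ofReal_mul_I t)))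
    rw [show (q.1, Complex.exp ((0 : ℝ) * Complex.I) • q.2) = q by simp,
      ← im_inner_hamField, inner_smul_right, Complex.I_mul_im] at h4
    rw [← inner_conj_symm, Complex.conj_re]
    linarith
  have := h.eq_of_hasFDerivAt (φ := fun q => ‖q.2‖ ^ 2)
    (φ' := fun q => (2 • innerSL ℝ q.2) ∘L ContinuousLinearMap.snd ℝ ℝ C2)
    (fun q _ => (hasStrictFDerivAt_norm_sq q.2).hasFDerivAt.comp q hasFDerivAt_snd) fun q hq => by
      have h1 : inner ℝ q.2 (hamField H q).2 = (inner ℂ q.2 (hamField H q).2).re :=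
        real_inner_eq_re_inner ℂ _ _
      simp [h1, key q hq]
  exact ((sq_eq_sq₀ (norm_nonneg _) (norm_nonneg _)).1 this).symm

omit hΩ hH in
theorem fst_of_flowRel_hamField {t : ℝ} {x y : ℝ × C2} (h : FlowRel (hamField H) Ω t x y) :
    y.1 = x.1 + t := by
  obtain ⟨γ, rfl, rfl, hγ⟩ := h
  have := eq_of_hasDerivAt_zero (g := fun s => (γ s).1 - s) (t := t) fun s hs => by
    have h1 := ((ContinuousLinearMap.fst ℝ ℝ C2).hasFDerivAt.comp_hasDerivAt s (hγ s hs).2).sub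
      (hasDerivAt_id s)
    refine h1.congr_deriv ?_
    simp [hamField]
  simp only [sub_zero] at this
  linarith

end hamiltonian

variable {m : ℕ} (κ : Fin m → ℝ) (e : ℝ → Fin m → C2) (C : ℝ) (j : Fin m)

/-- The quantity controlling the cutoff of the cone Hamiltonian. -/
def collarLevel (q : ℝ × C2) : ℝ :=
  -- On the j-th cone, `shape` equals K exactly where this equals K / a_j - 1, and is smaller than K
  -- where this is larger. It depends on ‖c‖ and ‖η‖ only, so moving r leaves it unchanged.
  ((∑ i, κ i) / ‖q.2‖ ^ 2 - 1) * Real.exp ((∑ i, κ i) * ‖(coneInv κ e j q).2.2‖ ^ 2)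

/-- The part of the cone where the cutoff equals one. -/
def collar : Set (ℝ × C2) := {q | q ∈ attracted κ e j ∧ collarLevel κ e j q < C}

/-- The domain of the interpolating flow. -/
def collarDomain : Set (ℝ × C2) := {q | ‖q.2‖ ^ 2 < ∑ i, κ i} ∪ ⋃ j, collar κ e C j

/-- The sum of the cone Hamiltonians, cut off. -/
def totalHam (q : ℝ × C2) : ℝ := open Classical in ∑ j, if q ∈ attracted κ e j then
  Real.smoothTransition (C + 1 - collarLevel κ e j q) * coneHam κ e j q else 0

variable {κ e C j}

theorem attracted_smul_iff {q : ℝ × C2} {c : ℂ} (hc : c ≠ 0) :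
    (q.1, c • q.2) ∈ attracted κ e j ↔ q ∈ attracted κ e j := by
  refine ⟨fun h => ?_, fun h => attracted_smul h hc⟩
  have := attracted_smul h (inv_ne_zero hc)
  rwa [smul_smul, inv_mul_cancel₀ hc, one_smul] at this

variable (he : IsCrossFamily κ e)
include he

theorem snd_ne_zero_of_attracted {q : ℝ × C2} (hq : q ∈ attracted κ e j) : q.2 ≠ 0 := by
  obtain ⟨p, hp, rfl⟩ := hq
  rw [← norm_pos_iff, norm_coneMap he, norm_pos_iff]
  exact hp

theorem contDiffOn_collarLevel : ContDiffOn ℝ ∞ (collarLevel κ e j) (attracted κ e j) := by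
  have h1 : ContDiffOn ℝ ∞ (fun q : ℝ × C2 => ‖q.2‖ ^ 2) (attracted κ e j) :=
    (contDiff_snd.norm_sq ℝ).contDiffOn
  have h2 : ContDiffOn ℝ ∞ (fun q : ℝ × C2 => ‖(coneInv κ e j q).2.2‖ ^ 2) (attracted κ e j) :=
    ((contDiff_snd.comp contDiff_snd).norm_sq ℝ).comp_contDiffOn (contDiffOn_coneInv he)
  refine ((contDiffOn_const.div h1 fun q hq => ?_).sub contDiffOn_const).mul
    (contDiffOn_const.mul h2).exp
  exact pow_ne_zero 2 (norm_ne_zero_iff.2 (snd_ne_zero_of_attracted he hq))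

theorem isOpen_collar : IsOpen (collar κ e C j) :=
  (contDiffOn_collarLevel he).continuousOn.isOpen_inter_preimage (isOpen_attracted he) isOpen_Iio

theorem isOpen_collarDomain : IsOpen (collarDomain κ e C) :=
  (isOpen_lt (by fun_prop) continuous_const).union (isOpen_iUnion fun _ => isOpen_collar he)

theorem coneMap_mem_collar {p : ℝ × ℂ × ℂ} (hp : p ∈ coneSource) : coneMap κ e j p ∈ collar κ e C j ↔
    ((∑ i, κ i) / ‖p.2.1‖ ^ 2 - 1) * Real.exp ((∑ i, κ i) * ‖p.2.2‖ ^ 2) < C := by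
  rw [collar, Set.mem_ofPred_eq, collarLevel, coneInv_coneMap he hp, norm_coneMap he]
  exact and_iff_right ⟨p, hp, rfl⟩

theorem totalHam_eq {q : ℝ × C2} (hq : q ∈ attracted κ e j) : totalHam κ e C q =
    Real.smoothTransition (C + 1 - collarLevel κ e j q) * coneHam κ e j q := by
  rw [totalHam, Finset.sum_eq_single j, if_pos hq]
  · intro i _ hij
    rw [if_neg]
    exact fun h => (disjoint_attracted he hij).le_bot ⟨h, hq⟩
  · simp

theorem totalHam_smul (q : ℝ × C2) {c : ℂ} (hc : ‖c‖ = 1) :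
    totalHam κ e C (q.1, c • q.2) = totalHam κ e C q := by
  have hc0 : c ≠ 0 := by rw [← norm_pos_iff, hc]; exact one_pos
  by_cases h : ∃ j, q ∈ attracted κ e j
  · obtain ⟨j, hj⟩ := h
    rw [totalHam_eq he hj, totalHam_eq he (attracted_smul hj hc0), coneHam_smul he hj hc,
      collarLevel, collarLevel, coneInv_smul he hj hc0, norm_smul, hc, one_mul]
  · push Not at h
    rw [totalHam, totalHam]
    simp only [attracted_smul_iff hc0, h, if_false]

/-- Only points that are not attracted need care. In the domain they satisfy ‖z‖² < K, and near them
`collarLevel` exceeds C + 1, so every cut off term vanishes. -/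
theorem contDiffOn_totalHam [NeZero m] (hC : 0 ≤ C) :
    ContDiffOn ℝ ∞ (totalHam κ e C) (collarDomain κ e C) := by
  intro q hq
  refine ContDiffAt.contDiffWithinAt ?_
  by_cases h : ∃ j, q ∈ attracted κ e j
  · obtain ⟨j, hj⟩ := h
    have hop := (isOpen_attracted (j := j) he).mem_nhds hj
    have h1 : ContDiffAt ℝ ∞ (fun q => Real.smoothTransition (C + 1 - collarLevel κ e j q) *
        coneHam κ e j q) q := by
      refine ContDiffAt.mul ?_ ((contDiffOn_coneHam he).contDiffAt hop)
      exact Real.smoothTransition.contDiff.contDiffAt.comp q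
        (contDiffAt_const.sub ((contDiffOn_collarLevel he).contDiffAt hop))
    refine h1.congr_of_eventuallyEq ?_
    filter_upwards [hop] with x hx using totalHam_eq he hx
  · push Not at h
    have hK := sum_weights_pos he
    rcases hq with hq | hq
    · have hC2 : 0 < C + 2 := by linarith
      -- For this auxiliary a one has K / a_j - 1 = C + 1. Continuity of the corresponding `shape`
      -- turns the bound at q into `collarLevel` > C + 1 on nearby attracted points.
      let a : Fin m → ℝ := fun _ => (∑ i, κ i) / (C + 2)
      have hs : shape κ a e q < ∑ i, κ i := by
        have : shape κ a e q = ‖q.2‖ ^ 2 := by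
          rw [shape, Finset.sum_eq_zero fun j _ => by rw [decay_of_notMem (h j), mul_zero]]
          simp
        rw [this]
        exact hq
      refine contDiffAt_const (c := (0 : ℝ)) |>.congr_of_eventuallyEq ?_
      filter_upwards [((continuous_shape he a).tendsto q).eventually_lt_const hs] with x hx
      refine Finset.sum_eq_zero fun j _ => ?_
      split_ifs with hxj
      · rw [Real.smoothTransition.zero_of_nonpos, zero_mul]
        have hx0 := norm_pos_iff.2 (snd_ne_zero_of_attracted he hxj)
        obtain ⟨p, hp, rfl⟩ := hxj
        rw [shape_coneMap he a hp] at hx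
        rw [norm_coneMap he] at hx0
        rw [collarLevel, coneInv_coneMap he hp, norm_coneMap he]
        set K := ∑ i, κ i
        have h2 : Real.exp (-K * ‖p.2.2‖ ^ 2) * Real.exp (K * ‖p.2.2‖ ^ 2) = 1 := by
          rw [← Real.exp_add]; simp
        have h3 : K / a j = C + 2 := by
          change K / (K / (C + 2)) = C + 2
          field_simp
        rw [h3] at hx
        have h4 : (C + 1) * Real.exp (-K * ‖p.2.2‖ ^ 2) < K / ‖p.2.1‖ ^ 2 - 1 := by
          rw [lt_sub_iff_add_lt, lt_div_iff₀ (by positivity)]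
          linarith
        have h5 := mul_lt_mul_of_pos_right h4 (Real.exp_pos (K * ‖p.2.2‖ ^ 2))
        rw [mul_assoc, h2, mul_one] at h5
        linarith
      · rfl
    · obtain ⟨j, hj⟩ := Set.mem_iUnion.1 hq
      exact absurd hj.1 (h j)

theorem hamField_totalHam [NeZero m] {q : ℝ × C2} (hq : q ∈ collar κ e C j) :
    hamField (totalHam κ e C) q = (1, coneField κ e j q) := by
  refine Prod.ext rfl (eq_of_im_inner_eq fun w => ?_)
  have h1 : totalHam κ e C =ᶠ[𝓝 q] coneHam κ e j := by
    filter_upwards [(isOpen_collar he).mem_nhds hq] with x hx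
    rw [totalHam_eq he hx.1, Real.smoothTransition.one_of_one_le (by linarith [hx.2]), one_mul]
  have h2 := im_inner_hamField (H := totalHam κ e C) q w
  rw [h1.fderiv_eq, fderiv_coneHam he hq.1] at h2
  simpa using h2

/-- On the collars the flow of the cut off Hamiltonian moves the parameter. -/
theorem flowRel_collar [NeZero m] {p : ℝ × ℂ × ℂ} (hp : p ∈ coneSource)
    (hpC : coneMap κ e j p ∈ collar κ e C j) (t : ℝ) :
    FlowRel (hamField (totalHam κ e C)) (collarDomain κ e C) t (coneMap κ e j p)
      (coneMap κ e j (p.1 + t, p.2)) := by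
  refine ⟨fun s => coneMap κ e j (p.1 + s, p.2), by simp, rfl, fun s _ => ?_⟩
  have hmem : coneMap κ e j (p.1 + s, p.2) ∈ collar κ e C j := by
    rw [coneMap_mem_collar he hp] at hpC
    exact (coneMap_mem_collar (p := (p.1 + s, p.2)) he hp).2 hpC
  refine ⟨Or.inr (Set.mem_iUnion.2 ⟨j, hmem⟩), ?_⟩
  rw [hamField_totalHam he hmem, coneField, coneInv_coneMap (p := (p.1 + s, p.2)) he hp]
  have h1 : HasDerivAt (fun s => p.1 + s) 1 s := (hasDerivAt_id s).const_add _
  have := (hasDerivAt_coneMap_fst' (j := j) he (p.1 + s) p.2).scomp s h1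
  simpa [Function.comp_def] using this

end

/-! ### The interpolating symplectic diffeomorphism -/

noncomputable section

/-- The fibres of a complete flow with first component one are identified symplectically. -/
theorem exists_symplecticDiffeo_of_flow {F : ℝ × C2 → ℝ × C2} {Ω : Set (ℝ × C2)} (hΩ : IsOpen Ω)
    (hF : ContDiffOn ℝ ∞ F Ω) (h1 : ∀ q ∈ Ω, (F q).1 = 1)
    (hs : ∀ q ∈ Ω, ∀ v w : C2, (inner ℂ (fderiv ℝ F q (0, v)).2 w).im +
      (inner ℂ v (fderiv ℝ F q (0, w)).2).im = 0)
    (hfst : ∀ {t : ℝ} {x y : ℝ × C2}, FlowRel F Ω t x y → y.1 = x.1 + t)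
    (hcomplete : ∀ q ∈ Ω, ∀ t, ∃ y, FlowRel F Ω t q y) :
    ∃ Φ : OpenPartialHomeomorph C2 C2, IsSymplecticDiffeo Φ ∧ Φ.source = {z | ((0 : ℝ), z) ∈ Ω} ∧
      Φ.target = {z | ((1 : ℝ), z) ∈ Ω} ∧ ∀ z ∈ Φ.source, FlowRel F Ω 1 (0, z) (1, Φ z) := by
  have hrel : ∀ {t r : ℝ} {z : C2}, (r, z) ∈ Ω →
      FlowRel F Ω t (r, z) (r + t, (flow F Ω t (r, z)).2) := by
    intro t r z hz
    have h2 := flowRel_flow (hcomplete _ hz t)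
    have h3 := hfst h2
    have : flow F Ω t (r, z) = (r + t, (flow F Ω t (r, z)).2) := Prod.ext h3 rfl
    rwa [← this]
  have hrel1 : ∀ {z : C2}, ((0 : ℝ), z) ∈ Ω →
      FlowRel F Ω 1 (0, z) (1, (flow F Ω 1 (0, z)).2) := fun hz => by
    simpa using hrel (t := 1) hz
  have hrel2 : ∀ {z : C2}, ((1 : ℝ), z) ∈ Ω →
      FlowRel F Ω (-1) (1, z) (0, (flow F Ω (-1) (1, z)).2) := fun hz => by
    simpa using hrel (t := -1) hz
  have hsm : ∀ (r t : ℝ), ContDiffOn ℝ ∞ (fun z => (flow F Ω t (r, z)).2) {z | (r, z) ∈ Ω} := by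
    intro r t z hz
    refine ContDiffAt.contDiffWithinAt ?_
    have h2 : ContDiffAt ℝ ∞ (fun z : C2 => (t, r, z)) z := by fun_prop
    have h3 := (contDiffAt_flow hΩ hF (hcomplete _ hz t)).comp z h2
    exact contDiff_snd.contDiffAt.comp z h3
  have hop : ∀ r : ℝ, IsOpen {z : C2 | (r, z) ∈ Ω} := fun r =>
    hΩ.preimage (Continuous.prodMk_right r)
  let Φ : OpenPartialHomeomorph C2 C2 :=
    { toFun := fun z => (flow F Ω 1 (0, z)).2
      invFun := fun z => (flow F Ω (-1) (1, z)).2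
      source := {z | ((0 : ℝ), z) ∈ Ω}
      target := {z | ((1 : ℝ), z) ∈ Ω}
      map_source' := fun z hz => (hrel1 hz).mem_right
      map_target' := fun z hz => (hrel2 hz).mem_right
      left_inv' := fun z hz => by
        rw [(hrel1 hz).reverse.flow_eq hΩ hF]
      right_inv' := fun z hz => by
        have := (hrel2 hz).reverse
        rw [neg_neg] at this
        rw [this.flow_eq hΩ hF]
      open_source := hop 0
      open_target := hop 1
      continuousOn_toFun := (hsm 0 1).continuousOn
      continuousOn_invFun := (hsm 1 (-1)).continuousOn }
  refine ⟨Φ, ⟨hsm 0 1, hsm 1 (-1), fun z hz v w => ?_⟩, rfl, rfl, fun z hz => hrel1 hz⟩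
  have hd : DifferentiableAt ℝ (flow F Ω 1) (0, z) := by
    have h2 : ContDiffAt ℝ ∞ (fun q : ℝ × C2 => ((1 : ℝ), q)) (0, z) := by fun_prop
    exact ((contDiffAt_flow hΩ hF (hcomplete _ hz 1)).comp ((0 : ℝ), z) h2).differentiableAt
      (by simp)
  have hfd (v : C2) : fderiv ℝ Φ z v = (fderiv ℝ (flow F Ω 1) (0, z) (0, v)).2 := by
    have h3 := (ContinuousLinearMap.snd ℝ ℝ C2).hasFDerivAt.comp z
      (hd.hasFDerivAt.comp z (hasFDerivAt_prodMk_right (0 : ℝ) z))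
    exact congrArg (fun L => L v) h3.fderiv
  rw [omegaSt_eq, omegaSt_eq, hfd, hfd,
    (fderiv_flow_symplectic hΩ hF h1 hs (hcomplete _ hz 1) v w).2]

variable {m : ℕ} [NeZero m] {κ : Fin m → ℝ} {e : ℝ → Fin m → C2} {C : ℝ}
  (he : IsCrossFamily κ e) (hC : 0 ≤ C)
include he hC

/-- In the ball ‖z‖² < K norms are preserved and r moves with unit speed, so the trajectory stays in
a compact piece of the domain. On the collars it is given explicitly for all times. -/
theorem exists_flowRel_totalHam {q : ℝ × C2} (hq : q ∈ collarDomain κ e C) (t : ℝ) :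
    ∃ y, FlowRel (hamField (totalHam κ e C)) (collarDomain κ e C) t q y := by
  have hΩ := isOpen_collarDomain (C := C) he
  have hH := contDiffOn_totalHam he hC
  have hF := contDiffOn_hamField hΩ hH
  rcases hq with hq | hq
  · have hnorm : ∀ {t : ℝ} {y : ℝ × C2},
        FlowRel (hamField (totalHam κ e C)) (collarDomain κ e C) t q y → ‖y.2‖ = ‖q.2‖ := fun h =>
      norm_eq_of_flowRel_hamField hΩ hH (fun q _ c hc => totalHam_smul he q hc) h
    have hcompact (x y : ℝ) : IsCompact (Set.Icc x y ×ˢ Metric.sphere (0 : C2) ‖q.2‖) :=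
      isCompact_Icc.prod (isCompact_sphere _ _)
    have hsub (x y : ℝ) : Set.Icc x y ×ˢ Metric.sphere (0 : C2) ‖q.2‖ ⊆ collarDomain κ e C := by
      rintro ⟨s, z⟩ ⟨-, hz⟩
      left
      rw [mem_sphere_zero_iff_norm] at hz
      rw [Set.mem_ofPred_eq, hz]
      exact hq
    rcases le_total 0 t with ht | ht
    · refine exists_flowRel_of_compact hΩ hF (hcompact q.1 (q.1 + t)) (hsub _ _) ht
        ⟨⟨le_rfl, by linarith⟩, by simp⟩ fun s hs y hy => ⟨?_, by simpa using hnorm hy⟩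
      rw [fst_of_flowRel_hamField hy]
      exact ⟨by linarith [hs.1], by linarith [hs.2]⟩
    · obtain ⟨y, hy⟩ := exists_flowRel_of_compact (f := fun z => -hamField (totalHam κ e C) z)
        hΩ hF.neg (hcompact (q.1 + t) q.1) (hsub _ _) (T := -t) (x := q) (by linarith)
        ⟨⟨by linarith, le_rfl⟩, by simp⟩ fun s hs y hy => by
          have h1 : FlowRel (hamField (totalHam κ e C)) (collarDomain κ e C) (-s) q y :=
            FlowRel.of_neg_field (by rwa [neg_neg])
          refine ⟨?_, by simpa using hnorm h1⟩
          rw [fst_of_flowRel_hamField h1]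
          exact ⟨by linarith [hs.2], by linarith [hs.1]⟩
      exact ⟨y, FlowRel.of_neg_field hy⟩
  · obtain ⟨j, hj⟩ := Set.mem_iUnion.1 hq
    obtain ⟨p, hp, rfl⟩ := hj.1
    exact ⟨_, flowRel_collar he hp hj t⟩

omit [NeZero m] hC in
theorem shape_lt_of_notMem_collar {a : Fin m → ℝ} (hCa : ∀ j, (∑ i, κ i) / a j < C + 1)
    {q : ℝ × C2} (hq : ‖q.2‖ ^ 2 < ∑ i, κ i) (h : ∀ j, q ∉ collar κ e C j) :
    shape κ a e q < ∑ i, κ i := by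
  by_cases hA : ∃ j, q ∈ attracted κ e j
  · obtain ⟨j, p, hp, rfl⟩ := hA
    have h1 := h j
    rw [coneMap_mem_collar he hp, not_lt] at h1
    rw [shape_coneMap he a hp]
    rw [norm_coneMap he] at hq
    have hp0 : 0 < ‖p.2.1‖ := norm_pos_iff.2 hp
    set K := ∑ i, κ i
    have h2 : Real.exp (-K * ‖p.2.2‖ ^ 2) * Real.exp (K * ‖p.2.2‖ ^ 2) = 1 := by
      rw [← Real.exp_add]; simp
    have h3 := mul_le_mul_of_nonneg_left h1 (Real.exp_pos (-K * ‖p.2.2‖ ^ 2)).le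
    rw [mul_left_comm, h2, mul_one] at h3
    have h4 : (K / a j - 1) * Real.exp (-K * ‖p.2.2‖ ^ 2) < K / ‖p.2.1‖ ^ 2 - 1 := by
      refine lt_of_lt_of_le ?_ h3
      rw [mul_comm]
      exact mul_lt_mul_of_pos_left (by linarith [hCa j]) (Real.exp_pos _)
    rw [lt_sub_iff_add_lt, lt_div_iff₀ (by positivity)] at h4
    linarith
  · push Not at hA
    rw [shape, Finset.sum_eq_zero fun j _ => by rw [decay_of_notMem (hA j), mul_zero]]
    simpa using hq

/-- On a collar the flow fixes (c, η), on which `shape` depends alone. Hence the collars and their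
complement are invariant, and off the collars `shape` is less than K at both ends. -/
theorem shape_flowRel {a : Fin m → ℝ} (hCa : ∀ j, (∑ i, κ i) / a j < C + 1) {t : ℝ}
    {x y : ℝ × C2} (h : FlowRel (hamField (totalHam κ e C)) (collarDomain κ e C) t x y) :
    (shape κ a e x < ∑ i, κ i ↔ shape κ a e y < ∑ i, κ i) ∧
    ((shape κ a e x = ∑ i, κ i ∧ ∃ j, x ∈ attracted κ e j) ↔
      (shape κ a e y = ∑ i, κ i ∧ ∃ j, y ∈ attracted κ e j)) := by
  have hΩ := isOpen_collarDomain (C := C) he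
  have hH := contDiffOn_totalHam he hC
  have hF := contDiffOn_hamField hΩ hH
  by_cases hx : ∃ j, x ∈ collar κ e C j
  · obtain ⟨j, hj⟩ := hx
    obtain ⟨p, hp, rfl⟩ := hj.1
    obtain rfl := (flowRel_collar he hp hj t).unique hΩ hF h
    have hp' : (p.1 + t, p.2) ∈ coneSource := hp
    rw [shape_coneMap he a hp, shape_coneMap he a hp']
    exact ⟨Iff.rfl, and_congr Iff.rfl (iff_of_true ⟨j, p, hp, rfl⟩ ⟨j, _, hp', rfl⟩)⟩
  · have hy : ¬ ∃ j, y ∈ collar κ e C j := by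
      rintro ⟨j, hj⟩
      obtain ⟨p, hp, rfl⟩ := hj.1
      obtain rfl := (flowRel_collar he hp hj (-t)).unique hΩ hF h.reverse
      refine hx ⟨j, (coneMap_mem_collar (p := (p.1 + -t, p.2)) he hp).2 ?_⟩
      exact (coneMap_mem_collar he hp).1 hj
    have hlt : ∀ {z : ℝ × C2}, z ∈ collarDomain κ e C → (¬ ∃ j, z ∈ collar κ e C j) →
        shape κ a e z < ∑ i, κ i := by
      intro z hz hz'
      rcases hz with hz | hz
      · exact shape_lt_of_notMem_collar he hCa hz fun j hj => hz' ⟨j, hj⟩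
      · exact absurd (Set.mem_iUnion.1 hz) hz'
    have h1 := hlt h.mem_left hx
    have h2 := hlt h.mem_right hy
    exact ⟨iff_of_true h1 h2, iff_of_false (fun h => h1.ne h.1) fun h => h2.ne h.1⟩

omit [NeZero m] hC in
theorem mem_collarDomain {a : Fin m → ℝ} (hC : 0 < C)
    {q : ℝ × C2} (h : shape κ a e q < ∑ i, κ i ∨
      shape κ a e q = ∑ i, κ i ∧ ∃ j, q ∈ attracted κ e j) : q ∈ collarDomain κ e C := by
  by_cases hq : ‖q.2‖ ^ 2 < ∑ i, κ i
  · exact Or.inl hq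
  rw [not_lt] at hq
  by_cases hA : ∃ j, q ∈ attracted κ e j
  · obtain ⟨j, p, hp, rfl⟩ := hA
    -- If ‖z‖² ≥ K, the first factor of `collarLevel` is nonpositive, so an attracted point is in
    -- the collar for any positive C.
    refine Or.inr (Set.mem_iUnion.2 ⟨j, (coneMap_mem_collar he hp).2 ?_⟩)
    rw [norm_coneMap he] at hq
    have hp0 : 0 < ‖p.2.1‖ := norm_pos_iff.2 hp
    refine lt_of_le_of_lt (mul_nonpos_of_nonpos_of_nonneg ?_ (Real.exp_pos _).le) hC
    rw [sub_nonpos, div_le_one (by positivity)]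
    exact hq
  · exfalso
    have h1 : shape κ a e q = ‖q.2‖ ^ 2 := by
      rw [not_exists] at hA
      rw [shape, Finset.sum_eq_zero fun j _ => by rw [decay_of_notMem (hA j), mul_zero]]
      simp
    rcases h with h | h
    · linarith
    · exact hA h.2

omit hC in
/-- The basins at the two ends of a family of crosses are identified symplectically. -/
theorem exists_symplecticDiffeo_of_family {a : Fin m → ℝ} (ha : ∀ j, 0 < a j)
    {u v : Fin m → Matrix.unitaryGroup (Fin 2) ℂ} (hu : ∀ j, IsUnitVectorOf (e 0 j) (u j))
    (hv : ∀ j, IsUnitVectorOf (e 1 j) (v j)) :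
    ∃ Φ : OpenPartialHomeomorph C2 C2, IsSymplecticDiffeo Φ ∧
      crossBasin κ a u ∪ basinRegularBoundary κ a u ⊆ Φ.source ∧
      crossBasin κ a v ∪ basinRegularBoundary κ a v ⊆ Φ.target ∧
      Φ '' crossBasin κ a u = crossBasin κ a v ∧
      Φ '' basinRegularBoundary κ a u = basinRegularBoundary κ a v := by
  have hK := sum_weights_pos he
  -- C exceeds every K / a_j - 1, so the attracted part of the level `shape` = K lies inside the
  -- collars.
  obtain ⟨C, hC, hCa⟩ : ∃ C : ℝ, 0 < C ∧ ∀ j, (∑ i, κ i) / a j < C + 1 := by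
    refine ⟨1 + ∑ j, (∑ i, κ i) / a j, ?_, fun j => ?_⟩
    · have : 0 ≤ ∑ j, (∑ i, κ i) / a j :=
        Finset.sum_nonneg fun j _ => (div_pos hK (ha j)).le
      linarith
    · have := Finset.single_le_sum (f := fun j => (∑ i, κ i) / a j)
        (fun j _ => (div_pos hK (ha j)).le) (Finset.mem_univ j)
      linarith
  have hΩ := isOpen_collarDomain (C := C) he
  have hH := contDiffOn_totalHam he hC.le
  obtain ⟨Φ, hΦ, hs, ht, hrel⟩ := exists_symplecticDiffeo_of_flow hΩ (contDiffOn_hamField hΩ hH)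
    (fun q _ => rfl) (fun q hq v w => hamField_symplectic hΩ hH hq v w)
    (fun h => fst_of_flowRel_hamField h) (fun q hq t => exists_flowRel_totalHam he hC.le hq t)
  have himage : ∀ {A B : Set C2}, B ⊆ Φ.target → A ⊆ Φ.source →
      (∀ z ∈ Φ.source, z ∈ A ↔ Φ z ∈ B) → Φ '' A = B := by
    intro A B hB hA h
    refine Set.Subset.antisymm ?_ fun w hw => ?_
    · rintro _ ⟨z, hz, rfl⟩
      exact (h z (hA hz)).1 hz
    · have h1 := Φ.map_target (hB hw)
      refine ⟨Φ.symm w, (h _ h1).2 ?_, Φ.right_inv (hB hw)⟩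
      rwa [Φ.right_inv (hB hw)]
  rw [crossBasin_eq he ha hu, crossBasin_eq he ha hv, basinRegularBoundary_eq he ha hu,
    basinRegularBoundary_eq he ha hv]
  have h0 : {z | shape κ a e (0, z) < ∑ i, κ i} ∪
      {z | shape κ a e (0, z) = ∑ i, κ i ∧ ∃ j, (0, z) ∈ attracted κ e j} ⊆ Φ.source := by
    rw [hs]
    exact fun z hz => mem_collarDomain he hC hz
  have h1 : {z | shape κ a e (1, z) < ∑ i, κ i} ∪
      {z | shape κ a e (1, z) = ∑ i, κ i ∧ ∃ j, (1, z) ∈ attracted κ e j} ⊆ Φ.target := by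
    rw [ht]
    exact fun z hz => mem_collarDomain he hC hz
  exact ⟨Φ, hΦ, h0, h1,
    himage (Set.subset_union_left.trans h1) (Set.subset_union_left.trans h0)
      fun z hz => (shape_flowRel he hC.le hCa (hrel z hz)).1,
    himage (Set.subset_union_right.trans h1) (Set.subset_union_right.trans h0)
      fun z hz => (shape_flowRel he hC.le hCa (hrel z hz)).2⟩

end

/-! ### Joining configurations of lines -/

noncomputable section

theorem IsUnitVectorOf.self (u : Matrix.unitaryGroup (Fin 2) ℂ) :
    IsUnitVectorOf (firstColumn u) u := ⟨1, by simp, by simp⟩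

theorem cross_firstColumn_ne_zero {u v : Matrix.unitaryGroup (Fin 2) ℂ}
    (h : crossLine u ≠ crossLine v) : cross (firstColumn u) (firstColumn v) ≠ 0 := by
  intro h0
  apply h
  have h1 := eq_smul_of_cross_eq_zero (norm_firstColumn u) h0
  set c := inner ℂ (firstColumn u) (firstColumn v)
  have hc : c ≠ 0 := by
    intro hc
    have := norm_firstColumn v
    rw [h1, hc, zero_smul, norm_zero] at this
    exact zero_ne_one this
  ext z
  rw [(IsUnitVectorOf.self u).mem_crossLine, (IsUnitVectorOf.self v).mem_crossLine, h1]
  have : cross (c • firstColumn u) z = c * cross (firstColumn u) z := by simp [cross]; ring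
  rw [this, mul_eq_zero_iff_left hc]

/-- A rotation matrix whose first column spans the real line of slope `s`. -/
def slopeUnitary (s : ℝ) : Matrix.unitaryGroup (Fin 2) ℂ :=
  ⟨!![(((√(1 + s ^ 2))⁻¹ : ℝ) : ℂ), -((√(1 + s ^ 2))⁻¹ * s : ℝ);
    ((√(1 + s ^ 2))⁻¹ * s : ℝ), ((√(1 + s ^ 2))⁻¹ : ℝ)], by
    have h : (√(1 + s ^ 2))⁻¹ ^ 2 * (1 + s ^ 2) = 1 := by
      rw [inv_pow, Real.sq_sqrt (by positivity)]
      field_simp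
    generalize (√(1 + s ^ 2))⁻¹ = d at *
    have h' : (d : ℂ) ^ 2 * (1 + (s : ℂ) ^ 2) = 1 := by exact_mod_cast h
    rw [Matrix.mem_unitaryGroup_iff]
    ext i j
    fin_cases i <;> fin_cases j <;>
      simp [Matrix.mul_apply, Fin.sum_univ_two, Matrix.star_apply] <;>
      first | linear_combination h' | ring⟩

theorem cross_slopeUnitary (s : ℝ) (z : C2) : cross (firstColumn (slopeUnitary s)) z =
    (((√(1 + s ^ 2))⁻¹ : ℝ) : ℂ) * (z 1 - s * z 0) := by
  simp [cross, firstColumn, slopeUnitary]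
  ring

theorem cross_slopeUnitary_ne_zero {s : ℝ} {z : C2} (hz : z ≠ 0) (hs : s ≠ (z 1 / z 0).re) :
    cross (firstColumn (slopeUnitary s)) z ≠ 0 := by
  rw [cross_slopeUnitary]
  refine mul_ne_zero ?_ fun h => ?_
  · have : (√(1 + s ^ 2))⁻¹ ≠ 0 := by positivity
    exact_mod_cast this
  · rw [sub_eq_zero] at h
    by_cases h0 : z 0 = 0
    · apply hz
      rw [h0, mul_zero] at h
      ext i
      fin_cases i
      · exact h0
      · exact h
    · apply hs
      rw [h, mul_div_cancel_right₀ _ h0, Complex.ofReal_re]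

theorem firstColumn_ne_zero (u : Matrix.unitaryGroup (Fin 2) ℂ) : firstColumn u ≠ 0 := by
  rw [← norm_ne_zero_iff, norm_firstColumn]
  exact one_ne_zero

theorem cross_slopeUnitary_slopeUnitary {s t : ℝ} (h : s ≠ t) :
    cross (firstColumn (slopeUnitary s)) (firstColumn (slopeUnitary t)) ≠ 0 := by
  refine cross_slopeUnitary_ne_zero (firstColumn_ne_zero _) ?_
  have : firstColumn (slopeUnitary t) 1 / firstColumn (slopeUnitary t) 0 = (t : ℂ) := by
    have h3 : √(1 + t ^ 2) ≠ 0 := by positivity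
    have h2 : (√(1 + t ^ 2) : ℂ) ≠ 0 := by exact_mod_cast h3
    simp only [firstColumn, slopeUnitary]
    simp
    field_simp
  rw [this, Complex.ofReal_re]
  exact h

/-- A real combination of this kind can vanish only if μ y_i / x_i is real. The choice μ = 1 + (M +
1)i makes none of these finitely many quotients real, M bounding the slopes to be avoided. -/
theorem exists_phase {ι : Type*} [Fintype ι] {x y : ι → ℂ} (hx : ∀ i, x i ≠ 0) (hy : ∀ i, y i ≠ 0) :
    ∃ μ : ℂ, μ ≠ 0 ∧ ∀ i, ∀ s : ℝ, ((1 - s : ℝ) : ℂ) * x i + (s : ℂ) * (μ * y i) ≠ 0 := by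
  obtain ⟨M, hM⟩ := Finset.exists_le (Finset.univ.image fun i => -(y i / x i).im / (y i / x i).re)
  refine ⟨1 + (M + 1 : ℝ) * Complex.I, fun h => ?_, fun i s h => ?_⟩
  · have := congrArg Complex.re h
    simp at this
  · have hβ : y i / x i ≠ 0 := div_ne_zero (hy i) (hx i)
    have h1 : ((1 - s : ℝ) : ℂ) + (s : ℂ) * ((1 + (M + 1 : ℝ) * Complex.I) * (y i / x i)) = 0 := by
      have := hx i
      field_simp
      linear_combination h
    have him := congrArg Complex.im h1
    have hre := congrArg Complex.re h1
    rw [Complex.add_im, Complex.im_ofReal_mul, Complex.ofReal_im] at him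
    rw [Complex.add_re, Complex.re_ofReal_mul, Complex.ofReal_re] at hre
    have e1 : ((1 + (M + 1 : ℝ) * Complex.I) * (y i / x i)).im =
        (y i / x i).im + (M + 1) * (y i / x i).re := by
      rw [add_mul, one_mul, mul_assoc, Complex.add_im, Complex.im_ofReal_mul, Complex.I_mul_im]
    rw [e1, zero_add, Complex.zero_im] at him
    have hle := hM _ (Finset.mem_image_of_mem _ (Finset.mem_univ i))
    rcases mul_eq_zero.1 him with hs | hs
    · rw [hs] at hre; simp at hre
    · by_cases h0 : (y i / x i).re = 0
      · rw [h0, mul_zero, add_zero] at hs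
        exact hβ (Complex.ext h0 hs)
      · rw [show -(y i / x i).im = (M + 1) * (y i / x i).re by linarith,
          mul_div_cancel_right₀ _ h0] at hle
        linarith


/-- The basins are identified by a symplectic diffeomorphism of neighbourhoods that matches the
regular parts of the boundaries. -/
def BasinEquiv {m : ℕ} (κ a : Fin m → ℝ) (u v : Fin m → Matrix.unitaryGroup (Fin 2) ℂ) : Prop :=
  ∃ Φ : OpenPartialHomeomorph C2 C2, IsSymplecticDiffeo Φ ∧
    crossBasin κ a u ∪ basinRegularBoundary κ a u ⊆ Φ.source ∧
    crossBasin κ a v ∪ basinRegularBoundary κ a v ⊆ Φ.target ∧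
    Φ '' crossBasin κ a u = crossBasin κ a v ∧
    Φ '' basinRegularBoundary κ a u = basinRegularBoundary κ a v

theorem IsSymplecticDiffeo.trans {Φ Ψ : OpenPartialHomeomorph C2 C2} (hΦ : IsSymplecticDiffeo Φ)
    (hΨ : IsSymplecticDiffeo Ψ) : IsSymplecticDiffeo (Φ.trans Ψ) := by
  refine ⟨?_, ?_, fun z hz v w => ?_⟩
  · rw [OpenPartialHomeomorph.trans_source]
    exact hΨ.1.comp (hΦ.1.mono Set.inter_subset_left) fun z hz => hz.2
  · rw [OpenPartialHomeomorph.trans_target]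
    exact hΦ.2.1.comp (hΨ.2.1.mono Set.inter_subset_left) fun z hz => hz.2
  · rw [OpenPartialHomeomorph.trans_source] at hz
    have h1 := ((hΦ.1.contDiffAt (Φ.open_source.mem_nhds hz.1)).differentiableAt
      (by simp)).hasFDerivAt
    have h2 := ((hΨ.1.contDiffAt (Ψ.open_source.mem_nhds hz.2)).differentiableAt
      (by simp)).hasFDerivAt
    rw [OpenPartialHomeomorph.coe_trans, (h2.comp z h1).fderiv]
    exact (hΨ.2.2 _ hz.2 _ _).trans (hΦ.2.2 z hz.1 v w)

section

variable {m : ℕ} {κ a : Fin m → ℝ} {u v w : Fin m → Matrix.unitaryGroup (Fin 2) ℂ}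

theorem BasinEquiv.trans (h : BasinEquiv κ a u v) (h' : BasinEquiv κ a v w) :
    BasinEquiv κ a u w := by
  obtain ⟨Φ, hΦ, h1, h2, h3, h4⟩ := h
  obtain ⟨Ψ, hΨ, k1, k2, k3, k4⟩ := h'
  have himage : Φ '' (crossBasin κ a u ∪ basinRegularBoundary κ a u) =
      crossBasin κ a v ∪ basinRegularBoundary κ a v := by rw [Set.image_union, h3, h4]
  have himage' : Ψ '' (crossBasin κ a v ∪ basinRegularBoundary κ a v) =
      crossBasin κ a w ∪ basinRegularBoundary κ a w := by rw [Set.image_union, k3, k4]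
  refine ⟨Φ.trans Ψ, hΦ.trans hΨ, ?_, ?_, ?_, ?_⟩
  · rw [OpenPartialHomeomorph.trans_source]
    exact fun z hz => ⟨h1 hz, k1 (himage ▸ Set.mem_image_of_mem Φ hz)⟩
  · rw [OpenPartialHomeomorph.trans_target]
    refine fun z hz => ⟨k2 hz, ?_⟩
    rw [← himage'] at hz
    obtain ⟨y, hy, rfl⟩ := hz
    rw [Set.mem_preimage, Ψ.left_inv (k1 hy)]
    exact h2 hy
  · rw [OpenPartialHomeomorph.coe_trans, Set.image_comp, h3, k3]
  · rw [OpenPartialHomeomorph.coe_trans, Set.image_comp, h4, k4]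

variable (hκ : ∀ j, 0 < κ j) (ha : ∀ j, 0 < a j)
include hκ ha

/-- Moving one line of a cross. -/
theorem basinEquiv_update [NeZero m] {j : Fin m} {u' : Matrix.unitaryGroup (Fin 2) ℂ}
    (hu : ∀ i k, i ≠ k → cross (firstColumn (u i)) (firstColumn (u k)) ≠ 0)
    (hu' : ∀ i, i ≠ j → cross (firstColumn (u i)) (firstColumn u') ≠ 0) :
    BasinEquiv κ a u (Function.update u j u') := by
  -- An auxiliary line distinct from both ends. Keeping the path off it ensures that the moving
  -- vector never vanishes, even when there is no other line.
  obtain ⟨s, hs, hs'⟩ : ∃ s : ℝ, cross (firstColumn (slopeUnitary s)) (firstColumn (u j)) ≠ 0 ∧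
      cross (firstColumn (slopeUnitary s)) (firstColumn u') ≠ 0 := by
    obtain ⟨s, hs⟩ := Infinite.exists_notMem_finset
      {(firstColumn (u j) 1 / firstColumn (u j) 0).re, (firstColumn u' 1 / firstColumn u' 0).re}
    simp only [Finset.mem_insert, Finset.mem_singleton, not_or] at hs
    exact ⟨s, cross_slopeUnitary_ne_zero (firstColumn_ne_zero _) hs.1,
      cross_slopeUnitary_ne_zero (firstColumn_ne_zero _) hs.2⟩
  let f : Option {i // i ≠ j} → C2 := fun o => o.elim (firstColumn (slopeUnitary s))
    fun i => firstColumn (u i)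
  have hf : ∀ o, cross (f o) (firstColumn (u j)) ≠ 0 := by
    rintro (_ | ⟨i, hi⟩)
    · exact hs
    · exact hu i j hi
  have hf' : ∀ o, cross (f o) (firstColumn u') ≠ 0 := by
    rintro (_ | ⟨i, hi⟩)
    · exact hs'
    · exact hu' i hi
  obtain ⟨μ, hμ, hμ'⟩ := exists_phase hf hf'
  -- A straight path reparametrised by `Real.smoothTransition`, so that it is smooth and avoids the
  -- other lines for every real r.
  let y : ℝ → C2 := fun r => (1 - Real.smoothTransition r) • firstColumn (u j) +
    Real.smoothTransition r • μ • firstColumn u'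
  have hy : ContDiff ℝ ∞ y :=
    ((contDiff_const.sub Real.smoothTransition.contDiff).smul contDiff_const).add
      (Real.smoothTransition.contDiff.smul contDiff_const)
  have hcross : ∀ o r, cross (f o) (y r) ≠ 0 := by
    intro o r
    have := hμ' o (Real.smoothTransition r)
    simp only [y]
    rwa [cross_add, real_smul_C2, real_smul_C2, cross_smul, cross_smul, cross_smul]
  have hy0 : ∀ r, y r ≠ 0 := fun r h => hcross none r (by rw [h, cross_zero_right])
  have hyn : ∀ r, ‖y r‖⁻¹ ≠ 0 := fun r => inv_ne_zero (norm_ne_zero_iff.2 (hy0 r))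
  let E : ℝ → Fin m → C2 := fun r => Function.update (fun i => firstColumn (u i)) j (‖y r‖⁻¹ • y r)
  have hEj : ∀ r, E r j = ‖y r‖⁻¹ • y r := fun r => Function.update_self ..
  have hEi : ∀ r i, i ≠ j → E r i = firstColumn (u i) := fun r i hi => Function.update_of_ne hi ..
  have hEc : ∀ r i, i ≠ j → cross (E r i) (E r j) ≠ 0 := by
    intro r i hi
    rw [hEi r i hi, hEj, real_smul_C2, cross_smul]
    exact mul_ne_zero (by exact_mod_cast hyn r) (hcross (some ⟨i, hi⟩) r)
  have hE : IsCrossFamily κ E := by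
    refine ⟨hκ, fun i => ?_, fun r i => ?_, fun r i k hik => ?_⟩
    · by_cases hi : i = j
      · subst hi
        simp only [hEj]
        exact ((hy.norm ℝ hy0).inv fun r => norm_ne_zero_iff.2 (hy0 r)).smul hy
      · simp only [hEi _ i hi]
        exact contDiff_const
    · by_cases hi : i = j
      · subst hi
        rw [hEj, norm_smul, norm_inv, norm_norm, inv_mul_cancel₀ (norm_ne_zero_iff.2 (hy0 r))]
      · rw [hEi _ i hi, norm_firstColumn]
    · by_cases hi : i = j
      · subst hi
        rw [cross_comm]
        exact neg_ne_zero.2 (hEc r k (Ne.symm hik))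
      · by_cases hk : k = j
        · subst hk
          exact hEc r i hi
        · rw [hEi _ i hi, hEi _ k hk]
          exact hu i k hik
  refine exists_symplecticDiffeo_of_family hE ha (fun i => ?_) fun i => ?_
  · by_cases hi : i = j
    · subst hi
      rw [hEj]
      have : y 0 = firstColumn (u i) := by simp [y]
      rw [this, norm_firstColumn, inv_one, one_smul]
      exact IsUnitVectorOf.self _
    · rw [hEi _ i hi]
      exact IsUnitVectorOf.self _
  · by_cases hi : i = j
    · subst hi
      rw [hEj, Function.update_self]
      have : y 1 = μ • firstColumn u' := by simp [y]
      rw [this, norm_smul, norm_firstColumn, mul_one, real_smul_C2, smul_smul]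
      refine ⟨_, ?_, rfl⟩
      rw [norm_mul, Complex.norm_real, norm_inv, norm_norm,
        inv_mul_cancel₀ (norm_ne_zero_iff.2 hμ)]
    · rw [hEi _ i hi, Function.update_of_ne hi]
      exact IsUnitVectorOf.self _

/-- The lines are exchanged one at a time. Mixed configurations stay pairwise distinct because every
line of u differs from every line of v. -/
theorem basinEquiv_of_generic [NeZero m]
    (hu : ∀ i k, i ≠ k → cross (firstColumn (u i)) (firstColumn (u k)) ≠ 0)
    (hv : ∀ i k, i ≠ k → cross (firstColumn (v i)) (firstColumn (v k)) ≠ 0)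
    (huv : ∀ i k, cross (firstColumn (u i)) (firstColumn (v k)) ≠ 0) : BasinEquiv κ a u v := by
  have hpw : ∀ (s : Finset (Fin m)) i k, i ≠ k →
      cross (firstColumn (s.piecewise v u i)) (firstColumn (s.piecewise v u k)) ≠ 0 := by
    intro s i k hik
    by_cases hi : i ∈ s <;> by_cases hk : k ∈ s <;> simp only [Finset.piecewise, hi, hk, if_true, if_false]
    · exact hv i k hik
    · rw [cross_comm]; exact neg_ne_zero.2 (huv k i)
    · exact huv i k
    · exact hu i k hik
  have key : ∀ s : Finset (Fin m), s.Nonempty → BasinEquiv κ a u (s.piecewise v u) := by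
    intro s hs
    induction hs using Finset.Nonempty.cons_induction with
    | singleton j =>
      rw [Finset.piecewise_singleton]
      exact basinEquiv_update hκ ha hu fun i _ => huv i j
    | cons j s hj hs ih =>
      rw [Finset.cons_eq_insert, Finset.piecewise_insert]
      refine ih.trans (basinEquiv_update hκ ha (hpw s) fun i hi => ?_)
      by_cases his : i ∈ s <;> simp only [Finset.piecewise, his, if_true, if_false]
      · exact hv i j hi
      · exact huv i j
  have := key Finset.univ ⟨0, Finset.mem_univ 0⟩
  rwa [Finset.piecewise_univ] at this

/-- The two families may share lines, so the comparison passes through a third one that shares none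
with either. -/
theorem basinEquiv [NeZero m]
    (hu : ∀ i k, i ≠ k → cross (firstColumn (u i)) (firstColumn (u k)) ≠ 0)
    (hv : ∀ i k, i ≠ k → cross (firstColumn (v i)) (firstColumn (v k)) ≠ 0) :
    BasinEquiv κ a u v := by
  obtain ⟨M, hM⟩ := Finset.exists_le
    ((Finset.univ.image fun i => (firstColumn (u i) 1 / firstColumn (u i) 0).re) ∪
      Finset.univ.image fun i => (firstColumn (v i) 1 / firstColumn (v i) 0).re)
  -- Distinct real slopes, all larger than the real parts of the slopes occurring in u and v.
  let s : Fin m → ℝ := fun i => M + 1 + (i : ℕ)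
  have hs : ∀ i, M < s i := fun i => by
    have : (0 : ℝ) ≤ (i : ℕ) := Nat.cast_nonneg _
    simp only [s]
    linarith
  have hinj : ∀ i k, i ≠ k → s i ≠ s k := by
    intro i k hik h
    simp only [s, add_right_inj, Nat.cast_inj] at h
    exact hik (Fin.ext h)
  have hsu : ∀ i k, cross (firstColumn (slopeUnitary (s i))) (firstColumn (u k)) ≠ 0 := fun i k =>
    cross_slopeUnitary_ne_zero (firstColumn_ne_zero _) (lt_of_le_of_lt (hM _
      (Finset.mem_union_left _ (Finset.mem_image_of_mem _ (Finset.mem_univ k)))) (hs i)).ne'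
  have hsv : ∀ i k, cross (firstColumn (slopeUnitary (s i))) (firstColumn (v k)) ≠ 0 := fun i k =>
    cross_slopeUnitary_ne_zero (firstColumn_ne_zero _) (lt_of_le_of_lt (hM _
      (Finset.mem_union_right _ (Finset.mem_image_of_mem _ (Finset.mem_univ k)))) (hs i)).ne'
  have hss : ∀ i k, i ≠ k → cross (firstColumn (slopeUnitary (s i)))
      (firstColumn (slopeUnitary (s k))) ≠ 0 := fun i k hik =>
    cross_slopeUnitary_slopeUnitary (hinj i k hik)
  refine (basinEquiv_of_generic hκ ha hu hss fun i k => ?_).trans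
    (basinEquiv_of_generic hκ ha hss hv hsv)
  rw [cross_comm]
  exact neg_ne_zero.2 (hsu k i)

/-- A single cross is treated as a constant family, so the results on `shape` apply at any
parameter. -/
theorem crossBasin_topology [NeZero m]
    (hu : ∀ i k, i ≠ k → cross (firstColumn (u i)) (firstColumn (u k)) ≠ 0) :
    IsOpen (crossBasin κ a u) ∧ IsConnected (crossBasin κ a u) ∧
      closure (basinRegularBoundary κ a u) = frontier (crossBasin κ a u) := by
  have he : IsCrossFamily κ fun (_ : ℝ) i => firstColumn (u i) :=
    ⟨hκ, fun _ => contDiff_const, fun _ i => norm_firstColumn (u i), fun _ i k => hu i k⟩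
  have h : ∀ i, IsUnitVectorOf (firstColumn (u i)) (u i) := fun i => IsUnitVectorOf.self _
  rw [crossBasin_eq (r := 0) he ha h, basinRegularBoundary_eq (r := 0) he ha h]
  exact ⟨isOpen_shape_lt he 0, isConnected_shape_lt he 0, closure_shape_eq he 0⟩

end

end

theorem mainTheorem11 (m : ℕ) (hm : 0 < m) (κ a : Fin m → ℝ)
    (hκ : ∀ j, 0 < κ j) (ha : ∀ j, 0 < a j)
    (u v : Fin m → Matrix.unitaryGroup (Fin 2) ℂ)
    (hu : ∀ i j, i ≠ j → crossLine (u i) ≠ crossLine (u j))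
    (hv : ∀ i j, i ≠ j → crossLine (v i) ≠ crossLine (v j)) :
    (IsOpen (crossBasin κ a u) ∧ IsConnected (crossBasin κ a u) ∧
      closure (basinRegularBoundary κ a u) = frontier (crossBasin κ a u)) ∧
    (IsOpen (crossBasin κ a v) ∧ IsConnected (crossBasin κ a v) ∧
      closure (basinRegularBoundary κ a v) = frontier (crossBasin κ a v)) ∧
    ∃ Φ : OpenPartialHomeomorph C2 C2,
      IsSymplecticDiffeo Φ ∧
      crossBasin κ a u ∪ basinRegularBoundary κ a u ⊆ Φ.source ∧
      crossBasin κ a v ∪ basinRegularBoundary κ a v ⊆ Φ.target ∧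
      Φ '' crossBasin κ a u = crossBasin κ a v ∧
      Φ '' basinRegularBoundary κ a u = basinRegularBoundary κ a v := by
  have : NeZero m := ⟨hm.ne'⟩
  have hu' := fun i k hik => cross_firstColumn_ne_zero (hu i k hik)
  have hv' := fun i k hik => cross_firstColumn_ne_zero (hv i k hik)
  exact ⟨crossBasin_topology hκ ha hu', crossBasin_topology hκ ha hv', basinEquiv hκ ha hu' hv'⟩
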